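/- **Setting (hard-sphere linearized Boltzmann equation).** For $v,v^*\in\mathbb{R}^3$ let $$\nu(v)=2^{-3/2}\Big[e^{-|v|^2}+\Big(2|v|+\tfrac1{|v|}\Big)\int_0^{|v|}e^{-\eta^2}\,d\eta\Big]$$ (extended to $v=0$ by its limit $2^{-1/2}$) and $$k(v,v^*)=\frac{2^{-3/2}}{\pi}\Big\{\frac{2}{|v^*-v|}\exp\Big(-\frac{(|v^*|^2-|v|^2)^2}{4|v^*-v|^2}-\frac{|v^*-v|^2}{4}\Big)-|v^*-v|\,e^{-\frac12(|v^*|^2+|v|^2)}\Big\},$$ and put $Kf(x,v)=\int_{\mathbb{R}^3}k(v,v^*)f(x,v^*)\,dv^*$ and $L=-\nu+K$. Let $\Omega\subset\mathbb{R}^3$ be a nonempty bounded convex open set with $C^2$ boundary and outward unit normal $n$, and let $\Gamma^-=\{(x,v)\in\partial\Omega\times\mathbb{R}^3: n(x)\cdot v<0\}$. For $(x,v)\in\Omega\times\mathbb{R}^3$, $v\ne0$, let $\tau(x,v)=\inf\{s>0: x-sv\notin\Omega\}$ and $q(x,v)=x-\tau(x,v)v$. A function $f$ is a solution of $$v\cdot\nabla_xf=L(f)\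 \text{ in }\Omega\times\mathbb{R}^3,\qquad f=g\ \text{ on }\Gamma^-,$$ if, for a.e. $(x,v)\in\Omega\times\mathbb{R}^3$, $$f(x,v)=e^{-\nu(v)\tau(x,v)}g(q(x,v),v)+\int_0^{\tau(x,v)}e^{-\nu(v)s}Kf(x-sv,v)\,ds,$$ the integrals being absolutely convergent for a.e. $(x,v)$. For $1\le p<\infty$ and $\alpha\ge0$, $W^{1,p}_\alpha(\Omega\times\mathbb{R}^3)$ is the set of $f$ such that $f$ and its weak gradients $\nabla_xf$, $\nabla_vf$ all have finite norm $\|h\|_{L^p_\alpha}=\big(\int_{\Omega\times\mathbb{R}^3}|h|^pe^{p\alpha|v|^2}\,dx\,dv\big)^{1/p}$. **Lemma 1.8.** Let $0<\rho<1$, $1\le p<2$ and $0\le\alpha<(1-\rho)/2$. For every $\varepsilon>0$ there exist a nonempty bounded convex open set $\Omega\subset\mathbb{R}^3$ with $C^2$ boundary and $\operatorname{diam}(\Omega)<\varepsilon$, a radius $r_1>0$ with $$D_{r_1}\subset\partial\Omega,\qquad \{x\in\mathbb{R}^3: |x|<r_1,\ x_1<0\}\subset\Omega,\qquad\text{where }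 D_r:=\{x=(0,x_2,x_3)\in\mathbb{R}^3:|x|<r\},$$ and a smooth cut-off function $\varphi_1$ on $\partial\Omega$ (the restriction of a function in $C^\infty(\mathbb{R}^3)$) with $0\le\varphi_1\le1$, $\varphi_1=1$ on $D_{r_1/4}$ and $\varphi_1=0$ on $\partial\Omega\setminus D_{r_1/2}$, such that the boundary value problem above with boundary data $$g(x,v)=\varphi_1(x)\,e^{-\frac12|v|^2}$$ has a solution $f\in L^2(\Omega\times\mathbb{R}^3)\cap W^{1,p}_\alpha(\Omega\times\mathbb{R}^3)$ with $f\notin W^{1,2}_\alpha(\Omega\times\mathbb{R}^3)$. -/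

import Mathlib

open MeasureTheory Set
open scoped ContDiff

noncomputable section

/-- Position space and velocity space `ℝ³`, with the Euclidean norm. -/
abbrev R3 : Type := EuclideanSpace ℝ (Fin 3)

/-! ### The hard-sphere linearized collision operator `L = -ν + K` -/

/-- Collision frequency of the hard-sphere model,
`ν(v) = 2^{-3/2} (e^{-|v|²} + (2|v| + 1/|v|) ∫₀^{|v|} e^{-η²} dη)`, extended to `v = 0` by its
limit `2^{-1/2}`. -/
def hardSphereFreq (v : R3) : ℝ :=
  if v = 0 then (2 : ℝ) ^ (-(1 / 2 : ℝ))
  else (2 : ℝ) ^ (-(3 / 2 : ℝ)) *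
    (Real.exp (-‖v‖ ^ 2)
      + (2 * ‖v‖ + 1 / ‖v‖) * ∫ η in (0 : ℝ)..‖v‖, Real.exp (-η ^ 2))

/-- Integral kernel of the hard-sphere model (its value on the null set `v = w` is immaterial):
`k(v,w) = 2^{-3/2} π⁻¹ (2|w-v|⁻¹ exp(-(|w|²-|v|²)²/(4|w-v|²) - |w-v|²/4)
  - |w-v| exp(-(|w|²+|v|²)/2))`. -/
def hardSphereKernel (v w : R3) : ℝ :=
  (2 : ℝ) ^ (-(3 / 2 : ℝ)) * Real.pi⁻¹ *
    (2 * ‖w - v‖⁻¹ *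
        Real.exp (-(1 / 4) * ((‖w‖ ^ 2 - ‖v‖ ^ 2) ^ 2 / ‖w - v‖ ^ 2) - (1 / 4) * ‖w - v‖ ^ 2)
      - ‖w - v‖ * Real.exp (-(1 / 2) * (‖w‖ ^ 2 + ‖v‖ ^ 2)))

/-- `K f (x,v) = ∫ k(v,w) f(x,w) dw`. -/
def collisionK (f : R3 × R3 → ℝ) (x v : R3) : ℝ :=
  ∫ w : R3, hardSphereKernel v w * f (x, w)

/-! ### Characteristics and the boundary value problem -/

/-- Backward exit time `τ(x,v) = inf {s > 0 | x - s v ∉ Ω}`. -/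
def exitTime (Ω : Set R3) (x v : R3) : ℝ :=
  sInf {s : ℝ | 0 < s ∧ x - s • v ∉ Ω}

/-- Backward exit point `q(x,v) = x - τ(x,v) v`. -/
def exitPoint (Ω : Set R3) (x v : R3) : R3 :=
  x - exitTime Ω x v • v

/-- Lebesgue measure on `Ω × ℝ³`. -/
def phaseMeasure (Ω : Set R3) : Measure (R3 × R3) :=
  (volume : Measure (R3 × R3)).restrict (Ω ×ˢ univ)

/-- `J g (x,v) = e^{-ν(v) τ(x,v)} g(q(x,v), v)`. For `x` in a bounded convex domain and `v ≠ 0`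
the pair `(q(x,v), v)` lies in the incoming boundary set, so only the values of `g` there matter. -/
def incomingJ (Ω : Set R3) (g : R3 × R3 → ℝ) (x v : R3) : ℝ :=
  Real.exp (-hardSphereFreq v * exitTime Ω x v) * g (exitPoint Ω x v, v)

/-- `S_Ω h (x,v) = ∫₀^{τ(x,v)} e^{-ν(v) s} h(x - s v, v) ds`. -/
def transportS (Ω : Set R3) (h : R3 → R3 → ℝ) (x v : R3) : ℝ :=
  ∫ s in (0 : ℝ)..exitTime Ω x v, Real.exp (-hardSphereFreq v * s) * h (x - s • v) v

/-- `f` solves `v · ∇ₓ f = L f` in `Ω × ℝ³` with incoming boundary data `g`, that is,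
`f = J g + S_Ω K f` almost everywhere in `Ω × ℝ³`, the integrals that define `K f` and `S_Ω K f`
being absolutely convergent almost everywhere. -/
structure IsHardSphereSolution (Ω : Set R3) (g f : R3 × R3 → ℝ) : Prop where
  integrable_K : ∀ᵐ z ∂phaseMeasure Ω,
    Integrable (fun w : R3 => hardSphereKernel z.2 w * f (z.1, w))
  integrable_S : ∀ᵐ z ∂phaseMeasure Ω,
    IntervalIntegrable
      (fun s : ℝ => Real.exp (-hardSphereFreq z.2 * s) * collisionK f (z.1 - s • z.2) z.2)
      volume 0 (exitTime Ω z.1 z.2)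
  eq_ae : ∀ᵐ z ∂phaseMeasure Ω,
    f z = incomingJ Ω g z.1 z.2 + transportS Ω (collisionK f) z.1 z.2

/-! ### Weighted Lebesgue and Sobolev spaces on `Ω × ℝ³` -/

/-- Membership in `L^p_α(Ω × ℝ³)`: `∫ |F(x,v)|^p e^{p α |v|²} dx dv < ∞`. -/
def MemLpWeighted {F : Type*} [NormedAddCommGroup F] [NormedSpace ℝ F]
    (Ω : Set R3) (p α : ℝ) (f : R3 × R3 → F) : Prop :=
  MemLp (fun z => Real.exp (α * ‖z.2‖ ^ 2) • f z) (ENNReal.ofReal p) (phaseMeasure Ω)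

/-- `Gx` and `Gv` are the weak gradients `∇ₓ f` and `∇ᵥ f` of `f` on `Ω × ℝ³` (to be used with
`f`, `Gx`, `Gv` locally integrable on `Ω × ℝ³`). -/
def IsWeakGradient (Ω : Set R3) (f : R3 × R3 → ℝ) (Gx Gv : R3 × R3 → R3) : Prop :=
  ∀ φ : R3 × R3 → ℝ, ContDiff ℝ ∞ φ → HasCompactSupport φ → tsupport φ ⊆ Ω ×ˢ univ →
    ∀ a b : R3,
      ∫ z, f z * fderiv ℝ φ z (a, b) ∂phaseMeasure Ω
        = -∫ z, (inner ℝ (Gx z) a + inner ℝ (Gv z) b) * φ z ∂phaseMeasure Ω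

/-- Membership in `W^{1,p}_α(Ω × ℝ³)`: `f`, `∇ₓ f` and `∇ᵥ f` (weak derivatives) belong to
`L^p_α(Ω × ℝ³)`. -/
def MemW1Weighted (Ω : Set R3) (p α : ℝ) (f : R3 × R3 → ℝ) : Prop :=
  MemLpWeighted Ω p α f ∧
    ∃ Gx Gv : R3 × R3 → R3,
      IsWeakGradient Ω f Gx Gv ∧ MemLpWeighted Ω p α Gx ∧ MemLpWeighted Ω p α Gv

/-! ### Domains -/

/-- The open set `Ω` has `C²` boundary: near each boundary point it is a strict sublevel set of a
`C²` function with nonvanishing derivative at that point. -/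
def HasC2Boundary (Ω : Set R3) : Prop :=
  ∀ z ∈ frontier Ω, ∃ (U : Set R3) (ψ : R3 → ℝ), IsOpen U ∧ z ∈ U ∧ ContDiffOn ℝ 2 ψ U ∧
    fderiv ℝ ψ z ≠ 0 ∧ Ω ∩ U = {x ∈ U | ψ x < 0}

/-- A bounded convex domain in `ℝ³` with `C²` boundary. -/
structure IsConvexC2Domain (Ω : Set R3) : Prop where
  isOpen : IsOpen Ω
  nonempty : Ω.Nonempty
  convex : Convex ℝ Ω
  isBounded : Bornology.IsBounded Ω
  c2Boundary : HasC2Boundary Ω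

/-- The flat disc `D_r = {x = (0, x₂, x₃) | |x| < r}`. -/
def flatDisc (r : ℝ) : Set R3 := {x | x 0 = 0 ∧ ‖x‖ < r}

/-- The open half ball `{x | |x| < r, x₁ < 0}`. -/
def halfBall (r : ℝ) : Set R3 := {x | ‖x‖ < r ∧ x 0 < 0}

/-- `φ` restricts on `∂Ω` to a smooth cut-off function with values in `[0,1]`, equal to `1` on
`D_{r/4}` and to `0` on `∂Ω ∖ D_{r/2}`. -/
structure IsFlatCutoff (Ω : Set R3) (r : ℝ) (φ : R3 → ℝ) : Prop where
  smooth : ContDiff ℝ ∞ φ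
  mem_Icc : ∀ x ∈ frontier Ω, φ x ∈ Icc (0 : ℝ) 1
  eq_one : ∀ x ∈ flatDisc (r / 4), φ x = 1
  eq_zero : ∀ x ∈ frontier Ω \ flatDisc (r / 2), φ x = 0

end

/-!
The solution is `f = J g + S_Ω k`, where `J` transports the boundary data along characteristics,
`S_Ω` integrates a source along them, and the source `k` is a fixed point of the collision gain
`k ↦ K (J g + S_Ω k)`. A backward trajectory with velocity `v` stays in a domain of diameter `D`
for a time `τ ≤ D / |v|` only, and `K` smooths the singularity at `v = 0`. So the gain is a
contraction on small domains (`exists_gainMap_class`, `exists_gainMap_eq`), on a class of functions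
with Gaussian decay that are locally Lipschitz in `v` and have in `x` the modulus of continuity
`|x - y| ((-ψ x) ^ (-2/5) + (-ψ y) ^ (-2/5))`. Here `ψ` is a convex defining function of the domain.

Regularity is a matter of the exit time. Its velocity derivatives are `-τ` times its spatial ones,
and its reciprocal is the gauge of `x - Ω`, hence convex in the velocity. Along a line in velocity
space, powers of `|∇ₓ τ|` therefore reduce to `|j'| j ^ (-p)` with `j` convex
(`lintegral_line_exitGrad_le`), and averaging over the lines shows that `|∇ₓ τ| ^ p` is integrable
for `p < 2` (`exists_lintegral_exitGrad_le`). The same estimate, with Young's inequality, propagates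
the spatial modulus of `k`. Away from `v = 0` the solution is locally Lipschitz, with a constant of
the order of a Gaussian times `1 + |∇ₓ τ| + |v|⁻¹ (1 + (-ψ) ^ (-2/5))` (`exists_locally_lipschitz`),
and this gives the membership in `W^{1,p}_α` (`memW1Weighted_of_locally_lipschitz`).

Square integrability fails at the grazing set `x₁ = v₁ = 0` of the flat disc. There the incoming
data are the Maxwellian `M`, and the time spent since the boundary is `τ = x₁ / v₁`. At points of
the domain near the disc, half of the velocities carry no incoming data, so that the gain at `v = 0`
is at most `2 ^ (-3/2) (1 + e ^ (-2))` plus a term that is small with the domain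
(`integral_kernel_zero_le`, `exists_gain_zero_le`); this is less than `ν(0) = 2 ^ (-1/2)`.
Consequently `M - f` is bounded above and below by multiples of `x₁ / v₁`
(`IsConvexSublevel.exists_grazing_bounds`). A function of this kind has a normal derivative of order
`1 / |v₁|` on the region `|x₁| ≤ |v₁|`, which is not square integrable. Since the bounds concern `f`
and not its derivative, the argument pairs the weak derivative with the test functions `grazingTest`,
which are bounded in `L²` and concentrate on a null set, while the pairing stays bounded below
(`le_integral_inner_mul_grazingTest`, `not_memW1Weighted_two_of_grazing_bounds`).

The domain is a barrel given by an explicit convex `C²` function (`barrelFun`).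
-/

open scoped Topology

/-! ### Gaussian integrals with a power singularity -/

lemma one_add_pow_le_exp_sq (n : ℕ) {e : ℝ} (he : 0 < e) :
    ∃ C : ℝ, 0 < C ∧ ∀ t : ℝ, 0 ≤ t → (1 + t) ^ n ≤ C * Real.exp (e * t ^ 2) := by
  obtain ⟨d, hd, hdn⟩ : ∃ d : ℝ, 0 < d ∧ n * d ≤ e := by
    refine ⟨e / (n + 1), by positivity, ?_⟩
    rw [mul_div_assoc', div_le_iff₀ (by positivity)]
    nlinarith
  refine ⟨(2 + 1 / d) ^ n, by positivity, fun t ht => ?_⟩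
  have h1 : 1 + t ≤ (2 + 1 / d) * Real.exp (d * t ^ 2) := by
    have h2 : d * t ^ 2 + 1 ≤ Real.exp (d * t ^ 2) := Real.add_one_le_exp _
    have h3 : (1 : ℝ) ≤ Real.exp (d * t ^ 2) := Real.one_le_exp (by positivity)
    have h4 : t ^ 2 ≤ 1 / d * Real.exp (d * t ^ 2) := by
      rw [div_mul_eq_mul_div, le_div_iff₀ hd]; nlinarith
    nlinarith [sq_nonneg (t - 1)]
  calc (1 + t) ^ n ≤ ((2 + 1 / d) * Real.exp (d * t ^ 2)) ^ n :=
        pow_le_pow_left₀ (by positivity) h1 n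
    _ = (2 + 1 / d) ^ n * Real.exp (n * (d * t ^ 2)) := by rw [mul_pow, ← Real.exp_nat_mul]
    _ ≤ _ := by
        refine mul_le_mul_of_nonneg_left (Real.exp_le_exp.2 ?_) (by positivity)
        nlinarith [mul_le_mul_of_nonneg_right hdn (sq_nonneg t)]

lemma integrable_norm_rpow_mul_exp {b c : ℝ} (hb : b < 3) (hc : 0 < c) :
    Integrable (fun u : R3 => ‖u‖ ^ (-b) * Real.exp (-c * ‖u‖ ^ 2)) := by
  have h := (integrable_fun_norm_addHaar (volume : Measure R3)
    (f := fun r : ℝ => r ^ (-b) * Real.exp (-c * r ^ 2))).2 ?_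
  · exact h
  · simp only [finrank_euclideanSpace, Fintype.card_fin, smul_eq_mul]
    refine (integrableOn_rpow_mul_exp_neg_mul_sq hc (s := 2 - b) (by linarith)).congr_fun ?_
      measurableSet_Ioi
    intro r hr
    have hr : 0 < r := hr
    simp only [Nat.add_one_sub_one]
    rw [← mul_assoc, ← Real.rpow_natCast, ← Real.rpow_add hr]
    norm_num [sub_eq_add_neg]

lemma integrable_norm_rpow_mul_exp_sub {b c : ℝ} (hb : b < 3) (hc : 0 < c) (v : R3) :
    Integrable (fun w : R3 => ‖w - v‖ ^ (-b) * Real.exp (-c * ‖w - v‖ ^ 2)) :=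
  (integrable_norm_rpow_mul_exp hb hc).comp_sub_right v

lemma integral_norm_rpow_mul_exp_sub (b c : ℝ) (v : R3) :
    ∫ w : R3, ‖w - v‖ ^ (-b) * Real.exp (-c * ‖w - v‖ ^ 2)
      = ∫ u : R3, ‖u‖ ^ (-b) * Real.exp (-c * ‖u‖ ^ 2) :=
  integral_sub_right_eq_self (fun u : R3 => ‖u‖ ^ (-b) * Real.exp (-c * ‖u‖ ^ 2)) v

lemma integrable_inv_norm_mul_exp_sub {c : ℝ} (hc : 0 < c) (v : R3) :
    Integrable (fun w : R3 => ‖w - v‖⁻¹ * Real.exp (-c * ‖w - v‖ ^ 2)) := by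
  simpa only [Real.rpow_neg_one] using integrable_norm_rpow_mul_exp_sub (b := 1) (by norm_num) hc v

lemma integral_inv_norm_mul_exp_sub (c : ℝ) (v : R3) :
    ∫ w : R3, ‖w - v‖⁻¹ * Real.exp (-c * ‖w - v‖ ^ 2)
      = ∫ u : R3, ‖u‖⁻¹ * Real.exp (-c * ‖u‖ ^ 2) := by
  simpa only [Real.rpow_neg_one] using integral_norm_rpow_mul_exp_sub 1 c v

lemma rpow_neg_two_eq (t : ℝ) (ht : 0 ≤ t) : t ^ (-2 : ℝ) = (t ^ 2)⁻¹ := by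
  rw [Real.rpow_neg ht]; norm_num

lemma integrable_inv_sq_mul_exp_sub {c : ℝ} (hc : 0 < c) (v : R3) :
    Integrable (fun w : R3 => (‖w - v‖ ^ 2)⁻¹ * Real.exp (-c * ‖w - v‖ ^ 2)) := by
  simpa only [rpow_neg_two_eq _ (norm_nonneg _)] using
    integrable_norm_rpow_mul_exp_sub (b := 2) (by norm_num) hc v

lemma integral_inv_sq_mul_exp_sub (c : ℝ) (v : R3) :
    ∫ w : R3, (‖w - v‖ ^ 2)⁻¹ * Real.exp (-c * ‖w - v‖ ^ 2)
      = ∫ u : R3, (‖u‖ ^ 2)⁻¹ * Real.exp (-c * ‖u‖ ^ 2) := by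
  simpa only [rpow_neg_two_eq _ (norm_nonneg _)] using integral_norm_rpow_mul_exp_sub 2 c v

/-- A Gaussian about `v` against the singularities `‖w - v‖⁻¹` and `‖w‖⁻¹`, uniformly in `v`: the
product of the two is at most the sum of their squares, and away from the unit ball the square of
the second is bounded. -/
lemma exists_integral_inv_norm_mul_inv_norm_le {c : ℝ} (hc : 0 < c) :
    ∃ C : ℝ, 0 < C ∧ ∀ v : R3,
      Integrable (fun w : R3 => ‖w - v‖⁻¹ * Real.exp (-c * ‖w - v‖ ^ 2) * ‖w‖⁻¹) ∧
      ∫ w : R3, ‖w - v‖⁻¹ * Real.exp (-c * ‖w - v‖ ^ 2) * ‖w‖⁻¹ ≤ C := by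
  set I2 := ∫ u : R3, (‖u‖ ^ 2)⁻¹ * Real.exp (-c * ‖u‖ ^ 2)
  set I1 := ∫ u : R3, Real.exp c * ((‖u‖ ^ 2)⁻¹ * Real.exp (-c * ‖u‖ ^ 2))
  set I0 := ∫ u : R3, Real.exp (-c * ‖u‖ ^ 2)
  have i0 : Integrable (fun u : R3 => Real.exp (-c * ‖u‖ ^ 2)) := by
    simpa using integrable_norm_rpow_mul_exp (b := 0) (by norm_num) hc
  have i1 : Integrable (fun u : R3 => Real.exp c * ((‖u‖ ^ 2)⁻¹ * Real.exp (-c * ‖u‖ ^ 2))) := by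
    simpa using (integrable_inv_sq_mul_exp_sub hc 0).const_mul (Real.exp c)
  have key : ∀ v w : R3, ‖w - v‖⁻¹ * Real.exp (-c * ‖w - v‖ ^ 2) * ‖w‖⁻¹ ≤
      (‖w - v‖ ^ 2)⁻¹ * Real.exp (-c * ‖w - v‖ ^ 2) +
        (Real.exp c * ((‖w‖ ^ 2)⁻¹ * Real.exp (-c * ‖w‖ ^ 2))
          + Real.exp (-c * ‖w - v‖ ^ 2)) := by
    intro v w
    set e := Real.exp (-c * ‖w - v‖ ^ 2)
    have he0 : 0 < e := Real.exp_pos _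
    have he1 : e ≤ 1 := Real.exp_le_one_iff.2 (by nlinarith [sq_nonneg ‖w - v‖])
    have h1 : ‖w - v‖⁻¹ * e * ‖w‖⁻¹ ≤ (‖w - v‖ ^ 2)⁻¹ * e + (‖w‖ ^ 2)⁻¹ * e := by
      rw [← inv_pow, ← inv_pow]
      nlinarith [sq_nonneg (‖w - v‖⁻¹ - ‖w‖⁻¹), sq_nonneg (‖w - v‖⁻¹ + ‖w‖⁻¹)]
    have h2 : (‖w‖ ^ 2)⁻¹ * e ≤
        Real.exp c * ((‖w‖ ^ 2)⁻¹ * Real.exp (-c * ‖w‖ ^ 2)) + e := by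
      rcases le_or_gt ‖w‖ 1 with hw | hw
      · have h3 : 1 ≤ Real.exp c * Real.exp (-c * ‖w‖ ^ 2) := by
          rw [← Real.exp_add]
          apply Real.one_le_exp
          have : ‖w‖ ^ 2 ≤ 1 := pow_le_one₀ (norm_nonneg _) hw
          nlinarith
        have h4 : (‖w‖ ^ 2)⁻¹ * e ≤ (‖w‖ ^ 2)⁻¹ * (Real.exp c * Real.exp (-c * ‖w‖ ^ 2)) := by
          gcongr; linarith
        nlinarith
      · have h3 : (‖w‖ ^ 2)⁻¹ ≤ 1 := inv_le_one_of_one_le₀ (by nlinarith)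
        have h4 : (‖w‖ ^ 2)⁻¹ * e ≤ 1 * e := by gcongr
        have h5 : 0 ≤ Real.exp c * ((‖w‖ ^ 2)⁻¹ * Real.exp (-c * ‖w‖ ^ 2)) := by positivity
        linarith
    linarith
  have ib : ∀ v : R3, Integrable (fun w : R3 => (‖w - v‖ ^ 2)⁻¹ * Real.exp (-c * ‖w - v‖ ^ 2) +
        (Real.exp c * ((‖w‖ ^ 2)⁻¹ * Real.exp (-c * ‖w‖ ^ 2))
          + Real.exp (-c * ‖w - v‖ ^ 2))) := fun v =>
    (integrable_inv_sq_mul_exp_sub hc v).add (i1.add (i0.comp_sub_right v))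
  have hpos : ∀ v w : R3, 0 ≤ ‖w - v‖⁻¹ * Real.exp (-c * ‖w - v‖ ^ 2) * ‖w‖⁻¹ := fun v w => by
    positivity
  have ii : ∀ v : R3,
      Integrable (fun w : R3 => ‖w - v‖⁻¹ * Real.exp (-c * ‖w - v‖ ^ 2) * ‖w‖⁻¹) := fun v => by
    refine (ib v).mono' (by measurability) (Filter.Eventually.of_forall fun w => ?_)
    rw [Real.norm_of_nonneg (hpos v w)]
    exact key v w
  refine ⟨|I2 + (I1 + I0)| + 1, by positivity, fun v => ⟨ii v, ?_⟩⟩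
  calc _ ≤ ∫ w : R3, ((‖w - v‖ ^ 2)⁻¹ * Real.exp (-c * ‖w - v‖ ^ 2) +
        (Real.exp c * ((‖w‖ ^ 2)⁻¹ * Real.exp (-c * ‖w‖ ^ 2))
          + Real.exp (-c * ‖w - v‖ ^ 2))) := integral_mono (ii v) (ib v) (key v)
    _ = I2 + (I1 + I0) := by
        have e1 := integral_add (integrable_inv_sq_mul_exp_sub hc v) (i1.add (i0.comp_sub_right v))
        have e2 := integral_add i1 (i0.comp_sub_right v)
        simp only [Pi.add_apply] at e1
        rw [e1, e2, integral_inv_sq_mul_exp_sub,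
          integral_sub_right_eq_self (fun u : R3 => Real.exp (-c * ‖u‖ ^ 2)) v]
    _ ≤ _ := by linarith [le_abs_self (I2 + (I1 + I0))]

/-! ### Pointwise bounds for the collision kernel -/

/-- The first Gaussian factor of the kernel absorbs the ratio of two Gaussian weights: with
`A = ‖w - v‖` and `A B = ‖w‖² - ‖v‖²`, the weights cost `a A B ≤ a (A² + B²) / 2`. -/
lemma kernel_exponent_le {a : ℝ} (ha0 : 0 ≤ a) (ha : a < 1 / 2) (v w : R3) :
    -(1 / 4) * ((‖w‖ ^ 2 - ‖v‖ ^ 2) ^ 2 / ‖w - v‖ ^ 2) - (1 / 4) * ‖w - v‖ ^ 2 - a * ‖w‖ ^ 2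
      ≤ -a * ‖v‖ ^ 2 - (1 / 4 - a / 2) * ‖w - v‖ ^ 2 := by
  rcases eq_or_ne w v with rfl | hne
  · simp
  have hA : 0 < ‖w - v‖ := norm_pos_iff.2 (sub_ne_zero.2 hne)
  set A := ‖w - v‖
  obtain ⟨B, hB⟩ : ∃ B, B = (‖w‖ ^ 2 - ‖v‖ ^ 2) / A := ⟨_, rfl⟩
  have hAB : ‖w‖ ^ 2 - ‖v‖ ^ 2 = A * B := by rw [hB]; field_simp
  rw [hAB, mul_pow, mul_div_cancel_left₀ _ (by positivity)]
  nlinarith [mul_nonneg ha0 (sq_nonneg (A + B)),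
    mul_nonneg (show 0 ≤ 1 / 4 - a / 2 by linarith) (sq_nonneg B)]

lemma kernel_exponent_le' {a : ℝ} (ha0 : 0 ≤ a) (ha : a < 1 / 2) (v w : R3) :
    -(1 / 2) * (‖w‖ ^ 2 + ‖v‖ ^ 2) - a * ‖w‖ ^ 2
      ≤ -a * ‖v‖ ^ 2 - (1 / 4 - a / 2) * ‖w - v‖ ^ 2 := by
  have h : ‖w - v‖ ^ 2 ≤ 2 * (‖w‖ ^ 2 + ‖v‖ ^ 2) := by
    have := norm_sub_le w v
    nlinarith [norm_nonneg (w - v), norm_nonneg w, norm_nonneg v, sq_nonneg (‖w‖ - ‖v‖)]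
  nlinarith [mul_le_mul_of_nonneg_left h (show 0 ≤ 1 / 4 - a / 2 by linarith),
    mul_nonneg ha0 (sq_nonneg ‖w‖)]

lemma kernel_const_pos : 0 < (2 : ℝ) ^ (-(3 / 2 : ℝ)) * Real.pi⁻¹ := by positivity

lemma kernel_const_le_one : (2 : ℝ) ^ (-(3 / 2 : ℝ)) * Real.pi⁻¹ ≤ 1 := by
  have h1 : (2 : ℝ) ^ (-(3 / 2 : ℝ)) ≤ 1 :=
    Real.rpow_le_one_of_one_le_of_nonpos (by norm_num) (by norm_num)
  have h2 : Real.pi⁻¹ ≤ 1 := inv_le_one_of_one_le₀ (by linarith [Real.pi_gt_three])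
  exact mul_le_one₀ h1 (by positivity) h2

lemma measurable_hardSphereKernel_right (v : R3) : Measurable (hardSphereKernel v) := by
  have h1 : Measurable fun w : R3 => ‖w - v‖ := (measurable_id.sub_const v).norm
  have h2 : Measurable fun w : R3 => ‖w‖ := measurable_norm
  unfold hardSphereKernel
  refine measurable_const.mul (Measurable.sub ?_ ?_)
  · refine (h1.inv.const_mul 2).mul (Real.measurable_exp.comp ?_)
    exact ((((h2.pow_const 2).sub_const _).pow_const 2).div (h1.pow_const 2)).const_mul _ |>.sub
      ((h1.pow_const 2).const_mul _)
  · exact h1.mul (Real.measurable_exp.comp (((h2.pow_const 2).add_const _).const_mul _))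

/-- Gaussian rate left over in the kernel once the weight `exp (a ‖v‖²)` has been absorbed. -/
noncomputable def kernelRate (a : ℝ) : ℝ := (1 / 4 - a / 2) / 2

/-- Constant in the pointwise kernel bound for the weight `exp (a ‖v‖²)`. -/
noncomputable def kernelConst (a : ℝ) : ℝ := 2 + 1 / kernelRate a

lemma kernelRate_pos {a : ℝ} (ha : a < 1 / 2) : 0 < kernelRate a := by
  unfold kernelRate; linarith

lemma kernelConst_pos {a : ℝ} (ha : a < 1 / 2) : 0 < kernelConst a := by
  have := kernelRate_pos ha
  unfold kernelConst; positivity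

/-- Conjugation of the kernel with a Gaussian of rate `a < 1/2`: part of the decay in `‖w - v‖` pays
for the change of the weight, and an integrable singularity with Gaussian decay remains. -/
lemma abs_hardSphereKernel_mul_exp_le {a : ℝ} (ha0 : 0 ≤ a) (ha : a < 1 / 2) (v w : R3) :
    |hardSphereKernel v w| * Real.exp (-a * ‖w‖ ^ 2) ≤
      kernelConst a * Real.exp (-a * ‖v‖ ^ 2) *
        (‖w - v‖⁻¹ * Real.exp (-kernelRate a * ‖w - v‖ ^ 2)) := by
  set c := kernelRate a with hc
  have hcp : 0 < c := kernelRate_pos ha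
  have hc2 : 1 / 4 - a / 2 = 2 * c := by rw [hc, kernelRate]; ring
  set u := ‖w - v‖
  have hu : 0 ≤ u := norm_nonneg _
  set G := Real.exp (-a * ‖v‖ ^ 2) * Real.exp (-(2 * c) * u ^ 2) with hG
  have h1 : Real.exp (-(1 / 4) * ((‖w‖ ^ 2 - ‖v‖ ^ 2) ^ 2 / u ^ 2) - (1 / 4) * u ^ 2)
      * Real.exp (-a * ‖w‖ ^ 2) ≤ G := by
    rw [hG, ← Real.exp_add, ← Real.exp_add, Real.exp_le_exp, ← hc2]
    have := kernel_exponent_le ha0 ha v w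
    linarith
  have h2 : Real.exp (-(1 / 2) * (‖w‖ ^ 2 + ‖v‖ ^ 2)) * Real.exp (-a * ‖w‖ ^ 2) ≤ G := by
    rw [hG, ← Real.exp_add, ← Real.exp_add, Real.exp_le_exp, ← hc2]
    have := kernel_exponent_le' ha0 ha v w
    linarith
  have h3 : |hardSphereKernel v w| ≤
      2 * u⁻¹ * Real.exp (-(1 / 4) * ((‖w‖ ^ 2 - ‖v‖ ^ 2) ^ 2 / u ^ 2) - (1 / 4) * u ^ 2)
        + u * Real.exp (-(1 / 2) * (‖w‖ ^ 2 + ‖v‖ ^ 2)) := by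
    unfold hardSphereKernel
    rw [abs_mul, abs_of_pos kernel_const_pos]
    refine (mul_le_of_le_one_left (abs_nonneg _) kernel_const_le_one).trans ?_
    refine (abs_sub _ _).trans ?_
    rw [abs_of_nonneg (by positivity), abs_of_nonneg (by positivity)]
  have h4 : u * Real.exp (-(2 * c) * u ^ 2) ≤ 1 / c * (u⁻¹ * Real.exp (-c * u ^ 2)) := by
    rcases hu.eq_or_lt with h0 | h0
    · rw [← h0]; simp
    have e1 : Real.exp (-(2 * c) * u ^ 2) = Real.exp (-c * u ^ 2) * Real.exp (-c * u ^ 2) := by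
      rw [← Real.exp_add]; congr 1; ring
    have e2 : c * u ^ 2 * Real.exp (-c * u ^ 2) ≤ 1 := by
      have h5 := Real.add_one_le_exp (c * u ^ 2)
      have h6 : Real.exp (c * u ^ 2) * Real.exp (-c * u ^ 2) = 1 := by
        rw [← Real.exp_add]; simp
      nlinarith [Real.exp_pos (-c * u ^ 2)]
    rw [e1]
    have e3 : u * (Real.exp (-c * u ^ 2) * Real.exp (-c * u ^ 2)) =
        1 / c * (u⁻¹ * Real.exp (-c * u ^ 2)) * (c * u ^ 2 * Real.exp (-c * u ^ 2)) := by
      field_simp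
    rw [e3]
    exact mul_le_of_le_one_right (by positivity) e2
  have h5 : Real.exp (-(2 * c) * u ^ 2) ≤ Real.exp (-c * u ^ 2) := by
    rw [Real.exp_le_exp]; nlinarith [mul_nonneg hcp.le (sq_nonneg u)]
  calc |hardSphereKernel v w| * Real.exp (-a * ‖w‖ ^ 2)
      ≤ 2 * u⁻¹ * (Real.exp (-(1 / 4) * ((‖w‖ ^ 2 - ‖v‖ ^ 2) ^ 2 / u ^ 2) - (1 / 4) * u ^ 2)
          * Real.exp (-a * ‖w‖ ^ 2))
        + u * (Real.exp (-(1 / 2) * (‖w‖ ^ 2 + ‖v‖ ^ 2)) * Real.exp (-a * ‖w‖ ^ 2)) := by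
        nlinarith [Real.exp_pos (-a * ‖w‖ ^ 2)]
    _ ≤ 2 * u⁻¹ * G + u * G := by gcongr
    _ = Real.exp (-a * ‖v‖ ^ 2) * (2 * (u⁻¹ * Real.exp (-(2 * c) * u ^ 2))
          + u * Real.exp (-(2 * c) * u ^ 2)) := by rw [hG]; ring
    _ ≤ Real.exp (-a * ‖v‖ ^ 2) * (2 * (u⁻¹ * Real.exp (-c * u ^ 2))
          + 1 / c * (u⁻¹ * Real.exp (-c * u ^ 2))) := by gcongr
    _ = _ := by rw [kernelConst]; ring

/-! ### The operator `K` in weighted spaces -/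

/-- Boundedness of `K` against a source `F` with `|F| ≤ exp (-a ‖w‖²) G`. -/
lemma integrable_kernel_mul_and_abs_integral_le {a : ℝ} (ha0 : 0 ≤ a) (ha : a < 1 / 2)
    {F G : R3 → ℝ} (hF : AEStronglyMeasurable F volume)
    (hFG : ∀ᵐ w, |F w| ≤ Real.exp (-a * ‖w‖ ^ 2) * G w) (v : R3)
    (hG : Integrable (fun w => ‖w - v‖⁻¹ * Real.exp (-kernelRate a * ‖w - v‖ ^ 2) * G w)) :
    Integrable (fun w => hardSphereKernel v w * F w) ∧
      |∫ w, hardSphereKernel v w * F w| ≤ kernelConst a * Real.exp (-a * ‖v‖ ^ 2) *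
        ∫ w, ‖w - v‖⁻¹ * Real.exp (-kernelRate a * ‖w - v‖ ^ 2) * G w := by
  have hb : ∀ᵐ w, ‖hardSphereKernel v w * F w‖ ≤ kernelConst a * Real.exp (-a * ‖v‖ ^ 2) *
      (‖w - v‖⁻¹ * Real.exp (-kernelRate a * ‖w - v‖ ^ 2) * G w) := by
    filter_upwards [hFG] with w hw
    have hGw : 0 ≤ G w := by
      have := (abs_nonneg _).trans hw
      exact nonneg_of_mul_nonneg_right this (Real.exp_pos _)
    rw [norm_mul, Real.norm_eq_abs, Real.norm_eq_abs]
    calc |hardSphereKernel v w| * |F w|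
        ≤ |hardSphereKernel v w| * (Real.exp (-a * ‖w‖ ^ 2) * G w) := by gcongr
      _ = |hardSphereKernel v w| * Real.exp (-a * ‖w‖ ^ 2) * G w := by ring
      _ ≤ _ := by
        have := mul_le_mul_of_nonneg_right (abs_hardSphereKernel_mul_exp_le ha0 ha v w) hGw
        linarith
  have hi := hG.const_mul (kernelConst a * Real.exp (-a * ‖v‖ ^ 2))
  refine ⟨hi.mono' ((measurable_hardSphereKernel_right v).aestronglyMeasurable.mul hF) hb, ?_⟩
  rw [← integral_const_mul]
  exact norm_integral_le_of_norm_le hi hb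

/-- `K` maps functions bounded by `B exp (-a ‖w‖²)` to such functions. -/
lemma exists_abs_integral_kernel_le {a : ℝ} (ha0 : 0 ≤ a) (ha : a < 1 / 2) :
    ∃ C : ℝ, 0 < C ∧ ∀ (B : ℝ) (F : R3 → ℝ), AEStronglyMeasurable F volume →
      (∀ᵐ w, |F w| ≤ B * Real.exp (-a * ‖w‖ ^ 2)) → ∀ v : R3,
        Integrable (fun w => hardSphereKernel v w * F w) ∧
        |∫ w, hardSphereKernel v w * F w| ≤ C * B * Real.exp (-a * ‖v‖ ^ 2) := by
  have hc := kernelRate_pos ha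
  have hC := kernelConst_pos ha
  set I := ∫ u : R3, ‖u‖⁻¹ * Real.exp (-kernelRate a * ‖u‖ ^ 2)
  have hI : 0 ≤ I := integral_nonneg fun u => by positivity
  refine ⟨kernelConst a * (I + 1), by positivity, fun B F hF hFB v => ?_⟩
  have hB : 0 ≤ B := by
    obtain ⟨w, hw⟩ := hFB.exists
    exact nonneg_of_mul_nonneg_left ((abs_nonneg _).trans hw) (Real.exp_pos _)
  obtain ⟨h1, h2⟩ := integrable_kernel_mul_and_abs_integral_le ha0 ha (G := fun _ => B) hF
    (by simpa only [mul_comm] using hFB) v ((integrable_inv_norm_mul_exp_sub hc v).mul_const B)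
  refine ⟨h1, h2.trans ?_⟩
  rw [integral_mul_const, integral_inv_norm_mul_exp_sub]
  have : 0 ≤ kernelConst a * B * Real.exp (-a * ‖v‖ ^ 2) := by positivity
  nlinarith

/-- `K` gains from a source with a factor `‖w‖⁻¹`. -/
lemma exists_abs_integral_kernel_le_of_inv_norm {a : ℝ} (ha0 : 0 ≤ a) (ha : a < 1 / 2) :
    ∃ C : ℝ, 0 < C ∧ ∀ (B : ℝ) (F : R3 → ℝ), AEStronglyMeasurable F volume → 0 ≤ B →
      (∀ᵐ w, |F w| ≤ B * Real.exp (-a * ‖w‖ ^ 2) * ‖w‖⁻¹) → ∀ v : R3,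
        Integrable (fun w => hardSphereKernel v w * F w) ∧
        |∫ w, hardSphereKernel v w * F w| ≤ C * B * Real.exp (-a * ‖v‖ ^ 2) := by
  have hc := kernelRate_pos ha
  have hC := kernelConst_pos ha
  obtain ⟨I, hI, hIv⟩ := exists_integral_inv_norm_mul_inv_norm_le hc
  refine ⟨kernelConst a * I, by positivity, fun B F hF hB hFB v => ?_⟩
  have hi : Integrable (fun w : R3 =>
      ‖w - v‖⁻¹ * Real.exp (-kernelRate a * ‖w - v‖ ^ 2) * (‖w‖⁻¹ * B)) := by
    simpa only [mul_assoc] using (hIv v).1.mul_const B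
  obtain ⟨h1, h2⟩ := integrable_kernel_mul_and_abs_integral_le ha0 ha (G := fun w => ‖w‖⁻¹ * B) hF
    (by
      filter_upwards [hFB] with w hw
      linarith) v hi
  refine ⟨h1, h2.trans ?_⟩
  have : 0 ≤ kernelConst a * B * Real.exp (-a * ‖v‖ ^ 2) := by positivity
  simp only [← mul_assoc]
  rw [integral_mul_const]
  nlinarith [(hIv v).2]

/-! ### Lipschitz dependence of the kernel on the first velocity -/

lemma abs_exp_neg_sub_exp_neg_le (x y : ℝ) :
    |Real.exp (-x) - Real.exp (-y)| ≤ |x - y| * (Real.exp (-x) + Real.exp (-y)) := by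
  wlog h : x ≤ y generalizing x y
  · rw [abs_sub_comm, abs_sub_comm x, add_comm]; exact this y x (not_le.1 h).le
  have h1 : Real.exp (-y) = Real.exp (-x) * Real.exp (x - y) := by rw [← Real.exp_add]; ring_nf
  have h2 := Real.add_one_le_exp (x - y)
  have hx := Real.exp_pos (-x)
  have hy := Real.exp_pos (-y)
  rw [abs_of_nonneg (sub_nonneg.2 (Real.exp_le_exp.2 (by linarith))), abs_of_nonpos (by linarith)]
  nlinarith

/-- The exponent of the first Gaussian factor of the kernel is Lipschitz in the first velocity, up
to polynomial factors and one inverse power of the distance: `A`, `A'` are the distances from `w` to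
`v`, `v'`, and `x`, `y`, `z` are the norms of `v`, `v'`, `w`. -/
lemma mul_abs_kernel_exponent_sub_le {A A' x y z e : ℝ} (hA : 0 < A) (hA' : 0 < A') (hx : 0 ≤ x)
    (hy : 0 ≤ y) (hz : 0 ≤ z) (he : |A - A'| ≤ e) (hxy : |x - y| ≤ e) (he1 : e ≤ 1)
    (hzA : |z - x| ≤ A) (hzA' : |z - y| ≤ A') :
    A * |(1 / 4 * ((z ^ 2 - x ^ 2) ^ 2 / A ^ 2) + 1 / 4 * A ^ 2)
      - (1 / 4 * ((z ^ 2 - y ^ 2) ^ 2 / A' ^ 2) + 1 / 4 * A' ^ 2)|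
      ≤ 5 * e * ((1 + x) * (1 + A)) ^ 2 := by
  have he0 : 0 ≤ e := (abs_nonneg _).trans he
  obtain ⟨B, hB⟩ : ∃ B, B = (z ^ 2 - x ^ 2) / A := ⟨_, rfl⟩
  obtain ⟨B', hB'⟩ : ∃ B, B = (z ^ 2 - y ^ 2) / A' := ⟨_, rfl⟩
  have hB2 : (z ^ 2 - x ^ 2) ^ 2 / A ^ 2 = B ^ 2 := by rw [hB, div_pow]
  have hB2' : (z ^ 2 - y ^ 2) ^ 2 / A' ^ 2 = B' ^ 2 := by rw [hB', div_pow]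
  have hAB : z ^ 2 - x ^ 2 = A * B := by rw [hB]; field_simp
  have hAB' : z ^ 2 - y ^ 2 = A' * B' := by rw [hB']; field_simp
  rw [hB2, hB2']
  obtain ⟨Q, hQ⟩ : ∃ Q, Q = (1 + x) * (1 + A) := ⟨_, rfl⟩
  rw [← hQ]
  have hxAQ : x + A + 1 ≤ Q := by rw [hQ]; linarith [mul_nonneg hx hA.le]
  obtain ⟨hA1, hA2⟩ := abs_le.1 he
  obtain ⟨hx1, hx2⟩ := abs_le.1 hxy
  obtain ⟨hz1, hz2⟩ := abs_le.1 hzA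
  have hb : |B| ≤ z + x := by
    rw [hB, abs_div, abs_of_pos hA, div_le_iff₀ hA, show z ^ 2 - x ^ 2 = (z - x) * (z + x) by ring,
      abs_mul, abs_of_nonneg (by positivity : 0 ≤ z + x), mul_comm]
    gcongr
  have hb' : |B'| ≤ z + y := by
    rw [hB', abs_div, abs_of_pos hA', div_le_iff₀ hA',
      show z ^ 2 - y ^ 2 = (z - y) * (z + y) by ring,
      abs_mul, abs_of_nonneg (by positivity : 0 ≤ z + y), mul_comm]
    gcongr
  -- since `A B - A' B' = y² - x²`, the product `A (B - B')` has no denominator left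
  have hABB : |A * (B - B')| ≤ e * (x + 2 * y + z) := by
    have h1 : A * (B - B') = (y - x) * (y + x) + (A' - A) * B' := by
      linear_combination hAB' - hAB
    rw [h1]
    refine (abs_add_le _ _).trans ?_
    rw [abs_mul, abs_mul, abs_sub_comm y, abs_sub_comm A', abs_of_nonneg (by positivity : 0 ≤ y + x)]
    calc _ ≤ e * (y + x) + e * (z + y) := by gcongr
      _ = _ := by ring
  have h1 : A * (1 / 4 * B ^ 2 + 1 / 4 * A ^ 2 - (1 / 4 * B' ^ 2 + 1 / 4 * A' ^ 2)) =
      (1 / 4) * ((A * (B - B')) * (B + B') + A * ((A - A') * (A + A'))) := by ring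
  have h2 : A * |1 / 4 * B ^ 2 + 1 / 4 * A ^ 2 - (1 / 4 * B' ^ 2 + 1 / 4 * A' ^ 2)| ≤
      (1 / 4) * (e * (x + 2 * y + z) * ((z + x) + (z + y)) + A * (e * (A + A'))) := by
    rw [← abs_of_pos hA, ← abs_mul, abs_of_pos hA, h1, abs_mul,
      abs_of_pos (by norm_num : (0 : ℝ) < 1 / 4)]
    refine mul_le_mul_of_nonneg_left ((abs_add_le _ _).trans ?_) (by norm_num)
    rw [abs_mul (A * (B - B')), abs_mul A ((A - A') * (A + A')), abs_mul (A - A'), abs_of_pos hA,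
      abs_of_pos (by positivity : 0 < A + A')]
    gcongr
    exact (abs_add_le _ _).trans (add_le_add hb hb')
  have h4 : x + 2 * y + z ≤ 4 * Q := by linarith
  have h5 : (z + x) + (z + y) ≤ 4 * Q := by linarith
  have h6 : A + A' ≤ 2 * Q := by linarith
  have h7 : A ≤ Q := by linarith
  have hQ0 : 0 ≤ Q := by linarith
  have h8 := mul_nonneg he0 (sq_nonneg Q)
  calc _ ≤ (1 / 4) * (e * (4 * Q) * (4 * Q) + Q * (e * (2 * Q))) := by
        refine h2.trans ?_
        gcongr
    _ = 9 / 2 * (e * Q ^ 2) := by ring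
    _ ≤ 5 * (e * Q ^ 2) := by gcongr; norm_num
    _ = _ := by ring

/-- Assembly of a kernel difference: `E`, `E'` and `F`, `F'` stand for the exponentials of the two
parts of the kernel, `D` for the difference of the exponents of `E` and `E'`, and `Q` for a
polynomial weight that dominates the distance `A`. -/
lemma abs_kernel_sub_kernel_le_of_factors {A A' e Q D E E' F F' : ℝ} (hA : 0 < A) (hA' : 0 < A')
    (hE : 0 ≤ E) (hE' : 0 ≤ E') (hF : 0 ≤ F) (hF' : 0 ≤ F') (hQ1 : 1 ≤ Q) (hAQ : A ≤ Q)
    (he : |A - A'| ≤ e) (hD : A * D ≤ 5 * e * Q ^ 2) (hEE : |E - E'| ≤ D * (E + E'))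
    (hFF : |F - F'| ≤ e * Q * (F + F')) :
    |(2 * A⁻¹ * E - A * F) - (2 * A'⁻¹ * E' - A' * F')|
      ≤ 16 * e * Q ^ 4 * ((A ^ 2)⁻¹ + (A' ^ 2)⁻¹) * ((E + E') + (F + F')) := by
  have he0 : 0 ≤ e := (abs_nonneg _).trans he
  have hinv : |A⁻¹ - A'⁻¹| ≤ e * ((A ^ 2)⁻¹ + (A' ^ 2)⁻¹) := by
    have h1 : A⁻¹ - A'⁻¹ = (A' - A) * (A⁻¹ * A'⁻¹) := by field_simp
    have h2 : A⁻¹ * A'⁻¹ ≤ (A ^ 2)⁻¹ + (A' ^ 2)⁻¹ := by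
      rw [← inv_pow, ← inv_pow]
      linarith [sq_nonneg (A⁻¹ - A'⁻¹), sq_nonneg (A⁻¹ + A'⁻¹), sq_nonneg A⁻¹, sq_nonneg A'⁻¹]
    rw [h1, abs_mul, abs_sub_comm, abs_of_pos (by positivity : 0 < A⁻¹ * A'⁻¹)]
    gcongr
  obtain ⟨p, hp⟩ : ∃ p, p = (A ^ 2)⁻¹ := ⟨_, rfl⟩
  obtain ⟨p', hp'⟩ : ∃ p, p = (A' ^ 2)⁻¹ := ⟨_, rfl⟩
  rw [← hp, ← hp'] at hinv ⊢
  have hp0 : 0 < p := by rw [hp]; positivity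
  have hp0' : 0 < p' := by rw [hp']; positivity
  have hQp : 1 ≤ Q ^ 2 * p := by
    rw [hp, ← div_eq_mul_inv, one_le_div (by positivity)]
    exact pow_le_pow_left₀ hA.le hAQ 2
  have hpp : p ≤ p + p' := by linarith
  have hQ4 : Q ^ 2 ≤ Q ^ 4 := pow_le_pow_right₀ hQ1 (by norm_num)
  have hQ04 : 1 ≤ Q ^ 4 := one_le_pow₀ hQ1
  have s1 : |2 * (A⁻¹ - A'⁻¹) * E'| ≤ 2 * (Q ^ 4 * (e * (p + p'))) * (E + E') := by
    rw [abs_mul, abs_mul, abs_of_nonneg hE', abs_of_pos (by norm_num : (0 : ℝ) < 2)]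
    have h0 : e * (p + p') ≤ Q ^ 4 * (e * (p + p')) :=
      le_mul_of_one_le_left (by positivity) hQ04
    have h1 := hinv.trans h0
    have h2 : E' ≤ E + E' := by linarith
    gcongr
  have s2 : |2 * A⁻¹ * (E - E')| ≤ 10 * e * Q ^ 4 * (p + p') * (E + E') := by
    rw [abs_mul, abs_of_pos (by positivity : 0 < 2 * A⁻¹)]
    have h3 : 2 * A⁻¹ * |E - E'| ≤ 2 * A⁻¹ * (D * (E + E')) := by gcongr
    have h4 : 2 * A⁻¹ * (D * (E + E')) = 2 * p * (A * D) * (E + E') := by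
      rw [hp]; field_simp
    rw [h4] at h3
    calc _ ≤ _ := h3
      _ ≤ 2 * p * (5 * e * Q ^ 2) * (E + E') := by gcongr
      _ = 10 * e * Q ^ 2 * p * (E + E') := by ring
      _ ≤ _ := by gcongr
  have s3 : |(A - A') * F'| ≤ e * (Q ^ 4 * (p + p')) * (F + F') := by
    rw [abs_mul, abs_of_nonneg hF']
    have h2 : F' ≤ F + F' := by linarith
    calc |A - A'| * F' ≤ e * 1 * (F + F') := by rw [mul_one]; gcongr
      _ ≤ e * (Q ^ 2 * p) * (F + F') := by gcongr
      _ ≤ _ := by gcongr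
  have s4 : |A * (F - F')| ≤ e * (Q ^ 4 * (p + p')) * (F + F') := by
    rw [abs_mul, abs_of_pos hA]
    calc A * |F - F'| ≤ Q * (e * Q * (F + F')) := by gcongr
      _ = e * Q ^ 2 * 1 * (F + F') := by ring
      _ ≤ e * Q ^ 2 * (Q ^ 2 * p) * (F + F') := by gcongr
      _ ≤ e * Q ^ 2 * (Q ^ 2 * (p + p')) * (F + F') := by gcongr
      _ = _ := by ring
  have hsplit : (2 * A⁻¹ * E - A * F) - (2 * A'⁻¹ * E' - A' * F')
      = (2 * (A⁻¹ - A'⁻¹) * E' + 2 * A⁻¹ * (E - E')) - ((A - A') * F' + A * (F - F')) := by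
    ring
  have t3 : 0 ≤ e * Q ^ 4 * (p + p') * (F + F') := by positivity
  have t4 : 0 ≤ e * Q ^ 4 * (p + p') * (E + E') := by positivity
  rw [hsplit]
  calc _ ≤ (|2 * (A⁻¹ - A'⁻¹) * E'| + |2 * A⁻¹ * (E - E')|) + (|(A - A') * F'| + |A * (F - F')|) :=
        (abs_sub _ _).trans (add_le_add (abs_add_le _ _) (abs_add_le _ _))
    _ ≤ _ := add_le_add (add_le_add s1 s2) (add_le_add s3 s4)
    _ = 12 * (e * Q ^ 4 * (p + p') * (E + E')) + 2 * (e * Q ^ 4 * (p + p') * (F + F')) := by ring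
    _ ≤ 16 * (e * Q ^ 4 * (p + p') * (E + E')) + 16 * (e * Q ^ 4 * (p + p') * (F + F')) := by
        gcongr <;> norm_num
    _ = _ := by ring

/-- Lipschitz estimate for the kernel in its first variable, with unweighted exponential factors. -/
lemma abs_kernel_sub_kernel_le_aux {A A' x y z e : ℝ} (hA : 0 < A) (hA' : 0 < A') (hx : 0 ≤ x)
    (hy : 0 ≤ y) (hz : 0 ≤ z) (he : |A - A'| ≤ e) (hxy : |x - y| ≤ e) (he1 : e ≤ 1)
    (hzA : |z - x| ≤ A) (hzA' : |z - y| ≤ A') :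
    |(2 * A⁻¹ * Real.exp (-(1 / 4) * ((z ^ 2 - x ^ 2) ^ 2 / A ^ 2) - (1 / 4) * A ^ 2)
        - A * Real.exp (-(1 / 2) * (z ^ 2 + x ^ 2)))
      - (2 * A'⁻¹ * Real.exp (-(1 / 4) * ((z ^ 2 - y ^ 2) ^ 2 / A' ^ 2) - (1 / 4) * A' ^ 2)
        - A' * Real.exp (-(1 / 2) * (z ^ 2 + y ^ 2)))|
      ≤ 16 * e * ((1 + x) * (1 + A)) ^ 4 * ((A ^ 2)⁻¹ + (A' ^ 2)⁻¹) *
        ((Real.exp (-(1 / 4) * ((z ^ 2 - x ^ 2) ^ 2 / A ^ 2) - (1 / 4) * A ^ 2)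
          + Real.exp (-(1 / 4) * ((z ^ 2 - y ^ 2) ^ 2 / A' ^ 2) - (1 / 4) * A' ^ 2))
          + (Real.exp (-(1 / 2) * (z ^ 2 + x ^ 2)) + Real.exp (-(1 / 2) * (z ^ 2 + y ^ 2)))) := by
  have he0 : 0 ≤ e := (abs_nonneg _).trans he
  have hXY := mul_abs_kernel_exponent_sub_le hA hA' hx hy hz he hxy he1 hzA hzA'
  have hQ1 : 1 ≤ (1 + x) * (1 + A) := by linarith [mul_nonneg hx hA.le]
  have hAQ : A ≤ (1 + x) * (1 + A) := by linarith [mul_nonneg hx hA.le]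
  have hxQ : x + 1 ≤ (1 + x) * (1 + A) := by linarith [mul_nonneg hx hA.le]
  obtain ⟨hx1, hx2⟩ := abs_le.1 hxy
  have hEE := abs_exp_neg_sub_exp_neg_le (1 / 4 * ((z ^ 2 - x ^ 2) ^ 2 / A ^ 2) + 1 / 4 * A ^ 2)
    (1 / 4 * ((z ^ 2 - y ^ 2) ^ 2 / A' ^ 2) + 1 / 4 * A' ^ 2)
  have hFF := abs_exp_neg_sub_exp_neg_le ((1 / 2) * (z ^ 2 + x ^ 2)) ((1 / 2) * (z ^ 2 + y ^ 2))
  simp only [neg_add, ← neg_mul] at hEE hFF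
  refine abs_kernel_sub_kernel_le_of_factors hA hA' (Real.exp_pos _).le (Real.exp_pos _).le
    (Real.exp_pos _).le (Real.exp_pos _).le hQ1 hAQ he hXY ?_ ?_
  · convert hEE using 4 <;> ring
  · refine hFF.trans (mul_le_mul_of_nonneg_right ?_ (by positivity))
    have h2 : (1 / 2) * (z ^ 2 + x ^ 2) - (1 / 2) * (z ^ 2 + y ^ 2)
      = (1 / 2) * ((x - y) * (x + y)) := by ring
    rw [h2, abs_mul, abs_mul, abs_of_pos (by norm_num : (0 : ℝ) < 1 / 2),
      abs_of_nonneg (by positivity : 0 ≤ x + y)]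
    have h3 : x + y ≤ 2 * ((1 + x) * (1 + A)) := by linarith
    calc 1 / 2 * (|x - y| * (x + y)) ≤ 1 / 2 * (e * (2 * ((1 + x) * (1 + A)))) := by gcongr
      _ = _ := by ring

/-- Elementary comparison of Gaussians at two points at distance at most one. -/
lemma exp_neg_mul_sq_le_of_abs_sub_le_one {c c' : ℝ} (hc : 0 ≤ c') (hcc : c' < c) :
    ∃ C : ℝ, 1 ≤ C ∧ ∀ s t : ℝ, |s - t| ≤ 1 →
      Real.exp (-c * s ^ 2) ≤ C * Real.exp (-c' * t ^ 2) := by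
  refine ⟨Real.exp (c' + c' ^ 2 / (c - c')), Real.one_le_exp
    (add_nonneg hc (div_nonneg (sq_nonneg _) (by linarith))), fun s t h => ?_⟩
  rw [← Real.exp_add, Real.exp_le_exp]
  have hd : 0 < c - c' := by linarith
  -- `t² ≤ (|s| + 1)²`, and `2 c' |s|` is absorbed by `(c - c') s²`
  have h1 : t ^ 2 ≤ (|s| + 1) ^ 2 := by
    rw [← sq_abs t]
    refine pow_le_pow_left₀ (abs_nonneg _) ?_ 2
    have := abs_sub_abs_le_abs_sub t s
    rw [abs_sub_comm] at this
    linarith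
  have h2 : 2 * c' * |s| ≤ (c - c') * |s| ^ 2 + c' ^ 2 / (c - c') := by
    have h3 : 0 ≤ ((c - c') * |s| - c') ^ 2 / (c - c') := by positivity
    have h4 : ((c - c') * |s| - c') ^ 2 / (c - c') =
      (c - c') * |s| ^ 2 + c' ^ 2 / (c - c') - 2 * c' * |s| := by field_simp; ring
    linarith
  have h5 : |s| ^ 2 = s ^ 2 := sq_abs s
  nlinarith [mul_le_mul_of_nonneg_left h1 hc]

/-- Weighted Lipschitz estimate for the kernel in its first variable. -/
lemma exists_abs_kernel_sub_kernel_le {a a' : ℝ} (ha0 : 0 ≤ a') (haa : a' < a) (ha : a < 1 / 2) :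
    ∃ C c : ℝ, 0 < C ∧ 0 < c ∧ ∀ v v' w : R3, ‖v - v'‖ ≤ 1 → w ≠ v → w ≠ v' →
      |hardSphereKernel v w - hardSphereKernel v' w| * Real.exp (-a * ‖w‖ ^ 2) ≤
        C * ‖v - v'‖ * Real.exp (-a' * ‖v‖ ^ 2) *
          ((‖w - v‖ ^ 2)⁻¹ * Real.exp (-c * ‖w - v‖ ^ 2)
            + (‖w - v'‖ ^ 2)⁻¹ * Real.exp (-c * ‖w - v'‖ ^ 2)) := by
  set g := 1 / 4 - a / 2 with hg
  have hgp : 0 < g := by rw [hg]; linarith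
  -- half of the margin `a - a'` pays for replacing `v'` by `v`, the other half for the polynomial
  -- factors in `‖v‖`
  set a1 := (a + a') / 2 with ha1
  obtain ⟨C1, hC1, H1⟩ := exp_neg_mul_sq_le_of_abs_sub_le_one (c := a) (c' := a1)
    (by linarith) (by linarith)
  obtain ⟨C2, hC2, H2⟩ := exp_neg_mul_sq_le_of_abs_sub_le_one (c := g) (c' := g / 2)
    (by linarith) (by linarith)
  obtain ⟨C3, hC3, H3⟩ := one_add_pow_le_exp_sq 4 (e := a1 - a') (by linarith)
  obtain ⟨C4, hC4, H4⟩ := one_add_pow_le_exp_sq 4 (e := g / 4) (by linarith)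
  obtain ⟨C5, hC5, H5⟩ := exp_neg_mul_sq_le_of_abs_sub_le_one (c := g / 4) (c' := g / 8)
    (by linarith) (by linarith)
  refine ⟨64 * C1 * C2 * C3 * C4 * C5, g / 8, by positivity, by linarith,
    fun v v' w hv hwv hwv' => ?_⟩
  have hA : 0 < ‖w - v‖ := norm_pos_iff.2 (sub_ne_zero.2 hwv)
  have hA' : 0 < ‖w - v'‖ := norm_pos_iff.2 (sub_ne_zero.2 hwv')
  have hAA : |‖w - v‖ - ‖w - v'‖| ≤ ‖v - v'‖ := by
    have := abs_norm_sub_norm_le (w - v) (w - v')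
    rwa [sub_sub_sub_cancel_left, norm_sub_rev v'] at this
  have hvv : |‖v‖ - ‖v'‖| ≤ ‖v - v'‖ := abs_norm_sub_norm_le v v'
  have haux := abs_kernel_sub_kernel_le_aux hA hA' (norm_nonneg v) (norm_nonneg v') (norm_nonneg w)
    hAA hvv hv (abs_norm_sub_norm_le w v) (abs_norm_sub_norm_le w v')
  have e1 := kernel_exponent_le (by linarith) ha v w
  have e2 := kernel_exponent_le (by linarith) ha v' w
  have e3 := kernel_exponent_le' (by linarith) ha v w
  have e4 := kernel_exponent_le' (by linarith) ha v' w
  rw [← hg] at e1 e2 e3 e4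
  have hkk : |hardSphereKernel v w - hardSphereKernel v' w| ≤ _ := le_trans (by
    unfold hardSphereKernel
    rw [← mul_sub, abs_mul, abs_of_pos kernel_const_pos]
    exact mul_le_of_le_one_left (abs_nonneg _) kernel_const_le_one) haux
  set A := ‖w - v‖
  set A' := ‖w - v'‖
  set x := ‖v‖
  set y := ‖v'‖
  set z := ‖w‖
  set d := ‖v - v'‖
  have hx0 : 0 ≤ x := norm_nonneg v
  have hd0 : 0 ≤ d := norm_nonneg _
  have hxy1 : |y - x| ≤ 1 := by rw [abs_sub_comm]; linarith
  have hAA1 : |A - A'| ≤ 1 := by linarith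
  have hAA2 : |A' - A| ≤ 1 := by rw [abs_sub_comm]; linarith
  set S := C1 * C2 * (Real.exp (-a1 * x ^ 2) * Real.exp (-(g / 2) * A ^ 2)) with hS
  have hx1 : Real.exp (-a * x ^ 2) ≤ C1 * Real.exp (-a1 * x ^ 2) := H1 x x (by simp)
  have hy1 : Real.exp (-a * y ^ 2) ≤ C1 * Real.exp (-a1 * x ^ 2) := H1 y x hxy1
  have hb1 : Real.exp (-g * A ^ 2) ≤ C2 * Real.exp (-(g / 2) * A ^ 2) := H2 A A (by simp)
  have hb2 : Real.exp (-g * A' ^ 2) ≤ C2 * Real.exp (-(g / 2) * A ^ 2) := H2 A' A hAA2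
  have hSv : ∀ r : ℝ, r - a * z ^ 2 ≤ -a * x ^ 2 - g * A ^ 2 →
      Real.exp r * Real.exp (-a * z ^ 2) ≤ S := fun r hr => by
    calc _ = Real.exp (r - a * z ^ 2) := by rw [← Real.exp_add]; ring_nf
      _ ≤ Real.exp (-a * x ^ 2 - g * A ^ 2) := Real.exp_le_exp.2 hr
      _ = Real.exp (-a * x ^ 2) * Real.exp (-g * A ^ 2) := by rw [← Real.exp_add]; ring_nf
      _ ≤ (C1 * Real.exp (-a1 * x ^ 2)) * (C2 * Real.exp (-(g / 2) * A ^ 2)) := by gcongr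
      _ = S := by rw [hS]; ring
  have hSv' : ∀ r : ℝ, r - a * z ^ 2 ≤ -a * y ^ 2 - g * A' ^ 2 →
      Real.exp r * Real.exp (-a * z ^ 2) ≤ S := fun r hr => by
    calc _ = Real.exp (r - a * z ^ 2) := by rw [← Real.exp_add]; ring_nf
      _ ≤ Real.exp (-a * y ^ 2 - g * A' ^ 2) := Real.exp_le_exp.2 hr
      _ = Real.exp (-a * y ^ 2) * Real.exp (-g * A' ^ 2) := by rw [← Real.exp_add]; ring_nf
      _ ≤ (C1 * Real.exp (-a1 * x ^ 2)) * (C2 * Real.exp (-(g / 2) * A ^ 2)) := by gcongr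
      _ = S := by rw [hS]; ring
  have hsum := add_le_add (add_le_add (hSv _ e1) (hSv' _ e2)) (add_le_add (hSv _ e3) (hSv' _ e4))
  have hQ : ((1 + x) * (1 + A)) ^ 4 * S ≤
      C1 * C2 * C3 * C4 * Real.exp (-a' * x ^ 2) * Real.exp (-(g / 4) * A ^ 2) := by
    have h1 := H3 x hx0
    have h2 := H4 A hA.le
    have h3 : Real.exp ((a1 - a') * x ^ 2) * Real.exp (-a1 * x ^ 2) = Real.exp (-a' * x ^ 2) := by
      rw [← Real.exp_add]; ring_nf
    have h4 : Real.exp (g / 4 * A ^ 2) * Real.exp (-(g / 2) * A ^ 2) =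
        Real.exp (-(g / 4) * A ^ 2) := by
      rw [← Real.exp_add]; ring_nf
    calc ((1 + x) * (1 + A)) ^ 4 * S = (1 + x) ^ 4 * (1 + A) ^ 4 * S := by rw [mul_pow]
      _ ≤ (C3 * Real.exp ((a1 - a') * x ^ 2)) * (C4 * Real.exp (g / 4 * A ^ 2)) * S := by gcongr
      _ = C1 * C2 * C3 * C4 * (Real.exp ((a1 - a') * x ^ 2) * Real.exp (-a1 * x ^ 2)) *
          (Real.exp (g / 4 * A ^ 2) * Real.exp (-(g / 2) * A ^ 2)) := by rw [hS]; ring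
      _ = _ := by rw [h3, h4]
  set p := (A ^ 2)⁻¹
  set p' := (A' ^ 2)⁻¹
  have hp : 0 < p := by positivity
  have hp' : 0 < p' := by positivity
  have g1 : Real.exp (-(g / 4) * A ^ 2) ≤ C5 * Real.exp (-(g / 8) * A ^ 2) := H5 A A (by simp)
  have g2 : Real.exp (-(g / 4) * A ^ 2) ≤ C5 * Real.exp (-(g / 8) * A' ^ 2) := H5 A A' hAA1
  calc _ ≤ _ := mul_le_mul_of_nonneg_right hkk (Real.exp_pos _).le
    _ ≤ 16 * d * ((1 + x) * (1 + A)) ^ 4 * (p + p') * (S + S + (S + S)) := by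
        rw [mul_assoc]
        refine mul_le_mul_of_nonneg_left (le_trans (le_of_eq ?_) hsum) (by positivity)
        ring
    _ = 64 * d * (p + p') * (((1 + x) * (1 + A)) ^ 4 * S) := by ring
    _ ≤ 64 * d * (p + p') *
        (C1 * C2 * C3 * C4 * Real.exp (-a' * x ^ 2) * Real.exp (-(g / 4) * A ^ 2)) := by gcongr
    _ = 64 * d * (C1 * C2 * C3 * C4 * Real.exp (-a' * x ^ 2)) *
        (p * Real.exp (-(g / 4) * A ^ 2) + p' * Real.exp (-(g / 4) * A ^ 2)) := by ring
    _ ≤ 64 * d * (C1 * C2 * C3 * C4 * Real.exp (-a' * x ^ 2)) *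
        (p * (C5 * Real.exp (-(g / 8) * A ^ 2)) + p' * (C5 * Real.exp (-(g / 8) * A' ^ 2))) := by
        gcongr
    _ = _ := by ring

/-- `K` maps bounded weighted functions to functions that are Lipschitz in the velocity. -/
lemma exists_abs_integral_kernel_sub_le {a a' : ℝ} (ha0 : 0 ≤ a') (haa : a' < a) (ha : a < 1 / 2) :
    ∃ C : ℝ, 0 < C ∧ ∀ (B : ℝ) (F : R3 → ℝ), AEStronglyMeasurable F volume → 0 ≤ B →
      (∀ᵐ w, |F w| ≤ B * Real.exp (-a * ‖w‖ ^ 2)) → ∀ v v' : R3, ‖v - v'‖ ≤ 1 →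
        |(∫ w, hardSphereKernel v w * F w) - ∫ w, hardSphereKernel v' w * F w|
          ≤ C * B * ‖v - v'‖ * Real.exp (-a' * ‖v‖ ^ 2) := by
  obtain ⟨C, c, hC, hc, hk⟩ := exists_abs_kernel_sub_kernel_le ha0 haa ha
  obtain ⟨K, hK, hKv⟩ := exists_abs_integral_kernel_le (by linarith) ha
  set I := ∫ u : R3, (‖u‖ ^ 2)⁻¹ * Real.exp (-c * ‖u‖ ^ 2)
  have hI : 0 ≤ I := integral_nonneg fun u => by positivity
  refine ⟨C * (2 * I + 1), by positivity, fun B F hF hB hFB v v' hv => ?_⟩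
  rw [← integral_sub (hKv B F hF hFB v).1 (hKv B F hF hFB v').1]
  have i1 := integrable_inv_sq_mul_exp_sub hc v
  have i2 := integrable_inv_sq_mul_exp_sub hc v'
  have hb : ∀ᵐ w, ‖hardSphereKernel v w * F w - hardSphereKernel v' w * F w‖ ≤
      C * ‖v - v'‖ * Real.exp (-a' * ‖v‖ ^ 2) * B *
          ((‖w - v‖ ^ 2)⁻¹ * Real.exp (-c * ‖w - v‖ ^ 2)
            + (‖w - v'‖ ^ 2)⁻¹ * Real.exp (-c * ‖w - v'‖ ^ 2)) := by
    filter_upwards [hFB, Measure.ae_ne volume v, Measure.ae_ne volume v'] with w h1 h2 h3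
    rw [← sub_mul, norm_mul, Real.norm_eq_abs, Real.norm_eq_abs]
    calc _ ≤ |hardSphereKernel v w - hardSphereKernel v' w| * (B * Real.exp (-a * ‖w‖ ^ 2)) := by
          gcongr
      _ = B * (|hardSphereKernel v w - hardSphereKernel v' w| * Real.exp (-a * ‖w‖ ^ 2)) := by ring
      _ ≤ B * _ := mul_le_mul_of_nonneg_left (hk v v' w hv h2 h3) hB
      _ = _ := by ring
  refine (norm_integral_le_of_norm_le ((i1.add i2).const_mul _) hb).trans ?_
  rw [integral_const_mul]
  have e := integral_add i1 i2
  rw [integral_inv_sq_mul_exp_sub, integral_inv_sq_mul_exp_sub] at e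
  simp only [Pi.add_apply]
  rw [e]
  have : 0 ≤ C * ‖v - v'‖ * Real.exp (-a' * ‖v‖ ^ 2) * B := by positivity
  change _ * (I + I) ≤ _
  nlinarith

/-! ### The kernel at zero velocity against half a Maxwellian -/

lemma hardSphereKernel_zero_left {w : R3} (hw : w ≠ 0) :
    hardSphereKernel 0 w = (2 : ℝ) ^ (-(3 / 2 : ℝ)) * Real.pi⁻¹ *
      ((2 * ‖w‖⁻¹ - ‖w‖) * Real.exp (-(1 / 2) * ‖w‖ ^ 2)) := by
  have hw' : ‖w‖ ≠ 0 := norm_ne_zero_iff.2 hw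
  unfold hardSphereKernel
  rw [norm_zero, sub_zero]
  have h1 : -(1 / 4) * ((‖w‖ ^ 2 - 0 ^ 2) ^ 2 / ‖w‖ ^ 2) - 1 / 4 * ‖w‖ ^ 2
      = -(1 / 2) * ‖w‖ ^ 2 := by field_simp; ring
  have h2 : -(1 / 2) * (‖w‖ ^ 2 + 0 ^ 2) = -(1 / 2) * ‖w‖ ^ 2 := by ring
  rw [h1, h2]; ring

/-- Radial profile of the positive part of `hardSphereKernel 0 w * exp (-‖w‖² / 2)`, up to the
normalizing constant. -/
noncomputable def posProfile (r : ℝ) : ℝ := max (2 * r⁻¹ - r) 0 * Real.exp (-r ^ 2)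

lemma posProfile_nonneg (r : ℝ) : 0 ≤ posProfile r := by unfold posProfile; positivity

lemma sq_mul_posProfile_eq {r : ℝ} (hr : 0 < r) :
    r ^ 2 * posProfile r =
      (Ioc 0 (√2)).indicator (fun r => (2 * r - r ^ 3) * Real.exp (-r ^ 2)) r := by
  unfold posProfile
  by_cases h : r ≤ √2
  · rw [indicator_of_mem (show r ∈ Ioc 0 (√2) from ⟨hr, h⟩), max_eq_left]
    · field_simp
    · have : r ^ 2 ≤ 2 := by
        have := pow_le_pow_left₀ hr.le h 2
        rwa [Real.sq_sqrt (by norm_num)] at this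
      rw [sub_nonneg, ← div_eq_mul_inv, le_div_iff₀ hr]; nlinarith
  · rw [indicator_of_notMem (fun h' => h h'.2), max_eq_right]
    · simp
    · have : 2 ≤ r ^ 2 := by
        have := pow_le_pow_left₀ (Real.sqrt_nonneg 2) (not_le.1 h).le 2
        rwa [Real.sq_sqrt (by norm_num)] at this
      rw [sub_nonpos, ← div_eq_mul_inv, div_le_iff₀ hr]; nlinarith

lemma integrableOn_sq_mul_posProfile : IntegrableOn (fun r => r ^ 2 * posProfile r) (Ioi 0) := by
  have h : IntegrableOn ((Ioc 0 (√2)).indicator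
      (fun r : ℝ => (2 * r - r ^ 3) * Real.exp (-r ^ 2))) (Ioi 0) :=
    ((by fun_prop : Continuous fun r : ℝ =>
      (2 * r - r ^ 3) * Real.exp (-r ^ 2)).integrableOn_Ioc.integrable_indicator
        measurableSet_Ioc).integrableOn
  exact h.congr_fun (fun r hr => (sq_mul_posProfile_eq hr).symm) measurableSet_Ioi

lemma integral_sq_mul_posProfile :
    ∫ r in Ioi (0 : ℝ), r ^ 2 * posProfile r = (1 + Real.exp (-2)) / 2 := by
  rw [setIntegral_congr_fun measurableSet_Ioi (fun r hr => sq_mul_posProfile_eq hr),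
    setIntegral_indicator measurableSet_Ioc,
    show Ioi (0 : ℝ) ∩ Ioc 0 (√2) = Ioc 0 (√2) from inter_eq_right.2 fun r hr => hr.1,
    ← intervalIntegral.integral_of_le (Real.sqrt_nonneg 2)]
  rw [intervalIntegral.integral_eq_sub_of_hasDerivAt
    (f := fun r => (r ^ 2 - 1) / 2 * Real.exp (-r ^ 2))]
  · rw [Real.sq_sqrt (by norm_num)]
    norm_num
    ring
  · intro r _
    have h1 : HasDerivAt (fun r : ℝ => (r ^ 2 - 1) / 2) r r :=
      (((hasDerivAt_pow 2 r).sub_const 1).div_const 2).congr_deriv (by norm_num)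
    have h2 : HasDerivAt (fun r : ℝ => Real.exp (-r ^ 2)) (Real.exp (-r ^ 2) * (-(2 * r))) r :=
      ((hasDerivAt_pow 2 r).neg).exp.congr_deriv (by norm_num)
    exact (h1.mul h2).congr_deriv (by ring)
  · exact (by fun_prop : Continuous fun r : ℝ =>
      (2 * r - r ^ 3) * Real.exp (-r ^ 2)).intervalIntegrable _ _

lemma integrable_posProfile_norm : Integrable (fun w : R3 => posProfile ‖w‖) := by
  refine (integrable_fun_norm_addHaar (volume : Measure R3) (f := posProfile)).2 ?_
  simpa using integrableOn_sq_mul_posProfile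

lemma integral_posProfile_norm :
    ∫ w : R3, posProfile ‖w‖ = 2 * Real.pi * (1 + Real.exp (-2)) := by
  rw [integral_fun_norm_addHaar (volume : Measure R3) posProfile]
  simp only [finrank_euclideanSpace, Fintype.card_fin, smul_eq_mul, Nat.add_one_sub_one,
    nsmul_eq_mul, integral_sq_mul_posProfile, Measure.real, EuclideanSpace.volume_ball_fin_three]
  rw [ENNReal.toReal_mul, ENNReal.toReal_ofReal (by positivity)]
  norm_num
  ring

/-- Half of the integral over the whole space, by the symmetry `w ↦ -w`. -/
lemma setIntegral_posProfile_le :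
    ∫ w in {w : R3 | w 0 < 0}, posProfile ‖w‖ ≤ Real.pi * (1 + Real.exp (-2)) := by
  have hm : Measurable fun w : R3 => w 0 := by fun_prop
  have hS : MeasurableSet {w : R3 | w 0 < 0} := measurableSet_lt hm measurable_const
  have hS' : MeasurableSet {w : R3 | 0 < w 0} := measurableSet_lt measurable_const hm
  have h1 : ∫ w in {w : R3 | 0 < w 0}, posProfile ‖w‖ = ∫ w in {w : R3 | w 0 < 0},
      posProfile ‖w‖ := by
    rw [← integral_indicator hS, ← integral_indicator hS', ← integral_neg_eq_self]
    congr 1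
    ext w
    simp [indicator]
  have h2 : ∫ w in {w : R3 | w 0 < 0} ∪ {w : R3 | 0 < w 0}, posProfile ‖w‖ =
      (∫ w in {w : R3 | w 0 < 0}, posProfile ‖w‖) + ∫ w in {w : R3 | 0 < w 0}, posProfile ‖w‖ :=
    setIntegral_union (Set.disjoint_left.2 fun w (h : w 0 < 0) (h' : 0 < w 0) => lt_asymm h h') hS'
      integrable_posProfile_norm.integrableOn integrable_posProfile_norm.integrableOn
  have h3 := setIntegral_le_integral (s := {w : R3 | w 0 < 0} ∪ {w : R3 | 0 < w 0})
    integrable_posProfile_norm (Filter.Eventually.of_forall fun w => posProfile_nonneg _)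
  rw [h2, h1, integral_posProfile_norm] at h3
  linarith

/-- Half a Maxwellian loses: at velocity zero, `K` applied to a function between zero and
`exp (-‖w‖² / 2)` that vanishes on a half space stays strictly below `ν(0) = 2 ^ (-1/2)`. -/
lemma integral_kernel_zero_le {F : R3 → ℝ} (hF0 : ∀ᵐ w, 0 ≤ F w)
    (hF1 : ∀ᵐ w, F w ≤ Real.exp (-(1 / 2) * ‖w‖ ^ 2)) (hF2 : ∀ᵐ w : R3, 0 ≤ w 0 → F w = 0) :
    ∫ w, hardSphereKernel 0 w * F w ≤ (2 : ℝ) ^ (-(3 / 2 : ℝ)) * (1 + Real.exp (-2)) := by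
  have hS : MeasurableSet {w : R3 | w 0 < 0} :=
    measurableSet_lt (by fun_prop) measurable_const
  set c := (2 : ℝ) ^ (-(3 / 2 : ℝ)) * Real.pi⁻¹ with hc
  have hc0 : 0 < c := kernel_const_pos
  have hi : Integrable ({w : R3 | w 0 < 0}.indicator fun w : R3 => c * posProfile ‖w‖) :=
    (integrable_posProfile_norm.const_mul c).indicator hS
  -- if the integrand is not integrable, the left side is `0`
  by_cases hk : Integrable fun w => hardSphereKernel 0 w * F w
  swap
  · rw [integral_undef hk]; positivity
  calc _ ≤ ∫ w, {w : R3 | w 0 < 0}.indicator (fun w : R3 => c * posProfile ‖w‖) w := by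
        refine integral_mono_ae hk hi ?_
        filter_upwards [hF0, hF1, hF2, Measure.ae_ne volume (0 : R3)] with w h0 h1 h2 hw
        by_cases hw0 : w 0 < 0
        · rw [indicator_of_mem (show w ∈ {w : R3 | w 0 < 0} from hw0),
            hardSphereKernel_zero_left hw, ← hc, mul_assoc]
          refine mul_le_mul_of_nonneg_left ?_ hc0.le
          unfold posProfile
          have e : Real.exp (-‖w‖ ^ 2) =
              Real.exp (-(1 / 2) * ‖w‖ ^ 2) * Real.exp (-(1 / 2) * ‖w‖ ^ 2) := by
            rw [← Real.exp_add]; ring_nf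
          rw [e, mul_assoc]
          have hE := Real.exp_pos (-(1 / 2) * ‖w‖ ^ 2)
          calc (2 * ‖w‖⁻¹ - ‖w‖) * (Real.exp (-(1 / 2) * ‖w‖ ^ 2) * F w)
              ≤ max (2 * ‖w‖⁻¹ - ‖w‖) 0 * (Real.exp (-(1 / 2) * ‖w‖ ^ 2) * F w) := by
                gcongr; exact le_max_left _ _
            _ ≤ _ := by gcongr
        · rw [h2 (not_lt.1 hw0), mul_zero]
          exact indicator_nonneg (fun w _ => mul_nonneg hc0.le (posProfile_nonneg _)) w
    _ = c * ∫ w in {w : R3 | w 0 < 0}, posProfile ‖w‖ := by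
        rw [integral_indicator hS, integral_const_mul]
    _ ≤ c * (Real.pi * (1 + Real.exp (-2))) :=
        mul_le_mul_of_nonneg_left setIntegral_posProfile_le hc0.le
    _ = _ := by
        rw [hc]; field_simp

/-! ### The collision frequency -/

/-- The function `∫₀¹ exp (-r² s²) ds`, through which the collision frequency is a function of `r`
that is regular at `r = 0`. -/
noncomputable def gaussMean (r : ℝ) : ℝ := ∫ s in (0 : ℝ)..1, Real.exp (-(r ^ 2 * s ^ 2))

lemma intervalIntegrable_gaussMean (r : ℝ) :
    IntervalIntegrable (fun s : ℝ => Real.exp (-(r ^ 2 * s ^ 2))) volume 0 1 :=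
  (by fun_prop : Continuous fun s : ℝ => Real.exp (-(r ^ 2 * s ^ 2))).intervalIntegrable _ _

lemma gaussMean_nonneg (r : ℝ) : 0 ≤ gaussMean r :=
  intervalIntegral.integral_nonneg zero_le_one fun _ _ => (Real.exp_pos _).le

lemma gaussMean_le_one (r : ℝ) : gaussMean r ≤ 1 := by
  have h := intervalIntegral.integral_mono_on zero_le_one (intervalIntegrable_gaussMean r)
    (intervalIntegrable_const (c := (1 : ℝ)))
    (fun s _ => Real.exp_le_one_iff.2 (neg_nonpos.2 (by positivity)))
  simpa [gaussMean] using h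

lemma exp_neg_sq_le_gaussMean (r : ℝ) : Real.exp (-r ^ 2) ≤ gaussMean r := by
  have h := intervalIntegral.integral_mono_on zero_le_one
    (intervalIntegrable_const (c := Real.exp (-r ^ 2))) (intervalIntegrable_gaussMean r)
    (fun s hs => by
      have hs2 : s ^ 2 ≤ 1 := pow_le_one₀ hs.1 hs.2
      exact Real.exp_le_exp.2 (by nlinarith [sq_nonneg r]))
  simpa [gaussMean] using h

lemma one_sub_exp_le_mul_gaussMean (r : ℝ) :
    1 - Real.exp (-r ^ 2) ≤ (2 * r ^ 2 + 1) * gaussMean r := by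
  have h1 : ∫ s in (0 : ℝ)..1, 2 * r ^ 2 * s * Real.exp (-(r ^ 2 * s ^ 2))
      = 1 - Real.exp (-r ^ 2) := by
    rw [intervalIntegral.integral_eq_sub_of_hasDerivAt
      (f := fun s => -Real.exp (-(r ^ 2 * s ^ 2)))]
    · simp; ring
    · intro s _
      exact (((hasDerivAt_pow 2 s).const_mul (r ^ 2)).neg).exp.neg.congr_deriv
        (by norm_num; ring)
    · exact (by fun_prop : Continuous fun s : ℝ =>
        2 * r ^ 2 * s * Real.exp (-(r ^ 2 * s ^ 2))).intervalIntegrable _ _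
  rw [← h1, gaussMean, ← intervalIntegral.integral_const_mul]
  refine intervalIntegral.integral_mono_on zero_le_one
    ((by fun_prop : Continuous fun s : ℝ =>
        2 * r ^ 2 * s * Real.exp (-(r ^ 2 * s ^ 2))).intervalIntegrable _ _)
    ((intervalIntegrable_gaussMean r).const_mul _) fun s hs => ?_
  refine mul_le_mul_of_nonneg_right ?_ (Real.exp_pos _).le
  nlinarith [sq_nonneg r, hs.1, hs.2]

lemma abs_gaussMean_sub_le (r t : ℝ) : |gaussMean r - gaussMean t| ≤ |r ^ 2 - t ^ 2| := by
  rw [gaussMean, gaussMean, ← intervalIntegral.integral_sub (intervalIntegrable_gaussMean r)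
    (intervalIntegrable_gaussMean t)]
  have := intervalIntegral.norm_integral_le_of_norm_le_const (a := (0 : ℝ)) (b := 1)
    (f := fun s => Real.exp (-(r ^ 2 * s ^ 2)) - Real.exp (-(t ^ 2 * s ^ 2)))
    (C := |r ^ 2 - t ^ 2|) (fun s hs => ?_)
  · simpa using this
  · rw [uIoc_of_le zero_le_one] at hs
    have h1 : ∀ x y : ℝ, 0 ≤ x → 0 ≤ y → |Real.exp (-x) - Real.exp (-y)| ≤ |x - y| := by
      intro x y hx hy
      wlog h : x ≤ y generalizing x y
      · rw [abs_sub_comm, abs_sub_comm x]; exact this y x hy hx (not_le.1 h).le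
      have h1 : Real.exp (-y) = Real.exp (-x) * Real.exp (x - y) := by
        rw [← Real.exp_add]; ring_nf
      have h2 := Real.add_one_le_exp (x - y)
      have h3 : Real.exp (-x) ≤ 1 := Real.exp_le_one_iff.2 (by linarith)
      have h4 := Real.exp_pos (-x)
      rw [abs_of_nonneg (sub_nonneg.2 (Real.exp_le_exp.2 (by linarith))),
        abs_of_nonpos (by linarith)]
      nlinarith
    rw [Real.norm_eq_abs]
    refine (h1 _ _ (by positivity) (by positivity)).trans ?_
    rw [← sub_mul, abs_mul, abs_of_nonneg (sq_nonneg s)]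
    exact mul_le_of_le_one_right (abs_nonneg _) (by nlinarith [hs.1, hs.2])

/-- Rescaling the integral to `[0, 1]` removes the quotient by `‖v‖`, so that the formula includes
`v = 0`. -/
lemma hardSphereFreq_eq (v : R3) : hardSphereFreq v = (2 : ℝ) ^ (-(3 / 2 : ℝ)) *
    (Real.exp (-‖v‖ ^ 2) + (2 * ‖v‖ ^ 2 + 1) * gaussMean ‖v‖) := by
  unfold hardSphereFreq
  split_ifs with h
  · subst h
    have : (2 : ℝ) ^ (-(1 / 2 : ℝ)) = (2 : ℝ) ^ (-(3 / 2 : ℝ)) * 2 := by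
      conv_rhs => rw [← Real.rpow_add_one (by norm_num)]
      norm_num
    rw [this, norm_zero, gaussMean]
    simp
    norm_num
  · have hv : ‖v‖ ≠ 0 := norm_ne_zero_iff.2 h
    have h1 : ∫ η in (0 : ℝ)..‖v‖, Real.exp (-η ^ 2) = ‖v‖ * gaussMean ‖v‖ := by
      have := intervalIntegral.integral_comp_mul_left (a := 0) (b := 1)
        (fun η => Real.exp (-η ^ 2)) hv
      simp only [mul_zero, mul_one, smul_eq_mul] at this
      rw [gaussMean]
      simp only [← mul_pow, this]
      field_simp
    rw [h1]
    field_simp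

lemma freq_const_pos : (0 : ℝ) < (2 : ℝ) ^ (-(3 / 2 : ℝ)) := by positivity

lemma freq_const_le_one : (2 : ℝ) ^ (-(3 / 2 : ℝ)) ≤ 1 :=
  Real.rpow_le_one_of_one_le_of_nonpos (by norm_num) (by norm_num)

/-- Positive lower bound for the collision frequency. -/
noncomputable def freqMin : ℝ := (2 : ℝ) ^ (-(3 / 2 : ℝ))

lemma freqMin_pos : 0 < freqMin := freq_const_pos

lemma freqMin_le (v : R3) : freqMin ≤ hardSphereFreq v := by
  rw [hardSphereFreq_eq, freqMin]
  have := one_sub_exp_le_mul_gaussMean ‖v‖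
  exact le_mul_of_one_le_right freq_const_pos.le (by linarith)

lemma hardSphereFreq_pos (v : R3) : 0 < hardSphereFreq v := freqMin_pos.trans_le (freqMin_le v)

lemma hardSphereFreq_le (v : R3) : hardSphereFreq v ≤ 2 * (1 + ‖v‖) ^ 2 := by
  rw [hardSphereFreq_eq]
  have h1 : Real.exp (-‖v‖ ^ 2) ≤ 1 := Real.exp_le_one_iff.2 (by nlinarith [sq_nonneg ‖v‖])
  have h2 : (2 * ‖v‖ ^ 2 + 1) * gaussMean ‖v‖ ≤ 2 * ‖v‖ ^ 2 + 1 :=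
    mul_le_of_le_one_right (by positivity) (gaussMean_le_one _)
  have h3 : 0 ≤ (2 * ‖v‖ ^ 2 + 1) * gaussMean ‖v‖ :=
    mul_nonneg (by positivity) (gaussMean_nonneg _)
  refine (mul_le_of_le_one_left (by positivity) freq_const_le_one).trans ?_
  nlinarith [norm_nonneg v]

/-- This lower bound is attained at `v = 0`, where both sides are `2 ^ (-1/2)`. -/
lemma le_hardSphereFreq (v : R3) :
    (2 : ℝ) ^ (-(3 / 2 : ℝ)) * (2 * Real.exp (-‖v‖ ^ 2)) ≤ hardSphereFreq v := by
  rw [hardSphereFreq_eq]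
  refine mul_le_mul_of_nonneg_left ?_ freq_const_pos.le
  have h1 := exp_neg_sq_le_gaussMean ‖v‖
  nlinarith [mul_nonneg (sq_nonneg ‖v‖) (gaussMean_nonneg ‖v‖)]

lemma abs_hardSphereFreq_sub_le (v v' : R3) (h : ‖v - v'‖ ≤ 1) :
    |hardSphereFreq v - hardSphereFreq v'| ≤ 24 * (1 + ‖v‖) ^ 3 * ‖v - v'‖ := by
  have hvv : |‖v‖ - ‖v'‖| ≤ ‖v - v'‖ := abs_norm_sub_norm_le v v'
  rw [hardSphereFreq_eq, hardSphereFreq_eq, ← mul_sub, abs_mul, abs_of_pos freq_const_pos]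
  refine (mul_le_of_le_one_left (abs_nonneg _) freq_const_le_one).trans ?_
  have hg := abs_gaussMean_sub_le ‖v‖ ‖v'‖
  have hg1 := gaussMean_le_one ‖v'‖
  have hg0 := gaussMean_nonneg ‖v'‖
  have hE : |Real.exp (-‖v‖ ^ 2) - Real.exp (-‖v'‖ ^ 2)| ≤ 2 * |‖v‖ ^ 2 - ‖v'‖ ^ 2| := by
    refine (abs_exp_neg_sub_exp_neg_le _ _).trans ?_
    have h1 : Real.exp (-‖v‖ ^ 2) ≤ 1 := Real.exp_le_one_iff.2 (by nlinarith [sq_nonneg ‖v‖])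
    have h2 : Real.exp (-‖v'‖ ^ 2) ≤ 1 := Real.exp_le_one_iff.2 (by nlinarith [sq_nonneg ‖v'‖])
    nlinarith [abs_nonneg (‖v‖ ^ 2 - ‖v'‖ ^ 2)]
  have hr : 0 ≤ ‖v‖ := norm_nonneg v
  have ht : 0 ≤ ‖v'‖ := norm_nonneg v'
  have hd0 : 0 ≤ ‖v - v'‖ := norm_nonneg _
  set r := ‖v‖
  set t := ‖v'‖
  set d := ‖v - v'‖
  set D := |r ^ 2 - t ^ 2| with hD
  have hD0 : 0 ≤ D := abs_nonneg _
  have htr : t ≤ r + 1 := by linarith [(abs_le.1 hvv).1]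
  have hDd : D ≤ d * (2 * (1 + r)) := by
    rw [hD, sq_sub_sq, abs_mul, mul_comm, abs_of_nonneg (by positivity : 0 ≤ r + t)]
    gcongr
    linarith
  have e : Real.exp (-r ^ 2) + (2 * r ^ 2 + 1) * gaussMean r
      - (Real.exp (-t ^ 2) + (2 * t ^ 2 + 1) * gaussMean t)
      = (Real.exp (-r ^ 2) - Real.exp (-t ^ 2)) + (2 * r ^ 2 + 1) * (gaussMean r - gaussMean t)
        + 2 * (r ^ 2 - t ^ 2) * gaussMean t := by ring
  rw [e]
  have t2 : |(2 * r ^ 2 + 1) * (gaussMean r - gaussMean t)| ≤ (2 * r ^ 2 + 1) * D := by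
    rw [abs_mul, abs_of_pos (by positivity : 0 < 2 * r ^ 2 + 1)]
    gcongr
  have t3 : |2 * (r ^ 2 - t ^ 2) * gaussMean t| ≤ 2 * D * 1 := by
    rw [abs_mul, abs_mul, abs_of_pos (by norm_num : (0 : ℝ) < 2), abs_of_nonneg hg0]
    gcongr
  have t4 : |(Real.exp (-r ^ 2) - Real.exp (-t ^ 2)) + (2 * r ^ 2 + 1) * (gaussMean r - gaussMean t)
        + 2 * (r ^ 2 - t ^ 2) * gaussMean t| ≤ (2 * r ^ 2 + 5) * D := by
    refine (abs_add_le _ _).trans ?_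
    have := abs_add_le (Real.exp (-r ^ 2) - Real.exp (-t ^ 2))
      ((2 * r ^ 2 + 1) * (gaussMean r - gaussMean t))
    linarith
  calc _ ≤ _ := t4
    _ ≤ (12 * (1 + r) ^ 2) * (d * (2 * (1 + r))) := by
        gcongr
        nlinarith
    _ = _ := by ring

lemma continuous_hardSphereFreq : Continuous hardSphereFreq := by
  rw [continuous_iff_continuousAt]
  intro v
  rw [ContinuousAt, tendsto_iff_norm_sub_tendsto_zero]
  have h1 : Filter.Tendsto (fun w : R3 => 24 * (1 + ‖v‖) ^ 3 * ‖v - w‖) (nhds v) (nhds 0) := by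
    have : Continuous fun w : R3 => 24 * (1 + ‖v‖) ^ 3 * ‖v - w‖ := by fun_prop
    simpa using this.tendsto v
  refine squeeze_zero' (Filter.Eventually.of_forall fun _ => norm_nonneg _) ?_ h1
  filter_upwards [Metric.ball_mem_nhds v one_pos] with w hw
  rw [norm_sub_rev, Real.norm_eq_abs]
  refine abs_hardSphereFreq_sub_le v w ?_
  rw [← dist_eq_norm, dist_comm]
  exact (Metric.mem_ball.1 hw).le

/-! ### Exit times of convex sublevel domains -/

/-- `Ω = {ψ < 0}` for a convex `C²` function `ψ` on `ℝ³`, with diameter at most `D`. The concave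
function `-ψ` plays the role of the distance to the boundary. -/
structure IsConvexSublevel (Ω : Set R3) (ψ : R3 → ℝ) (D : ℝ) : Prop where
  eq_sublevel : Ω = {x | ψ x < 0}
  convexOn : ConvexOn ℝ univ ψ
  contDiff : ContDiff ℝ 2 ψ
  norm_sub_le : ∀ x ∈ Ω, ∀ y ∈ Ω, ‖x - y‖ ≤ D
  diam_pos : 0 < D

namespace IsConvexSublevel

variable {Ω : Set R3} {ψ : R3 → ℝ} {D : ℝ}

lemma mem_iff (h : IsConvexSublevel Ω ψ D) {x : R3} : x ∈ Ω ↔ ψ x < 0 := by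
  rw [h.eq_sublevel]; rfl

lemma neg_pos (h : IsConvexSublevel Ω ψ D) {x : R3} (hx : x ∈ Ω) : 0 < -ψ x :=
  _root_.neg_pos.2 (h.mem_iff.1 hx)

lemma continuous (h : IsConvexSublevel Ω ψ D) : Continuous ψ := h.contDiff.continuous

lemma differentiable (h : IsConvexSublevel Ω ψ D) : Differentiable ℝ ψ :=
  h.contDiff.differentiable (by norm_num)

lemma isOpen (h : IsConvexSublevel Ω ψ D) : IsOpen Ω := by
  rw [h.eq_sublevel]; exact isOpen_lt h.continuous continuous_const

lemma measurableSet (h : IsConvexSublevel Ω ψ D) : MeasurableSet Ω := h.isOpen.measurableSet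

lemma convex (h : IsConvexSublevel Ω ψ D) : Convex ℝ Ω := by
  rw [h.eq_sublevel]; simpa using h.convexOn.convex_lt 0

lemma isBounded (h : IsConvexSublevel Ω ψ D) : Bornology.IsBounded Ω :=
  Metric.isBounded_iff.2 ⟨D, fun x hx y hy => by
    rw [dist_eq_norm]; exact h.norm_sub_le x hx y hy⟩

lemma volume_lt_top (h : IsConvexSublevel Ω ψ D) : volume Ω < ⊤ := h.isBounded.measure_lt_top

lemma exists_fderiv_le (h : IsConvexSublevel Ω ψ D) :
    ∃ L : ℝ, 0 < L ∧ ∀ q ∈ closure Ω, ‖fderiv ℝ ψ q‖ ≤ L := by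
  have hc : Continuous (fun x => ‖fderiv ℝ ψ x‖) :=
    (h.contDiff.continuous_fderiv (by norm_num)).norm
  obtain ⟨L, hL⟩ := (h.isBounded.isCompact_closure.image hc).bddAbove
  refine ⟨max L 1, by positivity, fun q hq => (hL (mem_image_of_mem _ hq)).trans (le_max_left _ _)⟩

/-- The set of displacements `u` with `x - u ∈ Ω`; its gauge is the reciprocal of the exit time. -/
def shifted (Ω : Set R3) (x : R3) : Set R3 := {u | x - u ∈ Ω}

lemma shifted_isOpen (h : IsConvexSublevel Ω ψ D) (x : R3) : IsOpen (shifted Ω x) :=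
  h.isOpen.preimage (by fun_prop : Continuous fun u : R3 => x - u)

lemma shifted_convex (h : IsConvexSublevel Ω ψ D) (x : R3) : Convex ℝ (shifted Ω x) := by
  intro u hu w hw a b ha hb hab
  have := h.convex hu hw ha hb hab
  have e : x - (a • u + b • w) = a • (x - u) + b • (x - w) := by
    rw [smul_sub, smul_sub, sub_add_sub_comm, ← add_smul, hab, one_smul]
  change x - (a • u + b • w) ∈ Ω
  rwa [e]

lemma zero_mem_shifted {x : R3} (hx : x ∈ Ω) : (0 : R3) ∈ shifted Ω x := by
  simpa [shifted] using hx

lemma shifted_mem_nhds (h : IsConvexSublevel Ω ψ D) {x : R3} (hx : x ∈ Ω) :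
    shifted Ω x ∈ 𝓝 (0 : R3) := (h.shifted_isOpen x).mem_nhds (zero_mem_shifted hx)

lemma absorbent_shifted (h : IsConvexSublevel Ω ψ D) {x : R3} (hx : x ∈ Ω) :
    Absorbent ℝ (shifted Ω x) := absorbent_nhds_zero (h.shifted_mem_nhds hx)

lemma norm_div_le_gauge (h : IsConvexSublevel Ω ψ D) {x : R3} (hx : x ∈ Ω) (w : R3) :
    ‖w‖ / D ≤ gauge (shifted Ω x) w := by
  refine le_gauge_of_subset_closedBall (h.absorbent_shifted hx) h.diam_pos.le fun u hu => ?_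
  have := h.norm_sub_le x hx (x - u) hu
  simpa using this

lemma gauge_pos (h : IsConvexSublevel Ω ψ D) {x w : R3} (hx : x ∈ Ω) (hw : w ≠ 0) :
    0 < gauge (shifted Ω x) w :=
  (div_pos (norm_pos_iff.2 hw) h.diam_pos).trans_le (h.norm_div_le_gauge hx w)

lemma sub_smul_mem_iff (h : IsConvexSublevel Ω ψ D) {x : R3} (hx : x ∈ Ω) (w : R3) {s : ℝ}
    (hs : 0 ≤ s) : x - s • w ∈ Ω ↔ s * gauge (shifted Ω x) w < 1 := by
  have h1 := setOfPred_gauge_lt_one_eq_self_of_isOpen (h.shifted_convex x) (zero_mem_shifted hx)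
    (h.shifted_isOpen x)
  have h2 : s • w ∈ shifted Ω x ↔ gauge (shifted Ω x) (s • w) < 1 := by
    conv_lhs => rw [← h1]
    rfl
  rw [gauge_smul_of_nonneg hs, smul_eq_mul] at h2
  exact h2

/-- The exit time is the reciprocal of the gauge of `x - Ω`. For `w = 0` both sides are `0`. -/
lemma exitTime_eq (h : IsConvexSublevel Ω ψ D) {x : R3} (hx : x ∈ Ω) (w : R3) :
    exitTime Ω x w = (gauge (shifted Ω x) w)⁻¹ := by
  unfold exitTime
  have h1 : {s : ℝ | 0 < s ∧ x - s • w ∉ Ω} = {s : ℝ | 0 < s ∧ 1 ≤ s * gauge (shifted Ω x) w} := by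
    ext s
    simp only [mem_ofPred_eq]
    refine and_congr_right fun hs => ?_
    rw [h.sub_smul_mem_iff hx w hs.le, not_lt]
  rw [h1]
  by_cases hw : w = 0
  · subst hw
    simp only [gauge_zero, mul_zero, inv_zero]
    have : {s : ℝ | 0 < s ∧ (1 : ℝ) ≤ 0} = ∅ := by ext s; simp
    rw [this, Real.sInf_empty]
  · have hj := h.gauge_pos hx hw
    have : {s : ℝ | 0 < s ∧ 1 ≤ s * gauge (shifted Ω x) w} = Ici (gauge (shifted Ω x) w)⁻¹ := by
      ext s
      simp only [mem_ofPred_eq, mem_Ici, inv_le_iff_one_le_mul₀ hj]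
      refine ⟨fun h => h.2, fun h => ⟨?_, h⟩⟩
      by_contra hs
      nlinarith
    rw [this, csInf_Ici]

lemma exitTime_nonneg (h : IsConvexSublevel Ω ψ D) {x : R3} (hx : x ∈ Ω) (w : R3) :
    0 ≤ exitTime Ω x w := by
  rw [h.exitTime_eq hx]; exact inv_nonneg.2 (gauge_nonneg w)

lemma exitTime_pos (h : IsConvexSublevel Ω ψ D) {x w : R3} (hx : x ∈ Ω) (hw : w ≠ 0) :
    0 < exitTime Ω x w := by
  rw [h.exitTime_eq hx]; exact inv_pos.2 (h.gauge_pos hx hw)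

lemma exitTime_zero (h : IsConvexSublevel Ω ψ D) {x : R3} (hx : x ∈ Ω) :
    exitTime Ω x 0 = 0 := by
  rw [h.exitTime_eq hx, gauge_zero, inv_zero]

lemma exitTime_le (h : IsConvexSublevel Ω ψ D) {x : R3} (hx : x ∈ Ω) (w : R3) :
    exitTime Ω x w ≤ D * ‖w‖⁻¹ := by
  rcases eq_or_ne w 0 with rfl | hw
  · simp [h.exitTime_zero hx]
  · rw [h.exitTime_eq hx, ← div_eq_mul_inv, ← inv_div]
    exact inv_anti₀ (div_pos (norm_pos_iff.2 hw) h.diam_pos) (h.norm_div_le_gauge hx w)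

lemma sub_smul_mem (h : IsConvexSublevel Ω ψ D) {x w : R3} (hx : x ∈ Ω) {s : ℝ} (hs : 0 ≤ s)
    (hst : s < exitTime Ω x w) : x - s • w ∈ Ω := by
  rw [h.sub_smul_mem_iff hx w hs]
  rw [h.exitTime_eq hx] at hst
  have hj : 0 < gauge (shifted Ω x) w := inv_pos.1 (hs.trans_lt hst)
  rwa [inv_eq_one_div, lt_div_iff₀ hj] at hst

lemma exitPoint_notMem (h : IsConvexSublevel Ω ψ D) {x w : R3} (hx : x ∈ Ω) (hw : w ≠ 0) :
    exitPoint Ω x w ∉ Ω := by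
  unfold exitPoint
  rw [h.sub_smul_mem_iff hx w (h.exitTime_nonneg hx w), h.exitTime_eq hx,
    inv_mul_cancel₀ (h.gauge_pos hx hw).ne']
  exact lt_irrefl _

lemma exitPoint_mem_closure (h : IsConvexSublevel Ω ψ D) {x w : R3} (hx : x ∈ Ω) (hw : w ≠ 0) :
    exitPoint Ω x w ∈ closure Ω := by
  have hc : Continuous fun s : ℝ => x - s • w := by fun_prop
  have hcl : exitTime Ω x w ∈ closure (Ico 0 (exitTime Ω x w)) := by
    rw [closure_Ico (h.exitTime_pos hx hw).ne]
    exact right_mem_Icc.2 (h.exitTime_nonneg hx w)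
  exact closure_mono (image_subset_iff.2 fun s hs => h.sub_smul_mem hx hs.1 hs.2)
    (image_closure_subset_closure_image hc (mem_image_of_mem _ hcl))

lemma closure_subset (h : IsConvexSublevel Ω ψ D) : closure Ω ⊆ {x | ψ x ≤ 0} := by
  refine closure_minimal (fun x hx => (h.mem_iff.1 hx).le) (isClosed_le h.continuous
    continuous_const)

lemma frontier_subset (h : IsConvexSublevel Ω ψ D) : frontier Ω ⊆ {x | ψ x = 0} := by
  intro x hx
  rw [h.isOpen.frontier_eq] at hx
  exact le_antisymm (h.closure_subset hx.1) (not_lt.1 fun h' => hx.2 (h.mem_iff.2 h'))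

lemma exitPoint_mem_frontier (h : IsConvexSublevel Ω ψ D) {x w : R3} (hx : x ∈ Ω) (hw : w ≠ 0) :
    exitPoint Ω x w ∈ frontier Ω := by
  rw [h.isOpen.frontier_eq]
  exact ⟨h.exitPoint_mem_closure hx hw, h.exitPoint_notMem hx hw⟩

lemma exitPoint_eq_zero (h : IsConvexSublevel Ω ψ D) {x w : R3} (hx : x ∈ Ω) (hw : w ≠ 0) :
    ψ (x - exitTime Ω x w • w) = 0 :=
  h.frontier_subset (h.exitPoint_mem_frontier hx hw)

/-- Concavity of `-ψ` along a backward trajectory. -/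
lemma mul_le_neg_sub_smul (h : IsConvexSublevel Ω ψ D) {x w : R3} (hx : x ∈ Ω) (hw : w ≠ 0)
    {s b : ℝ} (hs : 0 ≤ s) (hsb : s ≤ b) (hb : 0 < b) (hbt : b ≤ exitTime Ω x w) :
    (1 - s / b) * -ψ x ≤ -ψ (x - s • w) := by
  have hq := h.exitPoint_eq_zero hx hw
  have ht := h.exitTime_pos hx hw
  set t := exitTime Ω x w
  have hst : s / t ≤ s / b := by gcongr
  have h1 : s / t ≤ 1 := (div_le_one ht).2 (hsb.trans hbt)
  have h2 := h.convexOn.2 (mem_univ x) (mem_univ (x - t • w))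
    (sub_nonneg.2 h1) (div_nonneg hs ht.le) (by ring)
  have e : (1 - s / t) • x + (s / t) • (x - t • w) = x - s • w := by
    rw [smul_sub, smul_smul, div_mul_cancel₀ _ ht.ne', sub_smul, one_smul]; abel
  rw [e, hq] at h2
  simp only [smul_eq_mul, mul_zero, add_zero] at h2
  have := h.neg_pos hx
  nlinarith

/-- A backward trajectory meets `ψ = 0` only once: `ψ` is convex along it and negative at its start. -/
lemma eq_exitTime (h : IsConvexSublevel Ω ψ D) {x w : R3} (hx : x ∈ Ω) (hw : w ≠ 0) {s : ℝ}
    (hs : 0 < s) (h0 : ψ (x - s • w) = 0) : s = exitTime Ω x w := by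
  rcases lt_trichotomy s (exitTime Ω x w) with h1 | h1 | h1
  · exact absurd h0 (h.mem_iff.1 (h.sub_smul_mem hx hs.le h1)).ne
  · exact h1
  · have hq := h.exitPoint_eq_zero hx hw
    have ht := h.exitTime_pos hx hw
    set t := exitTime Ω x w
    have h2 : t / s < 1 := (div_lt_one hs).2 h1
    have h3 := h.convexOn.2 (mem_univ x) (mem_univ (x - s • w))
      (sub_nonneg.2 h2.le) (div_nonneg ht.le hs.le) (by ring)
    have e : (1 - t / s) • x + (t / s) • (x - s • w) = x - t • w := by
      rw [smul_sub, smul_smul, div_mul_cancel₀ _ hs.ne', sub_smul, one_smul]; abel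
    rw [e, hq, h0] at h3
    simp only [smul_eq_mul, mul_zero, add_zero] at h3
    have := h.mem_iff.1 hx
    nlinarith

/-- The tangent plane inequality for `ψ`. -/
lemma fderiv_sub_le (h : IsConvexSublevel Ω ψ D) (q x : R3) :
    fderiv ℝ ψ q (x - q) ≤ ψ x - ψ q := by
  have h1 : ConvexOn ℝ univ (fun t : ℝ => ψ (AffineMap.lineMap q x t)) := by
    have := h.convexOn.comp_affineMap (AffineMap.lineMap q x : ℝ →ᵃ[ℝ] R3)
    rwa [preimage_univ] at this
  have h2 : HasDerivAt (fun t : ℝ => ψ (AffineMap.lineMap q x t)) (fderiv ℝ ψ q (x - q)) 0 := by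
    have h3 : HasFDerivAt ψ (fderiv ℝ ψ q) (AffineMap.lineMap q x (0 : ℝ)) := by
      rw [AffineMap.lineMap_apply_zero]; exact (h.differentiable q).hasFDerivAt
    exact h3.comp_hasDerivAt 0 AffineMap.hasDerivAt_lineMap
  have h4 := h1.le_slope_of_hasDerivAt (mem_univ 0) (mem_univ 1) one_pos h2
  simpa [slope_def_field] using h4

/-- Quantitative transversality at the exit point, from the tangent plane inequality there. -/
lemma div_le_neg_fderiv (h : IsConvexSublevel Ω ψ D) {x w : R3} (hx : x ∈ Ω) (hw : w ≠ 0) :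
    -ψ x / exitTime Ω x w ≤ -fderiv ℝ ψ (exitPoint Ω x w) w := by
  have ht := h.exitTime_pos hx hw
  have h1 := h.fderiv_sub_le (exitPoint Ω x w) x
  have h2 : ψ (exitPoint Ω x w) = 0 := h.exitPoint_eq_zero hx hw
  have e : x - exitPoint Ω x w = exitTime Ω x w • w := by unfold exitPoint; abel
  rw [e, h2, map_smul, smul_eq_mul] at h1
  rw [div_le_iff₀ ht]
  linarith

lemma fderiv_exitPoint_neg (h : IsConvexSublevel Ω ψ D) {x w : R3} (hx : x ∈ Ω) (hw : w ≠ 0) :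
    fderiv ℝ ψ (exitPoint Ω x w) w < 0 := by
  have h1 := h.div_le_neg_fderiv hx hw
  have h2 := div_pos (h.neg_pos hx) (h.exitTime_pos hx hw)
  linarith

/-- The exit time is of class `C¹` away from zero velocity: the trajectory crosses the boundary
transversally, and it meets it only once. -/
lemma contDiffAt_exitTime (h : IsConvexSublevel Ω ψ D) {z : R3 × R3} (hx : z.1 ∈ Ω)
    (hw : z.2 ≠ 0) : ContDiffAt ℝ 1 (fun z : R3 × R3 => exitTime Ω z.1 z.2) z := by
  set t := exitTime Ω z.1 z.2 with ht
  have ht0 : 0 < t := h.exitTime_pos hx hw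
  -- the implicit function theorem for the equation `ψ (x - s w) = 0` in `s`
  set G : (R3 × R3) × ℝ → ℝ := fun y => ψ (y.1.1 - y.2 • y.1.2) with hG
  have hGc : ContDiff ℝ 1 G := by
    have h1 : ContDiff ℝ 1 ψ := h.contDiff.of_le (by norm_num)
    exact h1.comp (by fun_prop)
  have cdf : ContDiffAt ℝ 1 G (z, t) := hGc.contDiffAt
  have hder : ∀ s : ℝ, fderiv ℝ G (z, t) (0, s) = -s * fderiv ℝ ψ (exitPoint Ω z.1 z.2) z.2 := by
    intro s
    have h1 : HasFDerivAt G (fderiv ℝ G (z, t)) (z, t) :=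
      (hGc.differentiable (by norm_num) _).hasFDerivAt
    have h2 : HasDerivAt (fun r : ℝ => ((z, t + r * s) : (R3 × R3) × ℝ)) (0, s) 0 := by
      have : HasDerivAt (fun r : ℝ => t + r * s) s 0 := by
        simpa using ((hasDerivAt_id (0 : ℝ)).mul_const s).const_add t
      exact (hasDerivAt_const _ _).prodMk this
    have h1' : HasFDerivAt G (fderiv ℝ G (z, t)) ((z, t + 0 * s) : (R3 × R3) × ℝ) := by simpa
    have h3 := h1'.comp_hasDerivAt (0 : ℝ) h2
    have h4 : HasDerivAt (fun r : ℝ => z.1 - (t + r * s) • z.2) (-(s • z.2)) 0 := by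
      have : HasDerivAt (fun r : ℝ => t + r * s) s 0 := by
        simpa using ((hasDerivAt_id (0 : ℝ)).mul_const s).const_add t
      simpa using (this.smul_const z.2).const_sub z.1
    have h5 : HasFDerivAt ψ (fderiv ℝ ψ (exitPoint Ω z.1 z.2)) (z.1 - (t + 0 * s) • z.2) := by
      have e : z.1 - (t + 0 * s) • z.2 = exitPoint Ω z.1 z.2 := by simp [exitPoint, ht]
      rw [e]; exact (h.differentiable _).hasFDerivAt
    have h6 := h5.comp_hasDerivAt (0 : ℝ) h4
    have h7 := h3.unique h6
    rw [h7, map_neg, map_smul, smul_eq_mul, neg_mul]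
  have hc : fderiv ℝ ψ (exitPoint Ω z.1 z.2) z.2 < 0 := h.fderiv_exitPoint_neg hx hw
  have hinv : (fderiv ℝ G (z, t) ∘L .inr ℝ (R3 × R3) ℝ).IsInvertible := by
    set c := -fderiv ℝ ψ (exitPoint Ω z.1 z.2) z.2 with hcdef
    have hc0 : c ≠ 0 := by rw [hcdef]; linarith
    refine ⟨ContinuousLinearEquiv.unitsEquivAut ℝ (Units.mk0 c hc0), ?_⟩
    ext
    simp [hder, hcdef]
  have hI := cdf.contDiffAt_implicitFunction (by norm_num) hinv
  have hI0 := cdf.implicitFunction_apply_self (by norm_num) hinv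
  have hIe := cdf.eventually_apply_implicitFunction (by norm_num) hinv
  simp only at hI hI0 hIe
  refine hI.congr_of_eventuallyEq ?_
  have hpos : ∀ᶠ y in 𝓝 z, 0 < cdf.implicitFunction (by norm_num) hinv y :=
    hI.continuousAt.eventually_const_lt (by rw [hI0]; exact ht0)
  have hΩ : ∀ᶠ y : R3 × R3 in 𝓝 z, y.1 ∈ Ω :=
    continuous_fst.continuousAt.eventually_mem (h.isOpen.mem_nhds hx)
  have hne : ∀ᶠ y : R3 × R3 in 𝓝 z, y.2 ≠ 0 :=
    continuous_snd.continuousAt.eventually_ne hw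
  filter_upwards [hIe, hpos, hΩ, hne] with y h1 h2 h3 h4
  refine (h.eq_exitTime h3 h4 h2 ?_).symm
  have h5 : G (z, t) = 0 := h.exitPoint_eq_zero hx hw
  rw [h5] at h1
  exact h1

lemma hasFDerivAt_exitTime (h : IsConvexSublevel Ω ψ D) {z : R3 × R3} (hx : z.1 ∈ Ω)
    (hw : z.2 ≠ 0) : HasFDerivAt (fun z : R3 × R3 => exitTime Ω z.1 z.2)
      (fderiv ℝ (fun z : R3 × R3 => exitTime Ω z.1 z.2) z) z :=
  ((h.contDiffAt_exitTime hx hw).differentiableAt (by norm_num)).hasFDerivAt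

/-- Implicit differentiation of `ψ (x - τ w) = 0`. -/
lemma fderiv_exitTime (h : IsConvexSublevel Ω ψ D) {z : R3 × R3} (hx : z.1 ∈ Ω)
    (hw : z.2 ≠ 0) (a b : R3) : fderiv ℝ (fun z : R3 × R3 => exitTime Ω z.1 z.2) z (a, b) =
      fderiv ℝ ψ (exitPoint Ω z.1 z.2) (a - exitTime Ω z.1 z.2 • b) /
        fderiv ℝ ψ (exitPoint Ω z.1 z.2) z.2 := by
  have h1 := h.hasFDerivAt_exitTime hx hw
  set T := fderiv ℝ (fun z : R3 × R3 => exitTime Ω z.1 z.2) z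
  have h2 : HasFDerivAt (fun y : R3 × R3 => exitTime Ω y.1 y.2 • y.2) _ z := h1.smul hasFDerivAt_snd
  have h3 : HasFDerivAt (fun y : R3 × R3 => y.1 - exitTime Ω y.1 y.2 • y.2) _ z :=
    hasFDerivAt_fst.sub h2
  have h4 : HasFDerivAt ψ (fderiv ℝ ψ (exitPoint Ω z.1 z.2))
      (z.1 - exitTime Ω z.1 z.2 • z.2) := (h.differentiable _).hasFDerivAt
  have h5 : HasFDerivAt (fun y : R3 × R3 => ψ (y.1 - exitTime Ω y.1 y.2 • y.2)) _ z := h4.comp z h3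
  have hΩ : ∀ᶠ y : R3 × R3 in 𝓝 z, y.1 ∈ Ω :=
    continuous_fst.continuousAt.eventually_mem (h.isOpen.mem_nhds hx)
  have hne : ∀ᶠ y : R3 × R3 in 𝓝 z, y.2 ≠ 0 :=
    continuous_snd.continuousAt.eventually_ne hw
  have h6 : HasFDerivAt (fun y : R3 × R3 => ψ (y.1 - exitTime Ω y.1 y.2 • y.2))
      (0 : R3 × R3 →L[ℝ] ℝ) z := by
    refine (hasFDerivAt_const (0 : ℝ) z).congr_of_eventuallyEq ?_
    filter_upwards [hΩ, hne] with y h7 h8 using h.exitPoint_eq_zero h7 h8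
  have h7 := congrArg (fun A : R3 × R3 →L[ℝ] ℝ => A (a, b)) (h5.unique h6)
  simp at h7
  have hc := h.fderiv_exitPoint_neg hx hw
  rw [eq_div_iff hc.ne, map_sub, map_smul, smul_eq_mul]
  linarith

/-- A variation `b` of the velocity has the same effect as the variation `-τ b` of the position.
Hence all derivatives of the exit time are controlled by the spatial ones. -/
lemma fderiv_exitTime_eq_left (h : IsConvexSublevel Ω ψ D) {z : R3 × R3} (hx : z.1 ∈ Ω)
    (hw : z.2 ≠ 0) (a b : R3) : fderiv ℝ (fun z : R3 × R3 => exitTime Ω z.1 z.2) z (a, b) =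
      fderiv ℝ (fun z : R3 × R3 => exitTime Ω z.1 z.2) z (a - exitTime Ω z.1 z.2 • b, 0) := by
  rw [h.fderiv_exitTime hx hw, h.fderiv_exitTime hx hw, smul_zero, sub_zero]

/-- The spatial gradient of the exit time is at most `exitTime / (-ψ)`, up to a constant. -/
lemma abs_fderiv_exitTime_le (h : IsConvexSublevel Ω ψ D) {L : ℝ}
    (hL : ∀ q ∈ closure Ω, ‖fderiv ℝ ψ q‖ ≤ L) {z : R3 × R3} (hx : z.1 ∈ Ω)
    (hw : z.2 ≠ 0) (a : R3) :
    |fderiv ℝ (fun z : R3 × R3 => exitTime Ω z.1 z.2) z (a, 0)| ≤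
      L * ‖a‖ * (exitTime Ω z.1 z.2 / -ψ z.1) := by
  have ht := h.exitTime_pos hx hw
  have hm := h.neg_pos hx
  rw [h.fderiv_exitTime hx hw, smul_zero, sub_zero, abs_div, div_eq_mul_inv]
  have h1 : |fderiv ℝ ψ (exitPoint Ω z.1 z.2) a| ≤ L * ‖a‖ :=
    ((fderiv ℝ ψ (exitPoint Ω z.1 z.2)).le_opNorm a).trans (by
      gcongr; exact hL _ (h.exitPoint_mem_closure hx hw))
  have h2 : |fderiv ℝ ψ (exitPoint Ω z.1 z.2) z.2|⁻¹ ≤ exitTime Ω z.1 z.2 / -ψ z.1 := by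
    rw [← inv_div]
    refine inv_anti₀ (div_pos hm ht) ((h.div_le_neg_fderiv hx hw).trans (neg_le_abs _))
  have h3 : 0 ≤ L := (norm_nonneg _).trans (hL _ (h.exitPoint_mem_closure hx hw))
  gcongr

lemma min_le_neg_of_mem_segment (h : IsConvexSublevel Ω ψ D) (x y : R3) {t : ℝ}
    (ht : t ∈ Icc (0 : ℝ) 1) : min (-ψ x) (-ψ y) ≤ -ψ (AffineMap.lineMap x y t) := by
  have h1 := h.convexOn.2 (mem_univ x) (mem_univ y) (sub_nonneg.2 ht.2) ht.1 (by ring)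
  rw [AffineMap.lineMap_apply_module]
  simp only [smul_eq_mul] at h1
  rcases le_total (-ψ x) (-ψ y) with h2 | h2
  · rw [min_eq_left h2]; nlinarith [ht.1, ht.2]
  · rw [min_eq_right h2]; nlinarith [ht.1, ht.2]

lemma lineMap_mem (h : IsConvexSublevel Ω ψ D) {x y : R3} (hx : x ∈ Ω) (hy : y ∈ Ω) {t : ℝ}
    (ht : t ∈ Icc (0 : ℝ) 1) : AffineMap.lineMap x y t ∈ Ω :=
  h.convex.lineMap_mem hx hy ht

end IsConvexSublevel

/-! ### Integrability of the gradient of the exit time -/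

/-- On a half-line where `j` increases to infinity, `|j'| j ^ (-p)` has the primitive `-(p - 1)⁻¹ j
^ (1 - p)`. -/
lemma setLIntegral_Ioi_deriv_mul_rpow_le {j j' : ℝ → ℝ} {a b p : ℝ}
    (hder : ∀ t, HasDerivAt j (j' t) t) (hb : 0 < b) (hjb : ∀ t, b ≤ j t)
    (htop : Filter.Tendsto j Filter.atTop Filter.atTop) (hp : 1 < p) (hnn : ∀ t, a < t → 0 ≤ j' t) :
    ∫⁻ t in Ioi a, ENNReal.ofReal (|j' t| * j t ^ (-p)) ≤
      ENNReal.ofReal (1 / (p - 1) * b ^ (1 - p)) := by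
  have hj0 : ∀ t, 0 < j t := fun t => hb.trans_le (hjb t)
  have hp1 : 0 < p - 1 := by linarith
  set U : ℝ → ℝ := fun t => -(1 / (p - 1)) * j t ^ (1 - p) with hU
  have hUd : ∀ t ∈ Ici a, HasDerivAt U (j' t * j t ^ (-p)) t := fun t _ => by
    refine (((hder t).rpow_const (p := 1 - p) (Or.inl (hj0 t).ne')).const_mul
      (-(1 / (p - 1)))).congr_deriv ?_
    rw [show (1 : ℝ) - p - 1 = -p by ring]
    field_simp
    ring
  have hpos : ∀ t ∈ Ioi a, 0 ≤ j' t * j t ^ (-p) := fun t ht =>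
    mul_nonneg (hnn t ht) (Real.rpow_nonneg (hj0 t).le _)
  have hlim : Filter.Tendsto U Filter.atTop (𝓝 0) := by
    have h1 : Filter.Tendsto (fun t => j t ^ (-(p - 1))) Filter.atTop (𝓝 0) :=
      (tendsto_rpow_neg_atTop hp1).comp htop
    rw [neg_sub] at h1
    have h2 := h1.const_mul (-(1 / (p - 1)))
    rwa [mul_zero] at h2
  have hint := integrableOn_Ioi_deriv_of_nonneg' hUd hpos hlim
  have hval := integral_Ioi_of_hasDerivAt_of_nonneg' hUd hpos hlim
  calc _ = ∫⁻ t in Ioi a, ENNReal.ofReal (j' t * j t ^ (-p)) :=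
        setLIntegral_congr_fun measurableSet_Ioi fun t ht => by
          simp only [abs_of_nonneg (hnn t ht)]
    _ = ENNReal.ofReal (∫ t in Ioi a, j' t * j t ^ (-p)) :=
        (ofReal_integral_eq_lintegral_ofReal hint
          ((ae_restrict_mem measurableSet_Ioi).mono hpos)).symm
    _ ≤ _ := by
        rw [hval]
        apply ENNReal.ofReal_le_ofReal
        have : j a ^ (1 - p) ≤ b ^ (1 - p) :=
          Real.rpow_le_rpow_of_nonpos hb (hjb a) (by linarith)
        simp only [hU]
        have h3 : 0 < 1 / (p - 1) := by positivity
        nlinarith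

/-- For a positive coercive convex function `j` of one variable, `|j'| j ^ (-p)` is integrable with
a bound that only involves the minimum: `j ^ (1 - p)` increases and then decreases. -/
lemma lintegral_abs_deriv_mul_rpow_le {j j' : ℝ → ℝ} {b p : ℝ} (hconv : ConvexOn ℝ univ j)
    (hder : ∀ t, HasDerivAt j (j' t) t) (hb : 0 < b) (hjb : ∀ t, b ≤ j t)
    (htop : Filter.Tendsto j (Filter.cocompact ℝ) Filter.atTop) (hp : 1 < p) :
    ∫⁻ t, ENNReal.ofReal (|j' t| * j t ^ (-p)) ≤ ENNReal.ofReal (2 / (p - 1) * b ^ (1 - p)) := by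
  have hcont : Continuous j := continuous_iff_continuousAt.2 fun t => (hder t).continuousAt
  obtain ⟨a, ha⟩ := hcont.exists_forall_le htop
  have htt : Filter.Tendsto j Filter.atTop Filter.atTop :=
    htop.mono_left atTop_le_cocompact
  have htb : Filter.Tendsto j Filter.atBot Filter.atTop :=
    htop.mono_left atBot_le_cocompact
  have hnn : ∀ t, a < t → 0 ≤ j' t := fun t ht => by
    have h1 := hconv.slope_le_of_hasDerivAt (mem_univ a) (mem_univ t) ht (hder t)
    refine le_trans ?_ h1
    rw [slope_def_field]
    exact div_nonneg (sub_nonneg.2 (ha t)) (by linarith)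
  have hnp : ∀ t, t < a → j' t ≤ 0 := fun t ht => by
    have h1 := hconv.le_slope_of_hasDerivAt (mem_univ t) (mem_univ a) ht (hder t)
    refine h1.trans ?_
    rw [slope_def_field]
    exact div_nonpos_of_nonpos_of_nonneg (sub_nonpos.2 (ha t)) (by linarith)
  have h1 := setLIntegral_Ioi_deriv_mul_rpow_le hder hb hjb htt hp hnn
  have h2 := setLIntegral_Ioi_deriv_mul_rpow_le (j := fun t => j (-t)) (j' := fun t => -j' (-t))
    (a := -a) (fun t => ((hder (-t)).comp t (hasDerivAt_neg t)).congr_deriv (by ring)) hb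
    (fun t => hjb (-t)) (htb.comp Filter.tendsto_neg_atTop_atBot) hp
    (fun t ht => by have := hnp (-t) (by linarith); linarith)
  have h3 : ∫⁻ t in Iio a, ENNReal.ofReal (|j' t| * j t ^ (-p)) =
      ∫⁻ t in Ioi (-a), ENNReal.ofReal (|-j' (-t)| * j (-t) ^ (-p)) := by
    have := (Measure.measurePreserving_neg (volume : Measure ℝ)).setLIntegral_comp_preimage_emb
      (MeasurableEquiv.neg ℝ).measurableEmbedding
      (fun t => ENNReal.ofReal (|j' t| * j t ^ (-p))) (Iio a)
    rw [← this]
    simp only [abs_neg]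
    congr 2
    ext t
    simp
  have h4 : ∫⁻ t, ENNReal.ofReal (|j' t| * j t ^ (-p)) =
      (∫⁻ t in Iio a, ENNReal.ofReal (|j' t| * j t ^ (-p))) +
        ∫⁻ t in Ioi a, ENNReal.ofReal (|j' t| * j t ^ (-p)) := by
    rw [← lintegral_add_compl _ (measurableSet_Iio (a := a)), compl_Iio,
      setLIntegral_congr Ioi_ae_eq_Ici.symm]
  rw [h4, h3]
  refine (add_le_add h2 h1).trans (le_of_eq ?_)
  have : 0 ≤ 1 / (p - 1) * b ^ (1 - p) := by
    have : 0 < p - 1 := by linarith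
    positivity
  rw [← ENNReal.ofReal_add this this]
  ring_nf

/-- The `i`-th spatial derivative of the exit time. -/
noncomputable def exitGrad (Ω : Set R3) (i : Fin 3) (z : R3 × R3) : ℝ :=
  fderiv ℝ (fun z : R3 × R3 => exitTime Ω z.1 z.2) z (EuclideanSpace.single i 1, 0)

lemma measurable_exitGrad (Ω : Set R3) (i : Fin 3) : Measurable (exitGrad Ω i) :=
  measurable_fderiv_apply_const ℝ _ _

namespace IsConvexSublevel

variable {Ω : Set R3} {ψ : R3 → ℝ} {D : ℝ}

lemma convexOn_gauge (h : IsConvexSublevel Ω ψ D) {x : R3} (hx : x ∈ Ω) :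
    ConvexOn ℝ univ (gauge (shifted Ω x)) := by
  refine ⟨convex_univ, fun u _ w _ a b ha hb _ => ?_⟩
  refine (gauge_add_le (h.shifted_convex x) (h.absorbent_shifted hx) _ _).trans (le_of_eq ?_)
  rw [gauge_smul_of_nonneg ha, gauge_smul_of_nonneg hb]

/-- Integral of a power of the spatial derivative of the exit time over a line in velocity space.
The reciprocal `j` of the exit time is convex in the velocity, and the spatial derivative equals the
velocity derivative of `j` divided by `j`. -/
lemma lintegral_line_exitGrad_le (h : IsConvexSublevel Ω ψ D) {L : ℝ} (hL0 : 0 < L)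
    (hL : ∀ q ∈ closure Ω, ‖fderiv ℝ ψ q‖ ≤ L) {p : ℝ} (hp : 1 < p) {x : R3} (hx : x ∈ Ω)
    (i : Fin 3) (w₀ : R3) {b : ℝ} (hb : 0 < b)
    (hbw : ∀ t : ℝ, b ≤ ‖w₀ + t • EuclideanSpace.single i (1 : ℝ)‖) :
    ∫⁻ t : ℝ, ENNReal.ofReal (|exitGrad Ω i (x, w₀ + t • EuclideanSpace.single i (1 : ℝ))| ^ p) ≤
      ENNReal.ofReal ((L / -ψ x) ^ (p - 1) * (2 / (p - 1) * (b / D) ^ (1 - p))) := by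
  set e : R3 := EuclideanSpace.single i (1 : ℝ) with he
  have hen : ‖e‖ = 1 := by simp [he]
  have hm := h.neg_pos hx
  have hw : ∀ t : ℝ, w₀ + t • e ≠ 0 := fun t h0 => by
    have := hbw t
    rw [h0, norm_zero] at this
    linarith
  set j : ℝ → ℝ := fun t => gauge (shifted Ω x) (w₀ + t • e) with hj
  have hjt : ∀ t, j t = (exitTime Ω x (w₀ + t • e))⁻¹ := fun t => by
    rw [h.exitTime_eq hx, inv_inv]
  have hjD : ∀ t, ‖w₀ + t • e‖ / D ≤ j t := fun t => h.norm_div_le_gauge hx _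
  have hjb : ∀ t, b / D ≤ j t := fun t =>
    (div_le_div_of_nonneg_right (hbw t) h.diam_pos.le).trans (hjD t)
  have hj0 : ∀ t, 0 < j t := fun t => (div_pos hb h.diam_pos).trans_le (hjb t)
  -- `∂ᵥ τ = -τ ∂ₓ τ` says that `∂ᵥ (1 / τ) = (∂ₓ τ) / τ`
  set j' : ℝ → ℝ := fun t => exitGrad Ω i (x, w₀ + t • e) * j t with hj'
  have hder : ∀ t, HasDerivAt j (j' t) t := fun t => by
    have hz : HasDerivAt (fun t : ℝ => ((x, w₀ + t • e) : R3 × R3)) (0, e) t := by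
      refine (hasDerivAt_const t x).prodMk ?_
      simpa using ((hasDerivAt_id t).smul_const e).const_add w₀
    have h1 := (h.hasFDerivAt_exitTime (z := (x, w₀ + t • e)) hx (hw t)).comp_hasDerivAt t hz
    have ht0 := h.exitTime_pos hx (hw t)
    have h2 := h1.inv ht0.ne'
    have h3 : j = (fun t : ℝ => exitTime Ω x (w₀ + t • e))⁻¹ := funext hjt
    rw [h3]
    refine h2.congr_deriv ?_
    rw [h.fderiv_exitTime_eq_left hx (hw t), zero_sub]
    have h4 : ((-((exitTime Ω x (w₀ + t • e)) • e), 0) : R3 × R3) =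
        (-(exitTime Ω x (w₀ + t • e))) • ((e, 0) : R3 × R3) := by simp
    simp only [h4, map_smul, smul_eq_mul, hj', hjt t, exitGrad]
    simp only [Function.comp]
    field_simp
    rfl
  have hconv : ConvexOn ℝ univ j := by
    have h1 := (h.convexOn_gauge hx).comp_affineMap
      (AffineMap.lineMap w₀ (w₀ + e) : ℝ →ᵃ[ℝ] R3)
    rw [preimage_univ] at h1
    refine h1.congr fun t _ => ?_
    simp [hj, AffineMap.lineMap_apply, add_comm]
  have htop : Filter.Tendsto j (Filter.cocompact ℝ) Filter.atTop := by
    have h1 : Filter.Tendsto (fun t : ℝ => (‖t‖ - ‖w₀‖) / D) (Filter.cocompact ℝ) Filter.atTop :=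
      (Filter.tendsto_atTop_add_const_right _ (-‖w₀‖)
        (tendsto_norm_cocompact_atTop)).atTop_div_const h.diam_pos
    refine Filter.tendsto_atTop_mono (fun t => ?_) h1
    refine le_trans (div_le_div_of_nonneg_right ?_ h.diam_pos.le) (hjD t)
    have h2 : ‖t • e‖ = ‖t‖ := by rw [norm_smul, hen, mul_one]
    have h3 := norm_sub_norm_le (t • e) (-w₀)
    rw [norm_neg, sub_neg_eq_add, add_comm (t • e), h2] at h3
    exact h3
  have hmain := lintegral_abs_deriv_mul_rpow_le hconv hder (div_pos hb h.diam_pos) hjb htop hp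
  -- one factor `|j'|` is kept for the integral along the line, the power `p - 1` is bounded by the
  -- distance to the boundary
  have hpt : ∀ t, |exitGrad Ω i (x, w₀ + t • e)| ^ p ≤
      (L / -ψ x) ^ (p - 1) * (|j' t| * j t ^ (-p)) := fun t => by
    have h1 := h.abs_fderiv_exitTime_le hL (z := (x, w₀ + t • e)) hx (hw t) e
    rw [hen, mul_one] at h1
    have hjj : |j' t| ≤ L / -ψ x := by
      simp only [hj', abs_mul, abs_of_pos (hj0 t)]
      have ht0 := h.exitTime_pos hx (hw t)
      calc |exitGrad Ω i (x, w₀ + t • e)| * j t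
          ≤ (L * (exitTime Ω x (w₀ + t • e) / -ψ x)) * j t := by
            have := hj0 t
            gcongr
            exact h1
        _ = L / -ψ x := by rw [hjt t]; field_simp
    have h2 : |exitGrad Ω i (x, w₀ + t • e)| = |j' t| / j t := by
      simp only [hj', abs_mul, abs_of_pos (hj0 t)]
      rw [mul_div_cancel_right₀ _ (hj0 t).ne']
    rw [h2, Real.div_rpow (abs_nonneg _) (hj0 t).le, Real.rpow_neg (hj0 t).le, ← div_eq_mul_inv,
      ← mul_div_assoc]
    refine div_le_div_of_nonneg_right ?_ (Real.rpow_nonneg (hj0 t).le _)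
    have h3 : |j' t| ^ p = |j' t| ^ (p - 1) * |j' t| := by
      rcases (abs_nonneg (j' t)).eq_or_lt with h0 | h0
      · rw [← h0, mul_zero, Real.zero_rpow (by linarith)]
      · conv_rhs => rw [← Real.rpow_add_one h0.ne']
        ring_nf
    rw [h3]
    have := Real.rpow_le_rpow (abs_nonneg _) hjj (by linarith : 0 ≤ p - 1)
    gcongr
  calc _ ≤ ∫⁻ t : ℝ, ENNReal.ofReal ((L / -ψ x) ^ (p - 1)) *
        ENNReal.ofReal (|j' t| * j t ^ (-p)) := lintegral_mono fun t => by
          rw [← ENNReal.ofReal_mul (by positivity)]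
          exact ENNReal.ofReal_le_ofReal (hpt t)
    _ = ENNReal.ofReal ((L / -ψ x) ^ (p - 1)) *
        ∫⁻ t : ℝ, ENNReal.ofReal (|j' t| * j t ^ (-p)) :=
          lintegral_const_mul' _ _ ENNReal.ofReal_ne_top
    _ ≤ _ := by
        rw [ENNReal.ofReal_mul (by positivity)]
        gcongr

end IsConvexSublevel

/-- Splitting off the `i`-th coordinate of an integral over `ℝ³`. -/
lemma lintegral_eq_lintegral_line (i : Fin 3) {f : R3 → ENNReal} (hf : Measurable f) :
    ∫⁻ w, f w = ∫⁻ y : Fin 2 → ℝ, ∫⁻ t : ℝ,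
      f (WithLp.toLp 2 (i.insertNth 0 y : Fin 3 → ℝ) + t • EuclideanSpace.single i (1 : ℝ)) := by
  have h1 := (PiLp.volume_preserving_toLp (Fin 3)).lintegral_comp hf
  have h2 := ((volume_preserving_piFinSuccAbove (fun _ : Fin 3 => ℝ) i).symm
    (MeasurableEquiv.piFinSuccAbove (fun _ : Fin 3 => ℝ) i)).lintegral_comp
      (hf.comp (PiLp.volume_preserving_toLp (Fin 3)).measurable)
  rw [← h1]
  refine h2.symm.trans ?_
  have hm : Measurable fun q : ℝ × (Fin 2 → ℝ) => (f ∘ WithLp.toLp 2)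
      ((MeasurableEquiv.piFinSuccAbove (fun _ : Fin 3 => ℝ) i).symm q) :=
    (hf.comp (PiLp.volume_preserving_toLp (Fin 3)).measurable).comp (MeasurableEquiv.measurable _)
  refine (lintegral_prod_symm' _ hm).trans ?_
  refine lintegral_congr fun y => lintegral_congr fun t => ?_
  have e : (MeasurableEquiv.piFinSuccAbove (fun _ : Fin 3 => ℝ) i).symm (t, y)
      = i.insertNth t y := rfl
  rw [Function.comp, e]
  congr 1
  ext k
  refine Fin.succAboveCases i ?_ (fun k => ?_) k <;> simp

/-- A Gaussian on the line against a power singularity, uniformly in the centre of the Gaussian: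
away from `[-1, 1]` the power is at most `1`. -/
lemma exists_lintegral_gaussian_mul_rpow_le {c β : ℝ} (hc : 0 < c) (hβ : β < 1) (hβ0 : 0 ≤ β) :
    ∃ C : ℝ, 0 < C ∧ ∀ a : ℝ,
      ∫⁻ s : ℝ, ENNReal.ofReal (Real.exp (-c * (s - a) ^ 2) * |s| ^ (-β)) ≤ ENNReal.ofReal C := by
  have i1 : Integrable (fun s : ℝ => Real.exp (-c * s ^ 2)) := integrable_exp_neg_mul_sq hc
  have i2 : Integrable (fun s : ℝ => Real.exp c * (|s| ^ (-β) * Real.exp (-c * s ^ 2))) := by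
    refine Integrable.const_mul ?_ _
    have := (integrable_fun_norm_addHaar (volume : Measure ℝ)
      (f := fun r : ℝ => r ^ (-β) * Real.exp (-c * r ^ 2))).2 (by
        simpa using integrableOn_rpow_mul_exp_neg_mul_sq hc (s := -β) (by linarith))
    simpa using this
  have key : ∀ a s : ℝ, Real.exp (-c * (s - a) ^ 2) * |s| ^ (-β) ≤
      Real.exp (-c * (s - a) ^ 2) + Real.exp c * (|s| ^ (-β) * Real.exp (-c * s ^ 2)) := by
    intro a s
    have he : Real.exp (-c * (s - a) ^ 2) ≤ 1 :=
      Real.exp_le_one_iff.2 (by nlinarith [sq_nonneg (s - a)])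
    have hs0 : 0 ≤ |s| ^ (-β) := Real.rpow_nonneg (abs_nonneg s) _
    have hp := Real.exp_pos (-c * (s - a) ^ 2)
    rcases le_or_gt |s| 1 with hs | hs
    · have h3 : 1 ≤ Real.exp c * Real.exp (-c * s ^ 2) := by
        rw [← Real.exp_add]
        apply Real.one_le_exp
        have : s ^ 2 ≤ 1 := by rw [← sq_abs]; exact pow_le_one₀ (abs_nonneg _) hs
        nlinarith
      nlinarith
    · have h3 : |s| ^ (-β) ≤ 1 := Real.rpow_le_one_of_one_le_of_nonpos hs.le (by linarith)
      have h4 : 0 ≤ Real.exp c * (|s| ^ (-β) * Real.exp (-c * s ^ 2)) := by positivity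
      nlinarith
  set C := (∫ s : ℝ, Real.exp (-c * s ^ 2)) +
    ∫ s : ℝ, Real.exp c * (|s| ^ (-β) * Real.exp (-c * s ^ 2))
  refine ⟨|C| + 1, by positivity, fun a => ?_⟩
  have ia : Integrable (fun s : ℝ => Real.exp (-c * (s - a) ^ 2)) := i1.comp_sub_right a
  have hI : ∫ s : ℝ, (Real.exp (-c * (s - a) ^ 2) +
      Real.exp c * (|s| ^ (-β) * Real.exp (-c * s ^ 2))) = C := by
    rw [integral_add ia i2, integral_sub_right_eq_self (fun s : ℝ => Real.exp (-c * s ^ 2)) a]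
  calc _ ≤ ∫⁻ s : ℝ, ENNReal.ofReal (Real.exp (-c * (s - a) ^ 2) +
      Real.exp c * (|s| ^ (-β) * Real.exp (-c * s ^ 2))) :=
        lintegral_mono fun s => ENNReal.ofReal_le_ofReal (key a s)
    _ = ENNReal.ofReal C := by
        rw [← hI]
        exact (ofReal_integral_eq_lintegral_ofReal (ia.add i2)
          (Filter.Eventually.of_forall fun s => by
            have hs0 : 0 ≤ |s| ^ (-β) := Real.rpow_nonneg (abs_nonneg s) _
            simp only [Pi.zero_apply, Pi.add_apply]
            positivity)).symm
    _ ≤ _ := ENNReal.ofReal_le_ofReal (by linarith [le_abs_self C])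

namespace IsConvexSublevel

variable {Ω : Set R3} {ψ : R3 → ℝ} {D : ℝ}

/-- Velocity averages of `|∇ₓ τ| ^ p`, `1 < p < 2`, blow up at the boundary only like
`(-ψ) ^ (1 - p)`. -/
lemma exists_lintegral_exitGrad_le (h : IsConvexSublevel Ω ψ D) {p c : ℝ} (hp : 1 < p)
    (hp2 : p < 2) (hc : 0 < c) :
    ∃ C : ℝ, 0 < C ∧ ∀ x ∈ Ω, ∀ (v : R3) (i : Fin 3),
      ∫⁻ w, ENNReal.ofReal (|exitGrad Ω i (x, w)| ^ p * Real.exp (-c * ‖w - v‖ ^ 2)) ≤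
        ENNReal.ofReal (C * (-ψ x) ^ (1 - p)) := by
  obtain ⟨L, hL0, hL⟩ := h.exists_fderiv_le
  have hD := h.diam_pos
  obtain ⟨C1, hC1, H1⟩ := exists_lintegral_gaussian_mul_rpow_le hc (β := p - 1)
    (by linarith) (by linarith)
  obtain ⟨C2, hC2, H2⟩ := exists_lintegral_gaussian_mul_rpow_le hc (β := 0)
    (by linarith) le_rfl
  have hp1 : 0 < p - 1 := by linarith
  set K := L ^ (p - 1) * (2 / (p - 1) * D ^ (p - 1)) with hK
  have hK0 : 0 < K := by positivity
  refine ⟨K * (C1 * C2), by positivity, fun x hx v i => ?_⟩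
  have hm := h.neg_pos hx
  set e : R3 := EuclideanSpace.single i (1 : ℝ) with he
  have hmeas : Measurable fun w : R3 =>
      ENNReal.ofReal (|exitGrad Ω i (x, w)| ^ p * Real.exp (-c * ‖w - v‖ ^ 2)) := by
    have h1 : Measurable fun w : R3 => exitGrad Ω i (x, w) :=
      (measurable_exitGrad Ω i).comp measurable_prodMk_left
    have h2 : Measurable fun w : R3 => ‖w - v‖ := (measurable_id.sub_const v).norm
    exact ((h1.abs.pow_const p).mul
      (Real.measurable_exp.comp ((h2.pow_const 2).const_mul _))).ennreal_ofReal
  rw [lintegral_eq_lintegral_line i hmeas]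
  set a0 := v (i.succAbove 0)
  set a1 := v (i.succAbove 1)
  -- integrate first along lines in the direction `e`; the line with transversal coordinates `y` has
  -- distance at least `|y 0|` from the origin, and `|y 0| ^ (1 - p)` is integrable as `p < 2`
  set g : (Fin 2 → ℝ) → ENNReal := fun y =>
    ENNReal.ofReal (Real.exp (-c * (y 0 - a0) ^ 2) * |y 0| ^ (-(p - 1))) *
      ENNReal.ofReal (Real.exp (-c * (y 1 - a1) ^ 2) * |y 1| ^ (-(0 : ℝ))) with hg
  have hy0 : ∀ᵐ y : Fin 2 → ℝ, y 0 ≠ 0 := Measure.ae_eval_ne (fun _ => volume) 0 0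
  have hin : ∀ y : Fin 2 → ℝ, y 0 ≠ 0 →
      ∫⁻ t : ℝ, ENNReal.ofReal
        (|exitGrad Ω i (x, WithLp.toLp 2 (i.insertNth 0 y : Fin 3 → ℝ) + t • e)| ^ p *
          Real.exp (-c * ‖WithLp.toLp 2 (i.insertNth 0 y : Fin 3 → ℝ) + t • e - v‖ ^ 2)) ≤
      ENNReal.ofReal (K * (-ψ x) ^ (1 - p)) * g y := by
    intro y hy
    set w₀ : R3 := WithLp.toLp 2 (i.insertNth 0 y : Fin 3 → ℝ)
    have hcoord : ∀ (t : ℝ) (k : Fin 2), (w₀ + t • e) (i.succAbove k) = y k := fun t k => by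
      simp [w₀, he]
    have hsum : ∀ u : R3, u (i.succAbove 0) ^ 2 + u (i.succAbove 1) ^ 2 ≤ ‖u‖ ^ 2 := fun u => by
      rw [EuclideanSpace.norm_sq_eq, Fin.sum_univ_succAbove _ i, Fin.sum_univ_two]
      simp only [Real.norm_eq_abs, sq_abs]
      nlinarith [sq_nonneg (u i)]
    have hbw : ∀ t : ℝ, |y 0| ≤ ‖w₀ + t • e‖ := fun t => by
      have := hsum (w₀ + t • e)
      rw [hcoord, hcoord] at this
      exact abs_le_of_sq_le_sq (by nlinarith [sq_nonneg (y 1)]) (norm_nonneg _)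
    have hexp : ∀ t : ℝ, Real.exp (-c * ‖w₀ + t • e - v‖ ^ 2) ≤
        Real.exp (-c * (y 0 - a0) ^ 2) * Real.exp (-c * (y 1 - a1) ^ 2) := fun t => by
      rw [← Real.exp_add, Real.exp_le_exp]
      have := hsum (w₀ + t • e - v)
      simp only [PiLp.sub_apply, hcoord] at this
      nlinarith
    have hline := h.lintegral_line_exitGrad_le hL0 hL hp hx i w₀ (abs_pos.2 hy) hbw
    calc _ ≤ ∫⁻ t : ℝ, ENNReal.ofReal (Real.exp (-c * (y 0 - a0) ^ 2) *
          Real.exp (-c * (y 1 - a1) ^ 2)) * ENNReal.ofReal (|exitGrad Ω i (x, w₀ + t • e)| ^ p) := by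
          refine lintegral_mono fun t => ?_
          rw [← ENNReal.ofReal_mul (by positivity)]
          refine ENNReal.ofReal_le_ofReal ?_
          rw [mul_comm]
          exact mul_le_mul_of_nonneg_right (hexp t) (Real.rpow_nonneg (abs_nonneg _) _)
      _ = ENNReal.ofReal (Real.exp (-c * (y 0 - a0) ^ 2) * Real.exp (-c * (y 1 - a1) ^ 2)) *
          ∫⁻ t : ℝ, ENNReal.ofReal (|exitGrad Ω i (x, w₀ + t • e)| ^ p) :=
          lintegral_const_mul' _ _ ENNReal.ofReal_ne_top
      _ ≤ _ := mul_le_mul_right hline _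
      _ = _ := by
          simp only [hg]
          rw [← ENNReal.ofReal_mul (by positivity), ← ENNReal.ofReal_mul (by positivity),
            ← ENNReal.ofReal_mul (by positivity)]
          congr 1
          have e1 : (L / -ψ x) ^ (p - 1) = L ^ (p - 1) * (-ψ x) ^ (1 - p) := by
            rw [Real.div_rpow hL0.le hm.le, div_eq_mul_inv, ← Real.rpow_neg hm.le, neg_sub]
          have e2 : (|y 0| / D) ^ (1 - p) = D ^ (p - 1) * |y 0| ^ (-(p - 1)) := by
            rw [Real.div_rpow (abs_nonneg _) hD.le, div_eq_mul_inv, ← Real.rpow_neg hD.le, neg_sub,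
              neg_sub, mul_comm]
          rw [e1, e2, neg_zero, Real.rpow_zero, hK]
          ring
  calc _ ≤ ∫⁻ y : Fin 2 → ℝ, ENNReal.ofReal (K * (-ψ x) ^ (1 - p)) * g y := by
        refine lintegral_mono_ae ?_
        filter_upwards [hy0] with y hy using hin y hy
    _ = ENNReal.ofReal (K * (-ψ x) ^ (1 - p)) * ∫⁻ y : Fin 2 → ℝ, g y :=
        lintegral_const_mul' _ _ ENNReal.ofReal_ne_top
    _ ≤ ENNReal.ofReal (K * (-ψ x) ^ (1 - p)) * (ENNReal.ofReal C1 * ENNReal.ofReal C2) := by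
        refine mul_le_mul_right ?_ _
        have m1 : Measurable fun s : ℝ =>
            ENNReal.ofReal (Real.exp (-c * (s - a0) ^ 2) * |s| ^ (-(p - 1))) := by fun_prop
        have m2 : Measurable fun s : ℝ =>
            ENNReal.ofReal (Real.exp (-c * (s - a1) ^ 2) * |s| ^ (-(0 : ℝ))) := by fun_prop
        have e1 : ∫⁻ y : Fin 2 → ℝ, g y = ∫⁻ q : ℝ × ℝ,
            ENNReal.ofReal (Real.exp (-c * (q.1 - a0) ^ 2) * |q.1| ^ (-(p - 1))) *
            ENNReal.ofReal (Real.exp (-c * (q.2 - a1) ^ 2) * |q.2| ^ (-(0 : ℝ))) := by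
          refine Eq.trans ?_ ((volume_preserving_finTwoArrow ℝ).lintegral_comp
            ((m1.comp measurable_fst).mul (m2.comp measurable_snd)))
          rfl
        rw [e1, Measure.volume_eq_prod, lintegral_prod_mul m1.aemeasurable m2.aemeasurable]
        exact mul_le_mul' (H1 a0) (H2 a1)
    _ = _ := by
        rw [← ENNReal.ofReal_mul hC1.le, ← ENNReal.ofReal_mul (by positivity)]
        congr 1
        ring

end IsConvexSublevel

/-! ### Differences of exit times -/

namespace IsConvexSublevel

variable {Ω : Set R3} {ψ : R3 → ℝ} {D : ℝ}

/-- The average of `|∇ₓ τ|` against the singular weight of the collision kernel. The exponent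
`-2/5` comes from Young's inequality with exponents `5/2`, which keeps `‖u‖ ^ (-5/2)` integrable in
dimension three, and `5/3 < 2`. -/
lemma exists_lintegral_inv_norm_exitGrad_le (h : IsConvexSublevel Ω ψ D) {c : ℝ} (hc : 0 < c) :
    ∃ C : ℝ, 0 < C ∧ ∀ x ∈ Ω, ∀ (v : R3) (i : Fin 3),
      ∫⁻ w, ENNReal.ofReal (‖w - v‖⁻¹ * Real.exp (-c * ‖w - v‖ ^ 2) * |exitGrad Ω i (x, w)|) ≤
        ENNReal.ofReal (C * (-ψ x) ^ (-(2 / 5) : ℝ)) := by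
  obtain ⟨C1, hC1, H1⟩ := h.exists_lintegral_exitGrad_le (p := 5 / 3) (c := c)
    (by norm_num) (by norm_num) hc
  have i0 := integrable_norm_rpow_mul_exp (b := 5 / 2) (c := c) (by norm_num) hc
  set I := ∫ u : R3, ‖u‖ ^ (-(5 / 2) : ℝ) * Real.exp (-c * ‖u‖ ^ 2) with hI
  have hI0 : 0 ≤ I := integral_nonneg fun u => by positivity
  refine ⟨I + C1, by positivity, fun x hx v i => ?_⟩
  have hm := h.neg_pos hx
  set m := -ψ x
  have i1 : Integrable fun w : R3 => ‖w - v‖ ^ (-(5 / 2) : ℝ) * Real.exp (-c * ‖w - v‖ ^ 2) :=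
    i0.comp_sub_right v
  have hI1 : ∫⁻ w : R3, ENNReal.ofReal (‖w - v‖ ^ (-(5 / 2) : ℝ) * Real.exp (-c * ‖w - v‖ ^ 2)) =
      ENNReal.ofReal I := by
    rw [hI, ← integral_sub_right_eq_self _ v]
    exact (ofReal_integral_eq_lintegral_ofReal i1
      (Filter.Eventually.of_forall fun u => by simp only [Pi.zero_apply]; positivity)).symm
  have key : ∀ w : R3, ‖w - v‖⁻¹ * Real.exp (-c * ‖w - v‖ ^ 2) * |exitGrad Ω i (x, w)| ≤
      m ^ (-(2 / 5) : ℝ) * (‖w - v‖ ^ (-(5 / 2) : ℝ) * Real.exp (-c * ‖w - v‖ ^ 2)) +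
      m ^ (4 / 15 : ℝ) * (|exitGrad Ω i (x, w)| ^ (5 / 3 : ℝ) * Real.exp (-c * ‖w - v‖ ^ 2)) := by
    intro w
    set u := ‖w - v‖
    have hu : 0 ≤ u := norm_nonneg _
    set g := |exitGrad Ω i (x, w)|
    have hg : 0 ≤ g := abs_nonneg _
    have hl : 0 < m ^ (4 / 25 : ℝ) := by positivity
    -- the power `4 / 25` makes both terms of Young's inequality of order `m ^ (-2/5)`, given that
    -- the average of `g ^ (5/3)` is of order `m ^ (-2/3)`
    have hY := Real.young_inequality_of_nonneg (a := u⁻¹ * m ^ (-(4 / 25) : ℝ))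
      (b := m ^ (4 / 25 : ℝ) * g) (p := 5 / 2) (q := 5 / 3) (by positivity) (by positivity)
      (by constructor <;> norm_num)
    have e1 : u⁻¹ * m ^ (-(4 / 25) : ℝ) * (m ^ (4 / 25 : ℝ) * g) = u⁻¹ * g := by
      rw [Real.rpow_neg hm.le]; field_simp
    have e2 : (u⁻¹ * m ^ (-(4 / 25) : ℝ)) ^ (5 / 2 : ℝ) =
        u ^ (-(5 / 2) : ℝ) * m ^ (-(2 / 5) : ℝ) := by
      rw [Real.mul_rpow (by positivity) (by positivity), Real.inv_rpow hu, Real.rpow_neg hu,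
        ← Real.rpow_mul hm.le]
      norm_num
    have e3 : (m ^ (4 / 25 : ℝ) * g) ^ (5 / 3 : ℝ) = m ^ (4 / 15 : ℝ) * g ^ (5 / 3 : ℝ) := by
      rw [Real.mul_rpow hl.le hg, ← Real.rpow_mul hm.le]
      norm_num
    rw [e1, e2, e3] at hY
    have p1 : 0 ≤ u ^ (-(5 / 2) : ℝ) * m ^ (-(2 / 5) : ℝ) := by positivity
    have p2 : 0 ≤ m ^ (4 / 15 : ℝ) * g ^ (5 / 3 : ℝ) := by positivity
    have h2 : u⁻¹ * g ≤ u ^ (-(5 / 2) : ℝ) * m ^ (-(2 / 5) : ℝ) +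
        m ^ (4 / 15 : ℝ) * g ^ (5 / 3 : ℝ) := by linarith
    have h3 := mul_le_mul_of_nonneg_right h2 (Real.exp_pos (-c * u ^ 2)).le
    linarith
  calc _ ≤ ∫⁻ w : R3, (ENNReal.ofReal (m ^ (-(2 / 5) : ℝ)) *
        ENNReal.ofReal (‖w - v‖ ^ (-(5 / 2) : ℝ) * Real.exp (-c * ‖w - v‖ ^ 2)) +
        ENNReal.ofReal (m ^ (4 / 15 : ℝ)) *
        ENNReal.ofReal (|exitGrad Ω i (x, w)| ^ (5 / 3 : ℝ) * Real.exp (-c * ‖w - v‖ ^ 2))) :=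
          lintegral_mono fun w => by
            rw [← ENNReal.ofReal_mul (by positivity), ← ENNReal.ofReal_mul (by positivity),
              ← ENNReal.ofReal_add (by positivity) (by positivity)]
            exact ENNReal.ofReal_le_ofReal (key w)
    _ = ENNReal.ofReal (m ^ (-(2 / 5) : ℝ)) * ENNReal.ofReal I +
        ENNReal.ofReal (m ^ (4 / 15 : ℝ)) * ∫⁻ w : R3,
        ENNReal.ofReal (|exitGrad Ω i (x, w)| ^ (5 / 3 : ℝ) * Real.exp (-c * ‖w - v‖ ^ 2)) := by
          rw [lintegral_add_left', lintegral_const_mul' _ _ ENNReal.ofReal_ne_top, hI1,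
            lintegral_const_mul' _ _ ENNReal.ofReal_ne_top]
          exact (i1.aestronglyMeasurable.aemeasurable.ennreal_ofReal).const_mul _
    _ ≤ ENNReal.ofReal (m ^ (-(2 / 5) : ℝ)) * ENNReal.ofReal I +
        ENNReal.ofReal (m ^ (4 / 15 : ℝ)) * ENNReal.ofReal (C1 * m ^ (1 - 5 / 3 : ℝ)) := by
          gcongr
          exact H1 x hx v i
    _ = _ := by
          rw [← ENNReal.ofReal_mul (by positivity), ← ENNReal.ofReal_mul (by positivity),
              ← ENNReal.ofReal_add (by positivity) (by positivity)]
          congr 1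
          rw [add_mul, mul_comm I, mul_left_comm, ← Real.rpow_add hm]
          norm_num

lemma measurable_exitTime_right (h : IsConvexSublevel Ω ψ D) {x : R3} (hx : x ∈ Ω) :
    Measurable fun w => exitTime Ω x w := by
  have e : (fun w => exitTime Ω x w) = fun w => (gauge (shifted Ω x) w)⁻¹ :=
    funext fun w => h.exitTime_eq hx w
  rw [e]
  have hcont : Continuous (gauge (shifted Ω x)) :=
    continuous_iff_continuousAt.2 fun w => by
      have := (h.convexOn_gauge hx).continuousOn isOpen_univ
      exact this.continuousAt Filter.univ_mem
  exact hcont.measurable.inv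

lemma abs_fderiv_exitTime_left_le (Ω : Set R3) (z : R3 × R3) (a : R3) :
    |fderiv ℝ (fun z : R3 × R3 => exitTime Ω z.1 z.2) z (a, 0)| ≤
      ‖a‖ * ∑ i, |exitGrad Ω i z| := by
  have e : ((a, 0) : R3 × R3) = ∑ i, a i • ((EuclideanSpace.single i (1 : ℝ), 0) : R3 × R3) := by
    ext k
    · simp [Prod.fst_sum, Finset.sum_apply, Pi.single_apply]
    · simp [Prod.snd_sum]
  rw [e, map_sum, Finset.mul_sum]
  refine (Finset.abs_sum_le_sum_abs _ _).trans (Finset.sum_le_sum fun i _ => ?_)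
  rw [map_smul, smul_eq_mul, abs_mul]
  exact mul_le_mul_of_nonneg_right (by simpa using PiLp.norm_apply_le a i) (abs_nonneg _)

/-- The fundamental theorem of calculus along the segment from `x` to `y`, which stays in `Ω`. -/
lemma ofReal_abs_exitTime_sub_le (h : IsConvexSublevel Ω ψ D) {x y w : R3} (hx : x ∈ Ω)
    (hy : y ∈ Ω) (hw : w ≠ 0) :
    ENNReal.ofReal |exitTime Ω x w - exitTime Ω y w| ≤
      ∫⁻ t in Icc (0 : ℝ) 1,
        ENNReal.ofReal (‖x - y‖ * ∑ i, |exitGrad Ω i (AffineMap.lineMap x y t, w)|) := by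
  set l : ℝ → R3 := fun t => AffineMap.lineMap x y t with hl
  have hlm : ∀ t ∈ Icc (0 : ℝ) 1, l t ∈ Ω := fun t ht => h.lineMap_mem hx hy ht
  set T : R3 × R3 → ℝ := fun z => exitTime Ω z.1 z.2 with hT
  have hder : ∀ t ∈ uIcc (0 : ℝ) 1,
      HasDerivAt (fun t => T (l t, w)) (fderiv ℝ T (l t, w) (y - x, 0)) t := fun t ht => by
    rw [uIcc_of_le zero_le_one] at ht
    have h1 : HasDerivAt (fun t => (l t, w)) ((y - x, 0) : R3 × R3) t :=
      (AffineMap.hasDerivAt_lineMap : HasDerivAt l (y - x) t).prodMk (hasDerivAt_const t w)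
    exact (h.hasFDerivAt_exitTime (z := (l t, w)) (hlm t ht) hw).comp_hasDerivAt t h1
  have hcl : Continuous fun t => (l t, w) :=
    (AffineMap.lineMap_continuous : Continuous l).prodMk continuous_const
  have hcont : ContinuousOn (fun t => fderiv ℝ T (l t, w) (y - x, 0)) (uIcc (0 : ℝ) 1) := by
    intro t ht
    rw [uIcc_of_le zero_le_one] at ht
    have h1 := (h.contDiffAt_exitTime (z := (l t, w)) (hlm t ht) hw).fderiv_right (m := 0) le_rfl
    have h2 : ContinuousAt (fun s => fderiv ℝ T (l s, w)) t :=
      ContinuousAt.comp (g := fderiv ℝ T) h1.continuousAt hcl.continuousAt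
    exact (h2.clm_apply continuousAt_const).continuousWithinAt
  have hF := intervalIntegral.integral_eq_sub_of_hasDerivAt hder hcont.intervalIntegrable
  have e0 : l 0 = x := by simp [hl]
  have e1 : l 1 = y := by simp [hl]
  simp only [e0, e1, hT] at hF
  rw [abs_sub_comm, ← hF, intervalIntegral.integral_of_le zero_le_one, ← Real.norm_eq_abs]
  refine (ENNReal.ofReal_le_ofReal (norm_integral_le_lintegral_norm _)).trans ?_
  refine ENNReal.ofReal_toReal_le.trans ?_
  rw [setLIntegral_congr Ioc_ae_eq_Icc]
  refine lintegral_mono fun t => ENNReal.ofReal_le_ofReal ?_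
  rw [Real.norm_eq_abs, norm_sub_rev x y]
  exact abs_fderiv_exitTime_left_le Ω (l t, w) (y - x)

/-- Mean difference of exit times from two points, weighted with the singular factor of the
collision kernel. -/
lemma exists_integral_exitTime_sub_le (h : IsConvexSublevel Ω ψ D) {c : ℝ} (hc : 0 < c) :
    ∃ C : ℝ, 0 < C ∧ ∀ x ∈ Ω, ∀ y ∈ Ω, ∀ v : R3,
      Integrable (fun w => ‖w - v‖⁻¹ * Real.exp (-c * ‖w - v‖ ^ 2) *
        |exitTime Ω x w - exitTime Ω y w|) ∧
      ∫ w, ‖w - v‖⁻¹ * Real.exp (-c * ‖w - v‖ ^ 2) * |exitTime Ω x w - exitTime Ω y w| ≤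
        C * (‖x - y‖ * ((-ψ x) ^ (-(2 / 5) : ℝ) + (-ψ y) ^ (-(2 / 5) : ℝ))) := by
  obtain ⟨C, hC, H⟩ := h.exists_lintegral_inv_norm_exitGrad_le hc
  refine ⟨3 * C, by positivity, fun x hx y hy v => ?_⟩
  have hmx := h.neg_pos hx
  have hmy := h.neg_pos hy
  set S := (-ψ x) ^ (-(2 / 5) : ℝ) + (-ψ y) ^ (-(2 / 5) : ℝ) with hS
  have hS0 : 0 ≤ S := by positivity
  set W : R3 → ℝ := fun w => ‖w - v‖⁻¹ * Real.exp (-c * ‖w - v‖ ^ 2) with hW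
  have hW0 : ∀ w, 0 ≤ W w := fun w => by positivity
  have hWm : Measurable W := by
    have : Measurable fun w : R3 => ‖w - v‖ := (measurable_id.sub_const v).norm
    exact this.inv.mul (Real.measurable_exp.comp ((this.pow_const 2).const_mul _))
  have hτm : Measurable fun w => W w * |exitTime Ω x w - exitTime Ω y w| := by
    have hm1 := h.measurable_exitTime_right hx
    have hm2 := h.measurable_exitTime_right hy
    have : Measurable fun w => |exitTime Ω x w - exitTime Ω y w| := (hm1.sub hm2).abs
    exact hWm.mul this
  set l : ℝ → R3 := fun t => AffineMap.lineMap x y t with hl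
  have hlm : ∀ t ∈ Icc (0 : ℝ) 1, l t ∈ Ω := fun t ht => h.lineMap_mem hx hy ht
  have hlc : Continuous l :=
    AffineMap.lineMap_continuous
  have hgm : ∀ i, Measurable fun q : R3 × ℝ => W q.1 * |exitGrad Ω i (l q.2, q.1)| := fun i => by
    have h1 : Measurable fun q : R3 × ℝ => exitGrad Ω i (l q.2, q.1) :=
      (measurable_exitGrad Ω i).comp ((hlc.measurable.comp measurable_snd).prodMk measurable_fst)
    exact (hWm.comp measurable_fst).mul h1.abs
  have hnn : ∀ w t i, 0 ≤ W w * |exitGrad Ω i (l t, w)| := fun w t i =>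
    mul_nonneg (hW0 w) (abs_nonneg _)
  have hmain : ∫⁻ w, ENNReal.ofReal (W w * |exitTime Ω x w - exitTime Ω y w|) ≤
      ENNReal.ofReal (3 * C * (‖x - y‖ * S)) := by
    calc _ ≤ ∫⁻ w, ∫⁻ t in Icc (0 : ℝ) 1, ENNReal.ofReal ‖x - y‖ * ∑ i,
          ENNReal.ofReal (W w * |exitGrad Ω i (l t, w)|) := by
          refine lintegral_mono_ae ?_
          filter_upwards [Measure.ae_ne (volume : Measure R3) 0] with w hw
          rw [ENNReal.ofReal_mul (hW0 w)]
          refine (mul_le_mul_right (h.ofReal_abs_exitTime_sub_le hx hy hw) _).trans ?_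
          rw [← lintegral_const_mul' _ _ ENNReal.ofReal_ne_top]
          refine lintegral_mono fun t => ?_
          rw [← ENNReal.ofReal_mul (hW0 w), ← ENNReal.ofReal_sum_of_nonneg fun i _ => hnn w t i,
            ← ENNReal.ofReal_mul (norm_nonneg _), ← Finset.mul_sum]
          exact ENNReal.ofReal_le_ofReal (by simp only [hl]; linarith)
      _ = ∫⁻ t in Icc (0 : ℝ) 1, ∫⁻ w, ENNReal.ofReal ‖x - y‖ * ∑ i,
          ENNReal.ofReal (W w * |exitGrad Ω i (l t, w)|) := by
          refine lintegral_lintegral_swap (Measurable.aemeasurable ?_)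
          exact (Finset.measurable_fun_sum _ fun i _ => (hgm i).ennreal_ofReal).const_mul _
      _ ≤ ∫⁻ t in Icc (0 : ℝ) 1, ENNReal.ofReal ‖x - y‖ * (3 * ENNReal.ofReal (C * S)) := by
          refine setLIntegral_mono' measurableSet_Icc fun t ht => ?_
          rw [lintegral_const_mul' _ _ ENNReal.ofReal_ne_top, lintegral_finsetSum]
          · refine mul_le_mul_right ?_ _
            refine (Finset.sum_le_card_nsmul _ _ (ENNReal.ofReal (C * S)) fun i _ => ?_).trans
              (le_of_eq (by simp))
            refine (H (l t) (hlm t ht) v i).trans (ENNReal.ofReal_le_ofReal ?_)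
            refine mul_le_mul_of_nonneg_left ?_ hC.le
            have hmin := h.min_le_neg_of_mem_segment x y ht
            have hmpos : 0 < min (-ψ x) (-ψ y) := lt_min hmx hmy
            refine (Real.rpow_le_rpow_of_nonpos hmpos hmin (by norm_num)).trans ?_
            have p1 : 0 ≤ (-ψ x) ^ (-(2 / 5) : ℝ) := by positivity
            have p2 : 0 ≤ (-ψ y) ^ (-(2 / 5) : ℝ) := by positivity
            rcases min_choice (-ψ x) (-ψ y) with e | e <;> rw [e] <;> linarith
          · intro i _
            exact ((hgm i).comp (measurable_id.prodMk measurable_const)).ennreal_ofReal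
      _ = _ := by
          rw [setLIntegral_const, Real.volume_Icc, sub_zero, ENNReal.ofReal_one, mul_one,
            show (3 : ENNReal) = ENNReal.ofReal 3 by simp,
            ← ENNReal.ofReal_mul (by norm_num), ← ENNReal.ofReal_mul (norm_nonneg _)]
          congr 1
          ring
  have hnn2 : ∀ w, 0 ≤ W w * |exitTime Ω x w - exitTime Ω y w| := fun w =>
    mul_nonneg (hW0 w) (abs_nonneg _)
  have hint : Integrable fun w => W w * |exitTime Ω x w - exitTime Ω y w| := by
    refine ⟨hτm.aestronglyMeasurable, ?_⟩
    rw [hasFiniteIntegral_iff_ofReal (Filter.Eventually.of_forall hnn2)]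
    exact hmain.trans_lt ENNReal.ofReal_lt_top
  refine ⟨hint, ?_⟩
  rw [integral_eq_lintegral_of_nonneg_ae (Filter.Eventually.of_forall hnn2)
    hτm.aestronglyMeasurable]
  exact ENNReal.toReal_le_of_le_ofReal (by positivity) hmain

/-- Near the boundary the sublevel sets of `-ψ` are thin: by concavity of `-ψ` the homothetic copy
of `Ω` of ratio `1 - s` about `x₀` avoids the set where `-ψ < s * (-ψ x₀)`. -/
lemma volume_lt_le (h : IsConvexSublevel Ω ψ D) {x₀ : R3} (hx₀ : x₀ ∈ Ω) {s : ℝ} (hs : 0 ≤ s) :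
    volume {x ∈ Ω | -ψ x < s * -ψ x₀} ≤ ENNReal.ofReal (3 * s) * volume Ω := by
  have hm0 := h.neg_pos hx₀
  rcases le_or_gt 1 s with h1 | h1
  · calc volume {x ∈ Ω | -ψ x < s * -ψ x₀} ≤ volume Ω := measure_mono fun x hx => hx.1
      _ = ENNReal.ofReal 1 * volume Ω := by simp
      _ ≤ _ := by
        gcongr
        linarith
  set Ω' := AffineMap.homothety x₀ (1 - s) '' Ω with hΩ'
  have hcomb : ∀ x : R3, AffineMap.homothety x₀ (1 - s) x = s • x₀ + (1 - s) • x := fun x => by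
    rw [AffineMap.homothety_apply, vsub_eq_sub, vadd_eq_add]
    module
  have hsub : Ω' ⊆ Ω := by
    rintro _ ⟨x, hx, rfl⟩
    rw [hcomb]
    exact h.convex hx₀ hx hs (by linarith) (by ring)
  have hsub2 : {x ∈ Ω | -ψ x < s * -ψ x₀} ⊆ Ω \ Ω' := by
    rintro y ⟨hy, hlt⟩
    refine ⟨hy, ?_⟩
    rintro ⟨x, hx, rfl⟩
    rw [hcomb] at hlt
    have h2 := h.convexOn.2 (mem_univ x₀) (mem_univ x) hs (by linarith : 0 ≤ 1 - s) (by ring)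
    simp only [smul_eq_mul] at h2
    have h3 := h.neg_pos hx
    nlinarith
  have hvol : volume Ω' = ENNReal.ofReal ((1 - s) ^ 3) * volume Ω := by
    rw [hΩ', Measure.addHaar_image_homothety]
    rw [finrank_euclideanSpace_fin, abs_of_nonneg (by have : 0 < 1 - s := by linarith
                                                      positivity)]
  have hΩm : NullMeasurableSet Ω' := by
    have : Convex ℝ Ω' := h.convex.affine_image _
    exact this.nullMeasurableSet volume
  refine (measure_mono hsub2).trans ?_
  rw [measure_sdiff hsub hΩm ((measure_mono hsub).trans_lt h.volume_lt_top).ne, hvol]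
  rw [tsub_le_iff_right, ← add_mul, ← ENNReal.ofReal_add (by positivity)
    (by have : 0 < 1 - s := by linarith
        positivity)]
  calc volume Ω = ENNReal.ofReal 1 * volume Ω := by simp
    _ ≤ _ := by
      gcongr
      nlinarith [mul_nonneg hs hs, mul_nonneg (mul_nonneg hs hs) (by linarith : 0 ≤ 1 - s)]

/-- Negative powers of `-ψ` of order below one are integrable over `Ω`, by the layer cake formula
and the thinness of the layers `volume_lt_le`. -/
lemma lintegral_rpow_lt_top (h : IsConvexSublevel Ω ψ D) {x₀ : R3} (hx₀ : x₀ ∈ Ω) {κ : ℝ}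
    (hκ0 : 0 < κ) (hκ : κ < 1) :
    ∫⁻ x in Ω, ENNReal.ofReal ((-ψ x) ^ (-κ)) < ⊤ := by
  have hm0 := h.neg_pos hx₀
  have hψm : Measurable fun x => (-ψ x)⁻¹ := h.continuous.measurable.neg.inv
  have hpos : ∀ᵐ x ∂volume.restrict Ω, 0 < -ψ x :=
    (ae_restrict_mem h.measurableSet).mono fun x hx => h.neg_pos hx
  have e1 : ∫⁻ x in Ω, ENNReal.ofReal ((-ψ x) ^ (-κ)) =
      ∫⁻ x in Ω, ENNReal.ofReal (((-ψ x)⁻¹) ^ κ) := by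
    refine lintegral_congr_ae (hpos.mono fun x hx => ?_)
    simp only
    rw [Real.rpow_neg hx.le, Real.inv_rpow hx.le]
  rw [e1, lintegral_rpow_eq_lintegral_meas_lt_mul _ (hpos.mono fun x hx => by
    simp only [Pi.zero_apply]; positivity) hψm.aemeasurable hκ0]
  refine ENNReal.mul_lt_top ENNReal.ofReal_lt_top ?_
  have hV := h.volume_lt_top
  have hbound : ∀ t : ℝ, 0 < t → (volume.restrict Ω) {x | t < (-ψ x)⁻¹} ≤
      ENNReal.ofReal (3 / -ψ x₀ * t⁻¹) * volume Ω := fun t ht => by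
    rw [Measure.restrict_apply (measurableSet_lt measurable_const hψm)]
    refine (measure_mono ?_).trans ((h.volume_lt_le hx₀ (s := t⁻¹ / -ψ x₀) (by positivity)).trans
      (le_of_eq ?_))
    · rintro x ⟨hx1, hx2⟩
      refine ⟨hx2, ?_⟩
      have := h.neg_pos hx2
      rw [div_mul_cancel₀ _ hm0.ne']
      exact (lt_inv_comm₀ ht this).1 hx1
    · congr 2
      ring
  -- levels `t ≤ 1` are bounded by the total volume, higher levels by the volume of a boundary layer
  rw [← Ioc_union_Ioi_eq_Ioi zero_le_one]
  refine (lintegral_union_le _ _ _).trans_lt (ENNReal.add_lt_top.2 ⟨?_, ?_⟩)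
  · calc _ ≤ ∫⁻ t in Ioc (0 : ℝ) 1, volume Ω * ENNReal.ofReal (t ^ (κ - 1)) := by
          refine setLIntegral_mono' measurableSet_Ioc fun t _ => ?_
          refine mul_le_mul_left ((measure_mono (subset_univ _)).trans ?_) _
          rw [Measure.restrict_apply_univ]
      _ = volume Ω * ∫⁻ t in Ioc (0 : ℝ) 1, ENNReal.ofReal (t ^ (κ - 1)) :=
          lintegral_const_mul' _ _ hV.ne
      _ < ⊤ := by
          refine ENNReal.mul_lt_top hV ?_
          have hi := (intervalIntegral.intervalIntegrable_rpow' (a := 0) (b := 1) (r := κ - 1)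
            (by linarith)).1
          exact hi.lintegral_lt_top
  · calc _ ≤ ∫⁻ t in Ioi (1 : ℝ), ENNReal.ofReal (3 / -ψ x₀) * volume Ω *
            ENNReal.ofReal (t ^ (κ - 2)) := by
          refine setLIntegral_mono' measurableSet_Ioi fun t ht => ?_
          have ht0 : (0 : ℝ) < t := zero_lt_one.trans ht
          refine (mul_le_mul_left (hbound t ht0) _).trans (le_of_eq ?_)
          rw [ENNReal.ofReal_mul (by positivity), mul_right_comm, mul_assoc (ENNReal.ofReal _),
            ← ENNReal.ofReal_mul (by positivity), mul_right_comm]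
          congr 3
          rw [← Real.rpow_neg_one, ← Real.rpow_add ht0]
          ring_nf
      _ = ENNReal.ofReal (3 / -ψ x₀) * volume Ω * ∫⁻ t in Ioi (1 : ℝ),
            ENNReal.ofReal (t ^ (κ - 2)) :=
          lintegral_const_mul' _ _ (ENNReal.mul_lt_top ENNReal.ofReal_lt_top hV).ne
      _ < ⊤ := by
          refine ENNReal.mul_lt_top (ENNReal.mul_lt_top ENNReal.ofReal_lt_top hV) ?_
          exact (integrableOn_Ioi_rpow_of_lt (by linarith : κ - 2 < -1)
            zero_lt_one).lintegral_lt_top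

end IsConvexSublevel

/-! ### Transport of weighted Hölder-type classes -/

/-- The modulus of continuity in the position variable that is preserved by the collision operator
in a domain `{ψ < 0}`: Lipschitz, with a constant blowing up at the boundary. -/
noncomputable def bdryModulus (ψ : R3 → ℝ) (x y : R3) : ℝ :=
  ‖x - y‖ * ((-ψ x) ^ (-(2 / 5) : ℝ) + (-ψ y) ^ (-(2 / 5) : ℝ))

/-- Functions of position in `Ω = {ψ < 0}` and velocity with Gaussian decay of rate `a`, with
modulus of continuity `bdryModulus ψ` in the position, and locally Lipschitz in the velocity with
Gaussian weight of rate `a'`. -/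
structure IsWeightedLip (Ω : Set R3) (ψ : R3 → ℝ) (a a' H N C : ℝ) (k : R3 → R3 → ℝ) : Prop where
  abs_le : ∀ x ∈ Ω, ∀ v, |k x v| ≤ H * Real.exp (-a * ‖v‖ ^ 2)
  abs_sub_le_left : ∀ x ∈ Ω, ∀ y ∈ Ω, ∀ v,
    |k x v - k y v| ≤ N * Real.exp (-a * ‖v‖ ^ 2) * bdryModulus ψ x y
  abs_sub_le_right : ∀ x ∈ Ω, ∀ v v' : R3, ‖v - v'‖ ≤ 1 →
    |k x v - k x v'| ≤ C * ‖v - v'‖ * Real.exp (-a' * ‖v‖ ^ 2)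

lemma mul_exp_neg_freqMin_le (s : ℝ) : s * Real.exp (-freqMin * s) ≤ freqMin⁻¹ := by
  have h1 := Real.add_one_le_exp (freqMin * s)
  have h0 := freqMin_pos
  have h2 : Real.exp (-freqMin * s) = (Real.exp (freqMin * s))⁻¹ := by rw [← Real.exp_neg]; ring_nf
  rw [h2, ← div_eq_mul_inv, div_le_iff₀ (Real.exp_pos _), inv_mul_eq_div, le_div_iff₀ h0]
  linarith

lemma exp_neg_hardSphereFreq_le (v : R3) {s : ℝ} (hs : 0 ≤ s) :
    Real.exp (-hardSphereFreq v * s) ≤ Real.exp (-freqMin * s) :=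
  Real.exp_le_exp.2 (by nlinarith [freqMin_le v])

lemma intervalIntegrable_one_sub_div_rpow (b : ℝ) :
    IntervalIntegrable (fun s : ℝ => (1 - s / b) ^ (-(2 / 5) : ℝ)) volume 0 b := by
  rcases eq_or_ne b 0 with rfl | hb
  · exact IntervalIntegrable.refl
  have h1 : IntervalIntegrable (fun u : ℝ => u ^ (-(2 / 5) : ℝ)) volume 1 0 :=
    intervalIntegral.intervalIntegrable_rpow' (by norm_num)
  have h2 := (h1.comp_sub_left 1).comp_mul_left (c := b⁻¹)
  simp only [sub_self, sub_zero, zero_div, one_div, inv_inv] at h2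
  refine h2.congr fun s _ => ?_
  simp only [div_eq_inv_mul]

lemma integral_one_sub_div_rpow {b : ℝ} (hb : b ≠ 0) :
    ∫ s in (0 : ℝ)..b, (1 - s / b) ^ (-(2 / 5) : ℝ) = b * (5 / 3) := by
  rw [intervalIntegral.integral_comp_sub_div (fun u : ℝ => u ^ (-(2 / 5) : ℝ)) hb 1, div_self hb,
    sub_self, zero_div, sub_zero, integral_rpow (Or.inl (by norm_num))]
  norm_num

namespace IsConvexSublevel

variable {Ω : Set R3} {ψ : R3 → ℝ} {D a a' H N C : ℝ} {k : R3 → R3 → ℝ}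

lemma bdryModulus_nonneg (h : IsConvexSublevel Ω ψ D) {x y : R3} (hx : x ∈ Ω) (hy : y ∈ Ω) :
    0 ≤ bdryModulus ψ x y := by
  have := h.neg_pos hx
  have := h.neg_pos hy
  unfold bdryModulus
  positivity

lemma continuousOn_left (h : IsConvexSublevel Ω ψ D) (hk : IsWeightedLip Ω ψ a a' H N C k)
    (v : R3) : ContinuousOn (fun x => k x v) Ω := by
  intro x hx
  have hm := h.neg_pos hx
  refine tendsto_iff_dist_tendsto_zero.2 ?_
  have hlim : Filter.Tendsto
      (fun y => N * Real.exp (-a * ‖v‖ ^ 2) * bdryModulus ψ y x) (𝓝[Ω] x) (𝓝 0) := by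
    have hc : ContinuousAt (fun y => N * Real.exp (-a * ‖v‖ ^ 2) * bdryModulus ψ y x) x := by
      unfold bdryModulus
      have h1 : ContinuousAt (fun y => (-ψ y) ^ (-(2 / 5) : ℝ)) x :=
        h.continuous.neg.continuousAt.rpow_const (Or.inl hm.ne')
      fun_prop
    have h2 := hc.tendsto.mono_left (nhdsWithin_le_nhds (s := Ω))
    simpa [bdryModulus] using h2
  refine squeeze_zero' (Filter.Eventually.of_forall fun _ => dist_nonneg) ?_ hlim
  filter_upwards [self_mem_nhdsWithin] with y hy
  rw [Real.dist_eq]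
  exact hk.abs_sub_le_left y hy x hx v

lemma abs_transport_integrand_le (h : IsConvexSublevel Ω ψ D)
    (hk : IsWeightedLip Ω ψ a a' H N C k) {x : R3} (hx : x ∈ Ω) (v : R3) {s : ℝ} (hs : 0 ≤ s)
    (hst : s < exitTime Ω x v) :
    |Real.exp (-hardSphereFreq v * s) * k (x - s • v) v| ≤
      Real.exp (-freqMin * s) * (H * Real.exp (-a * ‖v‖ ^ 2)) := by
  rw [abs_mul, abs_of_pos (Real.exp_pos _)]
  exact mul_le_mul (exp_neg_hardSphereFreq_le v hs) (hk.abs_le _ (h.sub_smul_mem hx hs hst) v)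
    (abs_nonneg _) (Real.exp_pos _).le

lemma intervalIntegrable_transport (h : IsConvexSublevel Ω ψ D)
    (hk : IsWeightedLip Ω ψ a a' H N C k) {x : R3} (hx : x ∈ Ω) (v : R3) :
    IntervalIntegrable (fun s => Real.exp (-hardSphereFreq v * s) * k (x - s • v) v) volume 0
      (exitTime Ω x v) := by
  rw [intervalIntegrable_iff_integrableOn_Ioo_of_le (h.exitTime_nonneg hx v)]
  have hmap : MapsTo (fun s : ℝ => x - s • v) (Ioo 0 (exitTime Ω x v)) Ω := fun s hs =>
    h.sub_smul_mem hx hs.1.le hs.2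
  have hc : ContinuousOn (fun s => Real.exp (-hardSphereFreq v * s) * k (x - s • v) v)
      (Ioo 0 (exitTime Ω x v)) :=
    (by fun_prop : Continuous fun s : ℝ => Real.exp (-hardSphereFreq v * s)).continuousOn.mul
      ((h.continuousOn_left hk v).comp (by fun_prop) hmap)
  refine Integrable.of_bound (hc.aestronglyMeasurable measurableSet_Ioo)
    (H * Real.exp (-a * ‖v‖ ^ 2)) ?_
  filter_upwards [ae_restrict_mem measurableSet_Ioo] with s hs
  refine (h.abs_transport_integrand_le hk hx v hs.1.le hs.2).trans ?_
  have h1 : 0 ≤ H * Real.exp (-a * ‖v‖ ^ 2) := (abs_nonneg _).trans (hk.abs_le x hx v)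
  refine mul_le_of_le_one_left h1 (Real.exp_le_one_iff.2 ?_)
  have := freqMin_pos
  nlinarith [hs.1]

lemma abs_transport_tail_le (h : IsConvexSublevel Ω ψ D)
    (hk : IsWeightedLip Ω ψ a a' H N C k) {x : R3} (hx : x ∈ Ω) (v : R3) {b : ℝ} (hb : 0 ≤ b)
    (hbt : b ≤ exitTime Ω x v) :
    |∫ s in b..exitTime Ω x v, Real.exp (-hardSphereFreq v * s) * k (x - s • v) v| ≤
      H * Real.exp (-a * ‖v‖ ^ 2) * Real.exp (-freqMin * b) * (exitTime Ω x v - b) := by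
  have h1 : 0 ≤ H * Real.exp (-a * ‖v‖ ^ 2) := (abs_nonneg _).trans (hk.abs_le x hx v)
  rw [intervalIntegral.integral_of_le hbt, integral_Ioc_eq_integral_Ioo]
  have := norm_setIntegral_le_of_norm_le_const
    (f := fun s => Real.exp (-hardSphereFreq v * s) * k (x - s • v) v)
    (C := H * Real.exp (-a * ‖v‖ ^ 2) * Real.exp (-freqMin * b))
    (measure_Ioo_lt_top (μ := volume) (a := b) (b := exitTime Ω x v)) (fun s hs => by
      refine (h.abs_transport_integrand_le hk hx v (hb.trans hs.1.le) hs.2).trans ?_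
      rw [mul_comm]
      refine mul_le_mul_of_nonneg_left (Real.exp_le_exp.2 ?_) h1
      have := freqMin_pos
      nlinarith [hs.1])
  rw [Real.norm_eq_abs, measureReal_def, Real.volume_Ioo, ENNReal.toReal_ofReal (by linarith)]
    at this
  exact this

/-- The transport operator gains a factor `τ`, which is small in a small domain. -/
lemma abs_transportS_le (h : IsConvexSublevel Ω ψ D) (hk : IsWeightedLip Ω ψ a a' H N C k)
    {x : R3} (hx : x ∈ Ω) (v : R3) :
    |transportS Ω k x v| ≤ H * Real.exp (-a * ‖v‖ ^ 2) * exitTime Ω x v := by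
  simpa [transportS] using h.abs_transport_tail_le hk hx v le_rfl (h.exitTime_nonneg hx v)

/-- The damping alone bounds the transport operator, uniformly in the domain. -/
lemma abs_transportS_le' (h : IsConvexSublevel Ω ψ D) (hk : IsWeightedLip Ω ψ a a' H N C k)
    {x : R3} (hx : x ∈ Ω) (v : R3) :
    |transportS Ω k x v| ≤ H / freqMin * Real.exp (-a * ‖v‖ ^ 2) := by
  have h0 := freqMin_pos
  have h1 : 0 ≤ H * Real.exp (-a * ‖v‖ ^ 2) := (abs_nonneg _).trans (hk.abs_le x hx v)
  have hτ := h.exitTime_nonneg hx v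
  have hg : IntervalIntegrable
      (fun s => Real.exp (-freqMin * s) * (H * Real.exp (-a * ‖v‖ ^ 2))) volume 0
      (exitTime Ω x v) := (by fun_prop : Continuous _).intervalIntegrable _ _
  have h2 := intervalIntegral.norm_integral_le_of_norm_le (μ := volume) hτ
    (f := fun s => Real.exp (-hardSphereFreq v * s) * k (x - s • v) v)
    (g := fun s => Real.exp (-freqMin * s) * (H * Real.exp (-a * ‖v‖ ^ 2)))
    (by
      filter_upwards [Measure.ae_ne volume (exitTime Ω x v)] with s hs1 hs
      exact h.abs_transport_integrand_le hk hx v hs.1.le (lt_of_le_of_ne hs.2 hs1)) hg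
  refine h2.trans ?_
  rw [intervalIntegral.integral_mul_const]
  have h3 : ∫ s in (0 : ℝ)..exitTime Ω x v, Real.exp (-freqMin * s) ≤ freqMin⁻¹ := by
    have hd : ∀ s ∈ uIcc 0 (exitTime Ω x v),
        HasDerivAt (fun s => -freqMin⁻¹ * Real.exp (-freqMin * s)) (Real.exp (-freqMin * s)) s :=
      fun s _ => by
        refine ((((hasDerivAt_id s).const_mul (-freqMin)).exp).const_mul
          (-freqMin⁻¹)).congr_deriv ?_
        simp only [id]
        field_simp
    rw [intervalIntegral.integral_eq_sub_of_hasDerivAt hd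
      ((by fun_prop : Continuous _).intervalIntegrable _ _), mul_zero, Real.exp_zero]
    have : 0 < freqMin⁻¹ * Real.exp (-freqMin * exitTime Ω x v) := by positivity
    linarith
  calc _ ≤ freqMin⁻¹ * (H * Real.exp (-a * ‖v‖ ^ 2)) := mul_le_mul_of_nonneg_right h3 h1
    _ = _ := by ring

/-- Pointwise comparison of the transport integrands along two characteristics. -/
lemma abs_transport_integrand_sub_le (h : IsConvexSublevel Ω ψ D)
    (hk : IsWeightedLip Ω ψ a a' H N C k) (hN : 0 ≤ N)
    {x x' v v' : R3} (hx : x ∈ Ω) (hx' : x' ∈ Ω) (hv : v ≠ 0) (hv' : v' ≠ 0)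
    (hvv : ‖v - v'‖ ≤ 1) {b s : ℝ} (hb : 0 < b) (hbt : b ≤ exitTime Ω x v)
    (hbt' : b ≤ exitTime Ω x' v') (hs : 0 ≤ s) (hsb : s < b) :
    |Real.exp (-hardSphereFreq v * s) * k (x - s • v) v -
        Real.exp (-hardSphereFreq v' * s) * k (x' - s • v') v'| ≤
      (2 * |hardSphereFreq v - hardSphereFreq v'| / freqMin * (H * Real.exp (-a * ‖v‖ ^ 2)) +
        C * ‖v - v'‖ * Real.exp (-a' * ‖v‖ ^ 2)) +
      N * Real.exp (-a * ‖v‖ ^ 2) * ((‖x - x'‖ + ‖v - v'‖ / freqMin) *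
        ((-ψ x) ^ (-(2 / 5) : ℝ) + (-ψ x') ^ (-(2 / 5) : ℝ))) * (1 - s / b) ^ (-(2 / 5) : ℝ) := by
  have h0 := freqMin_pos
  have hy := h.sub_smul_mem hx hs (hsb.trans_le hbt)
  have hy' := h.sub_smul_mem hx' hs (hsb.trans_le hbt')
  have hm := h.neg_pos hx
  have hm' := h.neg_pos hx'
  have hse := mul_exp_neg_freqMin_le s
  have he1 := exp_neg_hardSphereFreq_le v hs
  have he2 := exp_neg_hardSphereFreq_le v' hs
  have he3 : Real.exp (-freqMin * s) ≤ 1 := Real.exp_le_one_iff.2 (by nlinarith)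
  have hsb1 : 0 < 1 - s / b := by
    rw [sub_pos, div_lt_one hb]
    exact hsb
  set E := Real.exp (-freqMin * s)
  have hE : 0 < E := Real.exp_pos _
  set G := Real.exp (-a * ‖v‖ ^ 2)
  set G' := Real.exp (-a' * ‖v‖ ^ 2)
  have hG : 0 < G := Real.exp_pos _
  have hG' : 0 < G' := Real.exp_pos _
  set R := (1 - s / b) ^ (-(2 / 5) : ℝ)
  have hR : 0 ≤ R := Real.rpow_nonneg hsb1.le _
  set S := (-ψ x) ^ (-(2 / 5) : ℝ) + (-ψ x') ^ (-(2 / 5) : ℝ)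
  have hS : 0 ≤ S := by positivity
  -- difference of the damping factors
  have hA : |Real.exp (-hardSphereFreq v * s) - Real.exp (-hardSphereFreq v' * s)| *
      |k (x - s • v) v| ≤
      2 * |hardSphereFreq v - hardSphereFreq v'| / freqMin * (H * G) := by
    refine mul_le_mul ?_ (hk.abs_le _ hy v) (abs_nonneg _) (by positivity)
    have h1 := abs_exp_neg_sub_exp_neg_le (hardSphereFreq v * s) (hardSphereFreq v' * s)
    rw [← neg_mul, ← neg_mul, ← sub_mul, abs_mul, abs_of_nonneg hs] at h1
    refine h1.trans ?_
    calc |hardSphereFreq v - hardSphereFreq v'| * s *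
          (Real.exp (-hardSphereFreq v * s) + Real.exp (-hardSphereFreq v' * s))
        ≤ |hardSphereFreq v - hardSphereFreq v'| * s * (E + E) := by gcongr
      _ = 2 * |hardSphereFreq v - hardSphereFreq v'| * (s * E) := by ring
      _ ≤ 2 * |hardSphereFreq v - hardSphereFreq v'| * freqMin⁻¹ := by gcongr
      _ = _ := by ring
  -- difference in the position
  have hω : bdryModulus ψ (x - s • v) (x' - s • v') ≤ (‖x - x'‖ + s * ‖v - v'‖) * (R * S) := by
    unfold bdryModulus
    have e1 : ∀ y w : R3, y ∈ Ω → w ≠ 0 → b ≤ exitTime Ω y w →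
        (-ψ (y - s • w)) ^ (-(2 / 5) : ℝ) ≤ R * (-ψ y) ^ (-(2 / 5) : ℝ) := fun y w hy hw hbw => by
      have hmy := h.neg_pos hy
      have e2 := h.mul_le_neg_sub_smul hy hw hs hsb.le hb hbw
      rw [← Real.mul_rpow hsb1.le hmy.le]
      exact Real.rpow_le_rpow_of_nonpos (by positivity) e2 (by norm_num)
    have e3 : ‖x - s • v - (x' - s • v')‖ ≤ ‖x - x'‖ + s * ‖v - v'‖ := by
      have : x - s • v - (x' - s • v') = (x - x') - s • (v - v') := by module
      rw [this]
      refine (_root_.norm_sub_le _ _).trans (le_of_eq ?_)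
      rw [norm_smul, Real.norm_of_nonneg hs]
    have e4 := e1 x v hx hv hbt
    have e5 := e1 x' v' hx' hv' hbt'
    have p1 : 0 ≤ (-ψ (x - s • v)) ^ (-(2 / 5) : ℝ) := Real.rpow_nonneg (h.neg_pos hy).le _
    have p2 : 0 ≤ (-ψ (x' - s • v')) ^ (-(2 / 5) : ℝ) := Real.rpow_nonneg (h.neg_pos hy').le _
    refine mul_le_mul e3 ?_ (by positivity) (by positivity)
    rw [mul_add]
    exact add_le_add e4 e5
  have hB : E * |k (x - s • v) v - k (x' - s • v') v| ≤
      N * G * ((‖x - x'‖ + ‖v - v'‖ / freqMin) * S) * R := by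
    have h1 := (hk.abs_sub_le_left _ hy _ hy' v).trans
      (mul_le_mul_of_nonneg_left hω (by positivity))
    have h2 : E * (‖x - x'‖ + s * ‖v - v'‖) ≤ ‖x - x'‖ + ‖v - v'‖ / freqMin := by
      have e1 : E * ‖x - x'‖ ≤ ‖x - x'‖ := mul_le_of_le_one_left (norm_nonneg _) he3
      have e2 := mul_le_mul_of_nonneg_right hse (norm_nonneg (v - v'))
      rw [inv_mul_eq_div] at e2
      linarith
    calc _ ≤ E * (N * G * ((‖x - x'‖ + s * ‖v - v'‖) * (R * S))) :=
          mul_le_mul_of_nonneg_left h1 hE.le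
      _ = (E * (‖x - x'‖ + s * ‖v - v'‖)) * (N * G * (R * S)) := by ring
      _ ≤ (‖x - x'‖ + ‖v - v'‖ / freqMin) * (N * G * (R * S)) :=
          mul_le_mul_of_nonneg_right h2 (by positivity)
      _ = _ := by ring
  have hC' : E * |k (x' - s • v') v - k (x' - s • v') v'| ≤ C * ‖v - v'‖ * G' :=
    (mul_le_of_le_one_left (abs_nonneg _) he3).trans (hk.abs_sub_le_right _ hy' v v' hvv)
  have hsplit : Real.exp (-hardSphereFreq v * s) * k (x - s • v) v -
      Real.exp (-hardSphereFreq v' * s) * k (x' - s • v') v' =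
      (Real.exp (-hardSphereFreq v * s) - Real.exp (-hardSphereFreq v' * s)) * k (x - s • v) v +
      Real.exp (-hardSphereFreq v' * s) * ((k (x - s • v) v - k (x' - s • v') v) +
        (k (x' - s • v') v - k (x' - s • v') v')) := by ring
  rw [hsplit]
  refine (abs_add_le _ _).trans ?_
  rw [abs_mul, abs_mul, abs_of_pos (Real.exp_pos (-hardSphereFreq v' * s))]
  have h4 : Real.exp (-hardSphereFreq v' * s) * |k (x - s • v) v - k (x' - s • v') v +
      (k (x' - s • v') v - k (x' - s • v') v')| ≤
      E * (|k (x - s • v) v - k (x' - s • v') v| + |k (x' - s • v') v - k (x' - s • v') v'|) :=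
    mul_le_mul he2 (abs_add_le _ _) (abs_nonneg _) hE.le
  linarith

/-- Joint continuity estimate for the transport operator. Up to the smaller exit time `b` the two
characteristics are compared pointwise, and `-ψ` decreases at most linearly along each of them, so
that the singular factor of `bdryModulus` stays integrable in time. -/
lemma abs_transportS_sub_le (h : IsConvexSublevel Ω ψ D)
    (hk : IsWeightedLip Ω ψ a a' H N C k) (hN : 0 ≤ N)
    {x x' v v' : R3} (hx : x ∈ Ω) (hx' : x' ∈ Ω) (hv : v ≠ 0) (hv' : v' ≠ 0)
    (hvv : ‖v - v'‖ ≤ 1) {b : ℝ} (hb : b = min (exitTime Ω x v) (exitTime Ω x' v')) :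
    |transportS Ω k x v - transportS Ω k x' v'| ≤
      H * (Real.exp (-a * ‖v‖ ^ 2) + Real.exp (-a * ‖v'‖ ^ 2)) * Real.exp (-freqMin * b) *
        |exitTime Ω x v - exitTime Ω x' v'| +
      b * ((2 * |hardSphereFreq v - hardSphereFreq v'| / freqMin * (H * Real.exp (-a * ‖v‖ ^ 2)) +
        C * ‖v - v'‖ * Real.exp (-a' * ‖v‖ ^ 2)) +
      N * Real.exp (-a * ‖v‖ ^ 2) * ((‖x - x'‖ + ‖v - v'‖ / freqMin) *
        ((-ψ x) ^ (-(2 / 5) : ℝ) + (-ψ x') ^ (-(2 / 5) : ℝ))) * (5 / 3)) := by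
  have hτ := h.exitTime_pos hx hv
  have hτ' := h.exitTime_pos hx' hv'
  have hb0 : 0 < b := hb ▸ lt_min hτ hτ'
  have hbt : b ≤ exitTime Ω x v := hb ▸ min_le_left _ _
  have hbt' : b ≤ exitTime Ω x' v' := hb ▸ min_le_right _ _
  have hI := h.intervalIntegrable_transport hk hx v
  have hI' := h.intervalIntegrable_transport hk hx' v'
  have hm1 : b ∈ uIcc 0 (exitTime Ω x v) := by rw [uIcc_of_le hτ.le]; exact ⟨hb0.le, hbt⟩
  have hm2 : b ∈ uIcc 0 (exitTime Ω x' v') := by rw [uIcc_of_le hτ'.le]; exact ⟨hb0.le, hbt'⟩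
  have hI0 := hI.mono_set (uIcc_subset_uIcc_left hm1)
  have hI0' := hI'.mono_set (uIcc_subset_uIcc_left hm2)
  have hI1 := hI.mono_set (uIcc_subset_uIcc_right hm1)
  have hI1' := hI'.mono_set (uIcc_subset_uIcc_right hm2)
  have e1 := intervalIntegral.integral_add_adjacent_intervals hI0 hI1
  have e2 := intervalIntegral.integral_add_adjacent_intervals hI0' hI1'
  have e3 := intervalIntegral.integral_sub hI0 hI0'
  have t1 := h.abs_transport_tail_le hk hx v hb0.le hbt
  have t2 := h.abs_transport_tail_le hk hx' v' hb0.le hbt'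
  set P := 2 * |hardSphereFreq v - hardSphereFreq v'| / freqMin * (H * Real.exp (-a * ‖v‖ ^ 2)) +
        C * ‖v - v'‖ * Real.exp (-a' * ‖v‖ ^ 2) with hP
  set Q := N * Real.exp (-a * ‖v‖ ^ 2) * ((‖x - x'‖ + ‖v - v'‖ / freqMin) *
        ((-ψ x) ^ (-(2 / 5) : ℝ) + (-ψ x') ^ (-(2 / 5) : ℝ))) with hQ
  have hg : IntervalIntegrable (fun s : ℝ => P + Q * (1 - s / b) ^ (-(2 / 5) : ℝ)) volume 0 b :=
    intervalIntegrable_const.add ((intervalIntegrable_one_sub_div_rpow b).const_mul Q)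
  have hmid := intervalIntegral.norm_integral_le_of_norm_le (μ := volume) hb0.le
    (f := fun s => Real.exp (-hardSphereFreq v * s) * k (x - s • v) v -
        Real.exp (-hardSphereFreq v' * s) * k (x' - s • v') v')
    (g := fun s : ℝ => P + Q * (1 - s / b) ^ (-(2 / 5) : ℝ))
    (by
      filter_upwards [Measure.ae_ne volume b] with s hs1 hs
      exact h.abs_transport_integrand_sub_le hk hN hx hx' hv hv' hvv hb0 hbt hbt' hs.1.le
        (lt_of_le_of_ne hs.2 hs1)) hg
  rw [intervalIntegral.integral_add intervalIntegrable_const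
    ((intervalIntegrable_one_sub_div_rpow b).const_mul Q), intervalIntegral.integral_const_mul,
    integral_one_sub_div_rpow hb0.ne', intervalIntegral.integral_const, sub_zero, smul_eq_mul, e3,
    Real.norm_eq_abs] at hmid
  have hH : ∀ w : R3, 0 ≤ H * Real.exp (-a * ‖w‖ ^ 2) * Real.exp (-freqMin * b) := fun w =>
    mul_nonneg ((abs_nonneg _).trans (hk.abs_le x hx w)) (Real.exp_pos _).le
  have d1 : exitTime Ω x v - b ≤ |exitTime Ω x v - exitTime Ω x' v'| := by
    rw [hb]
    rcases min_choice (exitTime Ω x v) (exitTime Ω x' v') with e | e <;> rw [e]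
    · simp
    · exact le_abs_self _
  have d2 : exitTime Ω x' v' - b ≤ |exitTime Ω x v - exitTime Ω x' v'| := by
    rw [hb]
    rcases min_choice (exitTime Ω x v) (exitTime Ω x' v') with e | e <;> rw [e]
    · rw [abs_sub_comm]; exact le_abs_self _
    · simp
  have t1' := t1.trans (mul_le_mul_of_nonneg_left d1 (hH v))
  have t2' := t2.trans (mul_le_mul_of_nonneg_left d2 (hH v'))
  unfold transportS
  rw [← e1, ← e2]
  clear_value P Q
  set A1 := ∫ s in (0 : ℝ)..b, Real.exp (-hardSphereFreq v * s) * k (x - s • v) v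
  set A2 := ∫ s in (0 : ℝ)..b, Real.exp (-hardSphereFreq v' * s) * k (x' - s • v') v'
  set B1 := ∫ s in b..exitTime Ω x v, Real.exp (-hardSphereFreq v * s) * k (x - s • v) v
  set B2 := ∫ s in b..exitTime Ω x' v', Real.exp (-hardSphereFreq v' * s) * k (x' - s • v') v'
  have e5 : A1 + B1 - (A2 + B2) = (A1 - A2) + (B1 - B2) := by ring
  rw [e5]
  refine (abs_add_le _ _).trans ?_
  have e6 := abs_sub B1 B2
  linarith

end IsConvexSublevel

/-! ### Mild solutions with a given collision term -/

/-- The incoming boundary data `φ(x) exp (-|v|² / 2)`. -/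
noncomputable def maxwellData (φ : R3 → ℝ) (z : R3 × R3) : ℝ :=
  φ z.1 * Real.exp (-(1 / 2) * ‖z.2‖ ^ 2)

/-- The mild solution `J g + S_Ω k` of `v · ∇ₓ f + ν f = k` with incoming data `maxwellData φ`. -/
noncomputable def mildSolution (Ω : Set R3) (φ : R3 → ℝ) (k : R3 → R3 → ℝ) (z : R3 × R3) : ℝ :=
  incomingJ Ω (maxwellData φ) z.1 z.2 + transportS Ω k z.1 z.2

namespace IsConvexSublevel

variable {Ω : Set R3} {ψ : R3 → ℝ} {D a a' H N C : ℝ} {k : R3 → R3 → ℝ} {φ : R3 → ℝ}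

lemma abs_incomingJ_le (h : IsConvexSublevel Ω ψ D) (hφ : ∀ x, |φ x| ≤ 1) {x : R3} (hx : x ∈ Ω)
    (v : R3) : |incomingJ Ω (maxwellData φ) x v| ≤ Real.exp (-(1 / 2) * ‖v‖ ^ 2) := by
  have h1 : Real.exp (-hardSphereFreq v * exitTime Ω x v) ≤ 1 := by
    have := hardSphereFreq_pos v
    have := h.exitTime_nonneg hx v
    exact Real.exp_le_one_iff.2 (by nlinarith)
  have h2 := hφ (exitPoint Ω x v)
  simp only [incomingJ, maxwellData]
  rw [abs_mul, abs_mul, Real.abs_exp, Real.abs_exp, ← mul_assoc]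
  refine mul_le_of_le_one_left (Real.exp_pos _).le ?_
  exact mul_le_one₀ h1 (abs_nonneg _) h2

/-- Telescoping of the three factors of the incoming part. With `b` the smaller exit time, the
factor `exp (-freqMin * b)` is kept: it absorbs powers of the exit time, which is unbounded as the
velocity tends to zero. -/
lemma abs_incomingJ_sub_le (h : IsConvexSublevel Ω ψ D) (hφ : ∀ x, |φ x| ≤ 1) {L : NNReal}
    (hL : LipschitzWith L φ) {x x' v v' : R3} (hx : x ∈ Ω) (hx' : x' ∈ Ω)
    {b : ℝ} (hb : b = min (exitTime Ω x v) (exitTime Ω x' v')) :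
    |incomingJ Ω (maxwellData φ) x v - incomingJ Ω (maxwellData φ) x' v'| ≤
      Real.exp (-freqMin * b) *
        (2 * Real.exp (-(1 / 2) * ‖v‖ ^ 2) * (|hardSphereFreq v - hardSphereFreq v'| * b +
          (hardSphereFreq v + hardSphereFreq v') * |exitTime Ω x v - exitTime Ω x' v'|) +
        L * Real.exp (-(1 / 2) * ‖v‖ ^ 2) * (‖x - x'‖ + b * ‖v - v'‖ +
          (‖v‖ + ‖v'‖) * |exitTime Ω x v - exitTime Ω x' v'|) +
        |Real.exp (-(1 / 2) * ‖v‖ ^ 2) - Real.exp (-(1 / 2) * ‖v'‖ ^ 2)|) := by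
  have hτ := h.exitTime_nonneg hx v
  have hτ' := h.exitTime_nonneg hx' v'
  have hbt : b ≤ exitTime Ω x v := hb ▸ min_le_left _ _
  have hbt' : b ≤ exitTime Ω x' v' := hb ▸ min_le_right _ _
  have hb0 : 0 ≤ b := hb ▸ le_min hτ hτ'
  have hν := hardSphereFreq_pos v
  have hν' := hardSphereFreq_pos v'
  have hν0 := freqMin_pos
  have hmono : ∀ (w : R3) (t : ℝ), b ≤ t → 0 ≤ t →
      Real.exp (-hardSphereFreq w * t) ≤ Real.exp (-freqMin * b) := fun w t ht ht0 => by
    refine (exp_neg_hardSphereFreq_le w ht0).trans (Real.exp_le_exp.2 ?_)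
    nlinarith
  have m1 := hmono v _ hbt hτ
  have m2 := hmono v' _ hbt' hτ'
  have hp : |hardSphereFreq v * exitTime Ω x v - hardSphereFreq v' * exitTime Ω x' v'| ≤
      |hardSphereFreq v - hardSphereFreq v'| * b +
        (hardSphereFreq v + hardSphereFreq v') * |exitTime Ω x v - exitTime Ω x' v'| := by
    have q1 : 0 ≤ hardSphereFreq v * |exitTime Ω x v - exitTime Ω x' v'| := by positivity
    have q2 : 0 ≤ hardSphereFreq v' * |exitTime Ω x v - exitTime Ω x' v'| := by positivity
    rw [hb]
    rcases min_choice (exitTime Ω x v) (exitTime Ω x' v') with e | e <;> rw [e]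
    · have e1 : hardSphereFreq v * exitTime Ω x v - hardSphereFreq v' * exitTime Ω x' v' =
        (hardSphereFreq v - hardSphereFreq v') * exitTime Ω x v +
          hardSphereFreq v' * (exitTime Ω x v - exitTime Ω x' v') := by ring
      rw [e1]
      refine (abs_add_le _ _).trans ?_
      rw [abs_mul, abs_mul, abs_of_nonneg hτ, abs_of_pos hν']
      linarith
    · have e1 : hardSphereFreq v * exitTime Ω x v - hardSphereFreq v' * exitTime Ω x' v' =
        (hardSphereFreq v - hardSphereFreq v') * exitTime Ω x' v' +
          hardSphereFreq v * (exitTime Ω x v - exitTime Ω x' v') := by ring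
      rw [e1]
      refine (abs_add_le _ _).trans ?_
      rw [abs_mul, abs_mul, abs_of_nonneg hτ', abs_of_pos hν]
      linarith
  have hq : ‖exitPoint Ω x v - exitPoint Ω x' v'‖ ≤ ‖x - x'‖ + b * ‖v - v'‖ +
      (‖v‖ + ‖v'‖) * |exitTime Ω x v - exitTime Ω x' v'| := by
    have q1 : 0 ≤ ‖v‖ * |exitTime Ω x v - exitTime Ω x' v'| := by positivity
    have q2 : 0 ≤ ‖v'‖ * |exitTime Ω x v - exitTime Ω x' v'| := by positivity
    unfold exitPoint
    rw [hb]
    rcases min_choice (exitTime Ω x v) (exitTime Ω x' v') with e | e <;> rw [e]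
    · have e1 : x - exitTime Ω x v • v - (x' - exitTime Ω x' v' • v') =
          (x - x') - exitTime Ω x v • (v - v') - (exitTime Ω x v - exitTime Ω x' v') • v' := by
        module
      rw [e1]
      refine (_root_.norm_sub_le _ _).trans ?_
      have e2 := _root_.norm_sub_le (x - x') (exitTime Ω x v • (v - v'))
      rw [norm_smul, Real.norm_of_nonneg hτ] at e2
      rw [norm_smul, Real.norm_eq_abs]
      linarith
    · have e1 : x - exitTime Ω x v • v - (x' - exitTime Ω x' v' • v') =
          (x - x') - exitTime Ω x' v' • (v - v') - (exitTime Ω x v - exitTime Ω x' v') • v := by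
        module
      rw [e1]
      refine (_root_.norm_sub_le _ _).trans ?_
      have e2 := _root_.norm_sub_le (x - x') (exitTime Ω x' v' • (v - v'))
      rw [norm_smul, Real.norm_of_nonneg hτ'] at e2
      rw [norm_smul, Real.norm_eq_abs]
      linarith
  have hexp := abs_exp_neg_sub_exp_neg_le (hardSphereFreq v * exitTime Ω x v)
    (hardSphereFreq v' * exitTime Ω x' v')
  rw [← neg_mul, ← neg_mul] at hexp
  have hφq := hL.dist_le_mul (exitPoint Ω x v) (exitPoint Ω x' v')
  rw [Real.dist_eq, dist_eq_norm] at hφq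
  have hf1 := hφ (exitPoint Ω x v)
  have hf2 := hφ (exitPoint Ω x' v')
  simp only [incomingJ, maxwellData]
  set M := Real.exp (-(1 / 2) * ‖v‖ ^ 2)
  set M' := Real.exp (-(1 / 2) * ‖v'‖ ^ 2)
  have hM : 0 < M := Real.exp_pos _
  set E := Real.exp (-freqMin * b)
  have hE : 0 < E := Real.exp_pos _
  set e1 := Real.exp (-hardSphereFreq v * exitTime Ω x v)
  set e2 := Real.exp (-hardSphereFreq v' * exitTime Ω x' v')
  have he2 : 0 < e2 := Real.exp_pos _
  set f1 := φ (exitPoint Ω x v)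
  set f2 := φ (exitPoint Ω x' v')
  set X := |hardSphereFreq v - hardSphereFreq v'| * b +
        (hardSphereFreq v + hardSphereFreq v') * |exitTime Ω x v - exitTime Ω x' v'|
  have hX : 0 ≤ X := by positivity
  set Y := ‖x - x'‖ + b * ‖v - v'‖ + (‖v‖ + ‖v'‖) * |exitTime Ω x v - exitTime Ω x' v'|
  have hY : 0 ≤ Y := by positivity
  have split : e1 * (f1 * M) - e2 * (f2 * M') =
      (e1 - e2) * f1 * M + e2 * (f1 - f2) * M + e2 * f2 * (M - M') := by ring
  rw [split]
  refine (abs_add_three _ _ _).trans ?_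
  simp only [abs_mul]
  rw [abs_of_pos hM, abs_of_pos he2]
  have t1 : |e1 - e2| * |f1| * M ≤ E * (2 * M * X) := by
    have s1 : |e1 - e2| ≤ X * (2 * E) := hexp.trans (mul_le_mul hp (by linarith)
      (by positivity) hX)
    calc |e1 - e2| * |f1| * M ≤ X * (2 * E) * 1 * M := by gcongr
      _ = _ := by ring
  have t2 : e2 * |f1 - f2| * M ≤ E * (L * M * Y) := by
    have s1 : |f1 - f2| ≤ L * Y := hφq.trans (mul_le_mul_of_nonneg_left hq L.2)
    calc e2 * |f1 - f2| * M ≤ E * (L * Y) * M := by gcongr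
      _ = _ := by ring
  have t3 : e2 * |f2| * |M - M'| ≤ E * |M - M'| := by
    calc e2 * |f2| * |M - M'| ≤ E * 1 * |M - M'| := by gcongr
      _ = _ := by ring
  linarith

lemma continuousOn_exitTime (h : IsConvexSublevel Ω ψ D) :
    ContinuousOn (fun z : R3 × R3 => exitTime Ω z.1 z.2) (Ω ×ˢ {0}ᶜ) := fun _ hz =>
  (h.contDiffAt_exitTime hz.1 hz.2).continuousAt.continuousWithinAt

lemma continuousOn_incomingJ (h : IsConvexSublevel Ω ψ D) (hφ : Continuous φ) :
    ContinuousOn (fun z : R3 × R3 => incomingJ Ω (maxwellData φ) z.1 z.2) (Ω ×ˢ {0}ᶜ) := by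
  have h1 := h.continuousOn_exitTime
  have h2 : ContinuousOn (fun z : R3 × R3 => hardSphereFreq z.2) (Ω ×ˢ {0}ᶜ) :=
    (continuous_hardSphereFreq.comp continuous_snd).continuousOn
  have h3 : ContinuousOn (fun z : R3 × R3 => exitPoint Ω z.1 z.2) (Ω ×ˢ {0}ᶜ) :=
    continuousOn_fst.sub (h1.smul continuousOn_snd)
  exact (Real.continuous_exp.comp_continuousOn (h2.neg.mul h1)).mul
    ((hφ.comp_continuousOn h3).mul
      (by fun_prop : Continuous fun z : R3 × R3 => Real.exp (-(1 / 2) * ‖z.2‖ ^ 2)).continuousOn)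

/-- The right side of `abs_transportS_sub_le` vanishes as the two points merge. -/
lemma continuousOn_transportS (h : IsConvexSublevel Ω ψ D)
    (hk : IsWeightedLip Ω ψ a a' H N C k) (hN : 0 ≤ N) :
    ContinuousOn (fun z : R3 × R3 => transportS Ω k z.1 z.2) (Ω ×ˢ {0}ᶜ) := by
  rintro ⟨x, v⟩ ⟨hx, hv⟩
  have hv0 : v ≠ 0 := hv
  have hm := h.neg_pos hx
  have hτ : ContinuousAt (fun z : R3 × R3 => exitTime Ω z.1 z.2) (x, v) :=
    (h.contDiffAt_exitTime (z := (x, v)) hx hv0).continuousAt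
  have hν : ContinuousAt (fun z : R3 × R3 => hardSphereFreq z.2) (x, v) :=
    (continuous_hardSphereFreq.comp continuous_snd).continuousAt
  have hψ : ContinuousAt (fun z : R3 × R3 => (-ψ z.1) ^ (-(2 / 5) : ℝ)) (x, v) :=
    (h.continuous.neg.comp continuous_fst).continuousAt.rpow_const (Or.inl hm.ne')
  set B : R3 × R3 → ℝ := fun z => min (exitTime Ω x v) (exitTime Ω z.1 z.2) with hB
  have hBc : ContinuousAt B (x, v) := continuousAt_const.min hτ
  set R : R3 × R3 → ℝ := fun z =>
      H * (Real.exp (-a * ‖v‖ ^ 2) + Real.exp (-a * ‖z.2‖ ^ 2)) * Real.exp (-freqMin * B z) *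
        |exitTime Ω x v - exitTime Ω z.1 z.2| +
      B z * ((2 * |hardSphereFreq v - hardSphereFreq z.2| / freqMin *
        (H * Real.exp (-a * ‖v‖ ^ 2)) + C * ‖v - z.2‖ * Real.exp (-a' * ‖v‖ ^ 2)) +
      N * Real.exp (-a * ‖v‖ ^ 2) * ((‖x - z.1‖ + ‖v - z.2‖ / freqMin) *
        ((-ψ x) ^ (-(2 / 5) : ℝ) + (-ψ z.1) ^ (-(2 / 5) : ℝ))) * (5 / 3)) with hR
  have hRc : ContinuousAt R (x, v) := by
    clear_value B
    rw [hR]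
    fun_prop
  have hR0 : R (x, v) = 0 := by simp [hR]
  have hlim : Filter.Tendsto R (𝓝[Ω ×ˢ {0}ᶜ] (x, v)) (𝓝 0) :=
    hR0 ▸ hRc.tendsto.mono_left nhdsWithin_le_nhds
  refine tendsto_iff_dist_tendsto_zero.2 ?_
  refine squeeze_zero' (Filter.Eventually.of_forall fun _ => dist_nonneg) ?_ hlim
  have hnear : ∀ᶠ z : R3 × R3 in 𝓝[Ω ×ˢ {0}ᶜ] (x, v), ‖v - z.2‖ ≤ 1 := by
    refine Filter.Eventually.filter_mono nhdsWithin_le_nhds ?_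
    have hc : ContinuousAt (fun z : R3 × R3 => ‖v - z.2‖) (x, v) := by fun_prop
    have := hc.tendsto
    simp only [sub_self, norm_zero] at this
    exact (this.eventually (gt_mem_nhds zero_lt_one)).mono fun z hz => le_of_lt hz
  filter_upwards [hnear, self_mem_nhdsWithin] with z hz hzm
  rw [dist_comm, Real.dist_eq]
  exact h.abs_transportS_sub_le hk hN hx hzm.1 hv0 hzm.2 hz rfl

lemma continuousOn_mildSolution (h : IsConvexSublevel Ω ψ D)
    (hk : IsWeightedLip Ω ψ a a' H N C k) (hN : 0 ≤ N) (hφ : Continuous φ) :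
    ContinuousOn (mildSolution Ω φ k) (Ω ×ˢ {0}ᶜ) :=
  (h.continuousOn_incomingJ hφ).add (h.continuousOn_transportS hk hN)

lemma exp_half_le {a : ℝ} (ha : a < 1 / 2) (v : R3) :
    Real.exp (-(1 / 2) * ‖v‖ ^ 2) ≤ Real.exp (-a * ‖v‖ ^ 2) :=
  Real.exp_le_exp.2 (by nlinarith [sq_nonneg ‖v‖])

lemma abs_mildSolution_le (h : IsConvexSublevel Ω ψ D) (ha : a < 1 / 2)
    (hk : IsWeightedLip Ω ψ a a' H N C k) (hφ : ∀ x, |φ x| ≤ 1) {x : R3} (hx : x ∈ Ω) (v : R3) :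
    |mildSolution Ω φ k (x, v)| ≤ (1 + H / freqMin) * Real.exp (-a * ‖v‖ ^ 2) := by
  have h1 := (h.abs_incomingJ_le hφ hx v).trans (exp_half_le ha v)
  have h2 := h.abs_transportS_le' hk hx v
  unfold mildSolution
  refine (abs_add_le _ _).trans ?_
  simp only
  linarith

end IsConvexSublevel

lemma aestronglyMeasurable_section {Ω : Set R3} {F : R3 × R3 → ℝ}
    (hF : ContinuousOn F (Ω ×ˢ {0}ᶜ)) {x : R3} (hx : x ∈ Ω) :
    AEStronglyMeasurable (fun w => F (x, w)) volume := by
  have h1 : ContinuousOn (fun w => F (x, w)) ({0}ᶜ : Set R3) :=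
    hF.comp (by fun_prop) fun w hw => ⟨hx, hw⟩
  have h2 := h1.aestronglyMeasurable (μ := volume) (measurableSet_singleton (0 : R3)).compl
  rwa [restrict_compl_singleton] at h2

/-! ### The fixed point of the collision gain -/

/-- The collision gain `K (J g + S_Ω k)` of the mild solution with collision term `k`. -/
noncomputable def gainMap (Ω : Set R3) (φ : R3 → ℝ) (k : R3 → R3 → ℝ) : R3 → R3 → ℝ :=
  collisionK (mildSolution Ω φ k)

lemma isWeightedLip_zero (Ω : Set R3) (ψ : R3 → ℝ) (a a' : ℝ) :
    IsWeightedLip Ω ψ a a' 0 0 0 fun _ _ => 0 :=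
  ⟨fun _ _ _ => by simp, fun _ _ _ _ _ => by simp, fun _ _ _ _ _ => by simp⟩

lemma IsWeightedLip.mono {Ω : Set R3} {ψ : R3 → ℝ} {D a a' H N C H' N' C' : ℝ} {k : R3 → R3 → ℝ}
    (h : IsConvexSublevel Ω ψ D) (hk : IsWeightedLip Ω ψ a a' H N C k) (hH : H ≤ H') (hN : N ≤ N')
    (hC : C ≤ C') : IsWeightedLip Ω ψ a a' H' N' C' k := by
  refine ⟨fun x hx v => (hk.abs_le x hx v).trans ?_, fun x hx y hy v =>
    (hk.abs_sub_le_left x hx y hy v).trans ?_, fun x hx v v' hv =>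
    (hk.abs_sub_le_right x hx v v' hv).trans ?_⟩
  · gcongr
  · have := h.bdryModulus_nonneg hx hy
    gcongr
  · gcongr

namespace IsConvexSublevel

variable {Ω : Set R3} {ψ : R3 → ℝ} {D a a' H N C : ℝ} {k : R3 → R3 → ℝ} {φ : R3 → ℝ}

/-- Lipschitz bounds are bounds by `bdryModulus`, because `-ψ` is bounded on `Ω`. -/
lemma exists_norm_sub_le_bdryModulus (h : IsConvexSublevel Ω ψ D) :
    ∃ c : ℝ, 0 < c ∧ ∀ x ∈ Ω, ∀ y ∈ Ω, ‖x - y‖ ≤ c * bdryModulus ψ x y := by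
  have hcomp : IsCompact (closure Ω) := h.isBounded.isCompact_closure
  obtain ⟨B, hB⟩ := hcomp.exists_bound_of_continuousOn h.continuous.continuousOn
  have hM : 0 < |B| + 1 := by positivity
  refine ⟨(|B| + 1) ^ (2 / 5 : ℝ), by positivity, fun x hx y hy => ?_⟩
  have hmx := h.neg_pos hx
  have hmy := h.neg_pos hy
  have h1 : -ψ x ≤ |B| + 1 := by
    have := hB x (subset_closure hx)
    rw [Real.norm_eq_abs] at this
    linarith [neg_abs_le (ψ x), le_abs_self B]
  have h2 : (|B| + 1) ^ (-(2 / 5) : ℝ) ≤ (-ψ x) ^ (-(2 / 5) : ℝ) :=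
    Real.rpow_le_rpow_of_nonpos hmx h1 (by norm_num)
  have h3 : 0 ≤ (-ψ y) ^ (-(2 / 5) : ℝ) := by positivity
  have h4 : (|B| + 1) ^ (2 / 5 : ℝ) * (|B| + 1) ^ (-(2 / 5) : ℝ) = 1 := by
    rw [← Real.rpow_add hM]; norm_num
  unfold bdryModulus
  calc ‖x - y‖ = ‖x - y‖ * ((|B| + 1) ^ (2 / 5 : ℝ) * (|B| + 1) ^ (-(2 / 5) : ℝ)) := by
        rw [h4, mul_one]
    _ ≤ ‖x - y‖ * ((|B| + 1) ^ (2 / 5 : ℝ) *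
        ((-ψ x) ^ (-(2 / 5) : ℝ) + (-ψ y) ^ (-(2 / 5) : ℝ))) := by
        gcongr
        linarith
    _ = _ := by ring

lemma abs_transportS_le_inv_norm (h : IsConvexSublevel Ω ψ D)
    (hk : IsWeightedLip Ω ψ a a' H N C k) {x : R3} (hx : x ∈ Ω) (v : R3) :
    |transportS Ω k x v| ≤ H * D * Real.exp (-a * ‖v‖ ^ 2) * ‖v‖⁻¹ := by
  have h1 : 0 ≤ H * Real.exp (-a * ‖v‖ ^ 2) := (abs_nonneg _).trans (hk.abs_le x hx v)
  calc _ ≤ H * Real.exp (-a * ‖v‖ ^ 2) * exitTime Ω x v := h.abs_transportS_le hk hx v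
    _ ≤ H * Real.exp (-a * ‖v‖ ^ 2) * (D * ‖v‖⁻¹) :=
        mul_le_mul_of_nonneg_left (h.exitTime_le hx v) h1
    _ = _ := by ring

/-- Comparison of the transports of two close sources. -/
lemma abs_transportS_sub_right_le (h : IsConvexSublevel Ω ψ D) {k' : R3 → R3 → ℝ} {δ : ℝ}
    (hk : IsWeightedLip Ω ψ a a' H N C k) (hk' : IsWeightedLip Ω ψ a a' H N C k')
    (hδ : ∀ x ∈ Ω, ∀ v, |k x v - k' x v| ≤ δ * Real.exp (-a * ‖v‖ ^ 2)) {x : R3} (hx : x ∈ Ω)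
    (v : R3) :
    |transportS Ω k x v - transportS Ω k' x v| ≤
      δ * D * Real.exp (-a * ‖v‖ ^ 2) * ‖v‖⁻¹ := by
  have hτ := h.exitTime_nonneg hx v
  have h1 : 0 ≤ δ * Real.exp (-a * ‖v‖ ^ 2) := (abs_nonneg _).trans (hδ x hx v)
  unfold transportS
  rw [← intervalIntegral.integral_sub (h.intervalIntegrable_transport hk hx v)
    (h.intervalIntegrable_transport hk' hx v), intervalIntegral.integral_of_le hτ,
    integral_Ioc_eq_integral_Ioo]
  have := norm_setIntegral_le_of_norm_le_const
    (f := fun s => Real.exp (-hardSphereFreq v * s) * k (x - s • v) v -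
      Real.exp (-hardSphereFreq v * s) * k' (x - s • v) v)
    (C := δ * Real.exp (-a * ‖v‖ ^ 2))
    (measure_Ioo_lt_top (μ := volume) (a := 0) (b := exitTime Ω x v)) (fun s hs => by
      rw [← mul_sub, Real.norm_eq_abs, abs_mul, Real.abs_exp]
      refine (mul_le_of_le_one_left (abs_nonneg _) (Real.exp_le_one_iff.2 ?_)).trans
        (hδ _ (h.sub_smul_mem hx hs.1.le hs.2) v)
      have := hardSphereFreq_pos v
      nlinarith [hs.1])
  rw [Real.norm_eq_abs, measureReal_def, Real.volume_Ioo, ENNReal.toReal_ofReal (by linarith),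
    sub_zero] at this
  refine this.trans ?_
  calc _ ≤ δ * Real.exp (-a * ‖v‖ ^ 2) * (D * ‖v‖⁻¹) :=
        mul_le_mul_of_nonneg_left (h.exitTime_le hx v) h1
    _ = _ := by ring

/-- Spatial difference of the incoming part at equal velocities. -/
lemma abs_incomingJ_sub_left_le {a : ℝ} (ha : a < 1 / 2) (L : NNReal) :
    ∃ A : ℝ, 0 < A ∧ ∀ {Ω : Set R3} {ψ : R3 → ℝ} {D : ℝ} (_ : IsConvexSublevel Ω ψ D)
      {φ : R3 → ℝ} (_ : ∀ x, |φ x| ≤ 1) (_ : LipschitzWith L φ),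
      ∀ x ∈ Ω, ∀ y ∈ Ω, ∀ w : R3,
      |incomingJ Ω (maxwellData φ) x w - incomingJ Ω (maxwellData φ) y w| ≤
        A * Real.exp (-a * ‖w‖ ^ 2) * (|exitTime Ω x w - exitTime Ω y w| + ‖x - y‖) := by
  obtain ⟨P, hP, hpoly⟩ := one_add_pow_le_exp_sq 2 (e := 1 / 2 - a) (by linarith)
  refine ⟨(8 + 2 * L) * P, by positivity, fun {Ω ψ D} h {φ} hφ hL x hx y hy w => ?_⟩
  have h1 := h.abs_incomingJ_sub_le hφ hL hx hy (v := w) (v' := w) rfl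
  simp only [sub_self, abs_zero, zero_mul, norm_zero, mul_zero, add_zero, zero_add] at h1
  set M := Real.exp (-(1 / 2) * ‖w‖ ^ 2)
  have hM : 0 < M := Real.exp_pos _
  set t := |exitTime Ω x w - exitTime Ω y w|
  have ht : 0 ≤ t := abs_nonneg _
  have hE : Real.exp (-freqMin * min (exitTime Ω x w) (exitTime Ω y w)) ≤ 1 := by
    have := freqMin_pos
    have := le_min (h.exitTime_nonneg hx w) (h.exitTime_nonneg hy w)
    exact Real.exp_le_one_iff.2 (by nlinarith)
  have hν := hardSphereFreq_le w
  have hν0 := hardSphereFreq_pos w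
  have hMP : M * (1 + ‖w‖) ^ 2 ≤ P * Real.exp (-a * ‖w‖ ^ 2) := by
    calc M * (1 + ‖w‖) ^ 2 ≤ M * (P * Real.exp ((1 / 2 - a) * ‖w‖ ^ 2)) := by
          gcongr
          exact hpoly _ (norm_nonneg _)
      _ = P * Real.exp (-a * ‖w‖ ^ 2) := by
          rw [mul_left_comm, ← Real.exp_add]; ring_nf
  have hw2 : 1 ≤ (1 + ‖w‖) ^ 2 := one_le_pow₀ (by linarith [norm_nonneg w])
  have hw3 : ‖w‖ ≤ (1 + ‖w‖) ^ 2 := by nlinarith [norm_nonneg w]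
  have hL0 : (0 : ℝ) ≤ L := L.2
  calc _ ≤ 2 * M * ((hardSphereFreq w + hardSphereFreq w) * t) +
        L * M * (‖x - y‖ + (‖w‖ + ‖w‖) * t) := h1.trans
          (mul_le_of_le_one_left (by positivity) hE)
    _ ≤ 2 * M * ((2 * (1 + ‖w‖) ^ 2 + 2 * (1 + ‖w‖) ^ 2) * t) +
        L * M * ((1 + ‖w‖) ^ 2 * ‖x - y‖ + ((1 + ‖w‖) ^ 2 + (1 + ‖w‖) ^ 2) * t) := by
        gcongr
        exact le_mul_of_one_le_left (norm_nonneg _) hw2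
    _ = (M * (1 + ‖w‖) ^ 2) * (8 * t + L * ‖x - y‖ + 2 * L * t) := by ring
    _ ≤ (P * Real.exp (-a * ‖w‖ ^ 2)) * (8 * t + L * ‖x - y‖ + 2 * L * t) := by gcongr
    _ ≤ (P * Real.exp (-a * ‖w‖ ^ 2)) * ((8 + 2 * L) * (t + ‖x - y‖)) := by
        gcongr
        nlinarith [norm_nonneg (x - y), mul_nonneg hL0 (norm_nonneg (x - y))]
    _ = _ := by ring

/-- Spatial difference of the mild solution at equal velocities. The term with the constant `N` of
the source carries the factor `D`, which is small in a small domain. -/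
lemma abs_mildSolution_sub_left_le (h : IsConvexSublevel Ω ψ D)
    (hk : IsWeightedLip Ω ψ a a' H N C k) (hN : 0 ≤ N) {A : ℝ} {x y w : R3}
    (hA : |incomingJ Ω (maxwellData φ) x w - incomingJ Ω (maxwellData φ) y w| ≤
        A * Real.exp (-a * ‖w‖ ^ 2) * (|exitTime Ω x w - exitTime Ω y w| + ‖x - y‖))
    (hx : x ∈ Ω) (hy : y ∈ Ω) (hw : w ≠ 0) :
    |mildSolution Ω φ k (x, w) - mildSolution Ω φ k (y, w)| ≤
      Real.exp (-a * ‖w‖ ^ 2) * ((A + 2 * H) * |exitTime Ω x w - exitTime Ω y w| +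
        A * ‖x - y‖ + 5 / 3 * N * D * bdryModulus ψ x y * ‖w‖⁻¹) := by
  have h1 := h.abs_transportS_sub_le hk hN hx hy hw hw (by simp) rfl
  simp only [sub_self, abs_zero, zero_mul, norm_zero, mul_zero, add_zero, zero_add,
    zero_div] at h1
  set b := min (exitTime Ω x w) (exitTime Ω y w)
  have hb0 : 0 ≤ b := le_min (h.exitTime_nonneg hx w) (h.exitTime_nonneg hy w)
  have hbD : b ≤ D * ‖w‖⁻¹ := (min_le_left _ _).trans (h.exitTime_le hx w)
  set G := Real.exp (-a * ‖w‖ ^ 2)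
  have hG : 0 < G := Real.exp_pos _
  have hH : 0 ≤ H * G := (abs_nonneg _).trans (hk.abs_le x hx w)
  have hE : Real.exp (-freqMin * b) ≤ 1 := by
    have := freqMin_pos
    exact Real.exp_le_one_iff.2 (by nlinarith)
  set t := |exitTime Ω x w - exitTime Ω y w|
  have ht : 0 ≤ t := abs_nonneg _
  have hω := h.bdryModulus_nonneg hx hy
  have e1 : H * (G + G) * Real.exp (-freqMin * b) * t ≤ 2 * (H * G) * t := by
    have := mul_le_mul_of_nonneg_left hE (mul_nonneg hH ht)
    linarith
  have e2 : b * (N * G * (‖x - y‖ * ((-ψ x) ^ (-(2 / 5) : ℝ) + (-ψ y) ^ (-(2 / 5) : ℝ))) *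
      (5 / 3)) ≤ D * ‖w‖⁻¹ * (N * G * bdryModulus ψ x y * (5 / 3)) :=
    mul_le_mul hbD le_rfl (by unfold bdryModulus at hω; positivity) (hb0.trans hbD)
  have e3 : mildSolution Ω φ k (x, w) - mildSolution Ω φ k (y, w) =
      (incomingJ Ω (maxwellData φ) x w - incomingJ Ω (maxwellData φ) y w) +
      (transportS Ω k x w - transportS Ω k y w) := by
    simp only [mildSolution]; ring
  rw [e3]
  refine (abs_add_le _ _).trans ?_
  linarith

end IsConvexSublevel

/-- In a small domain the collision gain of the mild solution preserves the weighted class and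
contracts the weighted supremum norm by `1 / 2`: the transported part carries the factor `τ ≤ D /
‖w‖`, whose singularity is integrable against the kernel. The constants `H` and `D₀` depend neither
on the domain nor on `φ`, so that the domain can be chosen after them. -/
lemma exists_gainMap_class {a a' : ℝ} (ha0 : 0 ≤ a') (haa : a' < a) (ha : a < 1 / 2) :
    ∃ H D₀ : ℝ, 0 < H ∧ 0 < D₀ ∧
      ∀ (Ω : Set R3) (ψ : R3 → ℝ) (D : ℝ), IsConvexSublevel Ω ψ D → D ≤ D₀ →
      ∀ (φ : R3 → ℝ) (L : NNReal), (∀ x, |φ x| ≤ 1) → LipschitzWith L φ →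
      ∃ N C : ℝ, 0 ≤ N ∧ 0 ≤ C ∧
        (∀ k, IsWeightedLip Ω ψ a a' H N C k → IsWeightedLip Ω ψ a a' H N C (gainMap Ω φ k)) ∧
        (∀ k, IsWeightedLip Ω ψ a a' H N C k → ∀ x ∈ Ω, ∀ v,
          Integrable fun w => hardSphereKernel v w * mildSolution Ω φ k (x, w)) ∧
        (∀ k k', IsWeightedLip Ω ψ a a' H N C k → IsWeightedLip Ω ψ a a' H N C k' → ∀ δ : ℝ,
          (∀ x ∈ Ω, ∀ v, |k x v - k' x v| ≤ δ * Real.exp (-a * ‖v‖ ^ 2)) →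
          ∀ x ∈ Ω, ∀ v, |gainMap Ω φ k x v - gainMap Ω φ k' x v| ≤
            δ / 2 * Real.exp (-a * ‖v‖ ^ 2)) := by
  have ha0' : 0 ≤ a := by linarith
  obtain ⟨C1, hC1, H1⟩ := exists_abs_integral_kernel_le ha0' ha
  obtain ⟨C2, hC2, H2⟩ := exists_abs_integral_kernel_le_of_inv_norm ha0' ha
  obtain ⟨Cd, hCd, H3⟩ := exists_abs_integral_kernel_sub_le ha0 haa ha
  have hrate := kernelRate_pos ha
  have hK := kernelConst_pos ha
  obtain ⟨I, hI, hIv⟩ := exists_integral_inv_norm_mul_inv_norm_le hrate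
  set K := kernelConst a
  have hν0 := freqMin_pos
  set H := 2 * C1 with hH
  have hH0 : 0 < H := by positivity
  -- the first bound serves the size and the contraction, the second one the spatial modulus
  set D₀ := min (1 / (2 * C2)) (1 / (2 * (K * (5 / 3) * I))) with hD₀
  refine ⟨H, D₀, hH0, by positivity, fun Ω ψ D h hD φ L hφ hL => ?_⟩
  have hD2 : C2 * D ≤ 1 / 2 := by
    have h1 : D ≤ 1 / (2 * C2) := hD.trans (min_le_left _ _)
    rw [le_div_iff₀ (by positivity)] at h1
    linarith
  have hD3 : K * (5 / 3) * I * D ≤ 1 / 2 := by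
    have h1 : D ≤ 1 / (2 * (K * (5 / 3) * I)) := hD.trans (min_le_right _ _)
    rw [le_div_iff₀ (by positivity)] at h1
    linarith
  have hDpos := h.diam_pos
  obtain ⟨A, hA, hAJ⟩ := IsConvexSublevel.abs_incomingJ_sub_left_le ha L
  obtain ⟨Cτ, hCτ, hτ⟩ := h.exists_integral_exitTime_sub_le hrate
  obtain ⟨c, hc, hcω⟩ := h.exists_norm_sub_le_bdryModulus
  set I0 := ∫ u : R3, ‖u‖⁻¹ * Real.exp (-kernelRate a * ‖u‖ ^ 2) with hI0
  have hI0' : 0 ≤ I0 := integral_nonneg fun u => by positivity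
  set N := 2 * K * ((A + 2 * H) * Cτ + A * c * I0) with hN
  have hN0 : 0 ≤ N := by positivity
  set C := Cd * (1 + H / freqMin) with hCdef
  have hC0 : 0 ≤ C := by positivity
  have hφc : Continuous φ := hL.continuous
  -- measurability and integrability of the mild solution
  have hmeas : ∀ k, IsWeightedLip Ω ψ a a' H N C k → ∀ x ∈ Ω,
      AEStronglyMeasurable (fun w => mildSolution Ω φ k (x, w)) volume := fun k hk x hx =>
    aestronglyMeasurable_section (h.continuousOn_mildSolution hk hN0 hφc) hx
  have hint : ∀ k, IsWeightedLip Ω ψ a a' H N C k → ∀ x ∈ Ω, ∀ v,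
      Integrable fun w => hardSphereKernel v w * mildSolution Ω φ k (x, w) := fun k hk x hx v =>
    (H1 (1 + H / freqMin) _ (hmeas k hk x hx) (Filter.Eventually.of_forall fun w =>
      h.abs_mildSolution_le ha hk hφ hx w) v).1
  have hmJ : ∀ x ∈ Ω, AEStronglyMeasurable (fun w => incomingJ Ω (maxwellData φ) x w) volume :=
    fun x hx => aestronglyMeasurable_section (h.continuousOn_incomingJ hφc) hx
  have hmS : ∀ k, IsWeightedLip Ω ψ a a' H N C k → ∀ x ∈ Ω,
      AEStronglyMeasurable (fun w => transportS Ω k x w) volume := fun k hk x hx =>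
    aestronglyMeasurable_section (h.continuousOn_transportS hk hN0) hx
  refine ⟨N, C, hN0, hC0, fun k hk => ⟨fun x hx v => ?_, fun x hx y hy v => ?_,
    fun x hx v v' hvv => ?_⟩, hint, fun k k' hk hk' δ hδ x hx v => ?_⟩
  · -- each of the two parts of the mild solution contributes `H / 2`
    have b1 := H1 1 _ (hmJ x hx) (Filter.Eventually.of_forall fun w => by
      rw [one_mul]
      exact (h.abs_incomingJ_le hφ hx w).trans (IsConvexSublevel.exp_half_le ha w)) v
    have b2 := H2 (H * D) _ (hmS k hk x hx) (by positivity) (Filter.Eventually.of_forall fun w =>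
      h.abs_transportS_le_inv_norm hk hx w) v
    have e : gainMap Ω φ k x v = (∫ w, hardSphereKernel v w * incomingJ Ω (maxwellData φ) x w) +
        ∫ w, hardSphereKernel v w * transportS Ω k x w := by
      rw [← integral_add b1.1 b2.1]
      simp only [gainMap, collisionK, mildSolution, mul_add]
    rw [e]
    refine (abs_add_le _ _).trans ?_
    set G := Real.exp (-a * ‖v‖ ^ 2)
    have hG : 0 < G := Real.exp_pos _
    have e1 : C2 * (H * D) * G ≤ 1 / 2 * (H * G) := by
      have := mul_le_mul_of_nonneg_right hD2 (mul_nonneg hH0.le hG.le)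
      linarith
    have e2 : C1 * 1 * G = 1 / 2 * (H * G) := by rw [hH]; ring
    linarith [b1.2, b2.2]
  · -- position: `exitTime` differences are averaged, and the term with `N` is halved
    set β := bdryModulus ψ x y with hω
    have hω0 : 0 ≤ β := h.bdryModulus_nonneg hx hy
    set W : R3 → ℝ := fun w => ‖w - v‖⁻¹ * Real.exp (-kernelRate a * ‖w - v‖ ^ 2) with hW
    obtain ⟨g1, g1'⟩ := hτ x hx y hy v
    obtain ⟨g3, g3'⟩ := hIv v
    have g2 : Integrable W := integrable_inv_norm_mul_exp_sub hrate v
    have g2' : ∫ w, W w = I0 := integral_inv_norm_mul_exp_sub _ v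
    set Gf : R3 → ℝ := fun w => (A + 2 * H) * |exitTime Ω x w - exitTime Ω y w| +
        A * ‖x - y‖ + 5 / 3 * N * D * β * ‖w‖⁻¹ with hGf
    have eG : (fun w => W w * Gf w) = fun w =>
        ((A + 2 * H) * (W w * |exitTime Ω x w - exitTime Ω y w|) + A * ‖x - y‖ * W w) +
        5 / 3 * N * D * β * (W w * ‖w‖⁻¹) := by
      funext w
      simp only [hGf]
      ring
    have i1 : Integrable fun w => (A + 2 * H) * (W w * |exitTime Ω x w - exitTime Ω y w|) :=
      g1.const_mul _
    have i2 : Integrable fun w => A * ‖x - y‖ * W w := g2.const_mul _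
    have i3 : Integrable fun w => 5 / 3 * N * D * β * (W w * ‖w‖⁻¹) := g3.const_mul _
    have hGint : Integrable fun w => W w * Gf w := by
      rw [eG]
      exact (i1.add i2).add i3
    have hGval : ∫ w, W w * Gf w ≤ (A + 2 * H) * (Cτ * β) + A * (c * β) * I0 +
        5 / 3 * N * D * β * I := by
      have e1 := integral_add (i1.add i2) i3
      have e2 := integral_add i1 i2
      simp only [Pi.add_apply] at e1
      rw [eG, e1, e2, integral_const_mul, integral_const_mul, integral_const_mul, g2']
      have hxy := hcω x hx y hy
      gcongr
      exact g1'
    have hb := integrable_kernel_mul_and_abs_integral_le ha0' ha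
      ((hmeas k hk x hx).sub (hmeas k hk y hy)) (G := Gf) (by
        filter_upwards [Measure.ae_ne (volume : Measure R3) 0] with w hw
        exact h.abs_mildSolution_sub_left_le hk hN0 (hAJ h hφ hL x hx y hy w) hx hy hw) v hGint
    have e : gainMap Ω φ k x v - gainMap Ω φ k y v = ∫ w, hardSphereKernel v w *
        ((fun w => mildSolution Ω φ k (x, w)) - fun w => mildSolution Ω φ k (y, w)) w := by
      simp only [Pi.sub_apply, mul_sub]
      exact (integral_sub (hint k hk x hx v) (hint k hk y hy v)).symm
    rw [e]
    refine hb.2.trans ?_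
    set G := Real.exp (-a * ‖v‖ ^ 2)
    have hG : 0 < G := Real.exp_pos _
    calc K * G * ∫ w, W w * Gf w ≤ K * G * ((A + 2 * H) * (Cτ * β) + A * (c * β) * I0 +
        5 / 3 * N * D * β * I) := by gcongr
      _ = (K * ((A + 2 * H) * Cτ + A * c * I0) + K * (5 / 3) * I * D * N) * (G * β) := by ring
      _ ≤ (K * ((A + 2 * H) * Cτ + A * c * I0) + 1 / 2 * N) * (G * β) := by gcongr
      _ = N * G * β := by rw [hN]; ring
  · -- velocity: only the kernel depends on it
    have := H3 (1 + H / freqMin) _ (hmeas k hk x hx) (by positivity)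
      (Filter.Eventually.of_forall fun w => h.abs_mildSolution_le ha hk hφ hx w) v v' hvv
    exact this
  · -- contraction: the incoming part does not depend on the collision term
    have hδ0 : 0 ≤ δ := by
      have := (abs_nonneg _).trans (hδ x hx v)
      exact nonneg_of_mul_nonneg_left this (Real.exp_pos _)
    have b2 := H2 (δ * D) _ ((hmS k hk x hx).sub (hmS k' hk' x hx)) (by positivity)
      (Filter.Eventually.of_forall fun w =>
        h.abs_transportS_sub_right_le hk hk' hδ hx w) v
    have e : gainMap Ω φ k x v - gainMap Ω φ k' x v = ∫ w, hardSphereKernel v w *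
        ((fun w => transportS Ω k x w) - fun w => transportS Ω k' x w) w := by
      have e1 := integral_sub (hint k hk x hx v) (hint k' hk' x hx v)
      simp only [gainMap, collisionK]
      rw [← e1]
      refine integral_congr_ae (Filter.Eventually.of_forall fun w => ?_)
      simp only [mildSolution, Pi.sub_apply]
      ring
    rw [e]
    refine b2.2.trans ?_
    set G := Real.exp (-a * ‖v‖ ^ 2)
    have hG : 0 < G := Real.exp_pos _
    have := mul_le_mul_of_nonneg_right hD2 (mul_nonneg hδ0 hG.le)
    linarith

/-- The fixed point of the collision gain, by iteration from zero. The limit stays in the weighted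
class because the class is closed under pointwise limits. -/
lemma exists_gainMap_eq {a a' : ℝ} (ha0 : 0 ≤ a') (haa : a' < a) (ha : a < 1 / 2) :
    ∃ H D₀ : ℝ, 0 < H ∧ 0 < D₀ ∧
      ∀ (Ω : Set R3) (ψ : R3 → ℝ) (D : ℝ), IsConvexSublevel Ω ψ D → D ≤ D₀ →
      ∀ (φ : R3 → ℝ) (L : NNReal), (∀ x, |φ x| ≤ 1) → LipschitzWith L φ →
      ∃ (N C : ℝ) (k : R3 → R3 → ℝ), 0 ≤ N ∧ 0 ≤ C ∧ IsWeightedLip Ω ψ a a' H N C k ∧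
        ∀ x ∈ Ω, ∀ v,
          (Integrable fun w => hardSphereKernel v w * mildSolution Ω φ k (x, w)) ∧
          gainMap Ω φ k x v = k x v := by
  obtain ⟨H, D₀, hH, hD₀, hmain⟩ := exists_gainMap_class ha0 haa ha
  refine ⟨H, D₀, hH, hD₀, fun Ω ψ D h hD φ L hφ hL => ?_⟩
  obtain ⟨N, C, hN, hC, hcl, hint, hcon⟩ := hmain Ω ψ D h hD φ L hφ hL
  set u : ℕ → R3 → R3 → ℝ := fun n => (gainMap Ω φ)^[n] fun _ _ => 0 with hu
  have hus : ∀ n, u (n + 1) = gainMap Ω φ (u n) := fun n => by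
    simp only [hu, Function.iterate_succ_apply']
  have hun : ∀ n, IsWeightedLip Ω ψ a a' H N C (u n) := fun n => by
    induction n with
    | zero => exact (isWeightedLip_zero Ω ψ a a').mono h hH.le hN hC
    | succ n ih => rw [hus]; exact hcl _ ih
  have hstep : ∀ n, ∀ x ∈ Ω, ∀ v,
      |u (n + 1) x v - u n x v| ≤ H * (1 / 2) ^ n * Real.exp (-a * ‖v‖ ^ 2) := fun n => by
    induction n with
    | zero =>
      intro x hx v
      have := (hun 1).abs_le x hx v
      simpa [hu] using this
    | succ n ih =>
      intro x hx v
      have := hcon _ _ (hun (n + 1)) (hun n) _ ih x hx v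
      rw [← hus, ← hus] at this
      refine this.trans (le_of_eq ?_)
      ring
  -- pointwise limits in `Ω`; the values of the limit outside are immaterial
  have hex : ∀ x v, ∃ l : ℝ, x ∈ Ω → Filter.Tendsto (fun n => u n x v) Filter.atTop (𝓝 l) := by
    intro x v
    by_cases hx : x ∈ Ω
    · have hc := cauchySeq_of_le_geometric (f := fun n => u n x v) (1 / 2)
        (H * Real.exp (-a * ‖v‖ ^ 2)) (by norm_num) fun n => by
          rw [dist_comm, Real.dist_eq]
          refine (hstep n x hx v).trans (le_of_eq ?_)
          ring
      obtain ⟨l, hl⟩ := cauchySeq_tendsto_of_complete hc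
      exact ⟨l, fun _ => hl⟩
    · exact ⟨0, fun hx' => absurd hx' hx⟩
  choose k hk using hex
  have hdist : ∀ n, ∀ x ∈ Ω, ∀ v,
      |u n x v - k x v| ≤ 2 * H * (1 / 2) ^ n * Real.exp (-a * ‖v‖ ^ 2) := fun n x hx v => by
    have := dist_le_of_le_geometric_of_tendsto (f := fun n => u n x v) (1 / 2)
      (H * Real.exp (-a * ‖v‖ ^ 2)) (by norm_num) (fun n => by
          rw [dist_comm, Real.dist_eq]
          refine (hstep n x hx v).trans (le_of_eq ?_)
          ring) (hk x v hx) n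
    rw [Real.dist_eq] at this
    refine this.trans (le_of_eq ?_)
    ring
  have hkc : IsWeightedLip Ω ψ a a' H N C k := by
    refine ⟨fun x hx v => ?_, fun x hx y hy v => ?_, fun x hx v v' hvv => ?_⟩
    · exact le_of_tendsto (hk x v hx).abs
        (Filter.Eventually.of_forall fun n => (hun n).abs_le x hx v)
    · exact le_of_tendsto ((hk x v hx).sub (hk y v hy)).abs
        (Filter.Eventually.of_forall fun n => (hun n).abs_sub_le_left x hx y hy v)
    · exact le_of_tendsto ((hk x v hx).sub (hk x v' hx)).abs
        (Filter.Eventually.of_forall fun n => (hun n).abs_sub_le_right x hx v v' hvv)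
  refine ⟨N, C, k, hN, hC, hkc, fun x hx v => ⟨hint k hkc x hx v, ?_⟩⟩
  have hlim0 : Filter.Tendsto (fun n => u (n + 1) x v) Filter.atTop (𝓝 (gainMap Ω φ k x v)) := by
    refine tendsto_iff_dist_tendsto_zero.2 ?_
    have hz : Filter.Tendsto (fun n : ℕ => 2 * H * (1 / 2 : ℝ) ^ n / 2 *
        Real.exp (-a * ‖v‖ ^ 2)) Filter.atTop (𝓝 0) := by
      have := (tendsto_pow_atTop_nhds_zero_of_lt_one (r := (1 / 2 : ℝ)) (by norm_num)
        (by norm_num)).const_mul (2 * H / 2 * Real.exp (-a * ‖v‖ ^ 2))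
      rw [mul_zero] at this
      refine this.congr fun n => ?_
      ring
    refine squeeze_zero (fun _ => dist_nonneg) (fun n => ?_) hz
    rw [Real.dist_eq, hus]
    exact hcon _ _ (hun n) hkc _ (hdist n) x hx v
  exact tendsto_nhds_unique hlim0 ((hk x v hx).comp (Filter.tendsto_add_atTop_nat 1))

/-! ### Local Lipschitz bounds for mild solutions -/

lemma abs_exp_half_sub_le (v v' : R3) :
    |Real.exp (-(1 / 2) * ‖v‖ ^ 2) - Real.exp (-(1 / 2) * ‖v'‖ ^ 2)| ≤
      (‖v‖ + ‖v'‖) / 2 * ‖v - v'‖ *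
        (Real.exp (-(1 / 2) * ‖v‖ ^ 2) + Real.exp (-(1 / 2) * ‖v'‖ ^ 2)) := by
  have h1 := abs_exp_neg_sub_exp_neg_le (1 / 2 * ‖v‖ ^ 2) (1 / 2 * ‖v'‖ ^ 2)
  rw [← neg_mul, ← neg_mul] at h1
  refine h1.trans (mul_le_mul_of_nonneg_right ?_ (by positivity))
  have e : 1 / 2 * ‖v‖ ^ 2 - 1 / 2 * ‖v'‖ ^ 2 = (‖v‖ + ‖v'‖) / 2 * (‖v‖ - ‖v'‖) := by ring
  rw [e, abs_mul, abs_of_nonneg (by positivity)]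
  exact mul_le_mul_of_nonneg_left (abs_norm_sub_norm_le v v') (by positivity)

lemma ContinuousAt.eventually_le_two_mul {X : Type*} [TopologicalSpace X] {g : X → ℝ} {z : X}
    (hg : ContinuousAt g z) (hz : 0 < g z) : ∀ᶠ y in 𝓝 z, g y ≤ 2 * g z :=
  (hg.eventually (gt_mem_nhds (by linarith : g z < 2 * g z))).mono fun _ h => le_of_lt h

namespace IsConvexSublevel

variable {Ω : Set R3} {ψ : R3 → ℝ} {D a a' H N C : ℝ} {k : R3 → R3 → ℝ} {φ : R3 → ℝ}

/-- The exit time is locally Lipschitz, with a constant close to the norm of its derivative, and it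
varies by at most a factor two locally, as does its damping factor. -/
lemma eventually_exitTime (h : IsConvexSublevel Ω ψ D) {z₀ : R3 × R3} (hx : z₀.1 ∈ Ω)
    (hv : z₀.2 ≠ 0) :
    ∃ t ∈ 𝓝 z₀, ∀ z ∈ t, ∀ z' ∈ t, z.1 ∈ Ω ∧ z.2 ≠ 0 ∧ ‖z.2 - z'.2‖ ≤ 1 ∧
      ‖z.2‖ ≤ 2 * ‖z₀.2‖ ∧
      |exitTime Ω z.1 z.2 - exitTime Ω z'.1 z'.2| ≤
        (‖fderiv ℝ (fun z : R3 × R3 => exitTime Ω z.1 z.2) z₀‖ + 1) * ‖z - z'‖ ∧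
      min (exitTime Ω z.1 z.2) (exitTime Ω z'.1 z'.2) ≤ 2 * exitTime Ω z₀.1 z₀.2 ∧
      Real.exp (-freqMin * min (exitTime Ω z.1 z.2) (exitTime Ω z'.1 z'.2)) ≤
        2 * Real.exp (-freqMin * exitTime Ω z₀.1 z₀.2) := by
  set T : R3 × R3 → ℝ := fun z => exitTime Ω z.1 z.2 with hT
  have hC := h.contDiffAt_exitTime (z := z₀) hx hv
  have hTc : ContinuousAt T z₀ := hC.continuousAt
  obtain ⟨t, ht, hlip⟩ := hC.exists_lipschitzOnWith_of_nnnorm_lt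
    (‖fderiv ℝ T z₀‖₊ + 1) (lt_add_one _)
  have e1 : ∀ᶠ z in 𝓝 z₀, z ∈ t := ht
  have e2 : ∀ᶠ z : R3 × R3 in 𝓝 z₀, z.1 ∈ Ω :=
    continuousAt_fst.eventually (h.isOpen.mem_nhds hx)
  have e3 : ∀ᶠ z : R3 × R3 in 𝓝 z₀, z.2 ≠ 0 :=
    continuousAt_snd.eventually (isOpen_ne.mem_nhds hv)
  have e4 : ∀ᶠ z : R3 × R3 in 𝓝 z₀, z.2 ∈ Metric.ball z₀.2 (1 / 2) :=
    continuousAt_snd.eventually (Metric.ball_mem_nhds _ (by norm_num))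
  have e5 : ∀ᶠ z : R3 × R3 in 𝓝 z₀, ‖z.2‖ ≤ 2 * ‖z₀.2‖ :=
    ContinuousAt.eventually_le_two_mul (by fun_prop) (norm_pos_iff.2 hv)
  have e6 : ∀ᶠ z in 𝓝 z₀, T z ≤ 2 * T z₀ := hTc.eventually_le_two_mul (h.exitTime_pos hx hv)
  have e7 : ∀ᶠ z in 𝓝 z₀, Real.exp (-freqMin * T z) ≤ 2 * Real.exp (-freqMin * T z₀) :=
    ContinuousAt.eventually_le_two_mul (by fun_prop) (Real.exp_pos _)
  refine ⟨_, e1.and (e2.and (e3.and (e4.and (e5.and (e6.and e7))))), ?_⟩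
  rintro z ⟨h1, h2, h3, h4, h5, h6, h7⟩ z' ⟨h1', -, -, h4', -, -, h7'⟩
  refine ⟨h2, h3, ?_, h5, ?_, (min_le_left _ _).trans h6, ?_⟩
  · have := dist_triangle_right z.2 z'.2 z₀.2
    rw [Metric.mem_ball] at h4 h4'
    rw [← dist_eq_norm]
    linarith
  · have := hlip.dist_le_mul z h1 z' h1'
    rw [Real.dist_eq, dist_eq_norm] at this
    simpa using this
  · rcases min_choice (exitTime Ω z.1 z.2) (exitTime Ω z'.1 z'.2) with e | e <;> rw [e]
    · exact h7
    · exact h7'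

/-- The local Lipschitz constant of the transported part, in terms of the derivative of the exit
time at the base point. Nearby, every continuous positive factor at most doubles. -/
lemma transportS_locally_lipschitz (h : IsConvexSublevel Ω ψ D)
    (hk : IsWeightedLip Ω ψ a a' H N C k) (hH : 0 ≤ H) (hN : 0 ≤ N) (hC : 0 ≤ C)
    {z₀ : R3 × R3} (hx : z₀.1 ∈ Ω) (hv : z₀.2 ≠ 0) {K : ℝ}
    (hK : K = ‖fderiv ℝ (fun z : R3 × R3 => exitTime Ω z.1 z.2) z₀‖ + 1) :
    ∃ t ∈ 𝓝 z₀, ∀ z ∈ t, ∀ z' ∈ t, |transportS Ω k z.1 z.2 - transportS Ω k z'.1 z'.2| ≤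
      (8 * H * Real.exp (-a * ‖z₀.2‖ ^ 2) * Real.exp (-freqMin * exitTime Ω z₀.1 z₀.2) * K +
      2 * exitTime Ω z₀.1 z₀.2 * (192 * (1 + ‖z₀.2‖) ^ 3 / freqMin *
        (H * Real.exp (-a * ‖z₀.2‖ ^ 2)) + 2 * C * Real.exp (-a' * ‖z₀.2‖ ^ 2) +
        40 / 3 * N * Real.exp (-a * ‖z₀.2‖ ^ 2) * (1 + freqMin⁻¹) *
          (-ψ z₀.1) ^ (-(2 / 5) : ℝ))) * ‖z - z'‖ := by
  obtain ⟨t, ht, hgood⟩ := h.eventually_exitTime hx hv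
  have hm := h.neg_pos hx
  have hν := freqMin_pos
  have e1 : ∀ᶠ z : R3 × R3 in 𝓝 z₀, Real.exp (-a * ‖z.2‖ ^ 2) ≤
      2 * Real.exp (-a * ‖z₀.2‖ ^ 2) :=
    ContinuousAt.eventually_le_two_mul (by fun_prop) (Real.exp_pos _)
  have e2 : ∀ᶠ z : R3 × R3 in 𝓝 z₀, Real.exp (-a' * ‖z.2‖ ^ 2) ≤
      2 * Real.exp (-a' * ‖z₀.2‖ ^ 2) :=
    ContinuousAt.eventually_le_two_mul (by fun_prop) (Real.exp_pos _)
  have e3 : ∀ᶠ z : R3 × R3 in 𝓝 z₀, (1 + ‖z.2‖) ^ 3 ≤ 2 * (1 + ‖z₀.2‖) ^ 3 :=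
    ContinuousAt.eventually_le_two_mul (by fun_prop) (by positivity)
  have e4 : ∀ᶠ z : R3 × R3 in 𝓝 z₀, (-ψ z.1) ^ (-(2 / 5) : ℝ) ≤
      2 * (-ψ z₀.1) ^ (-(2 / 5) : ℝ) :=
    ContinuousAt.eventually_le_two_mul
      ((h.continuous.neg.comp continuous_fst).continuousAt.rpow_const (Or.inl hm.ne'))
      (by positivity)
  refine ⟨_, Filter.inter_mem ht (e1.and (e2.and (e3.and e4))), ?_⟩
  rintro z ⟨hz, f1, f2, f3, f4⟩ z' ⟨hz', f1', -, -, f4'⟩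
  obtain ⟨g1, g2, g3, -, g5, g6, g7⟩ := hgood z hz z' hz'
  obtain ⟨g1', g2', -⟩ := hgood z' hz' z hz
  have hτ0 := h.exitTime_pos hx hv
  have hb0 : 0 ≤ min (exitTime Ω z.1 z.2) (exitTime Ω z'.1 z'.2) :=
    le_min (h.exitTime_nonneg g1 _) (h.exitTime_nonneg g1' _)
  have hmain := h.abs_transportS_sub_le hk hN g1 g1' g2 g2' g3 rfl
  have hνd := abs_hardSphereFreq_sub_le z.2 z'.2 g3
  have d1 : ‖z.1 - z'.1‖ ≤ ‖z - z'‖ := norm_fst_le (z - z')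
  have d2 : ‖z.2 - z'.2‖ ≤ ‖z - z'‖ := norm_snd_le (z - z')
  rw [← hK] at g5
  have hK0 : 0 ≤ K := by rw [hK]; positivity
  refine hmain.trans ?_
  set b := min (exitTime Ω z.1 z.2) (exitTime Ω z'.1 z'.2)
  set δ := ‖z - z'‖
  have hδ : 0 ≤ δ := norm_nonneg _
  set G := Real.exp (-a * ‖z₀.2‖ ^ 2)
  have hG : 0 < G := Real.exp_pos _
  set G' := Real.exp (-a' * ‖z₀.2‖ ^ 2)
  have hG' : 0 < G' := Real.exp_pos _
  set E := Real.exp (-freqMin * exitTime Ω z₀.1 z₀.2)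
  have hE : 0 < E := Real.exp_pos _
  set m := (-ψ z₀.1) ^ (-(2 / 5) : ℝ)
  have hm0 : 0 < m := by positivity
  have hνd' : |hardSphereFreq z.2 - hardSphereFreq z'.2| ≤ 48 * (1 + ‖z₀.2‖) ^ 3 * δ := by
    refine hνd.trans ?_
    calc _ ≤ 24 * (2 * (1 + ‖z₀.2‖) ^ 3) * δ := by gcongr
      _ = _ := by ring
  have p1 : H * (Real.exp (-a * ‖z.2‖ ^ 2) + Real.exp (-a * ‖z'.2‖ ^ 2)) *
      Real.exp (-freqMin * b) * |exitTime Ω z.1 z.2 - exitTime Ω z'.1 z'.2| ≤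
      H * (2 * G + 2 * G) * (2 * E) * (K * δ) := by gcongr
  have p2 : 2 * |hardSphereFreq z.2 - hardSphereFreq z'.2| / freqMin *
        (H * Real.exp (-a * ‖z.2‖ ^ 2)) ≤
      2 * (48 * (1 + ‖z₀.2‖) ^ 3 * δ) / freqMin * (H * (2 * G)) := by gcongr
  have p3 : C * ‖z.2 - z'.2‖ * Real.exp (-a' * ‖z.2‖ ^ 2) ≤ C * δ * (2 * G') := by gcongr
  have q1 : 0 ≤ (-ψ z.1) ^ (-(2 / 5) : ℝ) := Real.rpow_nonneg (h.neg_pos g1).le _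
  have q2 : 0 ≤ (-ψ z'.1) ^ (-(2 / 5) : ℝ) := Real.rpow_nonneg (h.neg_pos g1').le _
  have p4 : N * Real.exp (-a * ‖z.2‖ ^ 2) * ((‖z.1 - z'.1‖ + ‖z.2 - z'.2‖ / freqMin) *
        ((-ψ z.1) ^ (-(2 / 5) : ℝ) + (-ψ z'.1) ^ (-(2 / 5) : ℝ))) * (5 / 3) ≤
      N * (2 * G) * ((δ + δ / freqMin) * (2 * m + 2 * m)) * (5 / 3) := by gcongr
  calc _ ≤ H * (2 * G + 2 * G) * (2 * E) * (K * δ) + 2 * exitTime Ω z₀.1 z₀.2 *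
        ((2 * (48 * (1 + ‖z₀.2‖) ^ 3 * δ) / freqMin * (H * (2 * G)) + C * δ * (2 * G')) +
        N * (2 * G) * ((δ + δ / freqMin) * (2 * m + 2 * m)) * (5 / 3)) := by
        refine add_le_add p1 (mul_le_mul g6 (add_le_add (add_le_add p2 p3) p4) ?_ (by positivity))
        positivity
    _ = _ := by
        rw [div_eq_mul_inv, div_eq_mul_inv, div_eq_mul_inv]
        ring

/-- The analogue of `transportS_locally_lipschitz` for the incoming part. -/
lemma incomingJ_locally_lipschitz (h : IsConvexSublevel Ω ψ D)
    (hφ : ∀ x, |φ x| ≤ 1) {L : NNReal} (hL : LipschitzWith L φ)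
    {z₀ : R3 × R3} (hx : z₀.1 ∈ Ω) (hv : z₀.2 ≠ 0) {K : ℝ}
    (hK : K = ‖fderiv ℝ (fun z : R3 × R3 => exitTime Ω z.1 z.2) z₀‖ + 1) :
    ∃ t ∈ 𝓝 z₀, ∀ z ∈ t, ∀ z' ∈ t,
      |incomingJ Ω (maxwellData φ) z.1 z.2 - incomingJ Ω (maxwellData φ) z'.1 z'.2| ≤
      (2 * Real.exp (-freqMin * exitTime Ω z₀.1 z₀.2) * Real.exp (-(1 / 2) * ‖z₀.2‖ ^ 2) *
        (384 * (1 + ‖z₀.2‖) ^ 3 * exitTime Ω z₀.1 z₀.2 + 16 * hardSphereFreq z₀.2 * K +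
          2 * L * (1 + 2 * exitTime Ω z₀.1 z₀.2 + 4 * ‖z₀.2‖ * K) + 8 * ‖z₀.2‖)) *
        ‖z - z'‖ := by
  obtain ⟨t, ht, hgood⟩ := h.eventually_exitTime hx hv
  have hν := freqMin_pos
  have e1 : ∀ᶠ z : R3 × R3 in 𝓝 z₀, Real.exp (-(1 / 2) * ‖z.2‖ ^ 2) ≤
      2 * Real.exp (-(1 / 2) * ‖z₀.2‖ ^ 2) :=
    ContinuousAt.eventually_le_two_mul (by fun_prop) (Real.exp_pos _)
  have e2 : ∀ᶠ z : R3 × R3 in 𝓝 z₀, hardSphereFreq z.2 ≤ 2 * hardSphereFreq z₀.2 :=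
    ContinuousAt.eventually_le_two_mul
      (continuous_hardSphereFreq.comp continuous_snd).continuousAt (hardSphereFreq_pos _)
  have e3 : ∀ᶠ z : R3 × R3 in 𝓝 z₀, (1 + ‖z.2‖) ^ 3 ≤ 2 * (1 + ‖z₀.2‖) ^ 3 :=
    ContinuousAt.eventually_le_two_mul (by fun_prop) (by positivity)
  refine ⟨_, Filter.inter_mem ht (e1.and (e2.and e3)), ?_⟩
  rintro z ⟨hz, f1, f2, f3⟩ z' ⟨hz', f1', f2', -⟩
  obtain ⟨g1, g2, g3, g4, g5, g6, g7⟩ := hgood z hz z' hz'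
  obtain ⟨g1', -, -, g4', -⟩ := hgood z' hz' z hz
  have hτ0 := h.exitTime_pos hx hv
  have hb0 : 0 ≤ min (exitTime Ω z.1 z.2) (exitTime Ω z'.1 z'.2) :=
    le_min (h.exitTime_nonneg g1 _) (h.exitTime_nonneg g1' _)
  have hmain := h.abs_incomingJ_sub_le hφ hL g1 g1' (v := z.2) (v' := z'.2) rfl
  have hνd := abs_hardSphereFreq_sub_le z.2 z'.2 g3
  have hMd := abs_exp_half_sub_le z.2 z'.2
  have d1 : ‖z.1 - z'.1‖ ≤ ‖z - z'‖ := norm_fst_le (z - z')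
  have d2 : ‖z.2 - z'.2‖ ≤ ‖z - z'‖ := norm_snd_le (z - z')
  rw [← hK] at g5
  have hK0 : 0 ≤ K := by rw [hK]; positivity
  have hνz := hardSphereFreq_pos z.2
  have hνz' := hardSphereFreq_pos z'.2
  have hνz0 := hardSphereFreq_pos z₀.2
  refine hmain.trans ?_
  set b := min (exitTime Ω z.1 z.2) (exitTime Ω z'.1 z'.2)
  set τ₀ := exitTime Ω z₀.1 z₀.2
  set δ := ‖z - z'‖
  have hδ : 0 ≤ δ := norm_nonneg _
  set M := Real.exp (-(1 / 2) * ‖z₀.2‖ ^ 2)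
  have hM : 0 < M := Real.exp_pos _
  set E := Real.exp (-freqMin * τ₀)
  have hE : 0 < E := Real.exp_pos _
  have hL0 : (0 : ℝ) ≤ L := L.2
  have hνd' : |hardSphereFreq z.2 - hardSphereFreq z'.2| ≤ 48 * (1 + ‖z₀.2‖) ^ 3 * δ := by
    refine hνd.trans ?_
    calc _ ≤ 24 * (2 * (1 + ‖z₀.2‖) ^ 3) * δ := by gcongr
      _ = _ := by ring
  have p1 : 2 * Real.exp (-(1 / 2) * ‖z.2‖ ^ 2) * (|hardSphereFreq z.2 - hardSphereFreq z'.2| * b +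
          (hardSphereFreq z.2 + hardSphereFreq z'.2) *
            |exitTime Ω z.1 z.2 - exitTime Ω z'.1 z'.2|) ≤
      2 * (2 * M) * (48 * (1 + ‖z₀.2‖) ^ 3 * δ * (2 * τ₀) +
          (2 * hardSphereFreq z₀.2 + 2 * hardSphereFreq z₀.2) * (K * δ)) := by gcongr
  have p2 : L * Real.exp (-(1 / 2) * ‖z.2‖ ^ 2) * (‖z.1 - z'.1‖ + b * ‖z.2 - z'.2‖ +
          (‖z.2‖ + ‖z'.2‖) * |exitTime Ω z.1 z.2 - exitTime Ω z'.1 z'.2|) ≤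
      L * (2 * M) * (δ + 2 * τ₀ * δ + (2 * ‖z₀.2‖ + 2 * ‖z₀.2‖) * (K * δ)) := by gcongr
  have p3 : |Real.exp (-(1 / 2) * ‖z.2‖ ^ 2) - Real.exp (-(1 / 2) * ‖z'.2‖ ^ 2)| ≤
      (2 * ‖z₀.2‖ + 2 * ‖z₀.2‖) / 2 * δ * (2 * M + 2 * M) := by
    refine hMd.trans ?_
    gcongr
  calc _ ≤ 2 * E * (2 * (2 * M) * (48 * (1 + ‖z₀.2‖) ^ 3 * δ * (2 * τ₀) +
          (2 * hardSphereFreq z₀.2 + 2 * hardSphereFreq z₀.2) * (K * δ)) +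
          L * (2 * M) * (δ + 2 * τ₀ * δ + (2 * ‖z₀.2‖ + 2 * ‖z₀.2‖) * (K * δ)) +
          (2 * ‖z₀.2‖ + 2 * ‖z₀.2‖) / 2 * δ * (2 * M + 2 * M)) := by
        refine mul_le_mul g7 (add_le_add (add_le_add p1 p2) p3) ?_ (by positivity)
        positivity
    _ = _ := by ring

/-- The factor `1 + τ` accounts for the velocity directions, see `fderiv_exitTime_eq_left`. -/
lemma norm_fderiv_exitTime_le (h : IsConvexSublevel Ω ψ D) {z : R3 × R3} (hx : z.1 ∈ Ω)
    (hv : z.2 ≠ 0) :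
    ‖fderiv ℝ (fun z : R3 × R3 => exitTime Ω z.1 z.2) z‖ ≤
      (1 + exitTime Ω z.1 z.2) * ∑ i, |exitGrad Ω i z| := by
  have hS : 0 ≤ ∑ i, |exitGrad Ω i z| := Finset.sum_nonneg fun i _ => abs_nonneg _
  have hτ := h.exitTime_nonneg hx z.2
  refine ContinuousLinearMap.opNorm_le_bound _ (by positivity) fun y => ?_
  obtain ⟨y1, y2⟩ := y
  rw [h.fderiv_exitTime_eq_left hx hv, Real.norm_eq_abs]
  refine (abs_fderiv_exitTime_left_le Ω z _).trans ?_
  have h1 : ‖y1 - exitTime Ω z.1 z.2 • y2‖ ≤ (1 + exitTime Ω z.1 z.2) * ‖(y1, y2)‖ := by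
    have d1 : ‖y1‖ ≤ ‖(y1, y2)‖ := norm_fst_le (y1, y2)
    have d2 : ‖y2‖ ≤ ‖(y1, y2)‖ := norm_snd_le (y1, y2)
    refine (_root_.norm_sub_le _ _).trans ?_
    rw [norm_smul, Real.norm_of_nonneg hτ]
    nlinarith
  calc _ ≤ (1 + exitTime Ω z.1 z.2) * ‖(y1, y2)‖ * ∑ i, |exitGrad Ω i z| := by gcongr
    _ = _ := by ring

end IsConvexSublevel

/-- All terms of the local Lipschitz constant are bounded by a Gaussian times `1 + S + (1 + m) / r`.
The factors `τ₀` are absorbed by the damping `E` where it is present, and by `τ₀ ≤ D / r` elsewhere. -/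
lemma collect_slope_terms {H P D N C L M E τ₀ G G' G2 K S m r ν c f : ℝ} (hH : 0 ≤ H) (hP : 0 < P)
    (hD : 0 < D) (hN : 0 ≤ N) (hC : 0 ≤ C) (hL0 : 0 ≤ L) (hM0 : 0 < M) (hE0 : 0 < E) (hτ : 0 < τ₀)
    (hG0 : 0 < G) (hG0' : 0 < G') (hG20 : 0 < G2) (hK0 : 0 ≤ K) (hS : 0 ≤ S) (hm : 0 < m)
    (hr0 : 0 < r) (hc0 : 0 < c) (hf : 0 < f) (hνv : ν ≤ 2 * (1 + r) ^ 2)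
    (hEK : E * K ≤ c * (S + 1)) (hEτ' : E * τ₀ ≤ c) (hEc : E ≤ c) (hτD : τ₀ ≤ D * r⁻¹)
    (hG' : G' ≤ G2) (hGP : G * (1 + r) ^ 3 ≤ P * G2) (hMG : M ≤ G) :
    2 * E * M * (384 * (1 + r) ^ 3 * τ₀ + 16 * ν * K + 2 * L * (1 + 2 * τ₀ + 4 * r * K) + 8 * r) +
      (8 * H * G * E * K + 2 * τ₀ * (192 * (1 + r) ^ 3 / f * (H * G) + 2 * C * G' +
        40 / 3 * N * G * c * m)) ≤
    (8 * H * P * c + D * (384 / f * H * P + 4 * C + 80 / 3 * N * P * c) +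
      P * c * (768 + 64 + 4 * L * 7 + 16) + 1) * (G2 * (1 + S + r⁻¹ * (1 + m))) := by
  have hv1 : 1 ≤ 1 + r := by linarith
  have g1 : G ≤ P * G2 := by
    have : G * 1 ≤ G * (1 + r) ^ 3 := by gcongr; exact one_le_pow₀ hv1
    linarith
  have g2 : M * (1 + r) ^ 3 ≤ P * G2 := le_trans (by gcongr) hGP
  have g3 : M * (1 + r) ^ 2 ≤ P * G2 := by
    have : M * (1 + r) ^ 2 ≤ M * (1 + r) ^ 3 := by gcongr; norm_num
    linarith
  have g4 : M * r ≤ P * G2 := by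
    have : M * r ≤ M * (1 + r) ^ 2 := by gcongr; nlinarith
    linarith
  have g5 : M ≤ P * G2 := hMG.trans g1
  set PG := P * G2 with hPG
  have hPG0 : 0 < PG := by positivity
  clear_value PG
  set X := 1 + S with hX
  have hX1 : 1 ≤ X := by rw [hX]; linarith
  have hEK' : E * K ≤ c * X := by rw [hX]; linarith
  have hcX : c ≤ c * X := le_mul_of_one_le_right hc0.le hX1
  have hEτX := hEτ'.trans hcX
  have hEcX := hEc.trans hcX
  set Z := r⁻¹ * (1 + m) with hZ
  have hZ1 : r⁻¹ ≤ Z := le_mul_of_one_le_right (by positivity) (by linarith)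
  have hZ2 : r⁻¹ * m ≤ Z := mul_le_mul_of_nonneg_left (by linarith) (by positivity)
  have hZ0 : 0 < Z := by positivity
  clear_value X Z
  have j1 : 2 * E * M * (384 * (1 + r) ^ 3 * τ₀) ≤ 768 * (PG * (c * X)) := by
    calc _ = 768 * ((M * (1 + r) ^ 3) * (E * τ₀)) := by ring
      _ ≤ _ := by gcongr
  have j2 : 2 * E * M * (16 * ν * K) ≤ 64 * (PG * (c * X)) := by
    calc _ ≤ 2 * E * M * (16 * (2 * (1 + r) ^ 2) * K) := by gcongr
      _ = 64 * ((M * (1 + r) ^ 2) * (E * K)) := by ring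
      _ ≤ _ := by gcongr
  have j3 : 2 * E * M * (2 * L * (1 + 2 * τ₀ + 4 * r * K)) ≤ 4 * L * 7 * (PG * (c * X)) := by
    calc _ = 4 * L * (M * E + 2 * (M * (E * τ₀)) + 4 * ((M * r) * (E * K))) := by ring
      _ ≤ 4 * L * (PG * (c * X) + 2 * (PG * (c * X)) + 4 * (PG * (c * X))) := by gcongr
      _ = _ := by ring
  have j4 : 2 * E * M * (8 * r) ≤ 16 * (PG * (c * X)) := by
    calc _ = 16 * ((M * r) * E) := by ring
      _ ≤ _ := by gcongr
  have s1 : 8 * H * G * E * K ≤ 8 * H * (PG * (c * X)) := by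
    calc _ = 8 * H * (G * (E * K)) := by ring
      _ ≤ _ := by gcongr
  have s2 : 2 * τ₀ * (192 * (1 + r) ^ 3 / f * (H * G)) ≤
      D * Z * (384 / f * H * PG) := by
    calc _ = τ₀ * (384 / f * H * (G * (1 + r) ^ 3)) := by ring
      _ ≤ (D * r⁻¹) * (384 / f * H * PG) := by gcongr
      _ ≤ _ := by gcongr
  have s3 : 2 * τ₀ * (2 * C * G') ≤ D * Z * (4 * C * G2) := by
    calc _ = τ₀ * (4 * C * G') := by ring
      _ ≤ (D * r⁻¹) * (4 * C * G2) := by gcongr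
      _ ≤ _ := by gcongr
  have s4 : 2 * τ₀ * (40 / 3 * N * G * c * m) ≤ D * Z * (80 / 3 * N * PG * c) := by
    calc _ = τ₀ * (80 / 3 * N * G * c * m) := by ring
      _ ≤ (D * r⁻¹) * (80 / 3 * N * PG * c * m) := by gcongr
      _ = D * (r⁻¹ * m) * (80 / 3 * N * PG * c) := by ring
      _ ≤ _ := by gcongr
  rw [← sub_nonneg]
  have hrest : 0 ≤ G2 * ((8 * H * P * c + P * c * (768 + 64 + 4 * L * 7 + 16) + 1) * Z +
        (D * (384 / f * H * P + 4 * C + 80 / 3 * N * P * c) + 1) * X) := by positivity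
  have hsum : (8 * H * P * c + D * (384 / f * H * P + 4 * C + 80 / 3 * N * P * c) +
      P * c * (768 + 64 + 4 * L * 7 + 16) + 1) * (G2 * (X + Z)) =
      (768 + 64 + 4 * L * 7 + 16 + 8 * H) * (PG * (c * X)) +
      D * Z * (384 / f * H * PG + 4 * C * G2 + 80 / 3 * N * PG * c) +
      G2 * ((8 * H * P * c + P * c * (768 + 64 + 4 * L * 7 + 16) + 1) * Z +
        (D * (384 / f * H * P + 4 * C + 80 / 3 * N * P * c) + 1) * X) := by
    rw [hPG]
    ring
  rw [hsum]
  linarith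

/-- Majorant for the local Lipschitz constant of the solution. -/
noncomputable def slopeBound (Ω : Set R3) (ψ : R3 → ℝ) (a : ℝ) (z : R3 × R3) : ℝ :=
  Real.exp (-a * ‖z.2‖ ^ 2) *
    (1 + ∑ i, |exitGrad Ω i z| + ‖z.2‖⁻¹ * (1 + (-ψ z.1) ^ (-(2 / 5) : ℝ)))

/-- Away from `v = 0` the mild solution is locally Lipschitz with a constant controlled by
`slopeBound`. The smaller Gaussian rate `a₂` pays for polynomial factors in the velocity. -/
lemma IsConvexSublevel.exists_locally_lipschitz {Ω : Set R3} {ψ : R3 → ℝ}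
    {D a a' a₂ H N C : ℝ} {k : R3 → R3 → ℝ} {φ : R3 → ℝ} (h : IsConvexSublevel Ω ψ D)
    (ha2 : a₂ < a') (haa : a' < a) (ha : a < 1 / 2)
    (hk : IsWeightedLip Ω ψ a a' H N C k) (hH : 0 ≤ H) (hN : 0 ≤ N) (hC : 0 ≤ C)
    (hφ : ∀ x, |φ x| ≤ 1) {L : NNReal} (hL : LipschitzWith L φ) :
    ∃ B : ℝ, 0 < B ∧ ∀ z₀ : R3 × R3, z₀.1 ∈ Ω → z₀.2 ≠ 0 → ∃ t ∈ 𝓝 z₀, ∀ z ∈ t, ∀ z' ∈ t,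
      |mildSolution Ω φ k z - mildSolution Ω φ k z'| ≤
        B * slopeBound Ω ψ a₂ z₀ * ‖z - z'‖ := by
  obtain ⟨P, hP, hpoly⟩ := one_add_pow_le_exp_sq 3 (e := a - a₂) (by linarith)
  have hν := freqMin_pos
  have hD := h.diam_pos
  set c := 1 + freqMin⁻¹ with hc
  have hc0 : 0 < c := by positivity
  have hL0 : (0 : ℝ) ≤ L := L.2
  set B := 8 * H * P * c + D * (384 / freqMin * H * P + 4 * C + 80 / 3 * N * P * c) +
    P * c * (768 + 64 + 4 * L * 7 + 16) + 1 with hB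
  refine ⟨B, by positivity, fun z₀ hx hv => ?_⟩
  obtain ⟨t, ht, h1⟩ := h.transportS_locally_lipschitz hk hH hN hC hx hv rfl
  obtain ⟨t', ht', h2⟩ := h.incomingJ_locally_lipschitz hφ hL hx hv rfl
  refine ⟨_, Filter.inter_mem ht ht', fun z hz z' hz' => ?_⟩
  have k1 := h1 z hz.1 z' hz'.1
  have k2 := h2 z hz.2 z' hz'.2
  have e3 : mildSolution Ω φ k z - mildSolution Ω φ k z' =
      (incomingJ Ω (maxwellData φ) z.1 z.2 - incomingJ Ω (maxwellData φ) z'.1 z'.2) +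
      (transportS Ω k z.1 z.2 - transportS Ω k z'.1 z'.2) := by
    simp only [mildSolution]; ring
  rw [e3]
  refine (abs_add_le _ _).trans ((add_le_add k2 k1).trans ?_)
  rw [← add_mul]
  refine mul_le_mul_of_nonneg_right ?_ (norm_nonneg _)
  clear h1 h2 k1 k2 e3
  have hτ := h.exitTime_pos hx hv
  have hτD := h.exitTime_le hx z₀.2
  have hKb := h.norm_fderiv_exitTime_le hx hv
  have hm : 0 < (-ψ z₀.1) ^ (-(2 / 5) : ℝ) := Real.rpow_pos_of_pos (h.neg_pos hx) _
  have hS : 0 ≤ ∑ i, |exitGrad Ω i z₀| := Finset.sum_nonneg fun i _ => abs_nonneg _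
  have hE1 : Real.exp (-freqMin * exitTime Ω z₀.1 z₀.2) ≤ 1 :=
    Real.exp_le_one_iff.2 (by nlinarith)
  have hEτ := mul_exp_neg_freqMin_le (exitTime Ω z₀.1 z₀.2)
  have hνv := hardSphereFreq_le z₀.2
  have hνv0 := hardSphereFreq_pos z₀.2
  have hpv := hpoly ‖z₀.2‖ (norm_nonneg _)
  have hv1 : 1 ≤ 1 + ‖z₀.2‖ := by linarith [norm_nonneg z₀.2]
  have hM := IsConvexSublevel.exp_half_le ha z₀.2
  have hG' : Real.exp (-a' * ‖z₀.2‖ ^ 2) ≤ Real.exp (-a₂ * ‖z₀.2‖ ^ 2) :=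
    Real.exp_le_exp.2 (by nlinarith [sq_nonneg ‖z₀.2‖])
  have hGP : Real.exp (-a * ‖z₀.2‖ ^ 2) * (1 + ‖z₀.2‖) ^ 3 ≤
      P * Real.exp (-a₂ * ‖z₀.2‖ ^ 2) := by
    calc _ ≤ Real.exp (-a * ‖z₀.2‖ ^ 2) * (P * Real.exp ((a - a₂) * ‖z₀.2‖ ^ 2)) := by gcongr
      _ = _ := by rw [mul_left_comm, ← Real.exp_add]; ring_nf
  unfold slopeBound
  set K := ‖fderiv ℝ (fun z : R3 × R3 => exitTime Ω z.1 z.2) z₀‖ + 1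
  set τ₀ := exitTime Ω z₀.1 z₀.2
  set S := ∑ i, |exitGrad Ω i z₀|
  set m := (-ψ z₀.1) ^ (-(2 / 5) : ℝ)
  set r := ‖z₀.2‖ with hr
  have hr0 : 0 < r := norm_pos_iff.2 hv
  set E := Real.exp (-freqMin * τ₀)
  have hE0 : 0 < E := Real.exp_pos _
  set M := Real.exp (-(1 / 2) * r ^ 2)
  have hM0 : 0 < M := Real.exp_pos _
  set G := Real.exp (-a * r ^ 2)
  have hG0 : 0 < G := Real.exp_pos _
  set G' := Real.exp (-a' * r ^ 2)
  have hG'0 : 0 < G' := Real.exp_pos _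
  set G2 := Real.exp (-a₂ * r ^ 2)
  have hG20 : 0 < G2 := Real.exp_pos _
  set ν := hardSphereFreq z₀.2
  have hK0 : 0 ≤ K := by positivity
  have hEK : E * K ≤ c * (S + 1) := by
    have hK' : K ≤ (1 + τ₀) * S + 1 := add_le_add_left hKb 1
    have q1 : E * K ≤ E * ((1 + τ₀) * S + 1) := by gcongr
    have q2 : E * (1 + τ₀) ≤ c := by rw [hc]; linarith
    have q3 : E * (1 + τ₀) * S ≤ c * S := by gcongr
    have q4 : 1 ≤ c := by rw [hc]; linarith [inv_pos.2 hν]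
    linarith
  have hEτ' : E * τ₀ ≤ c := by rw [hc]; linarith
  have hEc : E ≤ c := by rw [hc]; linarith [inv_pos.2 hν]
  exact (collect_slope_terms hH hP hD hN hC hL0 hM0 hE0 hτ hG0 hG'0 hG20 hK0 hS hm hr0 hc0 hν hνv
    hEK hEτ' hEc hτD hG' hGP hM).trans (le_of_eq (by rw [hB, mul_assoc]))

/-! ### Integrability of the local Lipschitz constant -/

lemma phaseMeasure_eq_prod (Ω : Set R3) :
    phaseMeasure Ω = ((volume : Measure R3).restrict Ω).prod (volume : Measure R3) := by
  rw [phaseMeasure, Measure.volume_eq_prod, ← Measure.prod_restrict, Measure.restrict_univ]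

lemma memLp_ofReal_of_lintegral {X : Type*} [MeasurableSpace X] {μ : Measure X} {f : X → ℝ} {p : ℝ}
    (hf : AEStronglyMeasurable f μ) (hp : 0 < p) (h : ∫⁻ z, ENNReal.ofReal (|f z| ^ p) ∂μ < ⊤) :
    MemLp f (ENNReal.ofReal p) μ := by
  refine ⟨hf, ?_⟩
  rw [eLpNorm_lt_top_iff_lintegral_rpow_enorm_lt_top (by simpa using hp) ENNReal.ofReal_ne_top,
    ENNReal.toReal_ofReal hp.le]
  refine lt_of_le_of_lt (lintegral_mono fun z => ?_) h
  rw [← ofReal_norm, ENNReal.ofReal_rpow_of_nonneg (norm_nonneg _) hp.le,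
    Real.norm_eq_abs]

namespace IsConvexSublevel

variable {Ω : Set R3} {ψ : R3 → ℝ} {D : ℝ}

/-- The condition `p β < 3` is integrability at `v = 0`, and `p κ < 1` is integrability at the
boundary. -/
lemma memLp_gaussian_mul_rpow (h : IsConvexSublevel Ω ψ D) (hne : Ω.Nonempty) {p c β κ : ℝ}
    (hp : 0 < p) (hc : 0 < c) (hβ : p * β < 3) (hκ0 : 0 ≤ κ) (hκ : p * κ < 1) :
    MemLp (fun z : R3 × R3 => Real.exp (-c * ‖z.2‖ ^ 2) * ‖z.2‖ ^ (-β) * (-ψ z.1) ^ (-κ))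
      (ENNReal.ofReal p) (phaseMeasure Ω) := by
  have hmx : Measurable fun x => (-ψ x) ^ (-κ) := h.continuous.measurable.neg.pow_const _
  have hmv : Measurable fun v : R3 => Real.exp (-c * ‖v‖ ^ 2) * ‖v‖ ^ (-β) := by fun_prop
  have hmeas : Measurable fun z : R3 × R3 =>
      Real.exp (-c * ‖z.2‖ ^ 2) * ‖z.2‖ ^ (-β) * (-ψ z.1) ^ (-κ) :=
    (hmv.comp measurable_snd).mul (hmx.comp measurable_fst)
  refine memLp_ofReal_of_lintegral hmeas.aestronglyMeasurable hp ?_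
  rw [phaseMeasure_eq_prod]
  have e1 : ∀ z : R3 × R3, ENNReal.ofReal
      (|Real.exp (-c * ‖z.2‖ ^ 2) * ‖z.2‖ ^ (-β) * (-ψ z.1) ^ (-κ)| ^ p) =
      ENNReal.ofReal (|(-ψ z.1) ^ (-κ)| ^ p) *
        ENNReal.ofReal (‖z.2‖ ^ (-(p * β)) * Real.exp (-(p * c) * ‖z.2‖ ^ 2)) := fun z => by
    rw [← ENNReal.ofReal_mul (by positivity)]
    congr 1
    rw [abs_mul, abs_mul, Real.abs_exp, Real.mul_rpow (by positivity) (abs_nonneg _),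
      Real.mul_rpow (by positivity) (abs_nonneg _), abs_of_nonneg (by positivity : 0 ≤ ‖z.2‖ ^ (-β)),
      ← Real.rpow_mul (norm_nonneg _), ← Real.exp_mul]
    ring_nf
  simp only [e1]
  have m1 : Measurable fun x => ENNReal.ofReal (|(-ψ x) ^ (-κ)| ^ p) :=
    (hmx.abs.pow_const p).ennreal_ofReal
  have m2 : Measurable fun v : R3 =>
      ENNReal.ofReal (‖v‖ ^ (-(p * β)) * Real.exp (-(p * c) * ‖v‖ ^ 2)) := by fun_prop
  rw [lintegral_prod_mul m1.aemeasurable m2.aemeasurable]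
  refine ENNReal.mul_lt_top ?_ ?_
  · rcases hκ0.eq_or_lt with rfl | hκ1
    · simpa using h.volume_lt_top
    · obtain ⟨x₀, hx₀⟩ := hne
      refine lt_of_eq_of_lt (setLIntegral_congr_fun h.measurableSet fun x hx => ?_)
        (h.lintegral_rpow_lt_top hx₀ (κ := p * κ) (by positivity) hκ)
      have := h.neg_pos hx
      rw [abs_of_nonneg (by positivity), ← Real.rpow_mul this.le]
      ring_nf
  · exact (integrable_norm_rpow_mul_exp hβ (by positivity)).lintegral_lt_top

/-- The spatial gradient of the exit time is `p`-integrable for `p < 2`. This is what limits the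
integrability exponent of the gradient of the solution. -/
lemma memLp_gaussian_mul_exitGrad (h : IsConvexSublevel Ω ψ D) (hne : Ω.Nonempty) {p c : ℝ}
    (hp : 1 ≤ p) (hp2 : p < 2) (hc : 0 < c) (i : Fin 3) :
    MemLp (fun z : R3 × R3 => Real.exp (-c * ‖z.2‖ ^ 2) * |exitGrad Ω i z|)
      (ENNReal.ofReal p) (phaseMeasure Ω) := by
  have hmg := measurable_exitGrad Ω i
  have hmeas : Measurable fun z : R3 × R3 =>
      Real.exp (-c * ‖z.2‖ ^ 2) * |exitGrad Ω i z| :=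
    (by fun_prop : Measurable fun z : R3 × R3 => Real.exp (-c * ‖z.2‖ ^ 2)).mul hmg.abs
  refine memLp_ofReal_of_lintegral hmeas.aestronglyMeasurable (by linarith) ?_
  -- `exists_lintegral_exitGrad_le` excludes the exponent `1`
  set r := max p (3 / 2) with hr
  have hr1 : 1 < r := lt_of_lt_of_le (by norm_num) (le_max_right _ _)
  have hr2 : r < 2 := max_lt hp2 (by norm_num)
  have hrp : p ≤ r := le_max_left _ _
  obtain ⟨C, hC, H⟩ := h.exists_lintegral_exitGrad_le hr1 hr2 hc
  have hpt : ∀ z : R3 × R3, ENNReal.ofReal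
      (|(Real.exp (-c * ‖z.2‖ ^ 2) * |exitGrad Ω i z|)| ^ p) ≤
      ENNReal.ofReal (Real.exp (-c * ‖z.2‖ ^ 2)) +
        ENNReal.ofReal (|exitGrad Ω i z| ^ r * Real.exp (-c * ‖z.2 - 0‖ ^ 2)) := fun z => by
    rw [← ENNReal.ofReal_add (by positivity) (by positivity)]
    apply ENNReal.ofReal_le_ofReal
    set g := |exitGrad Ω i z|
    have hg : 0 ≤ g := abs_nonneg _
    set E := Real.exp (-c * ‖z.2‖ ^ 2)
    have hE : 0 < E := Real.exp_pos _
    have hE1 : E ≤ 1 := Real.exp_le_one_iff.2 (by nlinarith [sq_nonneg ‖z.2‖])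
    rw [sub_zero, abs_of_nonneg (by positivity), Real.mul_rpow hE.le hg]
    have e1 : E ^ p ≤ E := by
      simpa using Real.rpow_le_rpow_of_exponent_ge hE hE1 hp
    have e2 : g ^ p ≤ 1 + g ^ r := by
      have h0 : 0 ≤ g ^ r := by positivity
      rcases le_or_gt g 1 with h1 | h1
      · have := Real.rpow_le_one hg h1 (by linarith : 0 ≤ p)
        linarith
      · have := Real.rpow_le_rpow_of_exponent_le h1.le hrp
        linarith
    calc E ^ p * g ^ p ≤ E * (1 + g ^ r) := by gcongr
      _ = _ := by ring
  refine (lintegral_mono hpt).trans_lt ?_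
  have m1 : Measurable fun z : R3 × R3 => ENNReal.ofReal (Real.exp (-c * ‖z.2‖ ^ 2)) := by fun_prop
  have m2 : Measurable fun z : R3 × R3 =>
      ENNReal.ofReal (|exitGrad Ω i z| ^ r * Real.exp (-c * ‖z.2 - 0‖ ^ 2)) :=
    ((hmg.abs.pow_const r).mul (by fun_prop)).ennreal_ofReal
  rw [lintegral_add_left m1, phaseMeasure_eq_prod, lintegral_prod _ m1.aemeasurable,
    lintegral_prod _ m2.aemeasurable]
  refine ENNReal.add_lt_top.2 ⟨?_, ?_⟩
  · simp only
    rw [lintegral_const, Measure.restrict_apply_univ]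
    refine ENNReal.mul_lt_top ?_ h.volume_lt_top
    have := integrable_norm_rpow_mul_exp (b := 0) (c := c) (by norm_num) hc
    simp only [neg_zero, Real.rpow_zero, one_mul] at this
    exact this.lintegral_lt_top
  · obtain ⟨x₀, hx₀⟩ := hne
    calc _ ≤ ∫⁻ x in Ω, ENNReal.ofReal C * ENNReal.ofReal ((-ψ x) ^ (-(r - 1))) := by
          refine setLIntegral_mono' h.measurableSet fun x hx => ?_
          rw [← ENNReal.ofReal_mul hC.le, neg_sub]
          exact H x hx 0 i
      _ = ENNReal.ofReal C * ∫⁻ x in Ω, ENNReal.ofReal ((-ψ x) ^ (-(r - 1))) :=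
          lintegral_const_mul' _ _ ENNReal.ofReal_ne_top
      _ < ⊤ := ENNReal.mul_lt_top ENNReal.ofReal_lt_top
          (h.lintegral_rpow_lt_top hx₀ (by linarith) (by linarith))

lemma memLp_slopeBound (h : IsConvexSublevel Ω ψ D) (hne : Ω.Nonempty) {p α a₂ : ℝ}
    (hp : 1 ≤ p) (hp2 : p < 2) (hα : α < a₂) :
    MemLp (fun z : R3 × R3 => Real.exp (α * ‖z.2‖ ^ 2) * slopeBound Ω ψ a₂ z)
      (ENNReal.ofReal p) (phaseMeasure Ω) := by
  have hc : 0 < a₂ - α := by linarith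
  have t1 := h.memLp_gaussian_mul_rpow hne (p := p) (β := 0) (κ := 0) (by linarith) hc
    (by linarith) le_rfl (by linarith)
  have t2 := h.memLp_gaussian_mul_rpow hne (p := p) (β := 1) (κ := 0) (by linarith) hc
    (by linarith) le_rfl (by linarith)
  have t3 := h.memLp_gaussian_mul_rpow hne (p := p) (β := 1) (κ := 2 / 5) (by linarith) hc
    (by linarith) (by norm_num) (by linarith)
  have t4 := h.memLp_gaussian_mul_exitGrad hne hp hp2 hc
  have e : (fun z : R3 × R3 => Real.exp (α * ‖z.2‖ ^ 2) * slopeBound Ω ψ a₂ z) = fun z =>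
      Real.exp (-(a₂ - α) * ‖z.2‖ ^ 2) * ‖z.2‖ ^ (-(0 : ℝ)) * (-ψ z.1) ^ (-(0 : ℝ)) +
      (Real.exp (-(a₂ - α) * ‖z.2‖ ^ 2) * |exitGrad Ω 0 z| +
      Real.exp (-(a₂ - α) * ‖z.2‖ ^ 2) * |exitGrad Ω 1 z| +
      Real.exp (-(a₂ - α) * ‖z.2‖ ^ 2) * |exitGrad Ω 2 z|) +
      (Real.exp (-(a₂ - α) * ‖z.2‖ ^ 2) * ‖z.2‖ ^ (-(1 : ℝ)) * (-ψ z.1) ^ (-(0 : ℝ)) +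
      Real.exp (-(a₂ - α) * ‖z.2‖ ^ 2) * ‖z.2‖ ^ (-(1 : ℝ)) * (-ψ z.1) ^ (-(2 / 5 : ℝ))) := by
    funext z
    have e1 : Real.exp (-(a₂ - α) * ‖z.2‖ ^ 2) =
        Real.exp (α * ‖z.2‖ ^ 2) * Real.exp (-a₂ * ‖z.2‖ ^ 2) := by
      rw [← Real.exp_add]; ring_nf
    rw [e1, slopeBound, neg_zero, Real.rpow_zero, Real.rpow_zero, Real.rpow_neg_one,
      Fin.sum_univ_three]
    ring
  rw [e]
  exact (t1.add (((t4 0).add (t4 1)).add (t4 2))).add (t2.add t3)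

end IsConvexSublevel

/-! ### Weak gradients of locally Lipschitz functions -/

/-- Integration by parts against a test function supported where `f` is locally Lipschitz. -/
lemma integral_mul_fderiv_of_locally_lipschitz {E : Type*} [NormedAddCommGroup E] [NormedSpace ℝ E]
    [FiniteDimensional ℝ E] [MeasurableSpace E] [BorelSpace E] (μ : Measure E) [μ.IsAddHaarMeasure]
    {f : E → ℝ} {U : Set E} (hU : IsOpen U)
    (hf : ∀ z ∈ U, ∃ C : NNReal, ∃ t ∈ 𝓝 z, LipschitzOnWith C f t) {θ : E → ℝ}
    (hθ : ContDiff ℝ ∞ θ) (hθc : HasCompactSupport θ) (hθU : tsupport θ ⊆ U) (e : E) :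
    ∫ z, f z * fderiv ℝ θ z e ∂μ = -∫ z, fderiv ℝ f z e * θ z ∂μ := by
  -- near the support of `θ`, `f` agrees with a globally Lipschitz function, which is differentiable
  -- almost everywhere by Rademacher's theorem
  obtain ⟨L, hLc, hKL, hLU⟩ := exists_compact_between hθc hU hθU
  have hloc : LocallyLipschitzOn L f := fun z hz => by
    obtain ⟨C, t, ht, hlip⟩ := hf z (hLU hz)
    exact ⟨C, t, mem_nhdsWithin_of_mem_nhds ht, hlip⟩
  obtain ⟨C, hC⟩ := hloc.exists_lipschitzOnWith_of_compact hLc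
  obtain ⟨F, hF, hFf⟩ := hC.extend_real
  obtain ⟨C', hC'⟩ := hθ.lipschitzWith_of_hasCompactSupport hθc (by simp)
  have hθd : Differentiable ℝ θ := hθ.differentiable (by simp)
  have key := hF.integral_lineDeriv_mul_eq (μ := μ) hC' hθc e
  have e1 : ∀ z, lineDeriv ℝ θ z (-e) * F z = -(f z * fderiv ℝ θ z e) := fun z => by
    rw [(hθd z).lineDeriv_eq_fderiv, map_neg]
    by_cases hz : z ∈ tsupport θ
    · rw [hFf (interior_subset (hKL hz))]; ring
    · rw [fderiv_of_notMem_tsupport ℝ hz]; simp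
  have e2 : ∀ᵐ z ∂μ, lineDeriv ℝ F z e * θ z = fderiv ℝ f z e * θ z := by
    filter_upwards [hF.ae_differentiableAt (μ := μ)] with z hz
    by_cases hzs : z ∈ tsupport θ
    · have hEq : f =ᶠ[𝓝 z] F := by
        filter_upwards [isOpen_interior.mem_nhds (hKL hzs)] with y hy
        exact hFf (interior_subset hy)
      rw [hz.lineDeriv_eq_fderiv, hEq.fderiv_eq]
    · rw [image_eq_zero_of_notMem_tsupport hzs, mul_zero, mul_zero]
  rw [integral_congr_ae e2, integral_congr_ae (Filter.Eventually.of_forall e1), integral_neg] at key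
  rw [key, neg_neg]

/-- The gradient in the position variable. -/
noncomputable def gradX (f : R3 × R3 → ℝ) (z : R3 × R3) : R3 :=
  (InnerProductSpace.toDual ℝ R3).symm ((fderiv ℝ f z).comp (ContinuousLinearMap.inl ℝ R3 R3))

/-- The gradient in the velocity variable. -/
noncomputable def gradV (f : R3 × R3 → ℝ) (z : R3 × R3) : R3 :=
  (InnerProductSpace.toDual ℝ R3).symm ((fderiv ℝ f z).comp (ContinuousLinearMap.inr ℝ R3 R3))

lemma inner_gradX_add_inner_gradV (f : R3 × R3 → ℝ) (z : R3 × R3) (a b : R3) :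
    inner ℝ (gradX f z) a + inner ℝ (gradV f z) b = fderiv ℝ f z (a, b) := by
  rw [gradX, gradV, InnerProductSpace.toDual_symm_apply, InnerProductSpace.toDual_symm_apply]
  simp only [ContinuousLinearMap.comp_apply, ContinuousLinearMap.inl_apply,
    ContinuousLinearMap.inr_apply]
  rw [← map_add]
  simp

lemma norm_gradX_le (f : R3 × R3 → ℝ) (z : R3 × R3) : ‖gradX f z‖ ≤ ‖fderiv ℝ f z‖ := by
  rw [gradX, LinearIsometryEquiv.norm_map]
  refine (ContinuousLinearMap.opNorm_comp_le _ _).trans ?_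
  exact mul_le_of_le_one_right (norm_nonneg _) (ContinuousLinearMap.norm_inl_le_one ℝ R3 R3)

lemma norm_gradV_le (f : R3 × R3 → ℝ) (z : R3 × R3) : ‖gradV f z‖ ≤ ‖fderiv ℝ f z‖ := by
  rw [gradV, LinearIsometryEquiv.norm_map]
  refine (ContinuousLinearMap.opNorm_comp_le _ _).trans ?_
  exact mul_le_of_le_one_right (norm_nonneg _) (ContinuousLinearMap.norm_inr_le_one ℝ R3 R3)

lemma measurable_gradX (f : R3 × R3 → ℝ) : Measurable (gradX f) := by
  have hc : Continuous fun A : R3 × R3 →L[ℝ] ℝ =>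
      (InnerProductSpace.toDual ℝ R3).symm (A.comp (ContinuousLinearMap.inl ℝ R3 R3)) :=
    (LinearIsometryEquiv.continuous _).comp (by fun_prop)
  exact hc.measurable.comp (measurable_fderiv ℝ f)

lemma measurable_gradV (f : R3 × R3 → ℝ) : Measurable (gradV f) := by
  have hc : Continuous fun A : R3 × R3 →L[ℝ] ℝ =>
      (InnerProductSpace.toDual ℝ R3).symm (A.comp (ContinuousLinearMap.inr ℝ R3 R3)) :=
    (LinearIsometryEquiv.continuous _).comp (by fun_prop)
  exact hc.measurable.comp (measurable_fderiv ℝ f)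

lemma ae_phaseMeasure_mem {Ω : Set R3} (hΩ : MeasurableSet Ω) :
    ∀ᵐ z ∂phaseMeasure Ω, z.1 ∈ Ω ∧ z.2 ≠ 0 := by
  have h1 : ∀ᵐ z ∂phaseMeasure Ω, z ∈ Ω ×ˢ (univ : Set R3) :=
    ae_restrict_mem (hΩ.prod MeasurableSet.univ)
  have h2 : ∀ᵐ z ∂phaseMeasure Ω, z.2 ≠ 0 := by
    rw [phaseMeasure_eq_prod]
    exact Measure.quasiMeasurePreserving_snd.ae (Measure.ae_ne (volume : Measure R3) 0)
  filter_upwards [h1, h2] with z hz hz2 using ⟨hz.1, hz2⟩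

lemma aestronglyMeasurable_phaseMeasure {Ω : Set R3} (hΩ : MeasurableSet Ω) {F : R3 × R3 → ℝ}
    (hF : ContinuousOn F (Ω ×ˢ {0}ᶜ)) : AEStronglyMeasurable F (phaseMeasure Ω) := by
  have hm : MeasurableSet (Ω ×ˢ ({0}ᶜ : Set R3)) := hΩ.prod (measurableSet_singleton 0).compl
  have h1 := hF.aestronglyMeasurable (μ := phaseMeasure Ω) hm
  rwa [Measure.restrict_eq_self_of_ae_mem] at h1
  filter_upwards [ae_phaseMeasure_mem hΩ] with z hz using ⟨hz.1, hz.2⟩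

/-- A continuous function with compact support is dominated by a Gaussian in the velocity. -/
lemma exists_abs_le_gaussian {g : R3 × R3 → ℝ} (hg : Continuous g) (hgc : HasCompactSupport g) :
    ∃ C : ℝ, 0 < C ∧ ∀ z, |g z| ≤ C * Real.exp (-1 * ‖z.2‖ ^ 2) := by
  obtain ⟨C, hC⟩ := (hgc.mul_right (f' := fun z : R3 × R3 =>
    Real.exp (‖z.2‖ ^ 2))).exists_bound_of_continuous (hg.mul (by fun_prop))
  refine ⟨|C| + 1, by positivity, fun z => ?_⟩
  have h1 := hC z
  have h2 : |g z| * Real.exp (‖z.2‖ ^ 2) ≤ C := by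
    rw [Pi.mul_apply, norm_mul, Real.norm_eq_abs, Real.norm_eq_abs, Real.abs_exp] at h1
    exact h1
  calc |g z| = |g z| * Real.exp (‖z.2‖ ^ 2) * Real.exp (-1 * ‖z.2‖ ^ 2) := by
        rw [mul_assoc, ← Real.exp_add]; simp
    _ ≤ (|C| + 1) * Real.exp (-1 * ‖z.2‖ ^ 2) := by
        gcongr
        linarith [le_abs_self C]

/-- The cut-off `1 - χ(n v)` that removes a neighbourhood of `v = 0`. -/
noncomputable def velocityCutoff (n : ℕ) (z : R3 × R3) : ℝ :=
  1 - (⟨1, 2, one_pos, one_lt_two⟩ : ContDiffBump (0 : R3)) ((n : ℝ) • z.2)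

lemma contDiff_velocityCutoff (n : ℕ) : ContDiff ℝ ∞ (velocityCutoff n) := by
  unfold velocityCutoff
  exact contDiff_const.sub ((ContDiffBump.contDiff _).comp (contDiff_snd.const_smul _))

lemma abs_velocityCutoff_le (n : ℕ) (z : R3 × R3) : |velocityCutoff n z| ≤ 1 := by
  unfold velocityCutoff
  have h1 := (⟨1, 2, one_pos, one_lt_two⟩ : ContDiffBump (0 : R3)).nonneg' ((n : ℝ) • z.2)
  have h2 := (⟨1, 2, one_pos, one_lt_two⟩ : ContDiffBump (0 : R3)).le_one (x := (n : ℝ) • z.2)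
  rw [abs_le]
  constructor <;> linarith

lemma velocityCutoff_eq_zero {n : ℕ} {z : R3 × R3} (hz : ‖(n : ℝ) • z.2‖ ≤ 1) :
    velocityCutoff n z = 0 := by
  unfold velocityCutoff
  rw [ContDiffBump.one_of_mem_closedBall, sub_self]
  simpa using hz

lemma velocityCutoff_eq_one {n : ℕ} {z : R3 × R3} (hz : 2 ≤ ‖(n : ℝ) • z.2‖) :
    velocityCutoff n z = 1 := by
  unfold velocityCutoff
  rw [ContDiffBump.zero_of_le_dist, sub_zero]
  simpa using hz

lemma velocityCutoff_eventually_eq {z : R3 × R3} (hz : z.2 ≠ 0) :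
    ∀ᶠ n : ℕ in Filter.atTop, velocityCutoff n =ᶠ[𝓝 z] fun _ => 1 := by
  have hpos : 0 < ‖z.2‖ := norm_pos_iff.2 hz
  have h1 : Filter.Tendsto (fun n : ℕ => (n : ℝ) * ‖z.2‖) Filter.atTop Filter.atTop :=
    tendsto_natCast_atTop_atTop.atTop_mul_const hpos
  filter_upwards [h1.eventually (Filter.eventually_gt_atTop 2)] with n hn
  have hc : ContinuousAt (fun y : R3 × R3 => ‖(n : ℝ) • y.2‖) z := by fun_prop
  have : (2 : ℝ) < ‖(n : ℝ) • z.2‖ := by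
    rw [norm_smul, Real.norm_natCast]; exact hn
  filter_upwards [hc.eventually (lt_mem_nhds this)] with y hy
  exact velocityCutoff_eq_one hy.le

/-- The derivative of the cut-off has size `n`, but it vanishes where `‖v‖ > 2 / n`. Hence a bound
independent of `n`, which is integrable in dimension three. -/
lemma exists_fderiv_velocityCutoff_le :
    ∃ C : ℝ, 0 < C ∧ ∀ (n : ℕ) (z : R3 × R3) (a b : R3), z.2 ≠ 0 →
      |fderiv ℝ (velocityCutoff n) z (a, b)| ≤ C * ‖b‖ * ‖z.2‖⁻¹ := by
  set χ : ContDiffBump (0 : R3) := ⟨1, 2, one_pos, one_lt_two⟩ with hχ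
  have hχs : ContDiff ℝ ∞ χ := χ.contDiff
  obtain ⟨C, hC⟩ := hχs.lipschitzWith_of_hasCompactSupport χ.hasCompactSupport
    (by simp)
  refine ⟨2 * (C + 1), by positivity, fun n z a b hz => ?_⟩
  have hpos : 0 < ‖z.2‖ := norm_pos_iff.2 hz
  have hd : HasFDerivAt (velocityCutoff n) (-((fderiv ℝ χ ((n : ℝ) • z.2)).comp
      ((n : ℝ) • ContinuousLinearMap.snd ℝ R3 R3))) z := by
    have h1 : HasFDerivAt χ (fderiv ℝ χ ((n : ℝ) • z.2)) ((n : ℝ) • z.2) :=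
      (hχs.differentiable (by simp) _).hasFDerivAt
    have h2 : HasFDerivAt (fun y : R3 × R3 => (n : ℝ) • y.2)
        ((n : ℝ) • ContinuousLinearMap.snd ℝ R3 R3) z :=
      ((n : ℝ) • ContinuousLinearMap.snd ℝ R3 R3).hasFDerivAt
    exact (HasFDerivAt.comp z h1 h2).const_sub 1
  rw [hd.fderiv]
  simp only [neg_apply, ContinuousLinearMap.comp_apply,
    smul_apply, ContinuousLinearMap.coe_snd', abs_neg, map_smul, smul_eq_mul,
    abs_mul, Nat.abs_cast]
  by_cases hn : (n : ℝ) * ‖z.2‖ ≤ 2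
  · have h3 : |fderiv ℝ χ ((n : ℝ) • z.2) b| ≤ C * ‖b‖ := by
      rw [← Real.norm_eq_abs]
      refine (ContinuousLinearMap.le_opNorm _ _).trans ?_
      gcongr
      exact norm_fderiv_le_of_lipschitz ℝ hC
    have h4 : (n : ℝ) ≤ 2 * ‖z.2‖⁻¹ := by
      rw [← div_eq_mul_inv, le_div_iff₀ hpos]; exact hn
    calc (n : ℝ) * |fderiv ℝ χ ((n : ℝ) • z.2) b| ≤ 2 * ‖z.2‖⁻¹ * (C * ‖b‖) := by gcongr
      _ ≤ 2 * ‖z.2‖⁻¹ * ((C + 1) * ‖b‖) := by gcongr; linarith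
      _ = _ := by ring
  · have h3 : (n : ℝ) • z.2 ∉ tsupport χ := by
      rw [χ.tsupport_eq]
      simp only [hχ, Metric.mem_closedBall, dist_zero_right, norm_smul, Real.norm_natCast, not_le]
      exact not_le.1 hn
    rw [fderiv_of_notMem_tsupport ℝ h3]
    simp only [zero_apply, abs_zero, mul_zero]
    positivity

namespace IsConvexSublevel

variable {Ω : Set R3} {ψ : R3 → ℝ} {D : ℝ}

lemma norm_fderiv_le_slopeBound {f : R3 × R3 → ℝ} {B a₂ : ℝ} (hB : 0 < B) {z : R3 × R3}
    (hz : ∃ t ∈ 𝓝 z, ∀ y ∈ t, ∀ y' ∈ t, |f y - f y'| ≤ B * slopeBound Ω ψ a₂ z * ‖y - y'‖)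
    (hs : 0 ≤ slopeBound Ω ψ a₂ z) :
    ‖fderiv ℝ f z‖ ≤ B * slopeBound Ω ψ a₂ z := by
  obtain ⟨t, ht, hlip⟩ := hz
  refine norm_fderiv_le_of_lip' ℝ (by positivity) ?_
  filter_upwards [ht] with y hy
  exact hlip y hy z (mem_of_mem_nhds ht)

lemma slopeBound_nonneg (h : IsConvexSublevel Ω ψ D) (a₂ : ℝ) {z : R3 × R3} (hz : z.1 ∈ Ω) :
    0 ≤ slopeBound Ω ψ a₂ z := by
  have := h.neg_pos hz
  have hS : 0 ≤ ∑ i, |exitGrad Ω i z| := Finset.sum_nonneg fun i _ => abs_nonneg _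
  unfold slopeBound
  positivity

/-- The classical gradient on `v ≠ 0` is the weak gradient on the whole phase space. Test functions
are cut off near `v = 0`, and the gradients of the cut-offs are dominated by a multiple of `‖v‖⁻¹`. -/
lemma isWeakGradient_of_locally_lipschitz (h : IsConvexSublevel Ω ψ D) (hne : Ω.Nonempty)
    {f : R3 × R3 → ℝ} {B a₂ F : ℝ} (hB : 0 < B) (ha2 : 0 < a₂)
    (hfm : AEStronglyMeasurable f (phaseMeasure Ω))
    (hF : ∀ z : R3 × R3, z.1 ∈ Ω → |f z| ≤ F)
    (hlip : ∀ z : R3 × R3, z.1 ∈ Ω → z.2 ≠ 0 → ∃ t ∈ 𝓝 z, ∀ y ∈ t, ∀ y' ∈ t,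
      |f y - f y'| ≤ B * slopeBound Ω ψ a₂ z * ‖y - y'‖) :
    IsWeakGradient Ω f (gradX f) (gradV f) := by
  intro θ hθ hθc hθs a b
  simp only [inner_gradX_add_inner_gradV]
  have hUo : IsOpen (Ω ×ˢ ({0}ᶜ : Set R3)) := h.isOpen.prod isOpen_compl_singleton
  set θn : ℕ → R3 × R3 → ℝ := fun n z => θ z * velocityCutoff n z with hθn
  have hθnd : ∀ n, ContDiff ℝ ∞ (θn n) := fun n => hθ.mul (contDiff_velocityCutoff n)
  have hθnc : ∀ n, HasCompactSupport (θn n) := fun n => hθc.mul_right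
  have hsub1 : ∀ n, tsupport (θn n) ⊆ Ω ×ˢ univ := fun n => by
    refine Subset.trans (closure_mono ?_) hθs
    exact Function.support_mul_subset_left _ _
  have hsub2 : ∀ n, tsupport (θn n) ⊆ {z | 1 ≤ ‖(n : ℝ) • z.2‖} := fun n => by
    refine closure_minimal (fun z hz => ?_) (isClosed_le continuous_const (by fun_prop))
    by_contra hlt
    rw [mem_ofPred_eq, not_le] at hlt
    exact hz (by simp only [hθn, velocityCutoff_eq_zero hlt.le, mul_zero])
  have hsub : ∀ n, tsupport (θn n) ⊆ Ω ×ˢ ({0}ᶜ : Set R3) := fun n z hz => by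
    refine ⟨(hsub1 n hz).1, fun h0 => ?_⟩
    have h1 := hsub2 n hz
    rw [mem_singleton_iff] at h0
    rw [mem_ofPred_eq, h0, smul_zero, norm_zero] at h1
    linarith
  -- integration by parts away from `v = 0`
  have hrestr : ∀ g : R3 × R3 → ℝ, (∀ z, z ∉ Ω ×ˢ (univ : Set R3) → g z = 0) →
      ∫ z, g z ∂phaseMeasure Ω = ∫ z, g z := fun g hg =>
    setIntegral_eq_integral_of_forall_compl_eq_zero hg
  have hibp : ∀ n, ∫ z, f z * fderiv ℝ (θn n) z (a, b) ∂phaseMeasure Ω =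
      -∫ z, fderiv ℝ f z (a, b) * θn n z ∂phaseMeasure Ω := fun n => by
    rw [hrestr _ fun z hz => by rw [fderiv_of_notMem_tsupport ℝ fun h' => hz (hsub1 n h')]; simp,
      hrestr _ fun z hz => by
        rw [image_eq_zero_of_notMem_tsupport fun h' => hz (hsub1 n h'), mul_zero]]
    have : (volume : Measure (R3 × R3)).IsAddHaarMeasure :=
      inferInstanceAs ((volume : Measure R3).prod (volume : Measure R3)).IsAddHaarMeasure
    refine integral_mul_fderiv_of_locally_lipschitz volume hUo (fun z hz => ?_) (hθnd n) (hθnc n)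
      (hsub n) (a, b)
    obtain ⟨t, ht, hl⟩ := hlip z hz.1 hz.2
    refine ⟨(B * slopeBound Ω ψ a₂ z).toNNReal, t, ht, LipschitzOnWith.of_dist_le_mul
      fun y hy y' hy' => ?_⟩
    rw [Real.dist_eq, dist_eq_norm, Real.coe_toNNReal _
      (mul_nonneg hB.le (h.slopeBound_nonneg a₂ hz.1))]
    exact hl y hy y' hy'
  -- passage to the limit
  have hae := ae_phaseMeasure_mem h.measurableSet
  have hfc : Continuous fun z => fderiv ℝ θ z (a, b) :=
    (hθ.continuous_fderiv (by simp)).clm_apply continuous_const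
  obtain ⟨C1, hC1, hb1⟩ := exists_abs_le_gaussian hfc (hθc.fderiv_apply (𝕜 := ℝ) (a, b))
  obtain ⟨C2, hC2, hb2⟩ := exists_abs_le_gaussian hθ.continuous hθc
  obtain ⟨C3, hC3, hb3⟩ := exists_fderiv_velocityCutoff_le
  have hgauss : Integrable (fun z : R3 × R3 => Real.exp (-1 * ‖z.2‖ ^ 2)) (phaseMeasure Ω) := by
    have := h.memLp_gaussian_mul_rpow hne (p := 1) (c := 1) (β := 0) (κ := 0) one_pos one_pos
      (by norm_num) le_rfl (by norm_num)
    rw [ENNReal.ofReal_one, memLp_one_iff_integrable] at this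
    simpa using this
  have hgauss' : Integrable (fun z : R3 × R3 => Real.exp (-1 * ‖z.2‖ ^ 2) * ‖z.2‖⁻¹)
      (phaseMeasure Ω) := by
    have := h.memLp_gaussian_mul_rpow hne (p := 1) (c := 1) (β := 1) (κ := 0) one_pos one_pos
      (by norm_num) le_rfl (by norm_num)
    rw [ENNReal.ofReal_one, memLp_one_iff_integrable] at this
    simpa [Real.rpow_neg_one] using this
  have hslope : Integrable (slopeBound Ω ψ a₂) (phaseMeasure Ω) := by
    have := h.memLp_slopeBound hne (p := 1) (α := 0) le_rfl one_lt_two ha2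
    rw [ENNReal.ofReal_one, memLp_one_iff_integrable] at this
    simpa using this
  have hlim1 : Filter.Tendsto (fun n => ∫ z, f z * fderiv ℝ (θn n) z (a, b) ∂phaseMeasure Ω)
      Filter.atTop (𝓝 (∫ z, f z * fderiv ℝ θ z (a, b) ∂phaseMeasure Ω)) := by
    refine tendsto_integral_of_dominated_convergence (fun z => F * (C1 * Real.exp (-1 * ‖z.2‖ ^ 2) +
      C2 * C3 * ‖b‖ * (Real.exp (-1 * ‖z.2‖ ^ 2) * ‖z.2‖⁻¹))) (fun n => ?_)
      (((hgauss.const_mul C1).add (hgauss'.const_mul (C2 * C3 * ‖b‖))).const_mul F) (fun n => ?_) ?_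
    · exact hfm.mul ((((hθnd n).continuous_fderiv (by simp)).clm_apply
        continuous_const).aestronglyMeasurable)
    · filter_upwards [hae] with z hz
      rw [norm_mul, Real.norm_eq_abs, Real.norm_eq_abs]
      have hF0 := hF z hz.1
      refine mul_le_mul hF0 ?_ (abs_nonneg _) ((abs_nonneg _).trans hF0)
      have hd : fderiv ℝ (θn n) z (a, b) = θ z * fderiv ℝ (velocityCutoff n) z (a, b) +
          velocityCutoff n z * fderiv ℝ θ z (a, b) := by
        have h1 := fderiv_fun_mul (hθ.differentiable (by simp) z)
          ((contDiff_velocityCutoff n).differentiable (by simp) z)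
        simp only [hθn]
        rw [h1]
        simp
      rw [hd]
      refine (abs_add_le _ _).trans ?_
      rw [abs_mul, abs_mul, add_comm]
      refine add_le_add ((mul_le_of_le_one_left (abs_nonneg _)
        (abs_velocityCutoff_le n z)).trans (hb1 z)) ?_
      calc _ ≤ (C2 * Real.exp (-1 * ‖z.2‖ ^ 2)) * (C3 * ‖b‖ * ‖z.2‖⁻¹) :=
            mul_le_mul (hb2 z) (hb3 n z a b hz.2) (abs_nonneg _) (by positivity)
        _ = _ := by ring
    · filter_upwards [hae] with z hz
      refine tendsto_const_nhds.congr' ?_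
      filter_upwards [velocityCutoff_eventually_eq hz.2] with n hn
      have : θn n =ᶠ[𝓝 z] θ := by
        filter_upwards [hn] with y hy
        simp only [hθn, hy, mul_one]
      rw [this.fderiv_eq]
  have hlim2 : Filter.Tendsto (fun n => ∫ z, fderiv ℝ f z (a, b) * θn n z ∂phaseMeasure Ω)
      Filter.atTop (𝓝 (∫ z, fderiv ℝ f z (a, b) * θ z ∂phaseMeasure Ω)) := by
    refine tendsto_integral_of_dominated_convergence
      (fun z => ‖(a, b)‖ * B * C2 * slopeBound Ω ψ a₂ z) (fun n => ?_)
      (hslope.const_mul _) (fun n => ?_) ?_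
    · exact (measurable_fderiv_apply_const ℝ f (a, b)).aestronglyMeasurable.mul
        (hθnd n).continuous.aestronglyMeasurable
    · filter_upwards [hae] with z hz
      have hs := h.slopeBound_nonneg a₂ hz.1
      have h1 := norm_fderiv_le_slopeBound hB (hlip z hz.1 hz.2) hs
      have h2 : ‖fderiv ℝ f z (a, b)‖ ≤ B * slopeBound Ω ψ a₂ z * ‖(a, b)‖ :=
        (ContinuousLinearMap.le_opNorm _ _).trans (by gcongr)
      have h3 : ‖θn n z‖ ≤ C2 := by
        simp only [hθn, norm_mul]
        have q1 := hb2 z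
        have q2 : Real.exp (-1 * ‖z.2‖ ^ 2) ≤ 1 :=
          Real.exp_le_one_iff.2 (by nlinarith [sq_nonneg ‖z.2‖])
        have q3 := abs_velocityCutoff_le n z
        rw [Real.norm_eq_abs, Real.norm_eq_abs]
        calc _ ≤ C2 * 1 * 1 := by
              refine mul_le_mul (q1.trans ?_) q3 (abs_nonneg _) (by positivity)
              gcongr
          _ = _ := by ring
      rw [norm_mul]
      calc _ ≤ (B * slopeBound Ω ψ a₂ z * ‖(a, b)‖) * C2 := by gcongr
        _ = _ := by ring
    · filter_upwards [hae] with z hz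
      refine tendsto_const_nhds.congr' ?_
      filter_upwards [velocityCutoff_eventually_eq hz.2] with n hn
      simp only [hθn, hn.eq_of_nhds, mul_one]
  exact tendsto_nhds_unique hlim1 (hlim2.neg.congr fun n => (hibp n).symm)

/-- A bounded function with Gaussian decay and the local Lipschitz bound `slopeBound` lies in
`W^{1,p}_α` for all `p < 2`. -/
lemma memW1Weighted_of_locally_lipschitz (h : IsConvexSublevel Ω ψ D) (hne : Ω.Nonempty)
    {f : R3 × R3 → ℝ} {B a a₂ F α p : ℝ} (hB : 0 < B) (hα0 : 0 ≤ α) (hα : α < a₂) (ha : a₂ < a)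
    (hp : 1 ≤ p) (hp2 : p < 2)
    (hfm : AEStronglyMeasurable f (phaseMeasure Ω))
    (hF : ∀ z : R3 × R3, z.1 ∈ Ω → |f z| ≤ F * Real.exp (-a * ‖z.2‖ ^ 2))
    (hlip : ∀ z : R3 × R3, z.1 ∈ Ω → z.2 ≠ 0 → ∃ t ∈ 𝓝 z, ∀ y ∈ t, ∀ y' ∈ t,
      |f y - f y'| ≤ B * slopeBound Ω ψ a₂ z * ‖y - y'‖) :
    MemW1Weighted Ω p α f := by
  have ha0 : 0 < a := by linarith
  have hF0 : 0 ≤ F := by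
    obtain ⟨x₀, hx₀⟩ := hne
    have := (abs_nonneg _).trans (hF (x₀, 0) hx₀)
    simpa using this
  have hae := ae_phaseMeasure_mem h.measurableSet
  have hexpm : AEStronglyMeasurable (fun z : R3 × R3 => Real.exp (α * ‖z.2‖ ^ 2))
      (phaseMeasure Ω) := (by fun_prop : Continuous _).aestronglyMeasurable
  have hslope := (h.memLp_slopeBound hne hp hp2 hα).const_mul B
  have hgrad : ∀ G : R3 × R3 → R3, Measurable G → (∀ z, ‖G z‖ ≤ ‖fderiv ℝ f z‖) →
      MemLpWeighted Ω p α G := fun G hG hGle => by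
    refine hslope.mono (hexpm.smul hG.aestronglyMeasurable) ?_
    filter_upwards [hae] with z hz
    have hs := h.slopeBound_nonneg a₂ hz.1
    have h1 := (hGle z).trans (norm_fderiv_le_slopeBound hB (hlip z hz.1 hz.2) hs)
    rw [norm_smul, Real.norm_of_nonneg (by positivity), Real.norm_of_nonneg (by positivity)]
    calc _ ≤ Real.exp (α * ‖z.2‖ ^ 2) * (B * slopeBound Ω ψ a₂ z) := by gcongr
      _ = _ := by ring
  refine ⟨?_, gradX f, gradV f, ?_, hgrad _ (measurable_gradX f) (norm_gradX_le f),
    hgrad _ (measurable_gradV f) (norm_gradV_le f)⟩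
  · have hg := (h.memLp_gaussian_mul_rpow hne (p := p) (c := a - α) (β := 0) (κ := 0) (by linarith)
      (by linarith) (by linarith) le_rfl (by linarith)).const_mul F
    refine hg.mono (hexpm.smul hfm) ?_
    filter_upwards [hae] with z hz
    have h1 := hF z hz.1
    rw [norm_smul, Real.norm_of_nonneg (by positivity), Real.norm_eq_abs, neg_zero, Real.rpow_zero,
      Real.rpow_zero, mul_one, mul_one, Real.norm_of_nonneg (by positivity)]
    calc _ ≤ Real.exp (α * ‖z.2‖ ^ 2) * (F * Real.exp (-a * ‖z.2‖ ^ 2)) := by gcongr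
      _ = _ := by rw [mul_left_comm, ← Real.exp_add]; ring_nf
  · refine h.isWeakGradient_of_locally_lipschitz hne hB (by linarith) hfm (F := F)
      (fun z hz => (hF z hz).trans ?_) hlip
    exact mul_le_of_le_one_right hF0 (Real.exp_le_one_iff.2 (by nlinarith [sq_nonneg ‖z.2‖]))

end IsConvexSublevel

/-! ### Boundary behaviour of the solution at grazing velocities -/

namespace IsConvexSublevel

variable {Ω : Set R3} {ψ : R3 → ℝ} {D a a' H N C : ℝ} {k : R3 → R3 → ℝ} {φ : R3 → ℝ}

/-- On characteristics that start where the data equal the Maxwellian, the deviation of the solution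
from the Maxwellian is comparable to the travel time, as soon as `ν M - k` has a sign. -/
lemma maxwellian_sub_mildSolution_bounds (h : IsConvexSublevel Ω ψ D)
    (hk : IsWeightedLip Ω ψ a a' H N C k) {x v : R3} (hx : x ∈ Ω)
    (hφ : φ (exitPoint Ω x v) = 1) {c c' : ℝ} (hc0 : 0 ≤ c)
    (hc : ∀ y ∈ Ω, c ≤ hardSphereFreq v * Real.exp (-(1 / 2) * ‖v‖ ^ 2) - k y v)
    (hc' : ∀ y ∈ Ω, hardSphereFreq v * Real.exp (-(1 / 2) * ‖v‖ ^ 2) - k y v ≤ c') :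
    c * Real.exp (-hardSphereFreq v * exitTime Ω x v) * exitTime Ω x v ≤
        Real.exp (-(1 / 2) * ‖v‖ ^ 2) - mildSolution Ω φ k (x, v) ∧
      Real.exp (-(1 / 2) * ‖v‖ ^ 2) - mildSolution Ω φ k (x, v) ≤ c' * exitTime Ω x v := by
  have hν := hardSphereFreq_pos v
  have hτ := h.exitTime_nonneg hx v
  have hI := h.intervalIntegrable_transport hk hx v
  set M := Real.exp (-(1 / 2) * ‖v‖ ^ 2) with hM
  set ν := hardSphereFreq v
  have hI0 : IntervalIntegrable (fun s => Real.exp (-ν * s) * (ν * M)) volume 0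
      (exitTime Ω x v) := (by fun_prop : Continuous _).intervalIntegrable _ _
  -- the Maxwellian is the mild solution with collision term `ν M`
  have hval : ∫ s in (0 : ℝ)..exitTime Ω x v, Real.exp (-ν * s) * (ν * M) =
      M - Real.exp (-ν * exitTime Ω x v) * M := by
    have hd : ∀ s ∈ uIcc 0 (exitTime Ω x v),
        HasDerivAt (fun s => -(Real.exp (-ν * s) * M)) (Real.exp (-ν * s) * (ν * M)) s :=
      fun s _ => by
        refine (((((hasDerivAt_id s).const_mul (-ν)).exp).mul_const M).neg).congr_deriv ?_
        simp only [id]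
        ring
    rw [intervalIntegral.integral_eq_sub_of_hasDerivAt hd hI0, mul_zero, Real.exp_zero]
    ring
  have hrep : M - mildSolution Ω φ k (x, v) = ∫ s in (0 : ℝ)..exitTime Ω x v,
      (Real.exp (-ν * s) * (ν * M) - Real.exp (-ν * s) * k (x - s • v) v) := by
    rw [intervalIntegral.integral_sub hI0 hI, hval]
    simp only [mildSolution, incomingJ, maxwellData, hφ, transportS, one_mul]
    ring
  have hpt : ∀ s ∈ Ioo 0 (exitTime Ω x v), c * Real.exp (-ν * exitTime Ω x v) ≤
      Real.exp (-ν * s) * (ν * M) - Real.exp (-ν * s) * k (x - s • v) v ∧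
      Real.exp (-ν * s) * (ν * M) - Real.exp (-ν * s) * k (x - s • v) v ≤ c' := fun s hs => by
    have hy := h.sub_smul_mem hx hs.1.le hs.2
    have e1 : Real.exp (-ν * exitTime Ω x v) ≤ Real.exp (-ν * s) :=
      Real.exp_le_exp.2 (by nlinarith [hs.2])
    have e2 : Real.exp (-ν * s) ≤ 1 := Real.exp_le_one_iff.2 (by nlinarith [hs.1])
    have e0 := Real.exp_pos (-ν * s)
    rw [← mul_sub]
    have b1 := hc _ hy
    have b2 := hc' _ hy
    constructor
    · rw [mul_comm c]
      exact mul_le_mul e1 b1 hc0 e0.le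
    · calc _ ≤ 1 * c' := mul_le_mul e2 b2 (hc0.trans b1) zero_le_one
        _ = c' := one_mul _
  rw [hrep]
  constructor
  · have := intervalIntegral.integral_mono_on_of_le_Ioo hτ
      (intervalIntegrable_const (c := c * Real.exp (-ν * exitTime Ω x v))) (hI0.sub hI)
      fun s hs => (hpt s hs).1
    rw [intervalIntegral.integral_const, sub_zero, smul_eq_mul] at this
    linarith
  · have := intervalIntegral.integral_mono_on_of_le_Ioo hτ (hI0.sub hI)
      (intervalIntegrable_const (c := c')) fun s hs => (hpt s hs).2
    rw [intervalIntegral.integral_const, sub_zero, smul_eq_mul] at this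
    linarith

end IsConvexSublevel

/-- The collision gain at `v = 0` is controlled by the half-space integral of the kernel. Indeed, a
backward trajectory with velocity `w`, `w₁ ≥ 0`, starting at a point with `x₁ < 0` leaves the domain
at a point with `x₁ < 0`, where the incoming data vanish. -/
lemma exists_gain_zero_le {a a' : ℝ} (ha0 : 0 ≤ a) (ha : a < 1 / 2) :
    ∃ K : ℝ, 0 < K ∧ ∀ (Ω : Set R3) (ψ : R3 → ℝ) (D H N C : ℝ) (k : R3 → R3 → ℝ) (φ : R3 → ℝ),
      IsConvexSublevel Ω ψ D → 0 ≤ H → 0 ≤ N → IsWeightedLip Ω ψ a a' H N C k → Continuous φ →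
      (∀ x, 0 ≤ φ x) → (∀ x, φ x ≤ 1) → (∀ x ∈ frontier Ω, x 0 < 0 → φ x = 0) →
      (∀ x ∈ Ω, x 0 < 0) →
      ∀ x ∈ Ω, gainMap Ω φ k x 0 ≤ 2 ^ (-(3 / 2 : ℝ)) * (1 + Real.exp (-2)) + K * (H * D) := by
  obtain ⟨C1, hC1, H1⟩ := exists_abs_integral_kernel_le ha0 ha
  obtain ⟨C2, hC2, H2⟩ := exists_abs_integral_kernel_le_of_inv_norm ha0 ha
  refine ⟨C2, hC2, fun Ω ψ D H N C k φ h hH hN hk hφc hφ0 hφ1 hφf hΩ x hx => ?_⟩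
  have hDpos := h.diam_pos
  have hφ : ∀ x, |φ x| ≤ 1 := fun x => abs_le.2 ⟨by linarith [hφ0 x], hφ1 x⟩
  have b1 := H1 1 _ (aestronglyMeasurable_section (h.continuousOn_incomingJ hφc) hx)
    (Filter.Eventually.of_forall fun w => by
      rw [one_mul]
      exact (h.abs_incomingJ_le hφ hx w).trans (IsConvexSublevel.exp_half_le ha w)) 0
  have b2 := H2 (H * D) _ (aestronglyMeasurable_section (h.continuousOn_transportS hk hN) hx)
    (by positivity) (Filter.Eventually.of_forall fun w => h.abs_transportS_le_inv_norm hk hx w) 0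
  have e : gainMap Ω φ k x 0 = (∫ w, hardSphereKernel 0 w * incomingJ Ω (maxwellData φ) x w) +
      ∫ w, hardSphereKernel 0 w * transportS Ω k x w := by
    rw [← integral_add b1.1 b2.1]
    simp only [gainMap, collisionK, mildSolution, mul_add]
  have hJ := integral_kernel_zero_le (F := fun w => incomingJ Ω (maxwellData φ) x w)
    (Filter.Eventually.of_forall fun w => mul_nonneg (Real.exp_pos _).le
      (mul_nonneg (hφ0 _) (Real.exp_pos _).le))
    (Filter.Eventually.of_forall fun w => (le_abs_self _).trans (h.abs_incomingJ_le hφ hx w))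
    (by
      filter_upwards [Measure.ae_ne (volume : Measure R3) 0] with w hw hw0
      have hq := h.exitPoint_mem_frontier hx hw
      have hq0 : exitPoint Ω x w 0 < 0 := by
        have h1 := h.exitTime_nonneg hx w
        have h2 := hΩ x hx
        simp only [exitPoint, PiLp.sub_apply, PiLp.smul_apply, smul_eq_mul]
        nlinarith
      simp only [incomingJ, maxwellData, hφf _ hq hq0, zero_mul, mul_zero])
  have h2 := (le_abs_self _).trans b2.2
  simp only [norm_zero, ne_eq, OfNat.ofNat_ne_zero, not_false_eq_true, zero_pow, mul_zero,
    Real.exp_zero, mul_one] at h2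
  rw [e]
  linarith

lemma norm_le_sum_abs (x : R3) : ‖x‖ ≤ |x 0| + |x 1| + |x 2| := by
  have h1 := EuclideanSpace.norm_sq_eq x
  rw [Fin.sum_univ_three] at h1
  simp only [Real.norm_eq_abs] at h1
  have p0 := abs_nonneg (x 0)
  have p1 := abs_nonneg (x 1)
  have p2 := abs_nonneg (x 2)
  refine abs_le_of_sq_le_sq' ?_ (by positivity) |>.2
  nlinarith [mul_nonneg p0 p1, mul_nonneg p0 p2, mul_nonneg p1 p2]

/-- Near the flat part of the boundary and for small velocities with `v₁ < 0`, the solution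
deviates from the Maxwellian by a quantity comparable to `x₁ / v₁`. -/
lemma IsConvexSublevel.exists_grazing_bounds {Ω : Set R3} {ψ : R3 → ℝ} {D a a' H N C r : ℝ}
    {k : R3 → R3 → ℝ} {φ : R3 → ℝ} (h : IsConvexSublevel Ω ψ D)
    (hk : IsWeightedLip Ω ψ a a' H N C k) (hH : 0 ≤ H) (hC : 0 ≤ C) (ha' : 0 ≤ a') (ha : 0 ≤ a)
    (hr : 0 < r) (hflat : ∀ x ∈ flatDisc r, ψ x = 0) (hhalf : halfBall r ⊆ Ω)
    (hφ : ∀ x ∈ flatDisc (r / 4), φ x = 1)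
    (hk0 : ∀ x ∈ Ω, k x 0 ≤ 2 ^ (-(3 / 2 : ℝ)) * (13 / 10)) :
    ∃ δ c c' : ℝ, 0 < δ ∧ 0 < c ∧ 0 < c' ∧ ∀ x v : R3, x 0 < 0 → v 0 < 0 → ‖x‖ ≤ δ → ‖v‖ ≤ δ →
      x 0 / v 0 ≤ 1 → x ∈ Ω ∧
        c * (x 0 / v 0) ≤ Real.exp (-(1 / 2) * ‖v‖ ^ 2) - mildSolution Ω φ k (x, v) ∧
        Real.exp (-(1 / 2) * ‖v‖ ^ 2) - mildSolution Ω φ k (x, v) ≤ c' * (x 0 / v 0) := by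
  set A : ℝ := 2 ^ (-(3 / 2 : ℝ)) with hA
  have hA0 : 0 < A := by positivity
  -- `ν(0) = 2 A`, and the gain at zero velocity is at most `(13 / 10) A`; for small `v` the two
  -- change by at most `A / 5` and `A / 10`
  set δ := min (min (r / 16) (1 / 4)) (A / 10 / (C + 1)) with hδ
  have hδ0 : 0 < δ := by positivity
  have hδr : δ ≤ r / 16 := (min_le_left _ _).trans (min_le_left _ _)
  have hδ1 : δ ≤ 1 / 4 := (min_le_left _ _).trans (min_le_right _ _)
  have hδC : C * δ ≤ A / 10 := by
    have h1 : δ ≤ A / 10 / (C + 1) := min_le_right _ _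
    rw [le_div_iff₀ (by positivity)] at h1
    nlinarith
  refine ⟨δ, A * (3 / 10) * Real.exp (-8), 8 + H, hδ0, by positivity, by positivity,
    fun x v hx0 hv0 hxδ hvδ hxv => ?_⟩
  have hxΩ : x ∈ Ω := hhalf ⟨by linarith, hx0⟩
  have hv : v ≠ 0 := fun h0 => by simp [h0] at hv0
  set t := x 0 / v 0 with ht
  have ht0 : 0 < t := div_pos_of_neg_of_neg hx0 hv0
  -- the backward trajectory meets the flat disc at time `x₁ / v₁`
  have hq : x - t • v ∈ flatDisc (r / 4) := by
    refine ⟨?_, ?_⟩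
    · simp only [PiLp.sub_apply, PiLp.smul_apply, smul_eq_mul, ht]
      rw [div_mul_cancel₀ _ hv0.ne, sub_self]
    · have := _root_.norm_sub_le x (t • v)
      rw [norm_smul, Real.norm_of_nonneg ht0.le] at this
      nlinarith [norm_nonneg v]
  have hτ : t = exitTime Ω x v :=
    h.eq_exitTime hxΩ hv ht0 (hflat _ ⟨hq.1, hq.2.trans (by linarith)⟩)
  have hφq : φ (exitPoint Ω x v) = 1 := by
    rw [exitPoint, ← hτ]
    exact hφ _ hq
  have hM1 : Real.exp (-(1 / 2) * ‖v‖ ^ 2) ≤ 1 :=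
    Real.exp_le_one_iff.2 (by nlinarith [sq_nonneg ‖v‖])
  have hν8 : hardSphereFreq v ≤ 8 := by
    refine (hardSphereFreq_le v).trans ?_
    have : ‖v‖ ≤ 1 := by linarith
    nlinarith [norm_nonneg v]
  have hv2 : ‖v‖ ^ 2 ≤ 1 / 16 := by nlinarith [norm_nonneg v]
  -- `ν M ≥ 2 A exp (-3 |v|² / 2) ≥ (9 / 5) A`
  have hνM : A * (9 / 5) ≤ hardSphereFreq v * Real.exp (-(1 / 2) * ‖v‖ ^ 2) := by
    have h1 := le_hardSphereFreq v
    have h2 : Real.exp (-‖v‖ ^ 2) * Real.exp (-(1 / 2) * ‖v‖ ^ 2) ≥ 1 - 3 / 2 * ‖v‖ ^ 2 := by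
      rw [← Real.exp_add]
      have := Real.add_one_le_exp (-‖v‖ ^ 2 + -(1 / 2) * ‖v‖ ^ 2)
      linarith
    calc A * (9 / 5) ≤ A * (2 * (Real.exp (-‖v‖ ^ 2) * Real.exp (-(1 / 2) * ‖v‖ ^ 2))) := by
          gcongr
          linarith
      _ = (A * (2 * Real.exp (-‖v‖ ^ 2))) * Real.exp (-(1 / 2) * ‖v‖ ^ 2) := by ring
      _ ≤ _ := by gcongr
  have hkv : ∀ y ∈ Ω, k y v ≤ A * (7 / 5) := fun y hy => by
    have h1 := hk.abs_sub_le_right y hy v 0 (by rw [sub_zero]; linarith)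
    rw [sub_zero] at h1
    have h2 : Real.exp (-a' * ‖v‖ ^ 2) ≤ 1 :=
      Real.exp_le_one_iff.2 (by nlinarith [sq_nonneg ‖v‖])
    have h3 : C * ‖v‖ * Real.exp (-a' * ‖v‖ ^ 2) ≤ C * δ := by
      calc _ ≤ C * δ * 1 := by gcongr
        _ = _ := mul_one _
    linarith [le_abs_self (k y v - k y 0), hk0 y hy]
  have hkl : ∀ y ∈ Ω, -H ≤ k y v := fun y hy => by
    have h1 := hk.abs_le y hy v
    have h2 : Real.exp (-a * ‖v‖ ^ 2) ≤ 1 :=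
      Real.exp_le_one_iff.2 (by nlinarith [sq_nonneg ‖v‖])
    have h3 : H * Real.exp (-a * ‖v‖ ^ 2) ≤ H := mul_le_of_le_one_right hH h2
    linarith [neg_abs_le (k y v)]
  have hmain := h.maxwellian_sub_mildSolution_bounds hk hxΩ hφq (c := A * (3 / 10)) (c' := 8 + H)
    (by positivity) (fun y hy => by linarith [hkv y hy])
    (fun y hy => by
      have h1 : hardSphereFreq v * Real.exp (-(1 / 2) * ‖v‖ ^ 2) ≤ 8 * 1 :=
        mul_le_mul hν8 hM1 (Real.exp_pos _).le (by norm_num)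
      linarith [hkl y hy])
  rw [← hτ] at hmain
  refine ⟨hxΩ, le_trans ?_ hmain.1, hmain.2⟩
  have : Real.exp (-8) ≤ Real.exp (-hardSphereFreq v * t) :=
    Real.exp_le_exp.2 (by nlinarith [hardSphereFreq_pos v])
  gcongr

/-! ### Anisotropic test functions -/

/-- The dilation of the first coordinate by the factor `κ`. -/
noncomputable def dilateFst (κ : ℝ) : R3 →ₗ[ℝ] R3 :=
  LinearMap.transvection ((κ - 1) • (EuclideanSpace.proj (0 : Fin 3) : R3 →L[ℝ] ℝ).toLinearMap)
    (EuclideanSpace.single 0 1)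

lemma dilateFst_apply_zero (κ : ℝ) (x : R3) : dilateFst κ x 0 = κ * x 0 := by
  simp [dilateFst, LinearMap.transvection.apply]
  ring

lemma dilateFst_apply_of_ne (κ : ℝ) (x : R3) {i : Fin 3} (hi : i ≠ 0) : dilateFst κ x i = x i := by
  simp [dilateFst, LinearMap.transvection.apply, hi]

lemma det_dilateFst (κ : ℝ) : LinearMap.det (dilateFst κ) = κ := by
  simp [dilateFst, LinearMap.transvection.det]

lemma integral_comp_dilateFst {κ n : ℝ} (hκ : 0 < κ) (hn : 0 < n) {g : R3 × R3 → ℝ}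
    (hg : Continuous g) :
    ∫ z : R3 × R3, g (dilateFst κ z.1, dilateFst n z.2) = (κ * n)⁻¹ * ∫ z, g z := by
  have : (volume : Measure (R3 × R3)).IsAddHaarMeasure :=
    inferInstanceAs ((volume : Measure R3).prod (volume : Measure R3)).IsAddHaarMeasure
  set A : R3 × R3 →ₗ[ℝ] R3 × R3 := (dilateFst κ).prodMap (dilateFst n)
  have hdet : LinearMap.det A = κ * n := by
    rw [LinearMap.det_prodMap, det_dilateFst, det_dilateFst]
  have hpos : 0 < κ * n := by positivity
  have hmap := Measure.map_linearMap_addHaar_eq_smul_addHaar (volume : Measure (R3 × R3))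
    (f := A) (by rw [hdet]; exact hpos.ne')
  have hc : Continuous A := A.continuous_of_finiteDimensional
  have h1 := integral_map (μ := (volume : Measure (R3 × R3))) hc.measurable.aemeasurable
    (f := g) hg.aestronglyMeasurable
  rw [hmap, hdet, integral_smul_measure, ENNReal.toReal_ofReal (abs_nonneg _),
    abs_of_pos (inv_pos.2 hpos), smul_eq_mul] at h1
  exact h1.symm

lemma hasCompactSupport_of_coord_le {F : R3 × R3 → ℝ} {R : ℝ}
    (h : ∀ z, F z ≠ 0 → (∀ i, |z.1 i| ≤ R) ∧ ∀ i, |z.2 i| ≤ R) : HasCompactSupport F := by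
  refine HasCompactSupport.of_support_subset_isCompact
    (isCompact_closedBall (0 : R3 × R3) (3 * R)) fun z hz => ?_
  obtain ⟨h1, h2⟩ := h z hz
  rw [mem_closedBall_zero_iff, Prod.norm_def]
  refine max_le ((norm_le_sum_abs z.1).trans ?_) ((norm_le_sum_abs z.2).trans ?_)
  · linarith [h1 0, h1 1, h1 2]
  · linarith [h2 0, h2 1, h2 2]

/-- Derivative of the smooth step that increases from `0` to `1` on `[1, 2]`. -/
noncomputable def stepDeriv (y : ℝ) : ℝ := deriv Real.smoothTransition (y - 1)

lemma hasDerivAt_step (y : ℝ) :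
    HasDerivAt (fun y => Real.smoothTransition (y - 1)) (stepDeriv y) y := by
  have h1 : HasDerivAt Real.smoothTransition (stepDeriv y) (y - 1) :=
    ((Real.smoothTransition.contDiff (n := 1)).differentiable (by simp) _).hasDerivAt
  have h2 := h1.comp y ((hasDerivAt_id y).sub_const 1)
  rw [mul_one] at h2
  exact h2

lemma continuous_stepDeriv : Continuous stepDeriv :=
  ((Real.smoothTransition.contDiff (n := 1)).continuous_deriv le_rfl).comp (by fun_prop)

lemma stepDeriv_nonneg (y : ℝ) : 0 ≤ stepDeriv y :=
  Real.smoothTransition.monotone.deriv_nonneg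

lemma stepDeriv_support {y : ℝ} (hy : stepDeriv y ≠ 0) : 1 ≤ y ∧ y ≤ 2 := by
  constructor
  · by_contra! hlt
    refine hy ?_
    have : Real.smoothTransition =ᶠ[𝓝 (y - 1)] fun _ => 0 := by
      filter_upwards [gt_mem_nhds (show y - 1 < 0 by linarith)] with t ht
      exact Real.smoothTransition.zero_of_nonpos (le_of_lt ht)
    rw [stepDeriv, this.deriv_eq, deriv_const]
  · by_contra! hlt
    refine hy ?_
    have : Real.smoothTransition =ᶠ[𝓝 (y - 1)] fun _ => 1 := by
      filter_upwards [lt_mem_nhds (show 1 < y - 1 by linarith)] with t ht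
      exact Real.smoothTransition.one_of_one_le (le_of_lt ht)
    rw [stepDeriv, this.deriv_eq, deriv_const]

lemma exists_stepDeriv_ne_zero : ∃ y, stepDeriv y ≠ 0 := by
  obtain ⟨y, -, hy⟩ := exists_hasDerivAt_eq_slope (fun y => Real.smoothTransition (y - 1)) stepDeriv
    (by norm_num : (1 : ℝ) < 2)
    (fun y _ => (hasDerivAt_step y).continuousAt.continuousWithinAt) fun y _ => hasDerivAt_step y
  refine ⟨y, ?_⟩
  rw [hy]
  norm_num

/-- The smooth step climbing from `0` to `1` on `[1, 2]`, minus its translate by `s`; for `s ≥ 0` a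
bump supported in `[1, s + 2]`. -/
noncomputable def plateau (s y : ℝ) : ℝ :=
  Real.smoothTransition (y - 1) - Real.smoothTransition (y - s - 1)

lemma contDiff_plateau (s : ℝ) : ContDiff ℝ ∞ (plateau s) := by
  unfold plateau
  exact (Real.smoothTransition.contDiff.comp (by fun_prop)).sub
    (Real.smoothTransition.contDiff.comp (by fun_prop))

lemma hasDerivAt_plateau (s y : ℝ) :
    HasDerivAt (plateau s) (stepDeriv y - stepDeriv (y - s)) y := by
  have h1 := (hasDerivAt_step (y - s)).comp y ((hasDerivAt_id y).sub_const s)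
  rw [mul_one] at h1
  exact (hasDerivAt_step y).sub h1

lemma plateau_support {s y : ℝ} (hs : 0 ≤ s) (hy : plateau s y ≠ 0) : 1 ≤ y ∧ y ≤ s + 2 := by
  constructor
  · by_contra! hlt
    refine hy ?_
    rw [plateau, Real.smoothTransition.zero_of_nonpos (by linarith),
      Real.smoothTransition.zero_of_nonpos (by linarith), sub_zero]
  · by_contra! hlt
    refine hy ?_
    rw [plateau, Real.smoothTransition.one_of_one_le (by linarith),
      Real.smoothTransition.one_of_one_le (by linarith), sub_self]

/-- Cut-off in the tangential positions and velocities. -/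
noncomputable def tangentialBump (Z : ContDiffBump (0 : ℝ)) (z : R3 × R3) : ℝ :=
  Z (z.1 1) * Z (z.1 2) * (Z (z.2 1) * Z (z.2 2))

/-- Product of a profile `g` in `-x₁`, the bump `Λ` in `-v₁` and the tangential cut-off. -/
noncomputable def profileBump (Λ : ContDiffBump (3 / 2 : ℝ)) (Z : ContDiffBump (0 : ℝ)) (g : ℝ → ℝ)
    (z : R3 × R3) : ℝ :=
  g (-z.1 0) * (Λ (-z.2 0) * tangentialBump Z z)

section Profile

variable (Λ : ContDiffBump (3 / 2 : ℝ)) (Z : ContDiffBump (0 : ℝ))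

lemma profileBump_dilate (g : ℝ → ℝ) (κ n : ℝ) (z : R3 × R3) :
    profileBump Λ Z g (dilateFst κ z.1, dilateFst n z.2) =
      g (-(κ * z.1 0)) * (Λ (-(n * z.2 0)) * tangentialBump Z z) := by
  simp only [profileBump, tangentialBump, dilateFst_apply_zero,
    dilateFst_apply_of_ne _ _ (by decide : (1 : Fin 3) ≠ 0),
    dilateFst_apply_of_ne _ _ (by decide : (2 : Fin 3) ≠ 0)]

lemma contDiff_coord_fst (i : Fin 3) : ContDiff ℝ ∞ fun z : R3 × R3 => z.1 i :=
  (EuclideanSpace.proj (𝕜 := ℝ) i : R3 →L[ℝ] ℝ).contDiff.comp contDiff_fst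

lemma contDiff_coord_snd (i : Fin 3) : ContDiff ℝ ∞ fun z : R3 × R3 => z.2 i :=
  (EuclideanSpace.proj (𝕜 := ℝ) i : R3 →L[ℝ] ℝ).contDiff.comp contDiff_snd

lemma contDiff_tangentialBump : ContDiff ℝ ∞ (tangentialBump Z) := by
  unfold tangentialBump
  exact ((Z.contDiff.comp (contDiff_coord_fst 1)).mul (Z.contDiff.comp (contDiff_coord_fst 2))).mul
    ((Z.contDiff.comp (contDiff_coord_snd 1)).mul (Z.contDiff.comp (contDiff_coord_snd 2)))

lemma tangentialBump_nonneg (z : R3 × R3) : 0 ≤ tangentialBump Z z :=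
  mul_nonneg (mul_nonneg Z.nonneg Z.nonneg) (mul_nonneg Z.nonneg Z.nonneg)

lemma ContDiffBump.abs_sub_le_of_ne_zero {c y : ℝ} (Z : ContDiffBump c) (hy : Z y ≠ 0) :
    |y - c| ≤ Z.rOut := by
  by_contra! hlt
  exact hy (Z.zero_of_le_dist (by rw [Real.dist_eq]; exact hlt.le))

lemma tangentialBump_support {z : R3 × R3} (hz : tangentialBump Z z ≠ 0) :
    |z.1 1| ≤ Z.rOut ∧ |z.1 2| ≤ Z.rOut ∧ |z.2 1| ≤ Z.rOut ∧ |z.2 2| ≤ Z.rOut := by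
  unfold tangentialBump at hz
  have h1 := left_ne_zero_of_mul hz
  have h2 := right_ne_zero_of_mul hz
  have key : ∀ y, Z y ≠ 0 → |y| ≤ Z.rOut := fun y hy => by
    simpa using Z.abs_sub_le_of_ne_zero hy
  exact ⟨key _ (left_ne_zero_of_mul h1), key _ (right_ne_zero_of_mul h1),
    key _ (left_ne_zero_of_mul h2), key _ (right_ne_zero_of_mul h2)⟩

lemma continuous_profileBump {g : ℝ → ℝ} (hg : Continuous g) :
    Continuous (profileBump Λ Z g) := by
  unfold profileBump
  have h1 := (contDiff_coord_fst 0).continuous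
  have h2 := (contDiff_coord_snd 0).continuous
  exact (hg.comp h1.neg).mul ((Λ.continuous.comp h2.neg).mul (contDiff_tangentialBump Z).continuous)

lemma hasCompactSupport_profileBump {g : ℝ → ℝ} {κ n R : ℝ} (hκ : 0 < κ) (hn : 0 < n)
    (hg : ∀ y, g y ≠ 0 → |y| ≤ R) :
    HasCompactSupport fun z : R3 × R3 =>
      profileBump Λ Z g (dilateFst κ z.1, dilateFst n z.2) := by
  refine hasCompactSupport_of_coord_le (R := |R| / κ + (Λ.rOut + 3 / 2) / n + Z.rOut)
    fun z hz => ?_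
  rw [profileBump_dilate] at hz
  have h1 := hg _ (left_ne_zero_of_mul hz)
  have h2 := Λ.abs_sub_le_of_ne_zero (left_ne_zero_of_mul (right_ne_zero_of_mul hz))
  obtain ⟨t1, t2, t3, t4⟩ := tangentialBump_support Z (right_ne_zero_of_mul (right_ne_zero_of_mul hz))
  have hZ := Z.rOut_pos
  have hΛ := Λ.rOut_pos
  have p1 : 0 ≤ |R| / κ := by positivity
  have p2 : 0 ≤ (Λ.rOut + 3 / 2) / n := by positivity
  have c1 : |z.1 0| ≤ |R| / κ := by
    rw [le_div_iff₀ hκ]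
    rw [abs_neg, abs_mul, abs_of_pos hκ] at h1
    linarith [le_abs_self R]
  have c2 : |z.2 0| ≤ (Λ.rOut + 3 / 2) / n := by
    rw [le_div_iff₀ hn]
    have h3 := abs_sub_abs_le_abs_sub (-(n * z.2 0)) (3 / 2)
    rw [abs_neg, abs_mul, abs_of_pos hn, abs_of_pos (by norm_num : (0 : ℝ) < 3 / 2)] at h3
    linarith
  constructor <;> intro i <;> fin_cases i <;> simp only [Fin.zero_eta, Fin.mk_one, Fin.reduceFinMk]
    <;> linarith

end Profile

/-! ### Failure of square integrability at the grazing set -/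

/-- The bump in the rescaled velocity `-n v₁`, supported in `[1, 2]`. -/
noncomputable def speedBump : ContDiffBump (3 / 2 : ℝ) := ⟨1 / 4, 1 / 2, by norm_num, by norm_num⟩

/-- The test function `n θ(-(s + 2) n x₁) Λ(-n v₁) Q`, where `θ` is the plateau on `[1, s + 2]` and
`Q` a fixed tangential cut-off. It concentrates at the grazing set `x₁ = v₁ = 0`, with `L²` norm
independent of `n`. -/
noncomputable def grazingTest (Z : ContDiffBump (0 : ℝ)) (s n : ℝ) (z : R3 × R3) : ℝ :=
  n * profileBump speedBump Z (plateau s) (dilateFst ((s + 2) * n) z.1, dilateFst n z.2)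

section GrazingTest

variable (Z : ContDiffBump (0 : ℝ)) {s n : ℝ}

lemma contDiff_grazingTest (s n : ℝ) : ContDiff ℝ ∞ (grazingTest Z s n) := by
  unfold grazingTest
  simp only [profileBump_dilate]
  exact contDiff_const.mul (((contDiff_plateau s).comp
    (contDiff_const.mul (contDiff_coord_fst 0)).neg).mul
    ((speedBump.contDiff.comp (contDiff_const.mul (contDiff_coord_snd 0)).neg).mul
      (contDiff_tangentialBump Z)))

/-- On the support of the rescaled profile, `-x₁ ≤ 1 / n ≤ -v₁ ≤ 2 / n`; in particular `x₁ / v₁ ≤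
1`. -/
lemma profileBump_dilate_support (hs : 0 ≤ s) {g : ℝ → ℝ}
    (hg : ∀ y, g y ≠ 0 → 1 ≤ y ∧ y ≤ s + 2) {z : R3 × R3}
    (hz : profileBump speedBump Z g (dilateFst ((s + 2) * n) z.1, dilateFst n z.2) ≠ 0) :
    (1 ≤ -((s + 2) * n * z.1 0) ∧ -(n * z.1 0) ≤ 1) ∧ (1 ≤ -(n * z.2 0) ∧ -(n * z.2 0) ≤ 2) ∧
      |z.1 1| ≤ Z.rOut ∧ |z.1 2| ≤ Z.rOut ∧ |z.2 1| ≤ Z.rOut ∧ |z.2 2| ≤ Z.rOut := by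
  rw [profileBump_dilate] at hz
  have h1 := hg _ (left_ne_zero_of_mul hz)
  have h2 := speedBump.abs_sub_le_of_ne_zero (left_ne_zero_of_mul (right_ne_zero_of_mul hz))
  have h3 := tangentialBump_support Z (right_ne_zero_of_mul (right_ne_zero_of_mul hz))
  have h4 : speedBump.rOut = 1 / 2 := rfl
  rw [h4, abs_le] at h2
  refine ⟨⟨h1.1, ?_⟩, ⟨by linarith, by linarith⟩, h3⟩
  have : (s + 2) * -(n * z.1 0) ≤ (s + 2) * 1 := by linarith [h1.2]
  exact le_of_mul_le_mul_left this (by linarith)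

lemma grazingTest_support (hs : 0 ≤ s) {z : R3 × R3} (hz : grazingTest Z s n z ≠ 0) :
    (1 ≤ -((s + 2) * n * z.1 0) ∧ -(n * z.1 0) ≤ 1) ∧ (1 ≤ -(n * z.2 0) ∧ -(n * z.2 0) ≤ 2) ∧
      |z.1 1| ≤ Z.rOut ∧ |z.1 2| ≤ Z.rOut ∧ |z.2 1| ≤ Z.rOut ∧ |z.2 2| ≤ Z.rOut :=
  profileBump_dilate_support Z hs (fun _ => plateau_support hs) (right_ne_zero_of_mul hz)

lemma tsupport_grazingTest_subset (hs : 0 ≤ s) :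
    tsupport (grazingTest Z s n) ⊆
      {z | (1 ≤ -((s + 2) * n * z.1 0) ∧ -(n * z.1 0) ≤ 1) ∧
        (1 ≤ -(n * z.2 0) ∧ -(n * z.2 0) ≤ 2) ∧
        |z.1 1| ≤ Z.rOut ∧ |z.1 2| ≤ Z.rOut ∧ |z.2 1| ≤ Z.rOut ∧ |z.2 2| ≤ Z.rOut} := by
  refine closure_minimal (fun z hz => grazingTest_support Z hs hz) ?_
  have c1 := fun i => (contDiff_coord_fst i).continuous
  have c2 := fun i => (contDiff_coord_snd i).continuous
  exact ((isClosed_le continuous_const ((c1 0).const_mul _).neg).inter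
    (isClosed_le ((c1 0).const_mul _).neg continuous_const)).inter
    (((isClosed_le continuous_const ((c2 0).const_mul _).neg).inter
    (isClosed_le ((c2 0).const_mul _).neg continuous_const)).inter
    ((isClosed_le (c1 1).abs continuous_const).inter ((isClosed_le (c1 2).abs continuous_const).inter
    ((isClosed_le (c2 1).abs continuous_const).inter (isClosed_le (c2 2).abs continuous_const)))))

lemma hasCompactSupport_grazingTest (hs : 0 ≤ s) (hn : 0 < n) :
    HasCompactSupport (grazingTest Z s n) := by
  refine HasCompactSupport.mul_left (hasCompactSupport_profileBump speedBump Z (R := s + 2)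
    (mul_pos (by linarith) hn) hn fun y hy => ?_)
  have h1 := plateau_support hs hy
  rw [abs_le]
  constructor <;> linarith

/-- The `x₁`-derivative consists of two translates of one nonnegative profile, with opposite signs. -/
lemma fderiv_grazingTest (s n : ℝ) (z : R3 × R3) :
    fderiv ℝ (grazingTest Z s n) z (EuclideanSpace.single 0 1, 0) =
      -((s + 2) * n ^ 2) * (profileBump speedBump Z stepDeriv
          (dilateFst ((s + 2) * n) z.1, dilateFst n z.2) -
        profileBump speedBump Z (fun y => stepDeriv (y - s))
          (dilateFst ((s + 2) * n) z.1, dilateFst n z.2)) := by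
  have h1 := ((contDiff_grazingTest Z s n).differentiable (by simp) z).hasFDerivAt.hasLineDerivAt
    (EuclideanSpace.single 0 1, 0)
  have h2 : HasDerivAt (fun t : ℝ => n * (plateau s (-((s + 2) * n * (z.1 0 + t))) *
      (speedBump (-(n * z.2 0)) * tangentialBump Z z)))
      (-((s + 2) * n ^ 2) * (profileBump speedBump Z stepDeriv
          (dilateFst ((s + 2) * n) z.1, dilateFst n z.2) -
        profileBump speedBump Z (fun y => stepDeriv (y - s))
          (dilateFst ((s + 2) * n) z.1, dilateFst n z.2))) 0 := by
    have h3 : HasDerivAt (fun t : ℝ => -((s + 2) * n * (z.1 0 + t))) (-((s + 2) * n)) 0 := by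
      exact ((((hasDerivAt_id (0 : ℝ)).const_add (z.1 0)).const_mul ((s + 2) * n)).neg).congr_deriv
        (by ring)
    have h4 := (((hasDerivAt_plateau s _).comp 0 h3).mul_const
      (speedBump (-(n * z.2 0)) * tangentialBump Z z)).const_mul n
    refine h4.congr_deriv ?_
    simp only [profileBump_dilate, add_zero]
    ring
  refine HasDerivAt.unique h1 (h2.congr_of_eventuallyEq (Filter.Eventually.of_forall fun t => ?_))
  simp only [grazingTest, profileBump_dilate]
  simp [tangentialBump]

lemma integral_profileBump_shift (g : ℝ → ℝ) (s : ℝ) :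
    ∫ z, profileBump speedBump Z (fun y => g (y - s)) z = ∫ z, profileBump speedBump Z g z := by
  have : (volume : Measure (R3 × R3)).IsAddHaarMeasure :=
    inferInstanceAs ((volume : Measure R3).prod (volume : Measure R3)).IsAddHaarMeasure
  rw [← integral_add_right_eq_self (fun z => profileBump speedBump Z g z)
    ((EuclideanSpace.single 0 s, 0) : R3 × R3)]
  refine integral_congr_ae (Filter.Eventually.of_forall fun z => ?_)
  simp [profileBump, tangentialBump, sub_eq_add_neg, add_comm]

lemma hasCompactSupport_profileBump_one {g : ℝ → ℝ} {R : ℝ} (hg : ∀ y, g y ≠ 0 → |y| ≤ R) :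
    HasCompactSupport (profileBump speedBump Z g) := by
  have h1 := hasCompactSupport_profileBump speedBump Z one_pos one_pos hg
  have h2 : ∀ x : R3, dilateFst 1 x = x := fun x => by simp [dilateFst]
  simpa only [h2] using h1

lemma integral_profileBump_stepDeriv_pos :
    0 < ∫ z, profileBump speedBump Z stepDeriv z := by
  have : (volume : Measure (R3 × R3)).IsAddHaarMeasure :=
    inferInstanceAs ((volume : Measure R3).prod (volume : Measure R3)).IsAddHaarMeasure
  have hc : HasCompactSupport (profileBump speedBump Z stepDeriv) :=
    hasCompactSupport_profileBump_one Z (R := 2) fun y hy => by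
      have := stepDeriv_support hy
      rw [abs_le]; constructor <;> linarith
  obtain ⟨y, hy⟩ := exists_stepDeriv_ne_zero
  have hcont := continuous_profileBump speedBump Z continuous_stepDeriv
  refine hcont.integral_pos_of_hasCompactSupport_nonneg_nonzero hc (fun z => mul_nonneg (stepDeriv_nonneg _)
      (mul_nonneg speedBump.nonneg (tangentialBump_nonneg Z z)))
    (x := (EuclideanSpace.single 0 (-y), EuclideanSpace.single 0 (-(3 / 2)))) ?_
  have hZ : Z 0 = 1 := Z.one_of_mem_closedBall (by simp [Z.rIn_pos.le])
  have hS : speedBump (3 / 2) = 1 := speedBump.one_of_mem_closedBall (by simp [speedBump.rIn_pos.le])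
  simp [profileBump, tangentialBump, hZ, hS, hy]

lemma integrable_profileBump_dilate (hs : 0 ≤ s) (hn : 0 < n) {g : ℝ → ℝ} (hg : Continuous g)
    {R : ℝ} (hR : ∀ y, g y ≠ 0 → |y| ≤ R) :
    Integrable fun z : R3 × R3 =>
      profileBump speedBump Z g (dilateFst ((s + 2) * n) z.1, dilateFst n z.2) := by
  have : (volume : Measure (R3 × R3)).IsAddHaarMeasure :=
    inferInstanceAs ((volume : Measure R3).prod (volume : Measure R3)).IsAddHaarMeasure
  refine Continuous.integrable_of_hasCompactSupport ?_
    (hasCompactSupport_profileBump speedBump Z (mul_pos (by linarith) hn) hn hR)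
  exact (continuous_profileBump speedBump Z hg).comp
    (((dilateFst _).continuous_of_finiteDimensional.comp continuous_fst).prodMk
      ((dilateFst _).continuous_of_finiteDimensional.comp continuous_snd))

/-- The `L²` norm of `grazingTest` is bounded uniformly in `n`. -/
lemma integral_grazingTest_sq_le (Ω : Set R3) (hs : 0 ≤ s) (hn : 0 < n) :
    Integrable (fun z => grazingTest Z s n z ^ 2) ∧
    ∫ z, grazingTest Z s n z ^ 2 ∂phaseMeasure Ω ≤
      (s + 2)⁻¹ * ∫ z, profileBump speedBump Z (plateau s) z ^ 2 := by
  have : (volume : Measure (R3 × R3)).IsAddHaarMeasure :=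
    inferInstanceAs ((volume : Measure R3).prod (volume : Measure R3)).IsAddHaarMeasure
  have hint : Integrable (fun z => grazingTest Z s n z ^ 2) := by
    refine Continuous.integrable_of_hasCompactSupport
      ((contDiff_grazingTest Z s n).continuous.pow 2) ?_
    simp only [pow_two]
    exact (hasCompactSupport_grazingTest Z hs hn).mul_right
  refine ⟨hint, ?_⟩
  calc ∫ z, grazingTest Z s n z ^ 2 ∂phaseMeasure Ω ≤ ∫ z, grazingTest Z s n z ^ 2 :=
        setIntegral_le_integral hint (Filter.Eventually.of_forall fun z => sq_nonneg _)
    _ = n ^ 2 * ∫ z : R3 × R3, profileBump speedBump Z (plateau s)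
          (dilateFst ((s + 2) * n) z.1, dilateFst n z.2) ^ 2 := by
        rw [← integral_const_mul]
        simp only [grazingTest, mul_pow]
    _ = n ^ 2 * ((((s + 2) * n) * n)⁻¹ * ∫ z, profileBump speedBump Z (plateau s) z ^ 2) := by
        rw [integral_comp_dilateFst (mul_pos (by linarith) hn) hn
          (g := fun z => profileBump speedBump Z (plateau s) z ^ 2)
          ((continuous_profileBump speedBump Z (contDiff_plateau s).continuous).pow 2)]
    _ = _ := by
        have : s + 2 ≠ 0 := by linarith
        field_simp

end GrazingTest

lemma integral_phaseMeasure_eq {Ω : Set R3} {g : R3 × R3 → ℝ}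
    (hg : ∀ z, z ∉ Ω ×ˢ (univ : Set R3) → g z = 0) : ∫ z, g z ∂phaseMeasure Ω = ∫ z, g z :=
  setIntegral_eq_integral_of_forall_compl_eq_zero hg

/-- The support of `grazingTest` lies in the region where the grazing bounds hold. -/
lemma grazing_region {Z : ContDiffBump (0 : ℝ)} {s n δ : ℝ} (hs : 0 ≤ s) (hn : 0 < n)
    (hZ : Z.rOut ≤ δ / 4) (hnδ : 2 / n ≤ δ / 2) {z : R3 × R3}
    (hz : (1 ≤ -((s + 2) * n * z.1 0) ∧ -(n * z.1 0) ≤ 1) ∧ (1 ≤ -(n * z.2 0) ∧ -(n * z.2 0) ≤ 2) ∧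
      |z.1 1| ≤ Z.rOut ∧ |z.1 2| ≤ Z.rOut ∧ |z.2 1| ≤ Z.rOut ∧ |z.2 2| ≤ Z.rOut) :
    z.1 0 < 0 ∧ z.2 0 < 0 ∧ ‖z.1‖ ≤ δ ∧ ‖z.2‖ ≤ δ ∧ z.1 0 / z.2 0 ≤ 1 := by
  obtain ⟨⟨a1, a2⟩, ⟨b1, b2⟩, t1, t2, t3, t4⟩ := hz
  have hx : z.1 0 < 0 := by
    by_contra! hlt
    have : 0 ≤ (s + 2) * n * z.1 0 := by positivity
    linarith
  have hv : z.2 0 < 0 := by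
    by_contra! hlt
    have : 0 ≤ n * z.2 0 := by positivity
    linarith
  rw [div_le_iff₀ hn] at hnδ
  have hx' : |z.1 0| ≤ δ / 2 := by
    rw [abs_of_neg hx]
    refine le_of_mul_le_mul_left ?_ hn
    linarith
  have hv' : |z.2 0| ≤ δ / 2 := by
    rw [abs_of_neg hv]
    refine le_of_mul_le_mul_left ?_ hn
    linarith
  refine ⟨hx, hv, (norm_le_sum_abs z.1).trans (by linarith),
    (norm_le_sum_abs z.2).trans (by linarith), ?_⟩
  rw [div_le_one_of_neg hv]
  refine le_of_mul_le_mul_left ?_ hn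
  linarith

/-- Pairing the weak gradient with `grazingTest` stays bounded below as `n → ∞`: the plateau's
ascent, where `f` may lose at most `c' x₁ / v₁` from the Maxwellian, is outweighed by its descent
further inside, where `f` has lost at least `c x₁ / v₁`. -/
lemma le_integral_inner_mul_grazingTest {Ω : Set R3} {f : R3 × R3 → ℝ} {Gx Gv : R3 × R3 → R3}
    {Z : ContDiffBump (0 : ℝ)} {n δ c c' : ℝ} (hc : 0 < c) (hc' : 0 < c')
    (hn : 0 < n) (hZ : Z.rOut ≤ δ / 4) (hnδ : 2 / n ≤ δ / 2)
    (hfm : AEStronglyMeasurable f (phaseMeasure Ω)) (hG : IsWeakGradient Ω f Gx Gv)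
    (hbd : ∀ x v : R3, x 0 < 0 → v 0 < 0 → ‖x‖ ≤ δ → ‖v‖ ≤ δ → x 0 / v 0 ≤ 1 → x ∈ Ω ∧
      c * (x 0 / v 0) ≤ Real.exp (-(1 / 2) * ‖v‖ ^ 2) - f (x, v) ∧
      Real.exp (-(1 / 2) * ‖v‖ ^ 2) - f (x, v) ≤ c' * (x 0 / v 0)) :
    (4 * c' / c + 2)⁻¹ * (c / 2) * (∫ z, profileBump speedBump Z stepDeriv z) ≤
      ∫ z, inner ℝ (Gx z) (EuclideanSpace.single 0 1) * grazingTest Z (4 * c' / c) n z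
        ∂phaseMeasure Ω := by
  have : (volume : Measure (R3 × R3)).IsAddHaarMeasure :=
    inferInstanceAs ((volume : Measure R3).prod (volume : Measure R3)).IsAddHaarMeasure
  -- the descent of the plateau starts so far inside that `c (1 + s) / 2` exceeds `2 c'` by `c / 2`
  set s : ℝ := 4 * c' / c with hsdef
  have hs : 0 ≤ s := by positivity
  have hsc : s * c = 4 * c' := by rw [hsdef]; field_simp
  clear_value s
  set e : R3 × R3 := (EuclideanSpace.single 0 1, 0) with he
  set Φ := grazingTest Z s n with hΦ
  have hΦs : ContDiff ℝ ∞ Φ := contDiff_grazingTest Z s n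
  have hΦc : HasCompactSupport Φ := hasCompactSupport_grazingTest Z hs hn
  have hreg : ∀ z ∈ tsupport Φ, z.1 0 < 0 ∧ z.2 0 < 0 ∧ ‖z.1‖ ≤ δ ∧ ‖z.2‖ ≤ δ ∧
      z.1 0 / z.2 0 ≤ 1 := fun z hz =>
    grazing_region hs hn hZ hnδ (tsupport_grazingTest_subset Z hs hz)
  have hmem : ∀ z ∈ tsupport Φ, z ∈ Ω ×ˢ (univ : Set R3) := fun z hz => by
    obtain ⟨h1, h2, h3, h4, h5⟩ := hreg z hz
    exact ⟨(hbd _ _ h1 h2 h3 h4 h5).1, mem_univ _⟩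
  set dΦ : R3 × R3 → ℝ := fun z => fderiv ℝ Φ z e with hdΦ
  have hdc : Continuous dΦ := (hΦs.continuous_fderiv (by simp)).clm_apply continuous_const
  have hdcs : HasCompactSupport dΦ := hΦc.fderiv_apply (𝕜 := ℝ) e
  have hd0 : ∀ z, z ∉ tsupport Φ → dΦ z = 0 := fun z hz => by
    simp only [hdΦ]
    rw [fderiv_of_notMem_tsupport ℝ hz]; simp
  -- the Maxwellian does not depend on the position
  set M : R3 × R3 → ℝ := fun z => Real.exp (-(1 / 2) * ‖z.2‖ ^ 2) with hM
  have hMs : ContDiff ℝ 1 M := by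
    simp only [hM]
    exact (contDiff_const.mul (contDiff_snd.norm_sq ℝ)).exp
  have hM0 : ∫ z, M z * dΦ z ∂phaseMeasure Ω = 0 := by
    rw [integral_phaseMeasure_eq fun z hz => by
      rw [hd0 z fun h' => hz (hmem z h'), mul_zero]]
    rw [integral_mul_fderiv_of_locally_lipschitz volume isOpen_univ
      (fun z _ => by
        obtain ⟨C, t, ht, hl⟩ := hMs.locallyLipschitz z
        exact ⟨C, t, ht, hl⟩) hΦs hΦc (subset_univ _) e, neg_eq_zero]
    refine integral_eq_zero_of_ae (Filter.Eventually.of_forall fun z => ?_)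
    have h1 := (hMs.differentiable (by simp) z).hasFDerivAt.hasLineDerivAt e
    have h2 : HasLineDerivAt ℝ M 0 z e := by
      have h3 : (fun t : ℝ => M (z + t • e)) = fun _ => M z := by
        funext t
        simp [hM, he]
      rw [HasLineDerivAt, h3]
      exact hasDerivAt_const _ _
    have h4 : fderiv ℝ M z e = 0 := HasDerivAt.unique h1 h2
    simp [h4]
  -- integrability of the two pieces
  have hiM : Integrable (fun z => M z * dΦ z) (phaseMeasure Ω) :=
    ((hMs.continuous.mul hdc).integrable_of_hasCompactSupport hdcs.mul_left).integrableOn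
  have hMf : ∀ z ∈ tsupport Φ, c * (z.1 0 / z.2 0) ≤ M z - f z ∧ M z - f z ≤ c' * (z.1 0 / z.2 0) :=
    fun z hz => by
      obtain ⟨h1, h2, h3, h4, h5⟩ := hreg z hz
      exact (hbd _ _ h1 h2 h3 h4 h5).2
  have hidef : Integrable (fun z => (M z - f z) * dΦ z) (phaseMeasure Ω) := by
    have hid : Integrable (fun z => c' * dΦ z) (phaseMeasure Ω) :=
      ((hdc.integrable_of_hasCompactSupport hdcs).integrableOn).const_mul c'
    refine hid.mono ((hMs.continuous.aestronglyMeasurable.sub hfm).mul hdc.aestronglyMeasurable)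
      (Filter.Eventually.of_forall fun z => ?_)
    by_cases hz : z ∈ tsupport Φ
    · rw [norm_mul, norm_mul]
      obtain ⟨h1, h2, -, -, h5⟩ := hreg z hz
      obtain ⟨b1, b2⟩ := hMf z hz
      have h6 : 0 < z.1 0 / z.2 0 := div_pos_of_neg_of_neg h1 h2
      gcongr
      rw [Real.norm_of_nonneg (le_trans (by positivity) b1), Real.norm_of_nonneg hc'.le]
      nlinarith
    · rw [hd0 z hz, mul_zero, mul_zero]
  have hsplit : ∫ z, f z * dΦ z ∂phaseMeasure Ω = -∫ z, (M z - f z) * dΦ z ∂phaseMeasure Ω := by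
    have h1 := integral_sub hiM hidef
    rw [hM0, zero_sub] at h1
    rw [← h1]
    refine integral_congr_ae (Filter.Eventually.of_forall fun z => ?_)
    ring
  have hweak := hG Φ hΦs hΦc hmem (EuclideanSpace.single 0 1) 0
  simp only [inner_zero_right, add_zero] at hweak
  have hgoal : ∫ z, inner ℝ (Gx z) (EuclideanSpace.single 0 1) * Φ z ∂phaseMeasure Ω =
      ∫ z, (M z - f z) * dΦ z ∂phaseMeasure Ω := by
    have h1 : ∫ z, f z * dΦ z ∂phaseMeasure Ω =
      -∫ z, inner ℝ (Gx z) (EuclideanSpace.single 0 1) * Φ z ∂phaseMeasure Ω := hweak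
    rw [hsplit] at h1
    linarith
  rw [hgoal]
  -- comparison with a multiple of the derivative profile
  set b₁ : R3 × R3 → ℝ := fun z => profileBump speedBump Z stepDeriv
    (dilateFst ((s + 2) * n) z.1, dilateFst n z.2) with hb₁
  set b₂ : R3 × R3 → ℝ := fun z => profileBump speedBump Z (fun y => stepDeriv (y - s))
    (dilateFst ((s + 2) * n) z.1, dilateFst n z.2) with hb₂
  have hsd : ∀ y, stepDeriv y ≠ 0 → |y| ≤ s + 2 := fun y hy => by
    have := stepDeriv_support hy
    rw [abs_le]; constructor <;> linarith
  have hsd' : ∀ y, stepDeriv (y - s) ≠ 0 → |y| ≤ s + 2 := fun y hy => by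
    have := stepDeriv_support hy
    rw [abs_le]; constructor <;> linarith
  have hcs' : Continuous fun y => stepDeriv (y - s) := continuous_stepDeriv.comp (by fun_prop)
  have hi1 : Integrable b₁ := integrable_profileBump_dilate Z hs hn continuous_stepDeriv hsd
  have hi2 : Integrable b₂ := integrable_profileBump_dilate Z hs hn hcs' hsd'
  have hJ1 : ∫ z, b₁ z = (((s + 2) * n) * n)⁻¹ * ∫ z, profileBump speedBump Z stepDeriv z :=
    integral_comp_dilateFst (mul_pos (by linarith) hn) hn
      (continuous_profileBump speedBump Z continuous_stepDeriv)
  have hJ2 : ∫ z, b₂ z = (((s + 2) * n) * n)⁻¹ * ∫ z, profileBump speedBump Z stepDeriv z := by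
    rw [← integral_profileBump_shift Z stepDeriv s]
    exact integral_comp_dilateFst (mul_pos (by linarith) hn) hn
      (continuous_profileBump speedBump Z hcs')
  have hder : ∀ z, dΦ z = -((s + 2) * n ^ 2) * (b₁ z - b₂ z) := fun z => fderiv_grazingTest Z s n z
  have hb0 : ∀ (g : ℝ → ℝ) (z : R3 × R3), (∀ y, 0 ≤ g y) →
      0 ≤ profileBump speedBump Z g (dilateFst ((s + 2) * n) z.1, dilateFst n z.2) :=
    fun g z hg => mul_nonneg (hg _) (mul_nonneg speedBump.nonneg (tangentialBump_nonneg Z _))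
  have hval : ∀ z : R3 × R3, z.2 0 < 0 → (s + 2) * (z.1 0 / z.2 0) * -(n * z.2 0) =
      -((s + 2) * n * z.1 0) := fun z hz => by
    have := hz.ne
    field_simp
  have hp1 : ∀ z, (s + 2) * (M z - f z) * b₁ z ≤ 2 * c' * b₁ z := fun z => by
    by_cases hz : b₁ z = 0
    · rw [hz, mul_zero, mul_zero]
    have hsup := profileBump_dilate_support Z hs (fun y hy =>
      ⟨(stepDeriv_support hy).1, (stepDeriv_support hy).2.trans (by linarith)⟩) hz
    obtain ⟨h1, h2, h3, h4, h5⟩ := grazing_region hs hn hZ hnδ hsup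
    refine mul_le_mul_of_nonneg_right ?_ (hb0 _ z stepDeriv_nonneg)
    have h6 := (hbd _ _ h1 h2 h3 h4 h5).2.2
    have h7 : -((s + 2) * n * z.1 0) ≤ 2 := by
      simp only [hb₁, profileBump_dilate] at hz
      exact (stepDeriv_support (left_ne_zero_of_mul hz)).2
    rw [← hval z h2] at h7
    have h8 : 0 < z.1 0 / z.2 0 := div_pos_of_neg_of_neg h1 h2
    have h9 : (s + 2) * (z.1 0 / z.2 0) ≤ 2 := le_trans
      (le_mul_of_one_le_right (mul_nonneg (by linarith) h8.le) hsup.2.1.1) h7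
    calc (s + 2) * (M z - f z) ≤ (s + 2) * (c' * (z.1 0 / z.2 0)) := by
          refine mul_le_mul_of_nonneg_left h6 (by linarith)
      _ = c' * ((s + 2) * (z.1 0 / z.2 0)) := by ring
      _ ≤ c' * 2 := by gcongr
      _ = _ := by ring
  have hp2 : ∀ z, (c / 2 + 2 * c') * b₂ z ≤ (s + 2) * (M z - f z) * b₂ z := fun z => by
    by_cases hz : b₂ z = 0
    · rw [hz, mul_zero, mul_zero]
    have hsup := profileBump_dilate_support Z hs (fun y hy =>
      ⟨by linarith [(stepDeriv_support hy).1], by linarith [(stepDeriv_support hy).2]⟩) hz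
    obtain ⟨h1, h2, h3, h4, h5⟩ := grazing_region hs hn hZ hnδ hsup
    refine mul_le_mul_of_nonneg_right ?_ (hb0 _ z fun y => stepDeriv_nonneg _)
    have h6 := (hbd _ _ h1 h2 h3 h4 h5).2.1
    have h7 : 1 ≤ -((s + 2) * n * z.1 0) - s := by
      simp only [hb₂, profileBump_dilate] at hz
      exact (stepDeriv_support (left_ne_zero_of_mul hz)).1
    rw [← hval z h2] at h7
    have h8 : 0 < z.1 0 / z.2 0 := div_pos_of_neg_of_neg h1 h2
    have h9 : (s + 2) * (z.1 0 / z.2 0) * -(n * z.2 0) ≤ (s + 2) * (z.1 0 / z.2 0) * 2 :=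
      mul_le_mul_of_nonneg_left hsup.2.1.2 (mul_nonneg (by linarith) h8.le)
    calc c / 2 + 2 * c' = c * ((1 + s) / 2) := by linear_combination -hsc / 2
      _ ≤ c * ((s + 2) * (z.1 0 / z.2 0)) := by
          refine mul_le_mul_of_nonneg_left ?_ hc.le
          linarith
      _ = (s + 2) * (c * (z.1 0 / z.2 0)) := by ring
      _ ≤ _ := mul_le_mul_of_nonneg_left h6 (by linarith)
  have hpt : ∀ z, n ^ 2 * ((c / 2 + 2 * c') * b₂ z - 2 * c' * b₁ z) ≤ (M z - f z) * dΦ z :=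
    fun z => by
      rw [hder]
      have := mul_le_mul_of_nonneg_left (sub_le_sub (hp2 z) (hp1 z)) (sq_nonneg n)
      linarith
  have hiR : Integrable fun z => n ^ 2 * ((c / 2 + 2 * c') * b₂ z - 2 * c' * b₁ z) :=
    ((hi2.const_mul _).sub (hi1.const_mul _)).const_mul _
  have hzero : ∀ (g : ℝ → ℝ) (z : R3 × R3), (∀ y, g y ≠ 0 → 1 ≤ y ∧ y ≤ s + 2) →
      z ∉ Ω ×ˢ (univ : Set R3) →
      profileBump speedBump Z g (dilateFst ((s + 2) * n) z.1, dilateFst n z.2) = 0 :=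
    fun g z hg hz => by
      by_contra hne
      obtain ⟨h1, h2, h3, h4, h5⟩ :=
        grazing_region hs hn hZ hnδ (profileBump_dilate_support Z hs hg hne)
      exact hz ⟨(hbd _ _ h1 h2 h3 h4 h5).1, mem_univ _⟩
  calc (s + 2)⁻¹ * (c / 2) * ∫ z, profileBump speedBump Z stepDeriv z
      = ∫ z, n ^ 2 * ((c / 2 + 2 * c') * b₂ z - 2 * c' * b₁ z) := by
        rw [integral_const_mul, integral_sub (hi2.const_mul _) (hi1.const_mul _),
          integral_const_mul, integral_const_mul, hJ1, hJ2]
        have : s + 2 ≠ 0 := by linarith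
        field_simp
        ring
    _ = ∫ z, n ^ 2 * ((c / 2 + 2 * c') * b₂ z - 2 * c' * b₁ z) ∂phaseMeasure Ω := by
        refine (integral_phaseMeasure_eq fun z hz => ?_).symm
        have e1 : b₁ z = 0 := hzero _ z (fun y hy =>
          ⟨(stepDeriv_support hy).1, (stepDeriv_support hy).2.trans (by linarith)⟩) hz
        have e2 : b₂ z = 0 := hzero _ z (fun y hy =>
          ⟨by linarith [(stepDeriv_support hy).1], by linarith [(stepDeriv_support hy).2]⟩) hz
        rw [e1, e2]; ring
    _ ≤ _ := integral_mono hiR.integrableOn hidef hpt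

/-- A function with the grazing bounds has no square integrable weak gradient: the pairings with
`grazingTest` stay away from `0`, whereas these test functions are bounded in `L²` and
concentrate on a null set. -/
lemma not_memW1Weighted_two_of_grazing_bounds {Ω : Set R3} {f : R3 × R3 → ℝ} {α δ c c' : ℝ}
    (hα : 0 ≤ α) (hc : 0 < c) (hc' : 0 < c') (hδ : 0 < δ)
    (hfm : AEStronglyMeasurable f (phaseMeasure Ω))
    (hbd : ∀ x v : R3, x 0 < 0 → v 0 < 0 → ‖x‖ ≤ δ → ‖v‖ ≤ δ → x 0 / v 0 ≤ 1 → x ∈ Ω ∧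
      c * (x 0 / v 0) ≤ Real.exp (-(1 / 2) * ‖v‖ ^ 2) - f (x, v) ∧
      Real.exp (-(1 / 2) * ‖v‖ ^ 2) - f (x, v) ≤ c' * (x 0 / v 0)) :
    ¬ MemW1Weighted Ω 2 α f := by
  rintro ⟨-, Gx, Gv, hG, hGx, -⟩
  set Z : ContDiffBump (0 : ℝ) := ⟨δ / 8, δ / 4, by positivity, by linarith⟩ with hZ
  set s : ℝ := 4 * c' / c with hs
  have hs0 : 0 ≤ s := by positivity
  set η : ℝ := (s + 2)⁻¹ * (c / 2) * ∫ z, profileBump speedBump Z stepDeriv z with hη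
  have hη0 : 0 < η := by
    have := integral_profileBump_stepDeriv_pos Z
    positivity
  set P : ℝ := (s + 2)⁻¹ * ∫ z, profileBump speedBump Z (plateau s) z ^ 2 with hP
  have hP0 : 0 ≤ P := by
    have : 0 ≤ ∫ z, profileBump speedBump Z (plateau s) z ^ 2 :=
      integral_nonneg fun z => sq_nonneg _
    positivity
  -- the normal derivative is square integrable
  set g : R3 × R3 → ℝ := fun z => inner ℝ (Gx z) (EuclideanSpace.single 0 1) with hg
  have hg2 : MemLp g 2 (phaseMeasure Ω) := by
    have h1 : MemLp (fun z => Real.exp (α * ‖z.2‖ ^ 2) • Gx z) 2 (phaseMeasure Ω) := by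
      have := hGx
      rw [MemLpWeighted, ENNReal.ofReal_ofNat] at this
      exact this
    have hGm : AEStronglyMeasurable Gx (phaseMeasure Ω) := by
      have h2 := ((by fun_prop : Continuous fun z : R3 × R3 =>
        Real.exp (-(α * ‖z.2‖ ^ 2))).aestronglyMeasurable (μ := phaseMeasure Ω)).smul
          h1.aestronglyMeasurable
      refine h2.congr (Filter.Eventually.of_forall fun z => ?_)
      simp only [Pi.smul_apply', smul_smul]
      rw [← Real.exp_add, neg_add_cancel, Real.exp_zero, one_smul]
    refine h1.mono (hGm.inner aestronglyMeasurable_const) (Filter.Eventually.of_forall fun z => ?_)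
    rw [norm_smul, Real.norm_of_nonneg (Real.exp_pos _).le]
    calc ‖g z‖ ≤ ‖Gx z‖ * ‖(EuclideanSpace.single 0 1 : R3)‖ := norm_inner_le_norm _ _
      _ = 1 * ‖Gx z‖ := by simp
      _ ≤ _ := by
          gcongr
          exact Real.one_le_exp (by positivity)
  have hg2i : Integrable (fun z => g z ^ 2) (phaseMeasure Ω) := hg2.integrable_sq
  -- the test functions live on a decreasing sequence of layers with empty intersection
  set E : ℕ → Set (R3 × R3) := fun n => {z | z.1 0 < 0 ∧ -((n : ℝ) * z.1 0) ≤ 1} with hE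
  have hEm : ∀ n, MeasurableSet (E n) := fun n => by
    have c1 := (contDiff_coord_fst 0).continuous
    exact (isOpen_lt c1 continuous_const).measurableSet.inter
      (isClosed_le (c1.const_mul _).neg continuous_const).measurableSet
  have hEa : Antitone E := fun m n hmn z hz => by
    refine ⟨hz.1, le_trans ?_ hz.2⟩
    have : (m : ℝ) ≤ n := by exact_mod_cast hmn
    have h1 : (m : ℝ) * -z.1 0 ≤ n * -z.1 0 := mul_le_mul_of_nonneg_right this (by linarith [hz.1])
    linarith
  have hEi : ⋂ n, E n = ∅ := by
    refine eq_empty_of_forall_notMem fun z hz => ?_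
    rw [mem_iInter] at hz
    have h0 : 0 < -z.1 0 := by linarith [(hz 0).1]
    obtain ⟨n, hn⟩ := exists_nat_gt ((-z.1 0)⁻¹)
    have h1 := (hz n).2
    rw [inv_lt_iff_one_lt_mul₀ h0] at hn
    linarith
  have hlim := tendsto_setIntegral_of_antitone (μ := phaseMeasure Ω) (f := fun z => g z ^ 2)
    hEm hEa ⟨0, hg2i.integrableOn⟩
  rw [hEi, Measure.restrict_empty, integral_zero_measure] at hlim
  -- the weight in `2 g Φ ≤ lam g² + Φ² / lam` for which the second term is at most `η / 2`
  set lam : ℝ := 2 * (P + 1) / η with hlam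
  have hlam0 : 0 < lam := by positivity
  have hsmall := hlim.eventually (gt_mem_nhds (show (0 : ℝ) < η / lam by positivity))
  obtain ⟨n, hn, hn2⟩ := (hsmall.and (Filter.eventually_gt_atTop ⌈4 / δ⌉₊)).exists
  have hnr : 4 / δ < (n : ℝ) := (Nat.le_ceil _).trans_lt (by exact_mod_cast hn2)
  have hn0 : 0 < (n : ℝ) := lt_trans (by positivity) hnr
  have hnδ : 2 / (n : ℝ) ≤ δ / 2 := by
    rw [div_le_iff₀ hn0]
    rw [div_lt_iff₀ hδ] at hnr
    linarith
  have hlow := le_integral_inner_mul_grazingTest (Z := Z) hc hc' hn0 le_rfl hnδ hfm hG hbd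
  obtain ⟨hΦi, hΦ⟩ := integral_grazingTest_sq_le Z Ω hs0 hn0
  have hpt : ∀ z, g z * grazingTest Z s n z ≤
      lam / 2 * (E n).indicator (fun z => g z ^ 2) z + 1 / (2 * lam) * grazingTest Z s n z ^ 2 :=
    fun z => by
      by_cases hz : grazingTest Z s n z = 0
      · rw [hz]
        have : 0 ≤ (E n).indicator (fun z => g z ^ 2) z :=
          indicator_nonneg (fun z _ => sq_nonneg _) z
        simp only [mul_zero, ne_eq, OfNat.ofNat_ne_zero, not_false_eq_true, zero_pow, add_zero]
        positivity
      · have hsup := grazingTest_support Z hs0 hz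
        have hzE : z ∈ E n := ⟨(grazing_region hs0 hn0 le_rfl hnδ hsup).1, hsup.1.2⟩
        rw [indicator_of_mem hzE]
        have key : 0 ≤ (lam * g z - grazingTest Z s n z) ^ 2 / (2 * lam) := by positivity
        have e : (lam * g z - grazingTest Z s n z) ^ 2 / (2 * lam) =
            lam / 2 * g z ^ 2 + 1 / (2 * lam) * grazingTest Z s n z ^ 2 -
              g z * grazingTest Z s n z := by
          field_simp
          ring
        linarith
  have hΦ' : Integrable (fun z => grazingTest Z s n z ^ 2) (phaseMeasure Ω) := hΦi.integrableOn
  have hgi : Integrable ((E n).indicator fun z => g z ^ 2) (phaseMeasure Ω) :=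
    hg2i.indicator (hEm n)
  have hgΦ : Integrable (fun z => g z * grazingTest Z s n z) (phaseMeasure Ω) := by
    refine MemLp.integrable_mul (p := 2) (q := 2) hg2 ?_
    exact (memLp_two_iff_integrable_sq
      (contDiff_grazingTest Z s n).continuous.aestronglyMeasurable).2 hΦ'
  have hup := integral_mono hgΦ ((hgi.const_mul (lam / 2)).add (hΦ'.const_mul (1 / (2 * lam)))) hpt
  rw [integral_add' (hgi.const_mul _) (hΦ'.const_mul _), integral_const_mul, integral_const_mul,
    integral_indicator (hEm n)] at hup
  have h1 : lam / 2 * ∫ z in E n, g z ^ 2 ∂phaseMeasure Ω < lam / 2 * (η / lam) :=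
    mul_lt_mul_of_pos_left hn (by positivity)
  have h2 : 1 / (2 * lam) * ∫ z, grazingTest Z s n z ^ 2 ∂phaseMeasure Ω ≤ 1 / (2 * lam) * P :=
    mul_le_mul_of_nonneg_left hΦ (by positivity)
  have h3 : lam / 2 * (η / lam) = η / 2 := by field_simp
  have h4 : 1 / (2 * lam) * P ≤ η / 4 := by
    rw [hlam]
    have : 1 / (2 * (2 * (P + 1) / η)) * P = η / 4 * (P / (P + 1)) := by
      field_simp
      ring
    rw [this]
    exact mul_le_of_le_one_right (by positivity) ((div_le_one (by positivity)).2 (by linarith))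
  have h5 : η ≤ ∫ z, g z * grazingTest Z s n z ∂phaseMeasure Ω := hlow
  linarith

/-! ### Convex domains with a flat boundary part -/

lemma hasDerivAt_max_zero_pow (n : ℕ) (t : ℝ) :
    HasDerivAt (fun t : ℝ => max t 0 ^ (n + 2)) ((n + 2) * max t 0 ^ (n + 1)) t := by
  rcases lt_trichotomy t 0 with ht | rfl | ht
  · rw [max_eq_right ht.le]
    simp only [ne_eq, Nat.add_eq_zero_iff, one_ne_zero, and_false, not_false_eq_true, zero_pow,
      mul_zero]
    refine (hasDerivAt_const t (0 : ℝ)).congr_of_eventuallyEq ?_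
    filter_upwards [gt_mem_nhds ht] with y hy
    rw [max_eq_right hy.le, zero_pow (by omega)]
  · have h1 : HasFDerivAt (fun t : ℝ => max t 0 ^ (n + 2)) (0 : ℝ →L[ℝ] ℝ) 0 := by
      refine Asymptotics.IsBigO.hasFDerivAt (n := n + 2) ?_ (by omega)
      refine Asymptotics.IsBigO.of_bound 1 (Filter.Eventually.of_forall fun y => ?_)
      rw [norm_pow, norm_pow, norm_norm, sub_zero, one_mul]
      gcongr
      rw [Real.norm_of_nonneg (le_max_right _ _)]
      exact max_le (le_abs_self y) (norm_nonneg y)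
    simpa using h1.hasDerivAt
  · rw [max_eq_left ht.le]
    have h1 := hasDerivAt_pow (n + 2) t
    refine (h1.congr_of_eventuallyEq ?_).congr_deriv (by push_cast; ring_nf)
    filter_upwards [lt_mem_nhds ht] with y hy
    rw [max_eq_left hy.le]

lemma contDiff_max_zero_pow (n : ℕ) : ContDiff ℝ n fun t : ℝ => max t 0 ^ (n + 1) := by
  induction n with
  | zero =>
    have : Continuous fun t : ℝ => max t 0 ^ (0 + 1) := by fun_prop
    exact contDiff_zero.2 this
  | succ n ih =>
    rw [Nat.cast_add, Nat.cast_one, contDiff_succ_iff_deriv]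
    refine ⟨fun t => (hasDerivAt_max_zero_pow n t).differentiableAt, fun h => by simp at h, ?_⟩
    have : deriv (fun t : ℝ => max t 0 ^ (n + 1 + 1)) =
        fun t : ℝ => ((n : ℝ) + 2) * max t 0 ^ (n + 1) :=
      funext fun t => (hasDerivAt_max_zero_pow n t).deriv
    rw [this]
    exact contDiff_const.mul ih

/-- The defining function of a barrel of radius about `d` and height `2 d`; it depends on `x₁` alone
as long as `x₂² + x₃² ≤ d²`. The third power of the positive part makes it of class `C²`. -/
noncomputable def barrelFun (d : ℝ) (x : R3) : ℝ :=
  max ((x 1 / d) ^ 2 + (x 2 / d) ^ 2 - 1) 0 ^ 3 + ((x 0 / d) ^ 2 + 2 * (x 0 / d))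

/-- The barrel-shaped domain `{barrelFun d < 0}`, whose boundary contains the flat disc of radius
`d`. -/
def barrel (d : ℝ) : Set R3 := {x | barrelFun d x < 0}

lemma contDiff_barrelFun (d : ℝ) : ContDiff ℝ 2 (barrelFun d) := by
  have hc : ∀ i, ContDiff ℝ 2 fun x : R3 => x i / d := fun i =>
    (EuclideanSpace.proj (𝕜 := ℝ) i : R3 →L[ℝ] ℝ).contDiff.div_const d
  have h1 : ContDiff ℝ 2 fun t : ℝ => max t 0 ^ (2 + 1) := contDiff_max_zero_pow 2
  exact (h1.comp ((((hc 1).pow 2).add ((hc 2).pow 2)).sub contDiff_const)).add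
    (((hc 0).pow 2).add (contDiff_const.mul (hc 0)))

lemma convexOn_barrelFun (d : ℝ) : ConvexOn ℝ univ (barrelFun d) := by
  have hl : ∀ i, ∃ l : R3 →ₗ[ℝ] ℝ, ∀ x : R3, l x = x i / d := fun i =>
    ⟨d⁻¹ • (EuclideanSpace.proj (𝕜 := ℝ) i : R3 →L[ℝ] ℝ).toLinearMap, fun x => by
      simp [div_eq_inv_mul]⟩
  have hlin : ∀ i, ConvexOn ℝ univ fun x : R3 => x i / d := fun i => by
    obtain ⟨l, hl⟩ := hl i
    exact (l.convexOn convex_univ).congr fun x _ => hl x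
  have hsq : ∀ i, ConvexOn ℝ univ fun x : R3 => (x i / d) ^ 2 := fun i => by
    obtain ⟨l, hl⟩ := hl i
    have h1 : ConvexOn ℝ univ fun t : ℝ => t ^ 2 := even_two.convexOn_pow
    have h2 := h1.comp_linearMap l
    rw [preimage_univ] at h2
    refine h2.congr fun x _ => ?_
    simp [hl]
  have h3 : ConvexOn ℝ univ fun x : R3 => max ((x 1 / d) ^ 2 + (x 2 / d) ^ 2 - 1) 0 :=
    (((hsq 1).add (hsq 2)).add_const (-1)).sup (convexOn_const 0 convex_univ)
  have h4 := h3.pow (fun x _ => le_max_right _ _) 3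
  exact h4.add ((hsq 0).add ((hlin 0).smul (by norm_num : (0 : ℝ) ≤ 2)))

section Barrel

variable {d : ℝ}

lemma barrel_subset {x : R3} (hx : x ∈ barrel d) : -2 < x 0 / d ∧ x 0 / d < 0 := by
  have h1 : barrelFun d x < 0 := hx
  have h2 : 0 ≤ max ((x 1 / d) ^ 2 + (x 2 / d) ^ 2 - 1) 0 ^ 3 := pow_nonneg (le_max_right _ _) 3
  unfold barrelFun at h1
  have h3 : x 0 / d * (x 0 / d + 2) < 0 := by nlinarith
  rcases mul_neg_iff.1 h3 with h4 | h4 <;> constructor <;> linarith [h4.1, h4.2]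

lemma neg_of_mem_barrel (hd : 0 < d) {x : R3} (hx : x ∈ barrel d) : x 0 < 0 := by
  have := (barrel_subset hx).2
  by_contra! hlt
  have : 0 ≤ x 0 / d := by positivity
  linarith

lemma norm_sub_center_le (hd : 0 < d) {x : R3} (hx : x ∈ barrel d) :
    ‖x - EuclideanSpace.single 0 (-d)‖ ≤ 2 * d := by
  obtain ⟨h1, h2⟩ := barrel_subset hx
  have h3 : (x 1 / d) ^ 2 + (x 2 / d) ^ 2 - 1 ≤ 1 := by
    by_contra! hlt
    have h4 : barrelFun d x < 0 := hx
    unfold barrelFun at h4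
    have h5 : 1 ≤ max ((x 1 / d) ^ 2 + (x 2 / d) ^ 2 - 1) 0 ^ 3 :=
      one_le_pow₀ (hlt.le.trans (le_max_left _ _))
    nlinarith [sq_nonneg (x 0 / d + 1)]
  rw [EuclideanSpace.norm_eq, Real.sqrt_le_left (by positivity)]
  simp only [Fin.sum_univ_three, Real.norm_eq_abs, sq_abs, PiLp.sub_apply]
  simp only [PiLp.single_apply, if_true, Fin.reduceEq, if_false, sub_zero, sub_neg_eq_add]
  have e0 : x 0 + d = d * (x 0 / d + 1) := by field_simp
  have e1 : x 1 = d * (x 1 / d) := by field_simp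
  have e2 : x 2 = d * (x 2 / d) := by field_simp
  have h6 : (x 0 / d + 1) ^ 2 ≤ 1 := by nlinarith
  calc (x 0 + d) ^ 2 + x 1 ^ 2 + x 2 ^ 2
      = d ^ 2 * ((x 0 / d + 1) ^ 2 + (x 1 / d) ^ 2 + (x 2 / d) ^ 2) := by
        rw [e0]; nth_rewrite 1 [e1]; nth_rewrite 1 [e2]; ring
    _ ≤ d ^ 2 * 4 := by gcongr; linarith
    _ = _ := by ring

lemma isConvexSublevel_barrel (hd : 0 < d) : IsConvexSublevel (barrel d) (barrelFun d) (4 * d) where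
  eq_sublevel := rfl
  convexOn := convexOn_barrelFun d
  contDiff := contDiff_barrelFun d
  norm_sub_le x hx y hy := by
    have h1 := norm_sub_le_norm_sub_add_norm_sub x (EuclideanSpace.single 0 (-d)) y
    have h2 := norm_sub_center_le hd hx
    have h3 := norm_sub_center_le hd hy
    rw [norm_sub_rev] at h3
    linarith
  diam_pos := by positivity

lemma barrelFun_eq_of_norm_lt (hd : 0 < d) {x : R3} (hx : ‖x‖ < d) :
    barrelFun d x = (x 0 / d) ^ 2 + 2 * (x 0 / d) := by
  have h1 : x 0 ^ 2 + x 1 ^ 2 + x 2 ^ 2 < d ^ 2 := by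
    have h2 := EuclideanSpace.norm_sq_eq x
    simp only [Fin.sum_univ_three, Real.norm_eq_abs, sq_abs] at h2
    rw [← h2]
    gcongr
  have h3 : (x 1 / d) ^ 2 + (x 2 / d) ^ 2 - 1 ≤ 0 := by
    rw [div_pow, div_pow, ← add_div, sub_nonpos, div_le_one (by positivity)]
    nlinarith [sq_nonneg (x 0)]
  rw [barrelFun, max_eq_right h3]
  ring

lemma barrelFun_flatDisc (hd : 0 < d) {x : R3} (hx : x ∈ flatDisc d) : barrelFun d x = 0 := by
  rw [barrelFun_eq_of_norm_lt hd hx.2, hx.1]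
  simp

lemma halfBall_subset_barrel (hd : 0 < d) : halfBall d ⊆ barrel d := fun x hx => by
  have h1 : |x 0| < d := lt_of_le_of_lt (by simpa using PiLp.norm_apply_le x 0) hx.1
  have h2 : x 0 / d < 0 := div_neg_of_neg_of_pos hx.2 hd
  have h3 : -1 < x 0 / d := by
    rw [lt_div_iff₀ hd]
    linarith [(abs_lt.1 h1).1]
  change barrelFun d x < 0
  rw [barrelFun_eq_of_norm_lt hd hx.1]
  nlinarith

lemma barrel_nonempty (hd : 0 < d) : (barrel d).Nonempty :=
  ⟨EuclideanSpace.single 0 (-(d / 2)), halfBall_subset_barrel hd ⟨by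
    simp only [PiLp.norm_single, norm_neg, Real.norm_eq_abs]
    rw [abs_of_pos (by positivity)]
    linarith, by simpa using hd⟩⟩

end Barrel

namespace IsConvexSublevel

variable {Ω : Set R3} {ψ : R3 → ℝ} {D : ℝ}

/-- Zeros of `ψ` are boundary points, because `ψ` is negative on the segment from such a zero to a
point of `Ω`. -/
lemma mem_frontier (h : IsConvexSublevel Ω ψ D) (hne : Ω.Nonempty) {x : R3} (hx : ψ x = 0) :
    x ∈ frontier Ω := by
  obtain ⟨y, hy⟩ := hne
  rw [h.isOpen.frontier_eq]
  refine ⟨?_, fun hxΩ => (h.mem_iff.1 hxΩ).ne hx⟩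
  have hc : Filter.Tendsto (fun t : ℝ => (1 - t) • x + t • y) (𝓝[>] 0) (𝓝 x) := by
    have : ContinuousAt (fun t : ℝ => (1 - t) • x + t • y) 0 := by fun_prop
    have h1 := this.tendsto
    simp only [sub_zero, one_smul, zero_smul, add_zero] at h1
    exact h1.mono_left nhdsWithin_le_nhds
  refine mem_closure_of_tendsto hc ?_
  filter_upwards [Ioo_mem_nhdsGT (show (0 : ℝ) < 1 by norm_num)] with t ht
  rw [h.mem_iff]
  have h1 := h.convexOn.2 (mem_univ x) (mem_univ y) (sub_nonneg.2 ht.2.le) ht.1.le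
    (sub_add_cancel 1 t)
  rw [hx, smul_zero, zero_add, smul_eq_mul] at h1
  exact h1.trans_lt (mul_neg_of_pos_of_neg ht.1 (h.mem_iff.1 hy))

lemma isConvexC2Domain (h : IsConvexSublevel Ω ψ D) (hne : Ω.Nonempty) : IsConvexC2Domain Ω where
  isOpen := h.isOpen
  nonempty := hne
  convex := h.convex
  isBounded := h.isBounded
  c2Boundary z hz := by
    refine ⟨univ, ψ, isOpen_univ, mem_univ z, h.contDiff.contDiffOn, fun h0 => ?_, ?_⟩
    · obtain ⟨y, hy⟩ := hne
      -- a critical point of the convex function `ψ` is a minimum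
      have h1 := h.fderiv_sub_le z y
      rw [h0, show ψ z = 0 from h.frontier_subset hz, zero_apply, sub_zero] at h1
      linarith [h.neg_pos hy]
    · rw [inter_univ, h.eq_sublevel]
      simp

lemma diam_le (h : IsConvexSublevel Ω ψ D) : Metric.diam Ω ≤ D :=
  Metric.diam_le_of_forall_dist_le h.diam_pos.le fun x hx y hy => by
    rw [dist_eq_norm]; exact h.norm_sub_le x hx y hy

end IsConvexSublevel

section FlatCutoff

variable {Ω : Set R3} {r : ℝ}

/-- The smooth radial cut-off equal to `1` on `|x| ≤ r / 4` and to `0` on `|x| ≥ r / 2`. -/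
noncomputable def flatCutoff (hr : 0 < r) : ContDiffBump (0 : R3) :=
  ⟨r / 4, r / 2, by positivity, by linarith⟩

lemma flatCutoff_eq_zero_of_neg (hr : 0 < r) (hΩ : IsOpen Ω) (hhalf : halfBall r ⊆ Ω) {x : R3}
    (hx : x ∈ frontier Ω) (hx0 : x 0 < 0) : flatCutoff hr x = 0 := by
  refine (flatCutoff hr).zero_of_le_dist ?_
  rw [dist_zero_right]
  by_contra! hlt
  rw [hΩ.frontier_eq] at hx
  refine hx.2 (hhalf ⟨hlt.trans ?_, hx0⟩)
  change r / 2 < r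
  linarith

lemma isFlatCutoff_flatCutoff (hr : 0 < r) (hΩ : IsOpen Ω) (hhalf : halfBall r ⊆ Ω)
    (hneg : ∀ x ∈ Ω, x 0 < 0) : IsFlatCutoff Ω r (flatCutoff hr) where
  smooth := (flatCutoff hr).contDiff
  mem_Icc x _ := ⟨(flatCutoff hr).nonneg, (flatCutoff hr).le_one⟩
  eq_one x hx := by
    refine (flatCutoff hr).one_of_mem_closedBall ?_
    rw [mem_closedBall_zero_iff]
    exact hx.2.le
  eq_zero x hx := by
    have hcl : closure Ω ⊆ {x : R3 | x 0 ≤ 0} :=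
      closure_minimal (fun x hx => (hneg x hx).le)
        (isClosed_le (EuclideanSpace.proj (𝕜 := ℝ) (0 : Fin 3)).continuous continuous_const)
    have hx0 : x 0 ≤ 0 := hcl hx.1.1
    rcases hx0.lt_or_eq with h0 | h0
    · exact flatCutoff_eq_zero_of_neg hr hΩ hhalf hx.1 h0
    · refine (flatCutoff hr).zero_of_le_dist ?_
      rw [dist_zero_right]
      by_contra! hlt
      exact hx.2 ⟨h0, hlt⟩

end FlatCutoff

/-! ### The solution -/

/-- `mildSolution Ω φ k` solves the boundary value problem once `k` is its own gain term. -/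
lemma IsConvexSublevel.isHardSphereSolution {Ω : Set R3} {ψ : R3 → ℝ} {D a a' H N C : ℝ}
    {k : R3 → R3 → ℝ} {φ : R3 → ℝ} (h : IsConvexSublevel Ω ψ D)
    (hk : IsWeightedLip Ω ψ a a' H N C k)
    (hint : ∀ x ∈ Ω, ∀ v, Integrable fun w => hardSphereKernel v w * mildSolution Ω φ k (x, w))
    (hfix : ∀ x ∈ Ω, ∀ v, gainMap Ω φ k x v = k x v) :
    IsHardSphereSolution Ω (maxwellData φ) (mildSolution Ω φ k) := by
  have hae := ae_phaseMeasure_mem h.measurableSet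
  -- the characteristic leaves `Ω` only at its endpoint
  have hchar : ∀ x ∈ Ω, ∀ v, ∀ᵐ s : ℝ, s ∈ uIoc 0 (exitTime Ω x v) →
      Real.exp (-hardSphereFreq v * s) * k (x - s • v) v =
        Real.exp (-hardSphereFreq v * s) * collisionK (mildSolution Ω φ k) (x - s • v) v :=
    fun x hx v => by
      filter_upwards [Measure.ae_ne volume (exitTime Ω x v)] with s hs hmem
      rw [uIoc_of_le (h.exitTime_nonneg hx v)] at hmem
      have hin := h.sub_smul_mem hx hmem.1.le (lt_of_le_of_ne hmem.2 hs)
      rw [← hfix _ hin v]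
      rfl
  refine ⟨?_, ?_, ?_⟩
  · filter_upwards [hae] with z hz using hint z.1 hz.1 z.2
  · filter_upwards [hae] with z hz
    refine (h.intervalIntegrable_transport hk hz.1 z.2).congr_ae ?_
    exact (ae_restrict_iff' measurableSet_uIoc).2 (hchar z.1 hz.1 z.2)
  · filter_upwards [hae] with z hz
    have h1 : transportS Ω (collisionK (mildSolution Ω φ k)) z.1 z.2 = transportS Ω k z.1 z.2 :=
      (intervalIntegral.integral_congr_ae (hchar z.1 hz.1 z.2)).symm
    rw [h1]
    rfl

/-- The right side stays below `ν(0) = 2 * 2 ^ (-3/2)`; `1 / 50` is room for the transported part. -/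
lemma gain_constant_le : (2 : ℝ) ^ (-(3 / 2 : ℝ)) * (1 + Real.exp (-2)) + 1 / 50 ≤
    2 ^ (-(3 / 2 : ℝ)) * (13 / 10) := by
  have h1 : (1 / 4 : ℝ) ≤ 2 ^ (-(3 / 2 : ℝ)) := by
    have h2 : (2 : ℝ) ^ (-(2 : ℝ)) ≤ 2 ^ (-(3 / 2 : ℝ)) :=
      Real.rpow_le_rpow_of_exponent_le (by norm_num) (by norm_num)
    refine le_trans (le_of_eq ?_) h2
    rw [Real.rpow_neg (by norm_num), Real.rpow_two]
    norm_num
  have h2 : Real.exp (-2) ≤ 14 / 100 := by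
    rw [show (-2 : ℝ) = -1 + -1 by norm_num, Real.exp_add]
    have h3 := Real.exp_neg_one_lt_d9
    have h4 := Real.exp_pos (-1)
    nlinarith
  nlinarith

theorem lemma1p8 (ρ p α : ℝ) (hρ0 : 0 < ρ) (hρ1 : ρ < 1) (hp1 : 1 ≤ p) (hp2 : p < 2)
    (hα0 : 0 ≤ α) (hα1 : α < (1 - ρ) / 2) :
    ∀ ε : ℝ, 0 < ε →
      ∃ (Ω : Set R3) (r : ℝ) (φ : R3 → ℝ) (f : R3 × R3 → ℝ),
        IsConvexC2Domain Ω ∧ Metric.diam Ω < ε ∧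
        0 < r ∧ flatDisc r ⊆ frontier Ω ∧ halfBall r ⊆ Ω ∧
        IsFlatCutoff Ω r φ ∧
        IsHardSphereSolution Ω (fun z => φ z.1 * Real.exp (-(1 / 2) * ‖z.2‖ ^ 2)) f ∧
        MemLp f 2 (phaseMeasure Ω) ∧
        MemW1Weighted Ω p α f ∧
        ¬ MemW1Weighted Ω 2 α f := by
  intro ε hε
  -- `a` is the Gaussian rate of the size of the gain, `a'` that of its velocity increments, `a₂`
  -- that of the slope of the solution
  obtain ⟨a₂, hαa₂, ha₂⟩ := exists_between (show α < 1 / 2 by linarith)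
  obtain ⟨a', ha₂a', ha'⟩ := exists_between ha₂
  obtain ⟨a, ha'a, ha⟩ := exists_between ha'
  have ha'0 : 0 ≤ a' := by linarith
  have ha0 : 0 ≤ a := by linarith
  obtain ⟨H, D₀, hH, hD₀, hfix⟩ := exists_gainMap_eq ha'0 ha'a ha
  obtain ⟨K, hK, hgain⟩ := exists_gain_zero_le (a' := a') ha0 ha
  -- a domain so small that `ν(0)` exceeds the gain at zero velocity
  obtain ⟨d, hd, hdmin⟩ := exists_between
    (show (0 : ℝ) < min (ε / 4) (min (D₀ / 4) (1 / (200 * (K * H)))) by positivity)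
  obtain ⟨hdε, hd'⟩ := lt_min_iff.1 hdmin
  obtain ⟨hdD, hdK⟩ := lt_min_iff.1 hd'
  have h := isConvexSublevel_barrel hd
  have hne := barrel_nonempty hd
  have hhalf := halfBall_subset_barrel hd
  have hneg : ∀ x ∈ barrel d, x 0 < 0 := fun x hx => neg_of_mem_barrel hd hx
  set φ : R3 → ℝ := ⇑(flatCutoff hd)
  have hφs : ContDiff ℝ ∞ φ := (flatCutoff hd).contDiff
  have hφ0 : ∀ x, 0 ≤ φ x := fun x => (flatCutoff hd).nonneg
  have hφ1 : ∀ x, φ x ≤ 1 := fun x => (flatCutoff hd).le_one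
  have hφabs : ∀ x, |φ x| ≤ 1 := fun x => by rw [abs_of_nonneg (hφ0 x)]; exact hφ1 x
  have hcut : IsFlatCutoff (barrel d) d φ := isFlatCutoff_flatCutoff hd h.isOpen hhalf hneg
  obtain ⟨L, hL⟩ := hφs.lipschitzWith_of_hasCompactSupport (flatCutoff hd).hasCompactSupport
    (by simp)
  obtain ⟨N, C, k, hN, hC, hk, hk'⟩ := hfix (barrel d) (barrelFun d) (4 * d) h (by linarith) φ L
    hφabs hL
  have hk0 : ∀ x ∈ barrel d, k x 0 ≤ 2 ^ (-(3 / 2 : ℝ)) * (13 / 10) := fun x hx => by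
    rw [← (hk' x hx 0).2]
    refine (hgain _ _ _ _ _ _ _ _ h hH.le hN hk hφs.continuous hφ0 hφ1
      (fun y hy hy0 => flatCutoff_eq_zero_of_neg hd h.isOpen hhalf hy hy0) hneg x hx).trans ?_
    refine le_trans ?_ gain_constant_le
    have hKH : 0 < K * H := by positivity
    rw [lt_div_iff₀ (by positivity)] at hdK
    linarith
  have hfc := h.continuousOn_mildSolution hk hN hφs.continuous
  have hfm := aestronglyMeasurable_phaseMeasure h.measurableSet hfc
  have hF : ∀ z : R3 × R3, z.1 ∈ barrel d → |mildSolution (barrel d) φ k z| ≤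
      (1 + H / freqMin) * Real.exp (-a * ‖z.2‖ ^ 2) := fun z hz =>
    h.abs_mildSolution_le ha hk hφabs hz z.2
  obtain ⟨B, hB, hlip⟩ := h.exists_locally_lipschitz ha₂a' ha'a ha hk hH.le hN hC hφabs hL
  obtain ⟨δ, c, c', hδ, hc, hc', hbd⟩ := h.exists_grazing_bounds (φ := φ) hk hH.le hC ha'0 ha0 hd
    (fun x hx => barrelFun_flatDisc hd hx) hhalf hcut.eq_one hk0
  refine ⟨barrel d, d, φ, mildSolution (barrel d) φ k, h.isConvexC2Domain hne,
    h.diam_le.trans_lt (by linarith), hd,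
    fun x hx => h.mem_frontier hne (barrelFun_flatDisc hd hx), hhalf, hcut,
    h.isHardSphereSolution hk (fun x hx v => (hk' x hx v).1) (fun x hx v => (hk' x hx v).2), ?_,
    h.memW1Weighted_of_locally_lipschitz hne hB hα0 hαa₂ (ha₂a'.trans ha'a) hp1 hp2 hfm hF hlip,
    not_memW1Weighted_two_of_grazing_bounds hα0 hc hc' hδ hfm hbd⟩
  have hg := (h.memLp_gaussian_mul_rpow hne (p := 2) (c := a) (β := 0) (κ := 0) two_pos
    (by linarith) (by norm_num) le_rfl (by norm_num)).const_mul (1 + H / freqMin)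
  rw [ENNReal.ofReal_ofNat] at hg
  refine hg.mono hfm ?_
  filter_upwards [ae_phaseMeasure_mem h.measurableSet] with z hz
  have h1 := hF z hz.1
  rw [neg_zero, Real.rpow_zero, Real.rpow_zero, mul_one, mul_one]
  exact h1.trans (le_abs_self _)
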